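/- **Setting.** There are $T$ clients and $M$ mixture components; $\Delta^M$ is the probability simplex. Client $t$ has a local distribution $\mathcal D_t$ on $\mathcal X\times\mathcal Y$ and a fixed data set of $n_t\ge 1$ samples $s_t^{(i)}=(x_t^{(i)},y_t^{(i)})$ (a realization at which the feature density below is positive); $n=\sum_t n_t$. The hypotheses are $h_\theta$, $\theta\in\mathbb R^d$, the loss $l\ge 0$, and $l(\theta;s)=l(h_\theta(x),y)$ for $s=(x,y)$. For $\Theta=(\theta_1,\dots,\theta_M)\in\mathbb R^{M\times d}$ and $\Pi=(\pi_1,\dots,\pi_T)$, $\pi_t\in\Delta^M$, the normalized negative log-likelihood is $$f(\Theta,\Pi)=-\frac1n\sum_{t=1}^T\sum_{i=1}^{n_t}\log\Big(\sum_{m=1}^M\pi_{tm}\,p(x_t^{(i)})\,e^{\,c-l(\theta_m;s_t^{(i)})}\Big),$$ where $p(x)$ and $c$ are as in assumptions (2) and (3). **Assumptions.** 1. There are probability distributions $\tilde{\mathcal D}_m$, $m\le M$, with densities $p_m(x,y)$, such that every $\mathcal D_t$ is a mixture $\sum_m\pi^*_{tm}\tilde{\mathcal D}_m$ with $\pi^*_t\in\Delta^M$.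 2. All $\tilde{\mathcal D}_m$ have the same marginal density $p(x)$ on $\mathcal X$. 3. There is $c\in\mathbb R$ such that for each $m$ there is $\theta_m^*$ with $l(h_{\theta_m^*}(x),y)=-\log p_m(y|x)+c$ for $\tilde{\mathcal D}_m$-almost every $(x,y)$, where $p_m(y|x)=p_m(x,y)/p(x)$. 4. $f$ is bounded below. 5. Each $\theta\mapsto l(\theta;s_t^{(i)})$ is twice continuously differentiable with $L$-Lipschitz gradient. 6. Client $t$ samples batches of $B_t\ge1$ indices, each index being uniform on $\{1,\dots,n_t\}$ (with any joint law, the same for all draws of the client). The batch average of the $\nabla_\theta l(\theta;s_t^{(i)})$ is an unbiased estimator of $\frac1{n_t}\sum_i\nabla_\theta l(\theta;s_t^{(i)})$ with variance at most $\sigma^2$, for every $\theta$. 7. There are $G,\beta$ such that for all $\alpha\in\Delta^M$ and all $\theta$, $$\sum_t\frac{n_t}{n}\Big\|\frac1{n_t}\sum_i\sum_m\alpha_m\nabla l(\theta;s_t^{(i)})\Big\|^2\le G^2+\beta^2\Big\|\frac1n\sum_t\sum_i\sum_m\alpha_m\nabla l(\theta;s_t^{(i)})\Big\|^2 .$$ 8.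 The mixing matrices $W^0,W^1,\dots$ are independent random $T\times T$ matrices, almost surely symmetric and doubly stochastic, and there are $p\in(0,1]$ and an integer $\tau\ge1$ such that for all $\Xi=[\Xi_1,\dots,\Xi_T]$ with columns in $\mathbb R^{M\times d}$ and all integers $0\le l\le K/\tau$, $$\mathbb E\,\|\Xi\,W^{(l+1)\tau-1}\cdots W^{l\tau}-\bar\Xi\|_F^2\le(1-p)\,\|\Xi-\bar\Xi\|_F^2,\qquad \bar\Xi=\Xi\,\tfrac{\mathbf 1\mathbf 1^{\top}}{T}.$$ **Algorithm (D-FedEM with $K$ rounds, $J\ge1$ local steps and learning rate $\eta$).** Start from arbitrary fixed $\Theta_t^0\in\mathbb R^{M\times d}$ and $\pi_t^0\in\Delta^M$. In round $k=1,\dots,K$ every client $t$ computes $$q_t^{k,i}(m)=\frac{\pi_{tm}^{k-1}e^{-l(\theta_{m,t}^{k-1};s_t^{(i)})}}{\sum_{m'}\pi_{tm'}^{k-1}e^{-l(\theta_{m',t}^{k-1};s_t^{(i)})}},\qquad \pi_{tm}^k=\frac1{n_t}\sum_i q_t^{k,i}(m);$$ for each $m$ it then obtains $\theta_{m,t}^{k-1/2}$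 from $\theta_{m,t}^{k-1}$ by $J$ SGD steps $$\theta\leftarrow\theta-\frac{n_t}{n}\,\eta\,\frac1{B_t}\sum_{i\in\mathcal I}q_t^{k,i}(m)\,\nabla l(\theta;s_t^{(i)}),$$ each with a new batch $\mathcal I$; all batches and all mixing matrices are mutually independent. Finally $\theta_{m,t}^k=\sum_s W^{k-1}_{s,t}\,\theta_{m,s}^{k-1/2}$. **Theorem.** Under these assumptions, let $a_0>0$ and $\eta=a_0/\sqrt K$, and let $\bar\Theta^k=\frac1T\sum_t\Theta_t^k$, $\Pi^k=(\pi_t^k)_t$. There are $C$ and $K_0$, which depend neither on $K$ nor on the laws of the mixing matrices except through $p$ and $\tau$, such that for all $K\ge K_0$ $$\frac1K\sum_{k=1}^K\mathbb E\,\|\nabla_\Theta f(\bar\Theta^k,\Pi^k)\|_F^2\le\frac{C}{\sqrt K},\qquad \frac1K\sum_{k=1}^K\sum_{t=1}^T\frac{n_t}{n}\,\mathbb E\,\mathcal{KL}(\pi_t^k,\pi_t^{k-1})\le\frac CK,$$ $$\min_{1\le k\le K}\ \mathbb E\sum_{t=1}^T\|\Theta_t^k-\bar\Theta^k\|_F^2\le\frac{C}{\sqrt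 K}.$$ The expectations are over the batches and the mixing matrices. -/

import Mathlib

open MeasureTheory ProbabilityTheory
open scoped ENNReal NNReal

universe u

/-! Federated expectation maximization under a mixture model: the statistical problem, its
standing assumptions, the fully decentralized algorithm and the quantities it controls. -/

/-- Parameters of one component model, with the Euclidean norm. -/
abbrev Vec (d : ℕ) := EuclideanSpace ℝ (Fin d)

/-- Parameters `Θ = (θ_1, …, θ_M)` of all the components, with the Frobenius norm. -/
abbrev Params (M d : ℕ) := PiLp 2 (fun _ : Fin M => Vec d)

/-- A federated learning problem with `T` clients, `M` mixture components and `d` parameters per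
component; `𝒳` is the feature space, `𝒴` the label space and `𝒜` the space of predictions.
The training data are a fixed realization. -/
structure FedProblem (𝒳 𝒴 𝒜 : Type*) [MeasurableSpace 𝒳] [MeasurableSpace 𝒴] (T M d : ℕ) where
  /-- reference measure on the features -/
  refX : Measure 𝒳
  /-- reference measure on the labels -/
  refY : Measure 𝒴
  /-- the local data distributions `D_t` -/
  localDist : Fin T → Measure (𝒳 × 𝒴)
  /-- the densities `p_m(x, y)` of the underlying distributions -/
  compDensity : Fin M → 𝒳 → 𝒴 → ℝ≥0
  /-- the density `p(x)` of the features -/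
  margDensity : 𝒳 → ℝ≥0
  /-- the hypotheses `h_θ` -/
  hyp : Vec d → 𝒳 → 𝒜
  /-- the loss `l` of a prediction against a label -/
  loss : 𝒜 → 𝒴 → ℝ≥0
  /-- the normalization constant of the log-loss -/
  c : ℝ
  /-- the numbers `n_t` of samples -/
  n : Fin T → ℕ
  /-- the local data sets `S_t` -/
  data : (t : Fin T) → Fin (n t) → 𝒳 × 𝒴

namespace FedProblem

variable {𝒳 𝒴 𝒜 : Type*} [MeasurableSpace 𝒳] [MeasurableSpace 𝒴] {T M d : ℕ}

section Problem

variable (Q : FedProblem 𝒳 𝒴 𝒜 T M d)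

/-- The total number `n` of samples. -/
def total : ℕ := ∑ t, Q.n t

/-- The weight `n_t / n` of client `t`. -/
noncomputable def weight (t : Fin T) : ℝ := (Q.n t : ℝ) / (Q.total : ℝ)

/-- The underlying distribution of component `m`, given by its density. -/
noncomputable def compDist (m : Fin M) : Measure (𝒳 × 𝒴) :=
  (Q.refX.prod Q.refY).withDensity fun z => (Q.compDensity m z.1 z.2 : ℝ≥0∞)

/-- `l(θ; s)` at the `i`-th sample of client `t`. -/
noncomputable def sampleLoss (t : Fin T) (i : Fin (Q.n t)) (θ : Vec d) : ℝ :=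
  Q.loss (Q.hyp θ (Q.data t i).1) (Q.data t i).2

/-- The joint density `p(x) · p_θ(y | x)` of the component model with parameter `θ`, where
`l(h_θ(x), y) = - log p_θ(y | x) + c`. -/
noncomputable def modelDensity (θ : Vec d) (x : 𝒳) (y : 𝒴) : ℝ :=
  (Q.margDensity x : ℝ) * Real.exp (Q.c - (Q.loss (Q.hyp θ x) y : ℝ))

/-- The normalized negative log-likelihood `f(Θ, ϖ)` of the training data. -/
noncomputable def negLogLik (Θ : Params M d) (ϖ : Fin T → Fin M → ℝ) : ℝ :=
  -((Q.total : ℝ)⁻¹ * ∑ t, ∑ i : Fin (Q.n t),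
    Real.log (∑ m, ϖ t m * Q.modelDensity (Θ m) (Q.data t i).1 (Q.data t i).2))

/-- The full local gradient `(1 / n_t) ∑_i ∇ l(θ; s_t^i)`. -/
noncomputable def localGrad (t : Fin T) (θ : Vec d) : Vec d :=
  (Q.n t : ℝ)⁻¹ • ∑ i, gradient (Q.sampleLoss t i) θ

/-- Standing conventions: the reference measures are σ-finite, densities are measurable, every
client has data, and the features in the data have positive density (which holds almost surely
for data drawn from the local distributions). -/
structure Regular : Prop where
  sigmaX : SigmaFinite Q.refX
  sigmaY : SigmaFinite Q.refY
  measComp : ∀ m, Measurable (Function.uncurry (Q.compDensity m))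
  measMarg : Measurable Q.margDensity
  samples : ∀ t, 0 < Q.n t
  support : ∀ t i, 0 < Q.margDensity (Q.data t i).1

/-- Mixture assumption: each local distribution is a mixture of the underlying distributions. -/
structure Mixture : Prop where
  prob : ∀ m, IsProbabilityMeasure (Q.compDist m)
  mixture : ∃ πs : Fin T → Fin M → ℝ, ∀ t, πs t ∈ stdSimplex ℝ (Fin M) ∧
    Q.localDist t = ∑ m, ENNReal.ofReal (πs t m) • Q.compDist m

/-- All the underlying distributions have the same marginal density `p(x)`. -/
def CommonMarginal : Prop :=
  ∀ m, ∀ᵐ x ∂Q.refX, ∫⁻ y, (Q.compDensity m x y : ℝ≥0∞) ∂Q.refY = Q.margDensity x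

/-- The loss is the log-loss of each underlying distribution at some hypothesis of the family:
`l(h_{θ_m^*}(x), y) = - log p_m(y | x) + c` for almost every `(x, y)` drawn from it. -/
def LogLoss : Prop :=
  ∀ m, ∃ θs : Vec d, ∀ᵐ z ∂Q.compDist m,
    (Q.loss (Q.hyp θs z.1) z.2 : ℝ) =
      -Real.log ((Q.compDensity m z.1 z.2 : ℝ) / (Q.margDensity z.1 : ℝ)) + Q.c

/-- The negative log-likelihood is bounded below. -/
def BoundedBelow : Prop :=
  ∃ fs : ℝ, ∀ (Θ : Params M d) (ϖ : Fin T → Fin M → ℝ),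
    (∀ t, ϖ t ∈ stdSimplex ℝ (Fin M)) → fs ≤ Q.negLogLik Θ ϖ

/-- Every sample loss is twice continuously differentiable with an `L`-Lipschitz gradient. -/
def Smooth (L : ℝ≥0) : Prop :=
  ∀ t (i : Fin (Q.n t)), ContDiff ℝ 2 (Q.sampleLoss t i) ∧
    LipschitzWith L (gradient (Q.sampleLoss t i))

/-- Bounded dissimilarity of the clients, with constants `G` and `β`. -/
def BoundedDissimilarity (G β : ℝ) : Prop :=
  ∀ α ∈ stdSimplex ℝ (Fin M), ∀ θ : Vec d,
    ∑ t, Q.weight t *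
        ‖(Q.n t : ℝ)⁻¹ • ∑ i : Fin (Q.n t), ∑ m, α m • gradient (Q.sampleLoss t i) θ‖ ^ 2 ≤
      G ^ 2 + β ^ 2 *
        ‖(Q.total : ℝ)⁻¹ • ∑ t, ∑ i : Fin (Q.n t), ∑ m, α m • gradient (Q.sampleLoss t i) θ‖ ^ 2

end Problem

/-- How clients sample mini-batches: client `t` draws `size t` indices of local samples, with
joint law `law t`. -/
structure BatchScheme (Q : FedProblem 𝒳 𝒴 𝒜 T M d) where
  size : Fin T → ℕ
  law : (t : Fin T) → Measure (Fin (size t) → Fin (Q.n t))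

/-- A mini-batch of client `t`. -/
abbrev BatchScheme.Batch {Q : FedProblem 𝒳 𝒴 𝒜 T M d} (𝓑 : Q.BatchScheme) (t : Fin T) : Type :=
  Fin (𝓑.size t) → Fin (Q.n t)

section Algorithm

variable {Q : FedProblem 𝒳 𝒴 𝒜 T M d} (𝓑 : Q.BatchScheme)

/-- Batches are nonempty and every index in a batch is uniformly distributed over the local
samples (independently of the others or not, so that sampling with and without replacement are
both covered). -/
structure BatchScheme.Uniform : Prop where
  size_pos : ∀ t, 0 < 𝓑.size t
  prob : ∀ t, IsProbabilityMeasure (𝓑.law t)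
  uniform : ∀ t (s : Fin (𝓑.size t)) (i : Fin (Q.n t)),
    𝓑.law t {b | b s = i} = (Q.n t : ℝ≥0∞)⁻¹

/-- The stochastic gradient on the batch `b` when sample `i` carries the weight `w i`. -/
noncomputable def BatchScheme.batchGrad (t : Fin T) (w : Fin (Q.n t) → ℝ) (θ : Vec d)
    (b : 𝓑.Batch t) : Vec d :=
  (𝓑.size t : ℝ)⁻¹ • ∑ s, w (b s) • gradient (Q.sampleLoss t (b s)) θ

/-- Unbiased stochastic gradients with variance at most `σ ^ 2`. -/
def BatchScheme.BoundedVariance (σ : ℝ) : Prop :=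
  ∀ t (θ : Vec d),
    ∫ b, 𝓑.batchGrad t (fun _ => 1) θ b ∂𝓑.law t = Q.localGrad t θ ∧
    ∫ b, ‖𝓑.batchGrad t (fun _ => 1) θ b - Q.localGrad t θ‖ ^ 2 ∂𝓑.law t ≤ σ ^ 2

/-- E-step at client `t`: posterior probability that sample `i` comes from component `m`. -/
noncomputable def eStep (Q : FedProblem 𝒳 𝒴 𝒜 T M d) (Θ : Params M d) (π : Fin M → ℝ)
    (t : Fin T) (i : Fin (Q.n t)) (m : Fin M) : ℝ :=
  π m * Real.exp (-Q.sampleLoss t i (Θ m)) /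
    ∑ m', π m' * Real.exp (-Q.sampleLoss t i (Θ m'))

/-- M-step for the mixture weights at client `t`. -/
noncomputable def mixtureUpdate (Q : FedProblem 𝒳 𝒴 𝒜 T M d) (Θ : Params M d) (π : Fin M → ℝ)
    (t : Fin T) (m : Fin M) : ℝ :=
  (∑ i, Q.eStep Θ π t i m) / (Q.n t : ℝ)

/-- Local solver: the given number of weighted SGD steps from `θ` at client `t`, with learning
rate `η`, the `j`-th one on the batch `b j`. -/
noncomputable def BatchScheme.localSGD (η : ℝ) (t : Fin T) (w : Fin (Q.n t) → ℝ)
    (b : ℕ → 𝓑.Batch t) (θ : Vec d) : ℕ → Vec d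
  | 0 => θ
  | j + 1 =>
    localSGD η t w b θ j -
      (Q.weight t * η) • 𝓑.batchGrad t w (localSGD η t w b θ j) (b j)

/-- State of the algorithm: the component parameters `Θ_t` and the mixture weights `π_t` held by
every client `t`. -/
structure ClientState (T M d : ℕ) where
  Θ : Fin T → Params M d
  π : Fin T → Fin M → ℝ

/-- The consensus average `(1 / T) ∑_t Θ_t`. -/
noncomputable def average (Θ : Fin T → Params M d) : Params M d := (T : ℝ)⁻¹ • ∑ t, Θ t

/-- The parameters of all the clients after mixing with the matrix `W`: the product `Ξ W`, where
the parameters of the clients are the columns of `Ξ`. -/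
noncomputable def mix (Ξ : Fin T → Params M d) (W : Fin T → Fin T → ℝ) : Fin T → Params M d :=
  fun t => ∑ s, W s t • Ξ s

/-- The parameters of client `t` after local training, before communication. -/
noncomputable def BatchScheme.localRound (η : ℝ) (J : ℕ) (S : ClientState T M d) (t : Fin T)
    (b : Fin M → ℕ → 𝓑.Batch t) : Params M d :=
  WithLp.toLp 2 fun m =>
    𝓑.localSGD η t (fun i => Q.eStep (S.Θ t) (S.π t) t i m) (b m) (S.Θ t m) J

/-- One communication round of the algorithm, with mixing matrix `W`, learning rate `η` and `J`
local steps, the `j`-th one of client `t` for component `m` using the batch `b t m j`. -/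
noncomputable def BatchScheme.round (η : ℝ) (J : ℕ) (W : Fin T → Fin T → ℝ)
    (b : (t : Fin T) → Fin M → ℕ → 𝓑.Batch t) (S : ClientState T M d) : ClientState T M d where
  Θ := mix (fun t => 𝓑.localRound η J S t (b t)) W
  π := fun t m => Q.mixtureUpdate (S.Θ t) (S.π t) t m

/-- The iterates of the algorithm, started from `S₀`; round `k + 1` uses `W k` and `b k`. -/
noncomputable def BatchScheme.iterate (η : ℝ) (J : ℕ) (S₀ : ClientState T M d)
    (W : ℕ → Fin T → Fin T → ℝ) (b : ℕ → (t : Fin T) → Fin M → ℕ → 𝓑.Batch t) :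
    ℕ → ClientState T M d
  | 0 => S₀
  | k + 1 => 𝓑.round η J (W k) (b k) (iterate η J S₀ W b k)

/-- The consensus distance `∑_t ‖Θ_t - Θ̄‖ ^ 2`. -/
noncomputable def consensusDist (Θ : Fin T → Params M d) : ℝ≥0∞ :=
  ∑ t, ‖Θ t - average Θ‖ₑ ^ 2

/-- The product `W^{a + r - 1} ⋯ W^{a + 1} W^a`. -/
def windowProd (W : ℕ → Fin T → Fin T → ℝ) (a : ℕ) : ℕ → Matrix (Fin T) (Fin T) ℝ
  | 0 => 1
  | r + 1 => Matrix.of (W (a + r)) * windowProd W a r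

variable {Ω : Type*} [MeasurableSpace Ω]

/-- Expected consensus rate over a horizon of `K` rounds: the mixing matrices are random,
symmetric and doubly stochastic, and every `τ` rounds they contract the distance to the average,
in expectation, by the factor `1 - p`. -/
structure ExpectedConsensus (M d : ℕ) (W : ℕ → Ω → Fin T → Fin T → ℝ) (p : ℝ) (τ K : ℕ)
    (P : Measure Ω) : Prop where
  measurable : ∀ k, Measurable (W k)
  symmetric : ∀ k, ∀ᵐ ω ∂P, (Matrix.of (W k ω)).IsSymm
  stochastic : ∀ k, ∀ᵐ ω ∂P, Matrix.of (W k ω) ∈ doublyStochastic ℝ (Fin T)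
  rate : ∀ (Ξ : Fin T → Params M d) (l : ℕ), l ≤ K / τ →
    ∫⁻ ω, ∑ t, ‖mix Ξ (windowProd (fun k => W k ω) (l * τ) τ) t - average Ξ‖ₑ ^ 2 ∂P ≤
      ENNReal.ofReal (1 - p) * consensusDist Ξ

/-- The sampled batches have the prescribed laws, and all the batches and all the mixing matrices
are mutually independent. -/
structure IndependentSampling (W : ℕ → Ω → Fin T → Fin T → ℝ)
    (ξ : ℕ → (t : Fin T) → Fin M → ℕ → Ω → 𝓑.Batch t) (P : Measure Ω) : Prop where
  law : ∀ k t m j, HasLaw (ξ k t m j) (𝓑.law t) P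
  measurable : ∀ k t m j, Measurable (ξ k t m j)
  indep : iIndep
    (Sum.elim (fun k : ℕ => MeasurableSpace.comap (W k) inferInstance)
      (fun a : ℕ × Fin T × Fin M × ℕ =>
        MeasurableSpace.comap (ξ a.1 a.2.1 a.2.2.1 a.2.2.2) inferInstance)) P

end Algorithm

end FedProblem

open Classical in
/-- Kullback–Leibler divergence of two probability vectors (with `0 log 0 = 0`). -/
noncomputable def klVec {M : ℕ} (a b : Fin M → ℝ) : ℝ≥0∞ :=
  if ∀ m, b m = 0 → a m = 0 then ENNReal.ofReal (∑ m, a m * Real.log (a m / b m)) else ⊤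

/-!
No gradient and no free energy of an iterate is bounded a priori, and a dissimilarity bound for
weights that are common to all samples says little about the updates, in which every sample is
weighted with its own responsibilities. The usual descent argument therefore does not close. The
proof rests on the following facts instead.

*Self-bounding.* A nonnegative function with `L`-Lipschitz gradient satisfies `‖∇l‖² ≤ 2 L l`
(`norm_gradient_sq_le`). Noise, drift and consensus error of a round therefore have second moments
of order `F`, the free energy of the current state. What has to be proved is that `F` does not grow,
in the sense of a sum over all rounds.

*A Lyapunov function for alternating minimization.* EM is alternating minimization of
`risk + respInfo`, and an EM step satisfies a three-point inequality against every comparator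
(`Comparator.regret`). As comparator serve the exponential moving averages, with a rate `κ`
proportional to the step size, of the responsibilities and of the mean iterate. The relative entropy
is jointly convex, so that a step of the averages costs at most the corresponding fraction of the
regret. The function `lyapunov` of the averages therefore grows in one round at most by a centered
noise term, by multiples of `κ²` times energies, and by a multiple of the consensus distance `D`
(`Comparator.lyapunov_next_le`). The divergence `X` of the averaged weights from the weights
decreases at the rate `κ F` (`Comparator.kl_next_le_lyapunov`), which makes sums of `κ² F²` finite.

*Mixing.* The rate hypothesis concerns products of the mixing matrices in one order, and the
algorithm applies them in the other one. The matrices are symmetric, so that the two products are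
transposes of each other; the squared Frobenius distance `frobDist` to the averaging matrix does not
see the difference and bounds the contraction of `D`. Testing the hypothesis against unit vectors
held by a single client gives `𝔼 frobDist ≤ T (1 - p) ^ w` over `w` windows
(`integral_frobDist_le`), which is small for a suitable block length `R = w τ`.

*A quartic potential.* Noise and contraction act on different scales, and the products `D F`, `D²`,
`κ² F²` have to be summed over the rounds. Over blocks of `R` rounds, a combination of products of
`Λ`, `X`, `F` and `D` (`potential`) decreases by these quantities, up to a factor `1 + O(κ²)`, a
term `O(κ²)` and centered terms (`BlockBounds.potential_le`). Since `K κ²` is a constant, the sum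
over `K` rounds of the expectations is bounded (`RandomBounds.sum_moment_le`). In particular
`∑ 𝔼 D = O(1)`, which implies the third estimate.

*Telescoping.* The likelihood at the mean iterate decreases in a round by the divergence of the
weights and by a multiple of `κ` times its squared gradient, up to the same errors
(`likelihood_descent`). In place of Lipschitz continuity of the posterior, the cost of evaluating
the E-step at the local parameters is bounded through the symmetrized relative entropy of two
posteriors (`relEnt_posterior_add_le`). Summation gives `∑ 𝔼 KL + κ ∑ 𝔼 ‖∇f‖² = O(1)`
(`RandomRun.sum_descent_le`), hence the first two estimates.

All quantities of round `k` are bounded almost surely for fixed `K`, by a bound that may depend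
on `K`, so that integrability is automatic.
-/

namespace FedEM

/-! ### Smooth nonnegative functions -/

section Smooth

variable {E : Type*} [NormedAddCommGroup E] [InnerProductSpace ℝ E] [CompleteSpace E]

lemma descent_upper {f : E → ℝ} {L : ℝ≥0} (hf : Differentiable ℝ f)
    (hL : LipschitzWith L (gradient f)) (x z : E) :
    f z ≤ f x + inner ℝ (gradient f x) (z - x) + L / 2 * ‖z - x‖ ^ 2 := by
  set φ : ℝ → ℝ := fun t => f (x + t • (z - x)) - t * inner ℝ (gradient f x) (z - x)
    - L / 2 * t ^ 2 * ‖z - x‖ ^ 2 with hφ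
  have hder : ∀ t : ℝ, HasDerivAt φ
      (inner ℝ (gradient f (x + t • (z - x))) (z - x) - inner ℝ (gradient f x) (z - x)
        - L * t * ‖z - x‖ ^ 2) t := by
    intro t
    have h1 : HasDerivAt (fun t : ℝ => x + t • (z - x)) (z - x) t := by
      simpa using ((hasDerivAt_id t).smul_const (z - x)).const_add x
    have h2 := (hf (x + t • (z - x))).hasGradientAt.hasFDerivAt.comp_hasDerivAt t h1
    have h3 : HasDerivAt (fun t : ℝ => t * inner ℝ (gradient f x) (z - x))
        (inner ℝ (gradient f x) (z - x)) t := by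
      simpa using (hasDerivAt_id t).mul_const (inner ℝ (gradient f x) (z - x))
    have h4 : HasDerivAt (fun t : ℝ => L / 2 * t ^ 2 * ‖z - x‖ ^ 2) (L * t * ‖z - x‖ ^ 2) t := by
      have := (((hasDerivAt_id t).pow 2).const_mul ((L : ℝ) / 2)).mul_const (‖z - x‖ ^ 2)
      refine this.congr_deriv ?_
      simp only [id_eq, Nat.cast_ofNat]; ring
    exact ((h2.sub h3).sub h4).congr_deriv (by simp)
  have hanti : AntitoneOn φ (Set.Icc 0 1) := by
    apply antitoneOn_of_deriv_nonpos (convex_Icc 0 1)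
    · exact fun t _ => (hder t).continuousAt.continuousWithinAt
    · exact fun t _ => (hder t).differentiableAt.differentiableWithinAt
    · intro t ht
      rw [interior_Icc] at ht
      rw [(hder t).deriv, ← inner_sub_left]
      have h1 := real_inner_le_norm (gradient f (x + t • (z - x)) - gradient f x) (z - x)
      have h2 := hL.norm_sub_le (x + t • (z - x)) x
      rw [add_sub_cancel_left, norm_smul, Real.norm_of_nonneg ht.1.le] at h2
      have h3 := mul_le_mul_of_nonneg_right h2 (norm_nonneg (z - x))
      nlinarith
  have := hanti (Set.left_mem_Icc.2 zero_le_one) (Set.right_mem_Icc.2 zero_le_one) zero_le_one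
  simp only [hφ, one_smul, zero_smul, add_zero, add_sub_cancel] at this
  linarith

lemma descent_lower {f : E → ℝ} {L : ℝ≥0} (hf : Differentiable ℝ f)
    (hL : LipschitzWith L (gradient f)) (x z : E) :
    f x + inner ℝ (gradient f x) (z - x) - L / 2 * ‖z - x‖ ^ 2 ≤ f z := by
  have hg : gradient (fun y => -f y) = fun y => -gradient f y := by
    funext y
    exact ((hf y).hasGradientAt.hasFDerivAt.neg.hasGradientAt.gradient).trans
      (by rw [map_neg, LinearIsometryEquiv.symm_apply_apply])
  have hL' : LipschitzWith L (gradient fun y => -f y) := by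
    rw [hg]; exact hL.neg
  have := descent_upper hf.neg (L := L) hL' x z
  have e : gradient (-f) x = - gradient f x := congrFun hg x
  rw [e] at this
  simp only [Pi.neg_apply, inner_neg_left] at this
  linarith

/-- A nonnegative function with `L`-Lipschitz gradient bounds its own gradient. This replaces any
bound on the gradients of the losses. -/
lemma norm_gradient_sq_le {f : E → ℝ} {L : ℝ≥0} (hf : Differentiable ℝ f)
    (hL : LipschitzWith L (gradient f)) (h0 : ∀ x, 0 ≤ f x) (hL1 : 1 ≤ L) (x : E) :
    ‖gradient f x‖ ^ 2 ≤ 2 * L * f x := by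
  have hLp : (0 : ℝ) < L := by exact_mod_cast lt_of_lt_of_le one_pos hL1
  have h := descent_upper hf hL x (x - (L : ℝ)⁻¹ • gradient f x)
  have h1 := h0 (x - (L : ℝ)⁻¹ • gradient f x)
  rw [sub_sub_cancel_left, inner_neg_right, norm_neg, inner_smul_right, norm_smul,
    real_inner_self_eq_norm_sq, Real.norm_of_nonneg (inv_nonneg.2 hLp.le)] at h
  have h2 : (L : ℝ) / 2 * ((L : ℝ)⁻¹ * ‖gradient f x‖) ^ 2
      = (L : ℝ)⁻¹ * ‖gradient f x‖ ^ 2 / 2 := by field_simp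
  rw [h2] at h
  have h3 : (L : ℝ)⁻¹ * ‖gradient f x‖ ^ 2 ≤ 2 * f x := by linarith
  have := mul_le_mul_of_nonneg_left h3 hLp.le
  rw [← mul_assoc, mul_inv_cancel₀ hLp.ne', one_mul] at this
  linarith

lemma smooth_le_mul_add {f : E → ℝ} {L : ℝ≥0} (hf : Differentiable ℝ f)
    (hL : LipschitzWith L (gradient f)) (h0 : ∀ x, 0 ≤ f x) (hL1 : 1 ≤ L) (x z : E) {a : ℝ}
    (ha : 0 < a) :
    f z ≤ (1 + a) * f x + L / 2 * (1 + 1 / a) * ‖z - x‖ ^ 2 := by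
  have hLp : (0 : ℝ) < L := by exact_mod_cast lt_of_lt_of_le one_pos hL1
  have h := descent_upper hf hL x z
  have h1 := norm_gradient_sq_le hf hL h0 hL1 x
  have h2 := real_inner_le_norm (gradient f x) (z - x)
  have h3 : ‖gradient f x‖ * ‖z - x‖
      ≤ a / (2 * L) * ‖gradient f x‖ ^ 2 + L / (2 * a) * ‖z - x‖ ^ 2 := by
    have : 0 ≤ (a * ‖gradient f x‖ - L * ‖z - x‖) ^ 2 / (2 * L * a) := by positivity
    have e : (a * ‖gradient f x‖ - L * ‖z - x‖) ^ 2 / (2 * L * a)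
      = a / (2 * L) * ‖gradient f x‖ ^ 2 + L / (2 * a) * ‖z - x‖ ^ 2
        - ‖gradient f x‖ * ‖z - x‖ := by field_simp; ring
    linarith
  have h4 : a / (2 * L) * ‖gradient f x‖ ^ 2 ≤ a * f x := by
    calc a / (2 * L) * ‖gradient f x‖ ^ 2 ≤ a / (2 * L) * (2 * L * f x) := by gcongr
      _ = a * f x := by field_simp
  have e : (L : ℝ) / 2 * (1 + 1 / a) * ‖z - x‖ ^ 2
    = L / 2 * ‖z - x‖ ^ 2 + L / (2 * a) * ‖z - x‖ ^ 2 := by field_simp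
  rw [e]
  linarith

/-- Squared variation of a smooth nonnegative function, in terms of its value at either end. -/
lemma smooth_sub_sq_le {f : E → ℝ} {L : ℝ≥0} (hf : Differentiable ℝ f)
    (hL : LipschitzWith L (gradient f)) (h0 : ∀ x, 0 ≤ f x) (hL1 : 1 ≤ L) (x z : E) :
    (f z - f x) ^ 2 ≤ 4 * L * ‖z - x‖ ^ 2 * f x + L ^ 2 / 2 * ‖z - x‖ ^ 4 := by
  have hLp : (0 : ℝ) < L := by exact_mod_cast lt_of_lt_of_le one_pos hL1
  have h := descent_upper hf hL x z
  have h' := descent_lower hf hL x z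
  have h1 := norm_gradient_sq_le hf hL h0 hL1 x
  have h2 := abs_le.1 (abs_real_inner_le_norm (gradient f x) (z - x))
  set g := ‖gradient f x‖
  set δ := ‖z - x‖
  have hg : 0 ≤ g := norm_nonneg _
  have hδ : 0 ≤ δ := norm_nonneg _
  have h3 : |f z - f x| ≤ g * δ + L / 2 * δ ^ 2 := by
    rw [abs_le]; constructor <;> linarith [h2.1, h2.2]
  have h4 : (f z - f x) ^ 2 ≤ (g * δ + L / 2 * δ ^ 2) ^ 2 := by
    rw [← sq_abs]; gcongr
  have h5 : (g * δ + L / 2 * δ ^ 2) ^ 2 ≤ 2 * (g ^ 2 * δ ^ 2) + L ^ 2 / 2 * δ ^ 4 := by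
    nlinarith [sq_nonneg (g * δ - L / 2 * δ ^ 2)]
  have h6 : g ^ 2 * δ ^ 2 ≤ 2 * L * f x * δ ^ 2 := by gcongr
  linarith

end Smooth

/-! ### Relative entropy of probability vectors -/

/-- Tangent bound for `a log (a / b)`, the only convexity used in the entropy inequalities. -/
lemma mul_log_div_ge {a b c : ℝ} (ha : 0 ≤ a) (hb : 0 ≤ b) (hab : b = 0 → a = 0) (hc : 0 < c) :
    a * Real.log c + a - b * c ≤ a * Real.log (a / b) := by
  rcases ha.eq_or_lt with rfl | ha
  · simp; positivity
  have hb : 0 < b := lt_of_le_of_ne hb fun h => ha.ne' (hab h.symm)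
  have h1 : Real.log (a / b) = Real.log c + -Real.log (b * c / a) := by
    rw [← Real.log_inv, ← Real.log_mul hc.ne' (by positivity)]
    congr 1; field_simp
  have h2 := Real.log_le_sub_one_of_pos (show 0 < b * c / a by positivity)
  rw [h1]
  have h3 : a * Real.log (b * c / a) ≤ a * (b * c / a - 1) := by gcongr
  have h4 : a * (b * c / a - 1) = b * c - a := by field_simp
  linarith

lemma mul_log_div_hellinger {a b : ℝ} (ha : 0 ≤ a) (hb : 0 ≤ b) (hab : b = 0 → a = 0) :
    2 * a - 2 * (√a * √b) ≤ a * Real.log (a / b) := by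
  rcases ha.eq_or_lt with rfl | ha
  · simp
  have hb : 0 < b := lt_of_le_of_ne hb fun h => ha.ne' (hab h.symm)
  have h := mul_log_div_ge ha.le hb.le hab (c := √a / √b) (by positivity)
  have hsa := Real.mul_self_sqrt ha.le
  have hsb := Real.mul_self_sqrt hb.le
  have h1 : a * Real.log (√a / √b) = a * Real.log (a / b) / 2 := by
    rw [← Real.sqrt_div ha.le, Real.log_sqrt (by positivity)]; ring
  have h2 : b * (√a / √b) = √a * √b := by
    have : √b ≠ 0 := by positivity
    field_simp
    linear_combination (-1 : ℝ) * hsb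
  linarith

lemma mul_log_div_convex {a b a' b' k : ℝ} (ha : 0 ≤ a) (hb : 0 ≤ b) (hab : b = 0 → a = 0)
    (ha' : 0 ≤ a') (hb' : 0 ≤ b') (hab' : b' = 0 → a' = 0) (hk0 : 0 ≤ k) (hk1 : k ≤ 1) :
    ((1 - k) * a + k * a') * Real.log (((1 - k) * a + k * a') / ((1 - k) * b + k * b')) ≤
      (1 - k) * (a * Real.log (a / b)) + k * (a' * Real.log (a' / b')) := by
  have hk : 0 ≤ 1 - k := by linarith
  set A := (1 - k) * a + k * a' with hA
  set B := (1 - k) * b + k * b' with hB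
  have hA0 : 0 ≤ A := by positivity
  have hB0 : 0 ≤ B := by positivity
  by_cases hAz : A = 0
  · have h1 : (1 - k) * a = 0 := by
      have := mul_nonneg hk ha; have := mul_nonneg hk0 ha'; linarith
    have h2 : k * a' = 0 := by
      have := mul_nonneg hk ha; have := mul_nonneg hk0 ha'; linarith
    rw [hAz, ← mul_assoc, ← mul_assoc, h1, h2]; simp
  have hBz : B ≠ 0 := by
    intro h
    apply hAz
    have h1 : (1 - k) * b = 0 := by
      have := mul_nonneg hk hb; have := mul_nonneg hk0 hb'; linarith
    have h2 : k * b' = 0 := by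
      have := mul_nonneg hk hb; have := mul_nonneg hk0 hb'; linarith
    rw [hA]
    rcases mul_eq_zero.1 h1 with h | h <;> rcases mul_eq_zero.1 h2 with h' | h'
    · linarith
    · simp [h, hab' h']
    · simp [h', hab h]
    · simp [hab h, hab' h']
  obtain ⟨c, hcdef⟩ : ∃ c, c = A / B := ⟨_, rfl⟩
  have hc : 0 < c := hcdef ▸ div_pos (lt_of_le_of_ne hA0 (Ne.symm hAz))
    (lt_of_le_of_ne hB0 (Ne.symm hBz))
  rw [← hcdef]
  have h1 := mul_le_mul_of_nonneg_left (mul_log_div_ge ha hb hab hc) hk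
  have h2 := mul_le_mul_of_nonneg_left (mul_log_div_ge ha' hb' hab' hc) hk0
  have h3 : B * c = A := by rw [hcdef]; field_simp
  have h4 : (1 - k) * (b * c) + k * (b' * c) = (1 - k) * a + k * a' := by
    rw [← hA, ← h3, hB]; ring
  rw [hA]
  linarith

section Entropy

variable {M : ℕ}

/-- Relative entropy of two finite families of weights, with `0 log 0 = 0`. -/
noncomputable def relEnt (a b : Fin M → ℝ) : ℝ := ∑ m, a m * Real.log (a m / b m)

lemma relEnt_self (a : Fin M → ℝ) : relEnt a a = 0 := by
  refine Finset.sum_eq_zero fun m _ => ?_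
  by_cases h : a m = 0
  · simp [h]
  · simp [div_self h]

lemma relEnt_nonneg {a b : Fin M → ℝ} (ha : a ∈ stdSimplex ℝ (Fin M))
    (hb : b ∈ stdSimplex ℝ (Fin M)) (hab : ∀ m, b m = 0 → a m = 0) : 0 ≤ relEnt a b := by
  have : ∑ m, (a m * Real.log 1 + a m - b m * 1) ≤ relEnt a b :=
    Finset.sum_le_sum fun m _ => mul_log_div_ge (ha.1 m) (hb.1 m) (hab m) one_pos
  simpa [Finset.sum_sub_distrib, ha.2, hb.2] using this

/-- Relative entropy dominates the squared Hellinger distance. -/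
lemma hellinger_le_relEnt {a b : Fin M → ℝ} (ha : a ∈ stdSimplex ℝ (Fin M))
    (hb : b ∈ stdSimplex ℝ (Fin M)) (hab : ∀ m, b m = 0 → a m = 0) :
    ∑ m, (√(a m) - √(b m)) ^ 2 ≤ relEnt a b := by
  have h : ∑ m, (2 * a m - 2 * (√(a m) * √(b m))) ≤ relEnt a b :=
    Finset.sum_le_sum fun m _ => mul_log_div_hellinger (ha.1 m) (hb.1 m) (hab m)
  have e : ∀ m, (√(a m) - √(b m)) ^ 2 = a m + b m - 2 * (√(a m) * √(b m)) := fun m => by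
    rw [sub_sq, Real.sq_sqrt (ha.1 m), Real.sq_sqrt (hb.1 m)]; ring
  simp_rw [e]
  have h1 : ∑ m, (a m + b m - 2 * (√(a m) * √(b m)))
      = ∑ m, (2 * a m - 2 * (√(a m) * √(b m))) := by
    simp only [Finset.sum_sub_distrib, Finset.sum_add_distrib, ← Finset.mul_sum, ha.2, hb.2]
    ring
  rw [h1]; exact h

lemma relEnt_convex {a b a' b' : Fin M → ℝ} {k : ℝ} (ha : ∀ m, 0 ≤ a m) (hb : ∀ m, 0 ≤ b m)
    (hab : ∀ m, b m = 0 → a m = 0) (ha' : ∀ m, 0 ≤ a' m) (hb' : ∀ m, 0 ≤ b' m)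
    (hab' : ∀ m, b' m = 0 → a' m = 0) (hk0 : 0 ≤ k) (hk1 : k ≤ 1) :
    relEnt (fun m => (1 - k) * a m + k * a' m) (fun m => (1 - k) * b m + k * b' m) ≤
      (1 - k) * relEnt a b + k * relEnt a' b' := by
  unfold relEnt
  rw [Finset.mul_sum, Finset.mul_sum, ← Finset.sum_add_distrib]
  exact Finset.sum_le_sum fun m _ => mul_log_div_convex (ha m) (hb m) (hab m) (ha' m) (hb' m)
    (hab' m) hk0 hk1

/-- Normalization constant of the posterior. -/
noncomputable def evidence (p lo : Fin M → ℝ) : ℝ := ∑ m, p m * Real.exp (-lo m)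

/-- Posterior of the prior `p` when component `m` has log-loss `lo m`. -/
noncomputable def posterior (p lo : Fin M → ℝ) (m : Fin M) : ℝ :=
  p m * Real.exp (-lo m) / evidence p lo

lemma evidence_pos {p : Fin M → ℝ} (hp : p ∈ stdSimplex ℝ (Fin M)) (lo : Fin M → ℝ) :
    0 < evidence p lo := by
  obtain ⟨m, -, hm⟩ : ∃ m ∈ Finset.univ, 0 < p m := by
    by_contra! h
    have := Finset.sum_nonpos h
    rw [hp.2] at this
    linarith
  exact Finset.sum_pos' (fun m _ => mul_nonneg (hp.1 m) (Real.exp_pos _).le)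
    ⟨m, Finset.mem_univ m, mul_pos hm (Real.exp_pos _)⟩

lemma posterior_mem {p : Fin M → ℝ} (hp : p ∈ stdSimplex ℝ (Fin M)) (lo : Fin M → ℝ) :
    posterior p lo ∈ stdSimplex ℝ (Fin M) := by
  refine ⟨fun m => div_nonneg (mul_nonneg (hp.1 m) (Real.exp_pos _).le) (evidence_pos hp lo).le, ?_⟩
  unfold posterior
  rw [← Finset.sum_div]
  exact div_self (evidence_pos hp lo).ne'

lemma posterior_eq_zero_iff {p : Fin M → ℝ} (hp : p ∈ stdSimplex ℝ (Fin M)) (lo : Fin M → ℝ)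
    (m : Fin M) : posterior p lo m = 0 ↔ p m = 0 := by
  simp [posterior, (evidence_pos hp lo).ne']

/-- The posterior minimizes the free energy `a ↦ ∑ a (lo + log (a / p))`, and the excess of any
other `a` is its relative entropy. -/
lemma freeEnergy_eq {p : Fin M → ℝ} (hp : p ∈ stdSimplex ℝ (Fin M)) (lo : Fin M → ℝ)
    {a : Fin M → ℝ} (ha : a ∈ stdSimplex ℝ (Fin M)) (hap : ∀ m, p m = 0 → a m = 0) :
    ∑ m, a m * lo m + relEnt a p = -Real.log (evidence p lo) + relEnt a (posterior p lo) := by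
  have hZ := evidence_pos hp lo
  have key : ∀ m, a m * lo m + a m * Real.log (a m / p m)
      = a m * -Real.log (evidence p lo) + a m * Real.log (a m / posterior p lo m) := by
    intro m
    by_cases h : a m = 0
    · simp [h]
    have hpm : p m ≠ 0 := fun h' => h (hap m h')
    have : a m / posterior p lo m = a m / p m * Real.exp (lo m) * evidence p lo := by
      unfold posterior
      rw [Real.exp_neg]
      have := (Real.exp_pos (lo m)).ne'
      field_simp
    rw [this, Real.log_mul (mul_ne_zero (div_ne_zero h hpm) (Real.exp_pos _).ne') hZ.ne',
      Real.log_mul (div_ne_zero h hpm) (Real.exp_pos _).ne', Real.log_exp]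
    ring
  unfold relEnt
  rw [← Finset.sum_add_distrib, Finset.sum_congr rfl fun m _ => key m, Finset.sum_add_distrib,
    ← Finset.sum_mul, ha.2, one_mul]

end Entropy

/-! ### Averages over the samples -/

section Avg

variable {S : Type*} [Fintype S]

/-- Average over all the samples. -/
noncomputable def avg {E : Type*} [AddCommGroup E] [Module ℝ E] (φ : S → E) : E :=
  (Fintype.card S : ℝ)⁻¹ • ∑ s, φ s

section Module
variable {E : Type*} [AddCommGroup E] [Module ℝ E]

lemma avg_add (φ ψ : S → E) : avg (fun s => φ s + ψ s) = avg φ + avg ψ := by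
  simp [avg, Finset.sum_add_distrib]

lemma avg_sub (φ ψ : S → E) : avg (fun s => φ s - ψ s) = avg φ - avg ψ := by
  simp [avg, Finset.sum_sub_distrib, smul_sub]

lemma avg_smul (c : ℝ) (φ : S → E) : avg (fun s => c • φ s) = c • avg φ := by
  simp [avg, ← Finset.smul_sum, smul_comm c]

lemma avg_const [Nonempty S] (c : E) : avg (fun _ : S => c) = c := by
  have : (Fintype.card S : ℝ) ≠ 0 := by exact_mod_cast Fintype.card_ne_zero
  simp [avg, ← Nat.cast_smul_eq_nsmul ℝ, smul_smul, this]

end Module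

lemma avg_mul (c : ℝ) (φ : S → ℝ) : avg (fun s => c * φ s) = c * avg φ := avg_smul c φ

lemma avg_mono {φ ψ : S → ℝ} (h : ∀ s, φ s ≤ ψ s) : avg φ ≤ avg ψ := by
  unfold avg
  exact mul_le_mul_of_nonneg_left (Finset.sum_le_sum fun s _ => h s) (by positivity)

lemma avg_nonneg {φ : S → ℝ} (h : ∀ s, 0 ≤ φ s) : 0 ≤ avg φ :=
  mul_nonneg (by positivity) (Finset.sum_nonneg fun s _ => h s)

lemma avg_le [Nonempty S] {φ : S → ℝ} {c : ℝ} (h : ∀ s, φ s ≤ c) : avg φ ≤ c :=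
  (avg_mono h).trans (avg_const c).le

variable {E : Type*} [NormedAddCommGroup E] [InnerProductSpace ℝ E]

lemma avg_inner (φ : S → E) (w : E) : avg (fun s => inner ℝ (φ s) w) = inner ℝ (avg φ) w := by
  simp [avg, inner_smul_left, sum_inner]

lemma norm_avg_sq_le (φ : S → E) : ‖avg φ‖ ^ 2 ≤ avg fun s => ‖φ s‖ ^ 2 := by
  rcases isEmpty_or_nonempty S with h | h
  · simp [avg]
  have h0 : 0 ≤ avg fun s => ‖φ s - avg φ‖ ^ 2 := avg_nonneg fun s => by positivity
  have e : (fun s => ‖φ s - avg φ‖ ^ 2)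
      = fun s => (‖φ s‖ ^ 2 - 2 * inner ℝ (φ s) (avg φ)) + ‖avg φ‖ ^ 2 := by
    funext s; rw [norm_sub_sq_real]
  rw [e, avg_add, avg_sub, avg_mul, avg_inner, avg_const, real_inner_self_eq_norm_sq] at h0
  linarith

end Avg

/-! ### The weighted risk and its gradient -/

/-- Per-sample losses that are nonnegative and smooth. -/
structure SmoothLoss {S : Type*} {d : ℕ} (l : S → Vec d → ℝ) (L : ℝ≥0) : Prop where
  diff : ∀ s, Differentiable ℝ (l s)
  lip : ∀ s, LipschitzWith L (gradient (l s))
  nonneg : ∀ s θ, 0 ≤ l s θ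
  one_le : 1 ≤ L

section Risk

variable {S : Type*} [Fintype S] {M d : ℕ}

/-- Average loss when sample `s` uses the parameters `z s` and weights component `m` by `q s m`. -/
noncomputable def risk (l : S → Vec d → ℝ) (z : S → Params M d) (q : S → Fin M → ℝ) : ℝ :=
  avg fun s => ∑ m, q s m * l s (z s m)

/-- Average of the weighted gradients; for constant `z` it is the gradient of `risk`. -/
noncomputable def gradVec (l : S → Vec d → ℝ) (z : S → Params M d) (q : S → Fin M → ℝ) :
    Params M d :=
  avg fun s => WithLp.toLp 2 fun m => q s m • gradient (l s) (z s m)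

/-- Directional derivative of `risk` in the direction `Δ`. -/
noncomputable def dirRisk (l : S → Vec d → ℝ) (z : S → Params M d) (q : S → Fin M → ℝ)
    (Δ : S → Params M d) : ℝ :=
  avg fun s => ∑ m, q s m * inner ℝ (gradient (l s) (z s m)) (Δ s m)

variable {l : S → Vec d → ℝ} {L : ℝ≥0} {q : S → Fin M → ℝ}

lemma params_norm_sq (w : Params M d) : ‖w‖ ^ 2 = ∑ m, ‖w m‖ ^ 2 := PiLp.norm_sq_eq_of_L2 _ w

lemma simplex_le_one {a : Fin M → ℝ} (ha : a ∈ stdSimplex ℝ (Fin M)) (m : Fin M) : a m ≤ 1 :=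
  ha.2 ▸ Finset.single_le_sum (fun i _ => ha.1 i) (Finset.mem_univ m)

omit [Fintype S] in
lemma weighted_norm_sq_le (hq : ∀ s, q s ∈ stdSimplex ℝ (Fin M)) (s : S) (w : Params M d) :
    ∑ m, q s m * ‖w m‖ ^ 2 ≤ ‖w‖ ^ 2 := by
  rw [params_norm_sq]
  exact Finset.sum_le_sum fun m _ => mul_le_of_le_one_left (by positivity) (simplex_le_one (hq s) m)

lemma risk_nonneg (hl : SmoothLoss l L) (hq : ∀ s, q s ∈ stdSimplex ℝ (Fin M))
    (z : S → Params M d) : 0 ≤ risk l z q :=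
  avg_nonneg fun s => Finset.sum_nonneg fun m _ => mul_nonneg ((hq s).1 m) (hl.nonneg s _)

lemma dirRisk_const (z : S → Params M d) (w : Params M d) :
    dirRisk l z q (fun _ => w) = inner ℝ (gradVec l z q) w := by
  unfold dirRisk gradVec
  rw [← avg_inner]
  congr 1; funext s
  simp [PiLp.inner_apply, inner_smul_left]

lemma dirRisk_add (z Δ Δ' : S → Params M d) :
    dirRisk l z q (fun s => Δ s + Δ' s) = dirRisk l z q Δ + dirRisk l z q Δ' := by
  unfold dirRisk
  rw [← avg_add]
  congr 1; funext s
  simp [inner_add_right, mul_add, Finset.sum_add_distrib]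

lemma dirRisk_sub (z Δ Δ' : S → Params M d) :
    dirRisk l z q (fun s => Δ s - Δ' s) = dirRisk l z q Δ - dirRisk l z q Δ' := by
  unfold dirRisk
  rw [← avg_sub]
  congr 1; funext s
  simp [inner_sub_right, mul_sub, Finset.sum_sub_distrib]

lemma risk_mix (z : S → Params M d) (q q' : S → Fin M → ℝ) (k : ℝ) :
    risk l z (fun s m => (1 - k) * q s m + k * q' s m)
      = (1 - k) * risk l z q + k * risk l z q' := by
  unfold risk
  rw [← avg_mul, ← avg_mul, ← avg_add]
  congr 1; funext s
  rw [Finset.mul_sum, Finset.mul_sum, ← Finset.sum_add_distrib]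
  exact Finset.sum_congr rfl fun m _ => by ring

lemma gradVec_mix (z : S → Params M d) (q q' : S → Fin M → ℝ) (k : ℝ) :
    gradVec l z (fun s m => (1 - k) * q s m + k * q' s m)
      = (1 - k) • gradVec l z q + k • gradVec l z q' := by
  unfold gradVec
  rw [← avg_smul, ← avg_smul, ← avg_add]
  congr 1; funext s
  ext m : 1
  simp [add_smul, smul_smul]

lemma norm_gradVec_sq_le (hl : SmoothLoss l L) (hq : ∀ s, q s ∈ stdSimplex ℝ (Fin M))
    (z : S → Params M d) : ‖gradVec l z q‖ ^ 2 ≤ 2 * L * risk l z q := by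
  unfold gradVec risk
  refine (norm_avg_sq_le _).trans ?_
  rw [← avg_mul]
  refine avg_mono fun s => ?_
  rw [params_norm_sq, Finset.mul_sum]
  refine Finset.sum_le_sum fun m _ => ?_
  have h0 := (hq s).1 m
  have h1 := simplex_le_one (hq s) m
  have h2 := norm_gradient_sq_le (hl.diff s) (hl.lip s) (hl.nonneg s) hl.one_le (z s m)
  rw [WithLp.ofLp_toLp, norm_smul, Real.norm_of_nonneg h0, mul_pow]
  calc q s m ^ 2 * ‖gradient (l s) (z s m)‖ ^ 2 ≤ q s m * (2 * L * l s (z s m)) := by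
        gcongr
        nlinarith
    _ = _ := by ring

lemma norm_gradVec_sub_sq_le (hl : SmoothLoss l L) (hq : ∀ s, q s ∈ stdSimplex ℝ (Fin M))
    (z z' : S → Params M d) :
    ‖gradVec l z q - gradVec l z' q‖ ^ 2 ≤ L ^ 2 * avg fun s => ‖z s - z' s‖ ^ 2 := by
  unfold gradVec
  rw [← avg_sub]
  refine (norm_avg_sq_le _).trans ?_
  rw [← avg_mul]
  refine avg_mono fun s => ?_
  rw [params_norm_sq, params_norm_sq, Finset.mul_sum]
  refine Finset.sum_le_sum fun m _ => ?_
  have h0 := (hq s).1 m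
  have h1 := simplex_le_one (hq s) m
  have h2 := (hl.lip s).norm_sub_le (z s m) (z' s m)
  rw [PiLp.sub_apply, PiLp.sub_apply, WithLp.ofLp_toLp, WithLp.ofLp_toLp, ← smul_sub, norm_smul,
    Real.norm_of_nonneg h0, ← mul_pow]
  refine pow_le_pow_left₀ (by positivity) ?_ 2
  calc q s m * ‖gradient (l s) (z s m) - gradient (l s) (z' s m)‖
      ≤ 1 * (L * ‖z s m - z' s m‖) := by gcongr
    _ = _ := one_mul _

lemma risk_le (hl : SmoothLoss l L) (hq : ∀ s, q s ∈ stdSimplex ℝ (Fin M))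
    (z z' : S → Params M d) :
    risk l z' q ≤ risk l z q + dirRisk l z q (fun s => z' s - z s)
      + L / 2 * avg fun s => ‖z' s - z s‖ ^ 2 := by
  unfold risk dirRisk
  rw [← avg_mul, ← avg_add, ← avg_add]
  refine avg_mono fun s => ?_
  have h1 : ∀ m, q s m * l s (z' s m) ≤ q s m * l s (z s m)
      + q s m * inner ℝ (gradient (l s) (z s m)) ((z' s - z s) m)
      + L / 2 * (q s m * ‖(z' s - z s) m‖ ^ 2) := fun m => by
    have := mul_le_mul_of_nonneg_left
      (descent_upper (hl.diff s) (hl.lip s) (z s m) (z' s m)) ((hq s).1 m)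
    simp only [PiLp.sub_apply]
    linarith
  refine (Finset.sum_le_sum fun m _ => h1 m).trans ?_
  rw [Finset.sum_add_distrib, Finset.sum_add_distrib, ← Finset.mul_sum]
  gcongr
  exact weighted_norm_sq_le hq s _

lemma risk_ge (hl : SmoothLoss l L) (hq : ∀ s, q s ∈ stdSimplex ℝ (Fin M))
    (z z' : S → Params M d) :
    risk l z q + dirRisk l z q (fun s => z' s - z s)
      - L / 2 * (avg fun s => ‖z' s - z s‖ ^ 2) ≤ risk l z' q := by
  unfold risk dirRisk
  rw [← avg_mul, ← avg_add, ← avg_sub]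
  refine avg_mono fun s => ?_
  have h1 : ∀ m, q s m * l s (z s m)
      + q s m * inner ℝ (gradient (l s) (z s m)) ((z' s - z s) m)
      ≤ q s m * l s (z' s m) + L / 2 * (q s m * ‖(z' s - z s) m‖ ^ 2) := fun m => by
    have := mul_le_mul_of_nonneg_left
      (descent_lower (hl.diff s) (hl.lip s) (z s m) (z' s m)) ((hq s).1 m)
    simp only [PiLp.sub_apply]
    linarith
  have h2 := Finset.sum_le_sum fun m (_ : m ∈ Finset.univ) => h1 m
  rw [Finset.sum_add_distrib, Finset.sum_add_distrib, ← Finset.mul_sum] at h2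
  have h3 : (L : ℝ) / 2 * ∑ m, q s m * ‖(z' s - z s) m‖ ^ 2 ≤ L / 2 * ‖z' s - z s‖ ^ 2 := by
    gcongr; exact weighted_norm_sq_le hq s _
  linarith

lemma risk_le_mul_add (hl : SmoothLoss l L) (hq : ∀ s, q s ∈ stdSimplex ℝ (Fin M))
    (z z' : S → Params M d) {a : ℝ} (ha : 0 < a) :
    risk l z' q ≤ (1 + a) * risk l z q
      + L / 2 * (1 + 1 / a) * avg fun s => ‖z' s - z s‖ ^ 2 := by
  unfold risk
  rw [← avg_mul, ← avg_mul, ← avg_add]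
  refine avg_mono fun s => ?_
  have h1 : ∀ m, q s m * l s (z' s m) ≤ (1 + a) * (q s m * l s (z s m))
      + L / 2 * (1 + 1 / a) * (q s m * ‖(z' s - z s) m‖ ^ 2) := fun m => by
    have := mul_le_mul_of_nonneg_left
      (smooth_le_mul_add (hl.diff s) (hl.lip s) (hl.nonneg s) hl.one_le (z s m) (z' s m) ha)
      ((hq s).1 m)
    simp only [PiLp.sub_apply]
    linarith
  refine (Finset.sum_le_sum fun m _ => h1 m).trans ?_
  rw [Finset.sum_add_distrib, ← Finset.mul_sum, ← Finset.mul_sum]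
  gcongr
  exact weighted_norm_sq_le hq s _

lemma abs_dirRisk_le (hl : SmoothLoss l L) (hq : ∀ s, q s ∈ stdSimplex ℝ (Fin M))
    (z Δ : S → Params M d) (k : ℝ) :
    k * |dirRisk l z q Δ| ≤ k ^ 2 * (L * risk l z q) + 1 / 2 * avg fun s => ‖Δ s‖ ^ 2 := by
  have key : ∀ σ : ℝ, σ ^ 2 = 1 → k * (σ * dirRisk l z q Δ)
      ≤ k ^ 2 * (L * risk l z q) + 1 / 2 * avg fun s => ‖Δ s‖ ^ 2 := by
    intro σ hσ
    unfold dirRisk risk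
    rw [← avg_mul, ← avg_mul, ← avg_mul, ← avg_mul, ← avg_mul, ← avg_add]
    refine avg_mono fun s => ?_
    have h1 : ∀ m, k * (σ * (q s m * inner ℝ (gradient (l s) (z s m)) (Δ s m)))
        ≤ k ^ 2 * (L * (q s m * l s (z s m))) + 1 / 2 * (q s m * ‖Δ s m‖ ^ 2) := fun m => by
      have h0 := (hq s).1 m
      have h2 := norm_gradient_sq_le (hl.diff s) (hl.lip s) (hl.nonneg s) hl.one_le (z s m)
      have h3 : 0 ≤ ‖(k * σ) • gradient (l s) (z s m) - Δ s m‖ ^ 2 := by positivity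
      rw [norm_sub_sq_real, norm_smul, mul_pow, Real.norm_eq_abs, sq_abs, mul_pow, hσ,
        inner_smul_left] at h3
      simp only [conj_trivial, mul_one] at h3
      have h4 : k ^ 2 * ‖gradient (l s) (z s m)‖ ^ 2 ≤ k ^ 2 * (2 * L * l s (z s m)) := by gcongr
      have h5 : k * σ * inner ℝ (gradient (l s) (z s m)) (Δ s m)
          ≤ k ^ 2 * (L * l s (z s m)) + 1 / 2 * ‖Δ s m‖ ^ 2 := by linarith
      have := mul_le_mul_of_nonneg_left h5 h0
      linarith
    rw [Finset.mul_sum, Finset.mul_sum]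
    refine (Finset.sum_le_sum fun m _ => h1 m).trans ?_
    rw [Finset.sum_add_distrib, ← Finset.mul_sum, ← Finset.mul_sum, ← Finset.mul_sum]
    gcongr
    exact weighted_norm_sq_le hq s _
  rcases abs_cases (dirRisk l z q Δ) with ⟨h, -⟩ | ⟨h, -⟩ <;> rw [h]
  · simpa using key 1 (by norm_num)
  · simpa using key (-1) (by norm_num)

end Risk

/-! ### Entropy inequalities of expectation maximization -/

section EM

variable {S : Type*} [Fintype S] {T M d : ℕ}

/-- Average relative entropy of the responsibilities `q` with respect to the mixture weights
`π` of the clients. -/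
noncomputable def respInfo (cl : S → Fin T) (π : Fin T → Fin M → ℝ) (q : S → Fin M → ℝ) : ℝ :=
  avg fun s => relEnt (q s) (π (cl s))

/-- Relative entropy of mixture weights, averaged over the samples (so that a client is weighted
by the size of its data set). -/
noncomputable def clientKL (cl : S → Fin T) (a b : Fin T → Fin M → ℝ) : ℝ :=
  avg fun s => relEnt (a (cl s)) (b (cl s))

/-- `π t` is the mean of the responsibilities `q` over the samples of client `t`, expressed by
testing against functions of the client. -/
structure IsClientMean (cl : S → Fin T) (q : S → Fin M → ℝ) (π : Fin T → Fin M → ℝ) : Prop where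
  mem : ∀ t, π t ∈ stdSimplex ℝ (Fin M)
  tower : ∀ m (φ : Fin T → ℝ), avg (fun s => q s m * φ (cl s)) = avg fun s => π (cl s) m * φ (cl s)

variable {cl : S → Fin T} {q q' : S → Fin M → ℝ} {π π' : Fin T → Fin M → ℝ}

lemma avg_sum_comm (φ : S → Fin M → ℝ) : (avg fun s => ∑ m, φ s m) = ∑ m, avg fun s => φ s m := by
  unfold avg
  rw [Finset.sum_comm, Finset.smul_sum]

lemma IsClientMean.tower_sum (h : IsClientMean cl q π) (φ : Fin T → Fin M → ℝ) :
    (avg fun s => ∑ m, q s m * φ (cl s) m) = avg fun s => ∑ m, π (cl s) m * φ (cl s) m := by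
  rw [avg_sum_comm, avg_sum_comm]
  exact Finset.sum_congr rfl fun m _ => h.tower m fun t => φ t m

lemma IsClientMean.mix (h : IsClientMean cl q π) (h' : IsClientMean cl q' π') {k : ℝ}
    (hk0 : 0 ≤ k) (hk1 : k ≤ 1) :
    IsClientMean cl (fun s m => (1 - k) * q s m + k * q' s m)
      (fun t m => (1 - k) * π t m + k * π' t m) where
  mem t := (convex_stdSimplex ℝ (Fin M)) (h.mem t) (h'.mem t) (by linarith) hk0 (by ring)
  tower m φ := by
    have h1 := h.tower m φ
    have h2 := h'.tower m φ
    simp only [add_mul, mul_assoc, avg_add, avg_mul] at h1 h2 ⊢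
    rw [h1, h2]

lemma avg_eq_zero_iff [Nonempty S] {φ : S → ℝ} (h0 : ∀ s, 0 ≤ φ s) (h : avg φ = 0) (s : S) :
    φ s = 0 := by
  have hc : (Fintype.card S : ℝ)⁻¹ ≠ 0 := inv_ne_zero (by exact_mod_cast Fintype.card_ne_zero)
  have : ∑ s, φ s = 0 := (mul_eq_zero.1 h).resolve_left hc
  exact (Finset.sum_eq_zero_iff_of_nonneg fun s _ => h0 s).1 this s (Finset.mem_univ s)

variable [Nonempty S]

lemma IsClientMean.eq_zero (h : IsClientMean cl q π) (hq : ∀ s, q s ∈ stdSimplex ℝ (Fin M))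
    {s : S} {m : Fin M} (h0 : π (cl s) m = 0) : q s m = 0 := by
  have h1 := h.tower m fun t => if t = cl s then 1 else 0
  have h2 : (avg fun s' => π (cl s') m * if cl s' = cl s then (1 : ℝ) else 0) = 0 := by
    have : (fun s' => π (cl s') m * if cl s' = cl s then (1 : ℝ) else 0) = fun _ => 0 := by
      funext s'
      by_cases hs : cl s' = cl s <;> simp [hs, h0]
    rw [this]; exact avg_const 0
  rw [h2] at h1
  have := avg_eq_zero_iff (fun s' => mul_nonneg ((hq s').1 m) (by split_ifs <;> norm_num)) h1 s
  simpa using this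

lemma IsClientMean.eq_zero' (h : IsClientMean cl q π) {s : S} {m : Fin M}
    (h0 : ∀ s', cl s' = cl s → q s' m = 0) : π (cl s) m = 0 := by
  have h1 := h.tower m fun t => if t = cl s then 1 else 0
  have h2 : (avg fun s' => q s' m * if cl s' = cl s then (1 : ℝ) else 0) = 0 := by
    have : (fun s' => q s' m * if cl s' = cl s then (1 : ℝ) else 0) = fun _ => 0 := by
      funext s'
      by_cases hs : cl s' = cl s <;> simp [hs, h0]
    rw [this]; exact avg_const 0
  rw [h2] at h1
  have := avg_eq_zero_iff
    (fun s' => mul_nonneg ((h.mem (cl s')).1 m) (by split_ifs <;> norm_num)) h1.symm s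
  simpa using this

omit [Nonempty S] in
lemma respInfo_nonneg (hq : ∀ s, q s ∈ stdSimplex ℝ (Fin M))
    (hπ : ∀ t, π t ∈ stdSimplex ℝ (Fin M)) (hac : ∀ s m, π (cl s) m = 0 → q s m = 0) :
    0 ≤ respInfo cl π q :=
  avg_nonneg fun s => relEnt_nonneg (hq s) (hπ _) (hac s)

omit [Nonempty S] in
lemma clientKL_nonneg (hπ' : ∀ t, π' t ∈ stdSimplex ℝ (Fin M))
    (hπ : ∀ t, π t ∈ stdSimplex ℝ (Fin M)) (hac : ∀ s m, π (cl s) m = 0 → π' (cl s) m = 0) :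
    0 ≤ clientKL cl π' π :=
  avg_nonneg fun s => relEnt_nonneg (hπ' _) (hπ _) (hac s)

/-- Compensation identity: replacing the prior by the client means of the responsibilities lowers
the information by the relative entropy of the change. -/
lemma respInfo_eq_add (h : IsClientMean cl q π') (hq : ∀ s, q s ∈ stdSimplex ℝ (Fin M))
    (hac : ∀ s m, π (cl s) m = 0 → q s m = 0) :
    respInfo cl π q = respInfo cl π' q + clientKL cl π' π := by
  unfold clientKL
  rw [show (avg fun s => relEnt (π' (cl s)) (π (cl s)))
    = avg fun s => ∑ m, q s m * Real.log (π' (cl s) m / π (cl s) m) from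
      (h.tower_sum fun t m => Real.log (π' t m / π t m)).symm]
  unfold respInfo
  rw [← avg_add]
  congr 1; funext s
  unfold relEnt
  rw [← Finset.sum_add_distrib]
  refine Finset.sum_congr rfl fun m _ => ?_
  by_cases h0 : q s m = 0
  · simp [h0]
  have h1 : π (cl s) m ≠ 0 := fun h' => h0 (hac s m h')
  have h2 : π' (cl s) m ≠ 0 := fun h' => h0 (h.eq_zero hq h')
  rw [← mul_add, ← Real.log_mul (div_ne_zero h0 h2) (div_ne_zero h2 h1)]
  congr 2
  field_simp

/-- Data processing: taking client means does not increase the relative entropy. -/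
lemma clientKL_le_avg_relEnt (h : IsClientMean cl q π) (h' : IsClientMean cl q' π')
    (hq : ∀ s, q s ∈ stdSimplex ℝ (Fin M)) (hq' : ∀ s, q' s ∈ stdSimplex ℝ (Fin M))
    (hac : ∀ s m, q' s m = 0 → q s m = 0) :
    clientKL cl π π' ≤ avg fun s => relEnt (q s) (q' s) := by
  -- the tangent of `relEnt` at the ratio of the means
  have h1 : ∀ s, ∑ m, (q s m * Real.log (π (cl s) m / π' (cl s) m) + q s m
      - q' s m * (π (cl s) m / π' (cl s) m)) ≤ relEnt (q s) (q' s) := by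
    intro s
    refine Finset.sum_le_sum fun m _ => ?_
    by_cases h0 : π (cl s) m = 0
    · rw [h0, h.eq_zero hq h0]; simp
    by_cases h0' : π' (cl s) m = 0
    · rw [hac s m (h'.eq_zero hq' h0'), h0']; simp
    · exact mul_log_div_ge ((hq s).1 m) ((hq' s).1 m) (hac s m)
        (div_pos (lt_of_le_of_ne ((h.mem _).1 m) (Ne.symm h0))
          (lt_of_le_of_ne ((h'.mem _).1 m) (Ne.symm h0')))
  refine le_trans (le_of_eq ?_) (avg_mono h1)
  have e : (fun s => ∑ m, (q s m * Real.log (π (cl s) m / π' (cl s) m) + q s m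
      - q' s m * (π (cl s) m / π' (cl s) m)))
      = fun s => (∑ m, q s m * Real.log (π (cl s) m / π' (cl s) m)) + 1
        - ∑ m, q' s m * (π (cl s) m / π' (cl s) m) := by
    funext s
    rw [Finset.sum_sub_distrib, Finset.sum_add_distrib, (hq s).2]
  rw [e, avg_sub, avg_add, h.tower_sum fun t m => Real.log (π t m / π' t m),
    h'.tower_sum fun t m => π t m / π' t m, avg_const]
  have h2 : (avg fun s => ∑ m, π' (cl s) m * (π (cl s) m / π' (cl s) m)) = 1 := by
    rw [← avg_const (S := S) (1 : ℝ)]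
    congr 1; funext s
    rw [← (h.mem (cl s)).2]
    refine Finset.sum_congr rfl fun m _ => ?_
    by_cases h0' : π' (cl s) m = 0
    · rw [h0', h.eq_zero' (s := s) fun s' hs' =>
        hac s' m (h'.eq_zero hq' (by rw [hs']; exact h0'))]; simp
    · field_simp
  rw [h2]
  unfold clientKL relEnt
  ring

lemma respInfo_convex {k : ℝ} (hk0 : 0 ≤ k) (hk1 : k ≤ 1)
    (hq : ∀ s, q s ∈ stdSimplex ℝ (Fin M)) (hq' : ∀ s, q' s ∈ stdSimplex ℝ (Fin M))
    (h : IsClientMean cl q π) (h' : IsClientMean cl q' π') :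
    respInfo cl (fun t m => (1 - k) * π t m + k * π' t m)
      (fun s m => (1 - k) * q s m + k * q' s m)
      ≤ (1 - k) * respInfo cl π q + k * respInfo cl π' q' := by
  unfold respInfo
  rw [← avg_mul, ← avg_mul, ← avg_add]
  exact avg_mono fun s => relEnt_convex (hq s).1 (h.mem _).1 (fun m => h.eq_zero hq) (hq' s).1
    (h'.mem _).1 (fun m => h'.eq_zero hq') hk0 hk1

end EM

section FreeEnergy

variable {S : Type*} [Fintype S] {T M d : ℕ}

/-- Responsibilities computed in the E-step from the client parameters `Θ` and weights `π`. -/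
noncomputable def resp (cl : S → Fin T) (l : S → Vec d → ℝ) (Θ : Fin T → Params M d)
    (π : Fin T → Fin M → ℝ) (s : S) : Fin M → ℝ :=
  posterior (π (cl s)) fun m => l s (Θ (cl s) m)

/-- Negative log-likelihood when every client is evaluated at its own parameters. -/
noncomputable def freeEnergy (cl : S → Fin T) (l : S → Vec d → ℝ) (Θ : Fin T → Params M d)
    (π : Fin T → Fin M → ℝ) : ℝ :=
  avg fun s => -Real.log (evidence (π (cl s)) fun m => l s (Θ (cl s) m))

variable {cl : S → Fin T} {l : S → Vec d → ℝ} {L : ℝ≥0} {Θ : Fin T → Params M d}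
  {π π' πh : Fin T → Fin M → ℝ} {qh : S → Fin M → ℝ}

omit [Fintype S] in
lemma resp_mem (hπ : ∀ t, π t ∈ stdSimplex ℝ (Fin M)) (s : S) :
    resp cl l Θ π s ∈ stdSimplex ℝ (Fin M) := posterior_mem (hπ _) _

omit [Fintype S] in
lemma resp_eq_zero_iff (hπ : ∀ t, π t ∈ stdSimplex ℝ (Fin M)) (s : S) (m : Fin M) :
    resp cl l Θ π s m = 0 ↔ π (cl s) m = 0 := posterior_eq_zero_iff (hπ _) _ _

lemma freeEnergy_add (hπ : ∀ t, π t ∈ stdSimplex ℝ (Fin M))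
    (hq : ∀ s, qh s ∈ stdSimplex ℝ (Fin M)) (hac : ∀ s m, π (cl s) m = 0 → qh s m = 0) :
    freeEnergy cl l Θ π + (avg fun s => relEnt (qh s) (resp cl l Θ π s))
      = risk l (fun s => Θ (cl s)) qh + respInfo cl π qh := by
  unfold freeEnergy risk respInfo
  rw [← avg_add, ← avg_add]
  congr 1; funext s
  exact (freeEnergy_eq (hπ (cl s)) _ (hq s) (hac s)).symm

lemma freeEnergy_eq_resp (hπ : ∀ t, π t ∈ stdSimplex ℝ (Fin M)) :
    freeEnergy cl l Θ π = risk l (fun s => Θ (cl s)) (resp cl l Θ π)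
      + respInfo cl π (resp cl l Θ π) := by
  rw [← freeEnergy_add hπ (resp_mem hπ) fun s m h => (resp_eq_zero_iff hπ s m).2 h]
  simp_rw [relEnt_self]
  simp [avg]

lemma freeEnergy_le (hπ : ∀ t, π t ∈ stdSimplex ℝ (Fin M))
    (hq : ∀ s, qh s ∈ stdSimplex ℝ (Fin M)) (hac : ∀ s m, π (cl s) m = 0 → qh s m = 0) :
    freeEnergy cl l Θ π ≤ risk l (fun s => Θ (cl s)) qh + respInfo cl π qh := by
  rw [← freeEnergy_add hπ hq hac]
  have : 0 ≤ avg fun s => relEnt (qh s) (resp cl l Θ π s) := avg_nonneg fun s =>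
    relEnt_nonneg (hq s) (resp_mem hπ s) fun m h => hac s m ((resp_eq_zero_iff hπ s m).1 h)
  linarith

lemma risk_resp_le (hπ : ∀ t, π t ∈ stdSimplex ℝ (Fin M)) :
    risk l (fun s => Θ (cl s)) (resp cl l Θ π) ≤ freeEnergy cl l Θ π := by
  rw [freeEnergy_eq_resp hπ]
  have := respInfo_nonneg (cl := cl) (resp_mem (cl := cl) (l := l) (Θ := Θ) hπ) hπ
    fun s m h => (resp_eq_zero_iff hπ s m).2 h
  linarith

lemma freeEnergy_nonneg (hl : SmoothLoss l L) (hπ : ∀ t, π t ∈ stdSimplex ℝ (Fin M)) :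
    0 ≤ freeEnergy cl l Θ π :=
  (risk_nonneg hl (resp_mem hπ) _).trans (risk_resp_le hπ)

/-- Comparison responsibilities `qh` with client means `πh`, supported by the weights `π`. -/
structure Comparator (cl : S → Fin T) (π : Fin T → Fin M → ℝ) (qh : S → Fin M → ℝ)
    (πh : Fin T → Fin M → ℝ) : Prop where
  weights : ∀ t, π t ∈ stdSimplex ℝ (Fin M)
  mem : ∀ s, qh s ∈ stdSimplex ℝ (Fin M)
  mean : IsClientMean cl qh πh
  ac : ∀ s m, π (cl s) m = 0 → qh s m = 0

variable [Nonempty S]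

lemma Comparator.ac_mean (h : Comparator cl π qh πh) (s : S) (m : Fin M)
    (h0 : π (cl s) m = 0) : πh (cl s) m = 0 :=
  h.mean.eq_zero' fun s' hs' => h.ac s' m (by rw [hs']; exact h0)

lemma Comparator.info_nonneg (h : Comparator cl π qh πh) : 0 ≤ respInfo cl πh qh :=
  respInfo_nonneg h.mem h.mean.mem fun _ _ h0 => h.mean.eq_zero h.mem h0

lemma Comparator.kl_nonneg (h : Comparator cl π qh πh) : 0 ≤ clientKL cl πh π :=
  clientKL_nonneg h.mean.mem h.weights h.ac_mean

lemma Comparator.freeEnergy_le (h : Comparator cl π qh πh) :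
    freeEnergy cl l Θ π
      ≤ risk l (fun s => Θ (cl s)) qh + respInfo cl πh qh + clientKL cl πh π := by
  have h1 := FedEM.freeEnergy_le (l := l) (Θ := Θ) h.weights h.mem h.ac
  rw [respInfo_eq_add h.mean h.mem h.ac] at h1
  linarith

lemma Comparator.next_ac (h : Comparator cl π qh πh)
    (hm : IsClientMean cl (resp cl l Θ π) π') (s : S) (m : Fin M) (h0 : π' (cl s) m = 0) :
    π (cl s) m = 0 :=
  (resp_eq_zero_iff h.weights s m).1 (hm.eq_zero (resp_mem h.weights) h0)

/-- Regret bound of one EM step against an arbitrary comparator (three-point inequality of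
alternating minimization). -/
lemma Comparator.regret (h : Comparator cl π qh πh)
    (hm : IsClientMean cl (resp cl l Θ π) π') :
    clientKL cl πh π' + freeEnergy cl l Θ π
      ≤ clientKL cl πh π + risk l (fun s => Θ (cl s)) qh + respInfo cl πh qh := by
  have h1 := freeEnergy_add (l := l) (Θ := Θ) h.weights h.mem h.ac
  have h2 := clientKL_le_avg_relEnt h.mean hm h.mem (resp_mem h.weights)
    fun s m h0 => h.ac s m ((resp_eq_zero_iff h.weights s m).1 h0)
  rw [respInfo_eq_add h.mean h.mem h.ac] at h1
  linarith

/-- The comparator moved by the fraction `k` towards the current responsibilities. -/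
lemma Comparator.next (h : Comparator cl π qh πh)
    (hm : IsClientMean cl (resp cl l Θ π) π') {k : ℝ} (hk0 : 0 ≤ k) (hk1 : k ≤ 1) :
    Comparator cl π' (fun s m => (1 - k) * qh s m + k * resp cl l Θ π s m)
      (fun t m => (1 - k) * πh t m + k * π' t m) where
  weights := hm.mem
  mem s := (convex_stdSimplex ℝ (Fin M)) (h.mem s) (resp_mem h.weights s) (by linarith) hk0
    (by ring)
  mean := h.mean.mix hm hk0 hk1
  ac s m h0 := by
    have h1 := h.next_ac hm s m h0
    simp [h.ac s m h1, (resp_eq_zero_iff (l := l) (Θ := Θ) h.weights s m).2 h1]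

lemma respInfo_resp_eq (hπ : ∀ t, π t ∈ stdSimplex ℝ (Fin M))
    (hm : IsClientMean cl (resp cl l Θ π) π') :
    respInfo cl π (resp cl l Θ π) = respInfo cl π' (resp cl l Θ π) + clientKL cl π' π :=
  respInfo_eq_add hm (resp_mem hπ) fun s m h => (resp_eq_zero_iff hπ s m).2 h

lemma clientKL_step_nonneg (hπ : ∀ t, π t ∈ stdSimplex ℝ (Fin M))
    (hm : IsClientMean cl (resp cl l Θ π) π') : 0 ≤ clientKL cl π' π :=
  clientKL_nonneg hm.mem hπ fun _ _ h => hm.eq_zero'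
    fun s' hs' => (resp_eq_zero_iff hπ s' _).2 (by rw [hs']; exact h)

lemma Comparator.kl_next_le (h : Comparator cl π qh πh)
    (hm : IsClientMean cl (resp cl l Θ π) π') {k : ℝ} (hk0 : 0 ≤ k) (hk1 : k ≤ 1) :
    clientKL cl (fun t m => (1 - k) * πh t m + k * π' t m) π' ≤ clientKL cl πh π' := by
  have hac : ∀ s m, π' (cl s) m = 0 → πh (cl s) m = 0 :=
    fun s m h0 => h.ac_mean s m (h.next_ac hm s m h0)
  have h1 : clientKL cl (fun t m => (1 - k) * πh t m + k * π' t m) π'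
      ≤ (1 - k) * clientKL cl πh π' := by
    unfold clientKL
    rw [← avg_mul]
    refine avg_mono fun s => ?_
    have := relEnt_convex (h.mean.mem (cl s)).1 (hm.mem (cl s)).1 (hac s) (hm.mem (cl s)).1
      (hm.mem (cl s)).1 (fun _ h => h) hk0 hk1
    rw [relEnt_self, mul_zero, add_zero] at this
    refine le_trans (le_of_eq ?_) this
    congr 1; funext m; ring
  have h2 := clientKL_nonneg h.mean.mem hm.mem hac
  nlinarith

/-- Change of the comparator energy in one round; `y` is arbitrary. -/
lemma Comparator.energy_next_le (h : Comparator cl π qh πh)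
    (hm : IsClientMean cl (resp cl l Θ π) π') {k : ℝ} (hk0 : 0 ≤ k) (hk1 : k ≤ 1)
    (y : S → Params M d) :
    risk l y (fun s m => (1 - k) * qh s m + k * resp cl l Θ π s m)
        + respInfo cl (fun t m => (1 - k) * πh t m + k * π' t m)
            (fun s m => (1 - k) * qh s m + k * resp cl l Θ π s m)
        + k * clientKL cl (fun t m => (1 - k) * πh t m + k * π' t m) π'
      ≤ risk l y qh + respInfo cl πh qh + k * clientKL cl πh π
        + k * ((risk l y (resp cl l Θ π) - risk l (fun s => Θ (cl s)) (resp cl l Θ π))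
          - (risk l y qh - risk l (fun s => Θ (cl s)) qh)) := by
  have h1 := respInfo_convex hk0 hk1 h.mem (resp_mem h.weights) h.mean hm
  have h2 := mul_le_mul_of_nonneg_left (h.kl_next_le hm hk0 hk1) hk0
  have h3 := mul_le_mul_of_nonneg_left (h.regret hm) hk0
  have h4 := respInfo_resp_eq h.weights hm
  have h5 := mul_nonneg hk0 (clientKL_step_nonneg h.weights hm)
  rw [freeEnergy_eq_resp h.weights] at h3
  rw [h4] at h3
  rw [risk_mix]
  linarith

end FreeEnergy

/-! ### One round of the Lyapunov function -/

section Hilbert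

variable {E : Type*} [NormedAddCommGroup E] [InnerProductSpace ℝ E]

omit [InnerProductSpace ℝ E] in
lemma norm_add_sq_le_two (a b : E) : ‖a + b‖ ^ 2 ≤ 2 * ‖a‖ ^ 2 + 2 * ‖b‖ ^ 2 := by
  have h := norm_add_le a b
  have : ‖a + b‖ ^ 2 ≤ (‖a‖ + ‖b‖) ^ 2 := by gcongr
  nlinarith [sq_nonneg (‖a‖ - ‖b‖)]

omit [InnerProductSpace ℝ E] in
lemma norm_sub_sq_le_two (a b : E) : ‖a - b‖ ^ 2 ≤ 2 * ‖a‖ ^ 2 + 2 * ‖b‖ ^ 2 := by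
  rw [sub_eq_add_neg, ← norm_neg b]; exact norm_add_sq_le_two a (-b)

omit [InnerProductSpace ℝ E] in
lemma norm_add_sq_le_three (a b c : E) :
    ‖a + b + c‖ ^ 2 ≤ 3 * ‖a‖ ^ 2 + 3 * ‖b‖ ^ 2 + 3 * ‖c‖ ^ 2 := by
  have h := norm_add₃_le (a := a) (b := b) (c := c)
  have : ‖a + b + c‖ ^ 2 ≤ (‖a‖ + ‖b‖ + ‖c‖) ^ 2 := by gcongr
  nlinarith [sq_nonneg (‖a‖ - ‖b‖), sq_nonneg (‖a‖ - ‖c‖), sq_nonneg (‖b‖ - ‖c‖)]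

lemma inner_le_half (a b : E) : inner ℝ a b ≤ 1 / 2 * ‖a‖ ^ 2 + 1 / 2 * ‖b‖ ^ 2 := by
  have h : 0 ≤ ‖a - b‖ ^ 2 := by positivity
  rw [norm_sub_sq_real] at h; linarith

lemma neg_inner_le_half (a b : E) : -inner ℝ a b ≤ 1 / 2 * ‖a‖ ^ 2 + 1 / 2 * ‖b‖ ^ 2 := by
  have h : 0 ≤ ‖a + b‖ ^ 2 := by positivity
  rw [norm_add_sq_real] at h; linarith

/-- The quadratic part of the one-round estimate. The first-order terms in `G` cancel, and the
remaining ones combine to the negative multiples of `‖u‖ ^ 2` and `‖c‖ ^ 2`. -/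
lemma lyapunov_quadratic (u v g G Z e Bv : E) {k r L : ℝ} (hk0 : 0 < k) (hk1 : k ≤ 1)
    (hr0 : 0 < r) (hL : 1 ≤ L) (hv : v = (r * k) • (G + Z + e)) :
    -(‖(1 - k) • (u - v)‖ ^ 2 - ‖u‖ ^ 2) / (2 * r)
      + 4 * r * (‖(1 - k) • (g + r⁻¹ • u) - k • Z + k • Bv‖ ^ 2 - ‖g + r⁻¹ • u‖ ^ 2)
      + k * inner ℝ g (u + (u - v)) - k * inner ℝ G u + k ^ 2 * inner ℝ (G - g) (u - v)
    ≤ k * inner ℝ ((1 - k) ^ 2 • u - (8 * r * (1 - k)) • (g + r⁻¹ • u)) Z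
      - k / (2 * r) * ‖u‖ ^ 2 - 2 * r * k * ‖g + r⁻¹ • u‖ ^ 2 + 8 * r * k * ‖Bv‖ ^ 2
      + k * L * ‖u‖ ^ 2 + k * ‖e‖ ^ 2 + 1 / 2 * ‖v‖ ^ 2
      + k ^ 2 * (‖g‖ ^ 2 + 2 * ‖G‖ ^ 2 + ‖u‖ ^ 2 + ‖u - v‖ ^ 2 + 8 * r * ‖Z‖ ^ 2) := by
  set c := g + r⁻¹ • u with hc
  have hgc : g = c - r⁻¹ • u := by rw [hc]; abel
  -- the term in `u⁺`
  have h1 : -(‖(1 - k) • (u - v)‖ ^ 2 - ‖u‖ ^ 2) / (2 * r)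
      ≤ k / r * ‖u‖ ^ 2 + k * (1 - k) ^ 2 * (inner ℝ u G + inner ℝ u Z + inner ℝ u e) := by
    have huv : inner ℝ u v = r * k * (inner ℝ u G + inner ℝ u Z + inner ℝ u e) := by
      rw [hv, inner_smul_right, inner_add_right, inner_add_right]
    rw [norm_smul, mul_pow, Real.norm_eq_abs, sq_abs, norm_sub_sq_real, huv, div_le_iff₀
      (by positivity)]
    have e1 : (k / r * ‖u‖ ^ 2 + k * (1 - k) ^ 2 * (inner ℝ u G + inner ℝ u Z + inner ℝ u e))
        * (2 * r) = 2 * k * ‖u‖ ^ 2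
          + 2 * r * k * (1 - k) ^ 2 * (inner ℝ u G + inner ℝ u Z + inner ℝ u e) := by
      field_simp
    rw [e1]
    have e2 : 0 ≤ (1 - k) ^ 2 * ‖v‖ ^ 2 := by positivity
    have e3 : 0 ≤ k ^ 2 * ‖u‖ ^ 2 := by positivity
    nlinarith
  -- the term in `c⁺`
  have h2 : ‖(1 - k) • c - k • Z + k • Bv‖ ^ 2 - ‖c‖ ^ 2
      ≤ -k * ‖c‖ ^ 2 + 2 * k * ‖Bv‖ ^ 2 + 2 * k ^ 2 * ‖Z‖ ^ 2
        - 2 * k * (1 - k) * inner ℝ c Z := by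
    have e1 : (1 - k) • c - k • Z + k • Bv = ((1 - k) • c + k • Bv) - k • Z := by abel
    have e2 : ‖(1 - k) • c + k • Bv‖ ^ 2 ≤ (1 - k) * ‖c‖ ^ 2 + k * ‖Bv‖ ^ 2 := by
      have e3 : 0 ≤ k * (1 - k) * ‖c - Bv‖ ^ 2 := by
        have : 0 ≤ 1 - k := by linarith
        positivity
      rw [norm_sub_sq_real] at e3
      rw [norm_add_sq_real, inner_smul_left, inner_smul_right, norm_smul, norm_smul, mul_pow,
        mul_pow, Real.norm_eq_abs, Real.norm_eq_abs, sq_abs, sq_abs]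
      simp only [conj_trivial]
      linarith
    rw [e1, norm_sub_sq_real, inner_smul_right, inner_add_left, inner_smul_left, inner_smul_left,
      norm_smul, mul_pow, Real.norm_eq_abs, sq_abs]
    simp only [conj_trivial]
    have e3 := mul_le_mul_of_nonneg_left (neg_inner_le_half Bv Z) (sq_nonneg k)
    have e4 : k ^ 2 * ‖Bv‖ ^ 2 ≤ k * ‖Bv‖ ^ 2 := by gcongr; nlinarith
    nlinarith
  -- the terms in `g`
  have h3 : k * inner ℝ g (u + (u - v)) ≤ 2 * k * inner ℝ c u - 2 * k / r * ‖u‖ ^ 2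
      + 1 / 2 * k ^ 2 * ‖g‖ ^ 2 + 1 / 2 * ‖v‖ ^ 2 := by
    have e1 : inner ℝ g u = inner ℝ c u - r⁻¹ * ‖u‖ ^ 2 := by
      rw [hgc, inner_sub_left, inner_smul_left, real_inner_self_eq_norm_sq]; simp
    have e2 := neg_inner_le_half (k • g) v
    rw [inner_smul_left, norm_smul, mul_pow, Real.norm_eq_abs, sq_abs] at e2
    simp only [conj_trivial] at e2
    rw [inner_add_right, inner_sub_right, e1]
    have e3 : 2 * k / r = 2 * k * r⁻¹ := by ring
    rw [e3]
    linarith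
  have h4 : 2 * inner ℝ c u ≤ 1 / (2 * r) * ‖u‖ ^ 2 + 2 * r * ‖c‖ ^ 2 := by
    have := inner_le_half ((2 * r) • c) u
    rw [inner_smul_left, norm_smul, mul_pow, Real.norm_eq_abs, sq_abs] at this
    simp only [conj_trivial] at this
    have e1 := mul_le_mul_of_nonneg_left this (show (0 : ℝ) ≤ 1 / r by positivity)
    have e2 : 1 / r * (2 * r * inner ℝ c u) = 2 * inner ℝ c u := by field_simp
    have e3 : 1 / r * (1 / 2 * ((2 * r) ^ 2 * ‖c‖ ^ 2) + 1 / 2 * ‖u‖ ^ 2)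
      = 1 / (2 * r) * ‖u‖ ^ 2 + 2 * r * ‖c‖ ^ 2 := by field_simp; ring
    rw [e2, e3] at e1
    exact e1
  have h5 : k ^ 2 * inner ℝ (G - g) (u - v)
      ≤ k ^ 2 * (1 / 2 * ‖G‖ ^ 2 + 1 / 2 * ‖g‖ ^ 2 + ‖u - v‖ ^ 2) := by
    gcongr
    rw [inner_sub_left]
    have := inner_le_half G (u - v)
    have := neg_inner_le_half g (u - v)
    linarith
  have h6 : k * (1 - k) ^ 2 * inner ℝ u G
      ≤ k * inner ℝ G u + k ^ 2 * (‖u‖ ^ 2 + ‖G‖ ^ 2) := by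
    have e1 := neg_inner_le_half u G
    have e2 : k * (1 - k) ^ 2 * inner ℝ u G
      = k * inner ℝ u G + k ^ 2 * (2 - k) * (-inner ℝ u G) := by ring
    rw [e2, real_inner_comm]
    have e3 : k ^ 2 * (2 - k) * (-inner ℝ u G)
        ≤ k ^ 2 * (2 - k) * (1 / 2 * ‖u‖ ^ 2 + 1 / 2 * ‖G‖ ^ 2) := by
      apply mul_le_mul_of_nonneg_left e1
      have : 0 ≤ 2 - k := by linarith
      positivity
    have e4 : k ^ 2 * (2 - k) * (1 / 2 * ‖u‖ ^ 2 + 1 / 2 * ‖G‖ ^ 2)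
        ≤ k ^ 2 * 2 * (1 / 2 * ‖u‖ ^ 2 + 1 / 2 * ‖G‖ ^ 2) := by gcongr; linarith
    rw [real_inner_comm u G] at *
    linarith
  have h7 : k * (1 - k) ^ 2 * inner ℝ u e ≤ k * L * ‖u‖ ^ 2 + k * ‖e‖ ^ 2 := by
    have e1 := inner_le_half u e
    have e2 : k * (1 - k) ^ 2 * inner ℝ u e
        ≤ k * (1 - k) ^ 2 * (1 / 2 * ‖u‖ ^ 2 + 1 / 2 * ‖e‖ ^ 2) := by gcongr
    have e3 : k * (1 - k) ^ 2 * (1 / 2 * ‖u‖ ^ 2 + 1 / 2 * ‖e‖ ^ 2)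
        ≤ k * 1 * (L * ‖u‖ ^ 2 + ‖e‖ ^ 2) := by
      gcongr
      · nlinarith
      · linarith
      · linarith [sq_nonneg ‖e‖]
    linarith
  have h8 : k * inner ℝ ((1 - k) ^ 2 • u - (8 * r * (1 - k)) • c) Z
      = k * (1 - k) ^ 2 * inner ℝ u Z - 4 * r * (2 * k * (1 - k) * inner ℝ c Z) := by
    rw [inner_sub_left, inner_smul_left, inner_smul_left]
    simp only [conj_trivial]; ring
  have h2' := mul_le_mul_of_nonneg_left h2 (show 0 ≤ 4 * r by positivity)
  have h4' := mul_le_mul_of_nonneg_left h4 hk0.le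
  have e9 : k * (1 / (2 * r) * ‖u‖ ^ 2 + 2 * r * ‖c‖ ^ 2)
    = k / (2 * r) * ‖u‖ ^ 2 + 2 * r * k * ‖c‖ ^ 2 := by ring
  have e10 : k / r * ‖u‖ ^ 2 = 2 * (k / (2 * r) * ‖u‖ ^ 2) := by field_simp
  have e11 : 2 * k / r * ‖u‖ ^ 2 = 4 * (k / (2 * r) * ‖u‖ ^ 2) := by field_simp; ring
  rw [h8]
  rw [e9] at h4'
  rw [e10] at h1
  rw [e11] at h3
  have p1 : 0 ≤ k ^ 2 * ‖G‖ ^ 2 := by positivity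
  linarith

end Hilbert

section Lyapunov

variable {S : Type*} [Fintype S] {T M d : ℕ}

/-- Lyapunov function of the mean iterate `x` with client weights `π`. The point `x - u` trails
`x` as an exponential moving average, `qh` and `πh` are the moving averages of the
responsibilities and of the weights, and `k` is the rate of the averages. The first three terms are
the energy of the comparator `(x - u, qh)`. The negative term in `‖u‖ ^ 2` cancels the first-order
change of the risk at the lagging point `x - u`. Since `u / r` differs from the vector in the last
term by a gradient, which the risk controls, the last term and the risk restore the positivity. -/
noncomputable def lyapunov (cl : S → Fin T) (l : S → Vec d → ℝ) (r k : ℝ) (x : Params M d)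
    (π : Fin T → Fin M → ℝ) (qh : S → Fin M → ℝ) (πh : Fin T → Fin M → ℝ) (u : Params M d) : ℝ :=
  risk l (fun _ => x - u) qh + respInfo cl πh qh + k * clientKL cl πh π - ‖u‖ ^ 2 / (2 * r)
    + 4 * r * ‖gradVec l (fun _ => x - u) qh + r⁻¹ • u‖ ^ 2

variable {cl : S → Fin T} {l : S → Vec d → ℝ} {L : ℝ≥0} {Θ : Fin T → Params M d}
  {π π' πh : Fin T → Fin M → ℝ} {qh : S → Fin M → ℝ} [Nonempty S]

lemma Comparator.lyapunov_ge (h : Comparator cl π qh πh) (hl : SmoothLoss l L) {r k : ℝ}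
    (hr0 : 0 < r) (hr : 8 * L * r ≤ 1) (x u : Params M d) :
    3 / 4 * (risk l (fun _ => x - u) qh + respInfo cl πh qh) + k * clientKL cl πh π
      + 3 * r * ‖gradVec l (fun _ => x - u) qh + r⁻¹ • u‖ ^ 2 ≤ lyapunov cl l r k x π qh πh u := by
  unfold lyapunov
  set g := gradVec l (fun _ : S => x - u) qh with hg
  have h1 : ‖g‖ ^ 2 ≤ 2 * L * risk l (fun _ => x - u) qh := norm_gradVec_sq_le hl h.mem _
  have h2 : ‖r⁻¹ • u‖ ^ 2 ≤ 2 * ‖g + r⁻¹ • u‖ ^ 2 + 2 * ‖g‖ ^ 2 := by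
    simpa using norm_sub_sq_le_two (g + r⁻¹ • u) g
  have h3 : ‖u‖ ^ 2 / (2 * r) = r / 2 * ‖r⁻¹ • u‖ ^ 2 := by
    rw [norm_smul, mul_pow, Real.norm_eq_abs, sq_abs]; field_simp
  have h4 := mul_le_mul_of_nonneg_left h2 (show 0 ≤ r / 2 by positivity)
  have h5 := mul_le_mul_of_nonneg_left h1 hr0.le
  have h6 := risk_nonneg hl h.mem (fun _ : S => x - u)
  have h7 := mul_le_mul_of_nonneg_right hr h6
  have h8 := h.info_nonneg
  rw [h3]
  linarith

lemma Comparator.lyapunov_nonneg (h : Comparator cl π qh πh) (hl : SmoothLoss l L) {r k : ℝ}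
    (hr0 : 0 < r) (hr : 8 * L * r ≤ 1) (hk : 0 ≤ k) (x u : Params M d) :
    0 ≤ lyapunov cl l r k x π qh πh u := by
  have h1 := h.lyapunov_ge hl hr0 hr x u (k := k)
  have h2 := risk_nonneg hl h.mem (fun _ : S => x - u)
  have h3 := h.info_nonneg
  have h4 := mul_nonneg hk h.kl_nonneg
  have : 0 ≤ 3 * r * ‖gradVec l (fun _ : S => x - u) qh + r⁻¹ • u‖ ^ 2 := by positivity
  linarith

lemma Comparator.norm_sq_le_lyapunov (h : Comparator cl π qh πh) (hl : SmoothLoss l L) {r k : ℝ}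
    (hr0 : 0 < r) (hr : 8 * L * r ≤ 1) (hk : 0 ≤ k) (x u : Params M d) :
    ‖u‖ ^ 2 ≤ 2 * r * lyapunov cl l r k x π qh πh u := by
  have h1 := h.lyapunov_ge hl hr0 hr x u (k := k)
  have h2 := risk_nonneg hl h.mem (fun _ : S => x - u)
  have h3 := h.info_nonneg
  have h4 := mul_nonneg hk h.kl_nonneg
  have h5 : 0 ≤ r * ‖gradVec l (fun _ : S => x - u) qh + r⁻¹ • u‖ ^ 2 := by positivity
  have h6 : ‖u‖ ^ 2 / (2 * r) ≤ lyapunov cl l r k x π qh πh u := by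
    have e : lyapunov cl l r k x π qh πh u = risk l (fun _ => x - u) qh + respInfo cl πh qh
      + k * clientKL cl πh π - ‖u‖ ^ 2 / (2 * r)
      + 4 * r * ‖gradVec l (fun _ => x - u) qh + r⁻¹ • u‖ ^ 2 := rfl
    linarith
  rw [div_le_iff₀ (by positivity)] at h6
  linarith

lemma Comparator.risk_client_le (h : Comparator cl π qh πh) (hl : SmoothLoss l L) {r k D : ℝ}
    (hr0 : 0 < r) (hr : 8 * L * r ≤ 1) (hk : 0 ≤ k) (x u : Params M d)
    (hD : ∀ s, ‖Θ (cl s) - x‖ ^ 2 ≤ D) :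
    risk l (fun s => Θ (cl s)) qh + respInfo cl πh qh
      ≤ 4 * lyapunov cl l r k x π qh πh u + 2 * L * D := by
  have h1 := h.lyapunov_ge hl hr0 hr x u (k := k)
  have h2 := risk_nonneg hl h.mem (fun _ : S => x - u)
  have h3 := h.info_nonneg
  have h4 := mul_nonneg hk h.kl_nonneg
  have h5 : 0 ≤ 3 * r * ‖gradVec l (fun _ : S => x - u) qh + r⁻¹ • u‖ ^ 2 := by positivity
  have h6 := h.norm_sq_le_lyapunov hl hr0 hr hk x u
  have h7 := risk_le_mul_add hl h.mem (fun _ : S => x - u) (fun s => Θ (cl s)) one_pos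
  have h8 : (avg fun s => ‖Θ (cl s) - (x - u)‖ ^ 2) ≤ 2 * D + 2 * ‖u‖ ^ 2 := avg_le fun s => by
    have := norm_add_sq_le_two (Θ (cl s) - x) u
    rw [show Θ (cl s) - (x - u) = Θ (cl s) - x + u by abel]
    linarith [hD s]
  have hL : (0 : ℝ) ≤ L := L.2
  have h9 : (L : ℝ) / 2 * (1 + 1 / 1) * (avg fun s => ‖Θ (cl s) - (x - u)‖ ^ 2)
      ≤ L / 2 * (1 + 1 / 1) * (2 * D + 2 * ‖u‖ ^ 2) := by gcongr
  have h10 := mul_le_mul_of_nonneg_left h6 hL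
  have h11 := mul_le_mul_of_nonneg_right hr (h.lyapunov_nonneg hl hr0 hr hk x u)
  linarith

/-- Decrease of `clientKL` towards the comparator, in terms of the Lyapunov function. -/
lemma Comparator.kl_next_le_lyapunov (h : Comparator cl π qh πh) (hl : SmoothLoss l L)
    (hm : IsClientMean cl (resp cl l Θ π) π') {r k D : ℝ}
    (hr0 : 0 < r) (hr : 8 * L * r ≤ 1) (hk0 : 0 ≤ k) (hk1 : k ≤ 1) (x u : Params M d)
    (hD : ∀ s, ‖Θ (cl s) - x‖ ^ 2 ≤ D) :
    k * clientKL cl (fun t m => (1 - k) * πh t m + k * π' t m) π'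
      ≤ k * clientKL cl πh π
        + k * (4 * lyapunov cl l r k x π qh πh u + 2 * L * D - freeEnergy cl l Θ π) := by
  have h1 := h.kl_next_le hm hk0 hk1
  have h2 := h.regret (Θ := Θ) (l := l) hm
  have h3 := h.risk_client_le hl hr0 hr hk0 x u hD
  rw [← mul_add]
  gcongr
  linarith

lemma Comparator.mul_freeEnergy_le (h : Comparator cl π qh πh) (hl : SmoothLoss l L)
    {r k D : ℝ} (hr0 : 0 < r) (hr : 8 * L * r ≤ 1) (hk0 : 0 ≤ k) (hk1 : k ≤ 1)
    (x u : Params M d) (hD0 : 0 ≤ D) (hD : ∀ s, ‖Θ (cl s) - x‖ ^ 2 ≤ D) :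
    k * freeEnergy cl l Θ π ≤ 5 * lyapunov cl l r k x π qh πh u + 2 * L * D := by
  have h1 := h.freeEnergy_le (Θ := Θ) (l := l)
  have h3 := h.risk_client_le hl hr0 hr hk0 x u hD
  have h4 := h.lyapunov_ge hl hr0 hr x u (k := k)
  have h5 := risk_nonneg hl h.mem (fun _ : S => x - u)
  have h6 := h.info_nonneg
  have h7 : 0 ≤ 3 * r * ‖gradVec l (fun _ : S => x - u) qh + r⁻¹ • u‖ ^ 2 := by positivity
  have h8 := h.lyapunov_nonneg hl hr0 hr hk0 x u
  have h9 := mul_le_mul_of_nonneg_left (h1.trans (add_le_add_left h3 _)) hk0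
  have hL : (0 : ℝ) ≤ L := L.2
  have h10 : k * (4 * lyapunov cl l r k x π qh πh u + 2 * L * D)
      ≤ 1 * (4 * lyapunov cl l r k x π qh πh u + 2 * L * D) := by gcongr
  linarith

/-- Noise coefficient of the Lyapunov function. -/
noncomputable def noiseCoeff (l : S → Vec d → ℝ) (r k : ℝ) (x : Params M d) (qh : S → Fin M → ℝ)
    (u : Params M d) : Params M d :=
  k • ((1 - k) ^ 2 • u - (8 * r * (1 - k)) • (gradVec l (fun _ => x - u) qh + r⁻¹ • u))

lemma Comparator.norm_noiseCoeff_sq_le (h : Comparator cl π qh πh) (hl : SmoothLoss l L)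
    {r k : ℝ} (hr0 : 0 < r) (hr : 8 * L * r ≤ 1) (hk0 : 0 ≤ k) (hk1 : k ≤ 1) (x u : Params M d) :
    ‖noiseCoeff l r k x qh u‖ ^ 2 ≤ 50 * k ^ 2 * lyapunov cl l r k x π qh πh u := by
  have h1 := h.lyapunov_ge hl hr0 hr x u (k := k)
  have h2 := risk_nonneg hl h.mem (fun _ : S => x - u)
  have h3 := h.info_nonneg
  have h4 := mul_nonneg hk0 h.kl_nonneg
  have h6 := h.norm_sq_le_lyapunov hl hr0 hr hk0 x u
  have h7 := h.lyapunov_nonneg hl hr0 hr hk0 x u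
  unfold noiseCoeff
  set c := gradVec l (fun _ : S => x - u) qh + r⁻¹ • u
  set Λ := lyapunov cl l r k x π qh πh u
  have hL1 : (1 : ℝ) ≤ L := by exact_mod_cast hl.one_le
  have hr1 : r ≤ 1 := by nlinarith
  have hq0 : 0 ≤ 1 - k := by linarith
  have hq1 : 1 - k ≤ 1 := by linarith
  have e1 := norm_sub_sq_le_two ((1 - k) ^ 2 • u) ((8 * r * (1 - k)) • c)
  rw [norm_smul, norm_smul, mul_pow, mul_pow, Real.norm_eq_abs, Real.norm_eq_abs, sq_abs,
    sq_abs] at e1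
  have e2 : ((1 - k) ^ 2) ^ 2 * ‖u‖ ^ 2 ≤ 1 * ‖u‖ ^ 2 := by
    gcongr
    exact pow_le_one₀ (by positivity) (pow_le_one₀ hq0 hq1)
  have e3 : (8 * r * (1 - k)) ^ 2 * ‖c‖ ^ 2 ≤ (64 * r * 1) * ‖c‖ ^ 2 := by
    gcongr
    have : (1 - k) ^ 2 ≤ 1 := pow_le_one₀ hq0 hq1
    have h8 : r ^ 2 ≤ r := by nlinarith
    calc (8 * r * (1 - k)) ^ 2 = 64 * (r ^ 2 * (1 - k) ^ 2) := by ring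
      _ ≤ 64 * (r * 1) := by gcongr
      _ = _ := by ring
  have e4 : r * Λ ≤ 1 / 8 * Λ := by
    gcongr; nlinarith
  rw [norm_smul, mul_pow, Real.norm_eq_abs, sq_abs]
  have : ‖(1 - k) ^ 2 • u - (8 * r * (1 - k)) • c‖ ^ 2 ≤ 50 * Λ := by linarith
  calc k ^ 2 * _ ≤ k ^ 2 * (50 * Λ) := by gcongr
    _ = _ := by ring

set_option maxHeartbeats 1600000 in
/-- One round changes the Lyapunov function by a noise term and by errors that are linear in the
energies and of second order in the step size. -/
lemma Comparator.lyapunov_next_le (h : Comparator cl π qh πh) (hl : SmoothLoss l L)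
    (hm : IsClientMean cl (resp cl l Θ π) π') {r k D b : ℝ}
    (hr : r = 1 / (64 * L)) (hk0 : 0 < k) (hk1 : k ≤ 1) (x u v Z e : Params M d)
    (hD0 : 0 ≤ D) (hD : ∀ s, ‖Θ (cl s) - x‖ ^ 2 ≤ D) (hb : L ≤ b)
    (hv : v = (r * k) • (gradVec l (fun s => Θ (cl s)) (resp cl l Θ π) + Z + e))
    (hZ : ‖Z‖ ^ 2 ≤ b * freeEnergy cl l Θ π)
    (he : ‖e‖ ^ 2 ≤ b * (k ^ 2 * freeEnergy cl l Θ π)) :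
    lyapunov cl l r k (x - v) π' (fun s m => (1 - k) * qh s m + k * resp cl l Θ π s m)
        (fun t m => (1 - k) * πh t m + k * π' t m) ((1 - k) • (u - v))
      ≤ lyapunov cl l r k x π qh πh u + inner ℝ (noiseCoeff l r k x qh u) Z
        + 100 * b ^ 2 * (k ^ 2 * freeEnergy cl l Θ π + k ^ 2 * lyapunov cl l r k x π qh πh u
          + D) := by
  have hL1 : (1 : ℝ) ≤ L := by exact_mod_cast hl.one_le
  have hL0 : (0 : ℝ) < L := by linarith
  have hr0 : 0 < r := by rw [hr]; positivity
  have hrL : 64 * L * r = 1 := by rw [hr]; field_simp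
  have hr8 : 8 * L * r ≤ 1 := by nlinarith
  have hr1 : r ≤ 1 / 64 := by nlinarith
  have hbd := h.lyapunov_ge hl hr0 hr8 x u (k := k)
  have hu := h.norm_sq_le_lyapunov hl hr0 hr8 hk0.le x u
  have hΛ0 := h.lyapunov_nonneg hl hr0 hr8 hk0.le x u
  have hF0 : 0 ≤ freeEnergy cl l Θ π := freeEnergy_nonneg hl h.weights
  have hp0 := risk_nonneg hl h.mem (fun _ : S => x - u)
  have hI0 := h.info_nonneg
  have hX0 := mul_nonneg hk0.le h.kl_nonneg
  have hq := resp_mem (cl := cl) (l := l) (Θ := Θ) h.weights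
  have hrq := risk_resp_le (cl := cl) (l := l) (Θ := Θ) h.weights
  have hG2 := norm_gradVec_sq_le hl hq (fun s => Θ (cl s))
  have hg2 := norm_gradVec_sq_le hl h.mem (fun _ : S => x - u)
  have hen := h.energy_next_le hm hk0.le hk1 (l := l) (Θ := Θ) fun _ => (x - u) + k • (u - v)
  have hy : x - v - (1 - k) • (u - v) = (x - u) + k • (u - v) := by module
  set q := resp cl l Θ π with hqdef
  set qn : S → Fin M → ℝ := fun s m => (1 - k) * qh s m + k * q s m with hqn
  set πn : Fin T → Fin M → ℝ := fun t m => (1 - k) * πh t m + k * π' t m with hπn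
  set F := freeEnergy cl l Θ π with hFdef
  set w := u - v with hw
  set y' := (x - u) + k • w with hy'
  set G := gradVec l (fun s => Θ (cl s)) q with hG
  set g := gradVec l (fun _ : S => x - u) qh with hg
  -- the risk part
  have hδ : ∀ s, ‖Θ (cl s) - x‖ ^ 2 ≤ D := hD
  have hw2 : ‖k • w‖ ^ 2 = k ^ 2 * ‖w‖ ^ 2 := by
    rw [norm_smul, mul_pow, Real.norm_eq_abs, sq_abs]
  have t1 : risk l (fun _ => y') qh ≤ risk l (fun _ => x - u) qh + k * inner ℝ g w
      + L / 2 * (k ^ 2 * ‖w‖ ^ 2) := by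
    have := risk_le hl h.mem (fun _ : S => x - u) (fun _ => y')
    simp only [hy', add_sub_cancel_left] at this
    rwa [dirRisk_const, avg_const, hw2, inner_smul_right] at this
  have t1' : risk l (fun _ => x - u) qh + k * inner ℝ g w - L / 2 * (k ^ 2 * ‖w‖ ^ 2)
      ≤ risk l (fun _ => y') qh := by
    have := risk_ge hl h.mem (fun _ : S => x - u) (fun _ => y')
    simp only [hy', add_sub_cancel_left] at this
    rwa [dirRisk_const, avg_const, hw2, inner_smul_right] at this
  have a1 : (avg fun s => ‖y' - Θ (cl s)‖ ^ 2)
      ≤ 3 * ‖u‖ ^ 2 + 3 * (k ^ 2 * ‖w‖ ^ 2) + 3 * D := avg_le fun s => by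
    have := norm_add_sq_le_three (-u) (k • w) (x - Θ (cl s))
    rw [norm_neg, hw2, norm_sub_rev x] at this
    rw [show y' - Θ (cl s) = -u + k • w + (x - Θ (cl s)) by rw [hy']; abel]
    linarith [hδ s]
  have a2 : (avg fun s => ‖Θ (cl s) - (x - u)‖ ^ 2) ≤ 2 * ‖u‖ ^ 2 + 2 * D := avg_le fun s => by
    have := norm_add_sq_le_two (Θ (cl s) - x) u
    rw [show Θ (cl s) - (x - u) = Θ (cl s) - x + u by abel]
    linarith [hδ s]
  have a3 : (avg fun s => ‖Θ (cl s) - x‖ ^ 2) ≤ D := avg_le hδ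
  have t2 : risk l (fun _ => y') q - risk l (fun s => Θ (cl s)) q
      ≤ inner ℝ G (k • w - u) - dirRisk l (fun s => Θ (cl s)) q (fun s => Θ (cl s) - x)
        + L / 2 * (3 * ‖u‖ ^ 2 + 3 * (k ^ 2 * ‖w‖ ^ 2) + 3 * D) := by
    have := risk_le hl hq (fun s => Θ (cl s)) (fun _ => y')
    have e1 : (fun s => y' - Θ (cl s)) = fun s => (k • w - u) - (Θ (cl s) - x) := by
      funext s; rw [hy']; abel
    have e2 : (L : ℝ) / 2 * (avg fun s => ‖y' - Θ (cl s)‖ ^ 2)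
      ≤ L / 2 * (3 * ‖u‖ ^ 2 + 3 * (k ^ 2 * ‖w‖ ^ 2) + 3 * D) := by gcongr
    rw [show dirRisk l (fun s => Θ (cl s)) q (fun s => y' - Θ (cl s))
      = inner ℝ G (k • w - u) - dirRisk l (fun s => Θ (cl s)) q (fun s => Θ (cl s) - x) by
        rw [e1, dirRisk_sub, dirRisk_const]] at this
    linarith
  have t3 : risk l (fun s => Θ (cl s)) qh
      ≤ risk l (fun _ => x - u) qh + inner ℝ g u
        + dirRisk l (fun _ => x - u) qh (fun s => Θ (cl s) - x)
        + L / 2 * (2 * ‖u‖ ^ 2 + 2 * D) := by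
    have := risk_le hl h.mem (fun _ : S => x - u) (fun s => Θ (cl s))
    have e1 : (fun s => Θ (cl s) - (x - u)) = fun s => u + (Θ (cl s) - x) := by
      funext s; abel
    have e2 : (L : ℝ) / 2 * (avg fun s => ‖Θ (cl s) - (x - u)‖ ^ 2)
      ≤ L / 2 * (2 * ‖u‖ ^ 2 + 2 * D) := by gcongr
    rw [show dirRisk l (fun _ => x - u) qh (fun s => Θ (cl s) - (x - u))
      = inner ℝ g u + dirRisk l (fun _ => x - u) qh (fun s => Θ (cl s) - x) by
        rw [e1, dirRisk_add, dirRisk_const]] at this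
    linarith
  have d1 := abs_dirRisk_le hl hq (fun s => Θ (cl s)) (fun s => Θ (cl s) - x) k
  have d2 := abs_dirRisk_le hl h.mem (fun _ : S => x - u) (fun s => Θ (cl s) - x) k
  have d1' : -(k * dirRisk l (fun s => Θ (cl s)) q (fun s => Θ (cl s) - x))
      ≤ k ^ 2 * (L * F) + 1 / 2 * D := by
    have e1 := mul_le_mul_of_nonneg_left
      (neg_abs_le (dirRisk l (fun s => Θ (cl s)) q (fun s => Θ (cl s) - x))) hk0.le
    have e2 : k ^ 2 * (L * risk l (fun s => Θ (cl s)) q) ≤ k ^ 2 * (L * F) := by gcongr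
    linarith
  have d2' : k * dirRisk l (fun _ : S => x - u) qh (fun s => Θ (cl s) - x)
      ≤ k ^ 2 * (L * risk l (fun _ => x - u) qh) + 1 / 2 * D := by
    have e1 := mul_le_mul_of_nonneg_left
      (le_abs_self (dirRisk l (fun _ : S => x - u) qh (fun s => Θ (cl s) - x))) hk0.le
    linarith
  have t2' := mul_le_mul_of_nonneg_left t2 hk0.le
  have t3' := mul_le_mul_of_nonneg_left t3 hk0.le
  have t1'' := mul_le_mul_of_nonneg_left t1' hk0.le
  -- the error in the recursion of `c`
  set Bv := ((k⁻¹ * (1 - k)) • (gradVec l (fun _ : S => y') qh - g)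
    + (gradVec l (fun _ : S => y') q - G)) + (k • (G + Z + e) - e) with hBv
  have hc' : gradVec l (fun _ : S => y') qn + r⁻¹ • ((1 - k) • w)
      = (1 - k) • (g + r⁻¹ • u) - k • Z + k • Bv := by
    have e1 : k • (k⁻¹ * (1 - k)) • (gradVec l (fun _ : S => y') qh - g)
        = (1 - k) • (gradVec l (fun _ : S => y') qh - g) := by
      rw [smul_smul, ← mul_assoc, mul_inv_cancel₀ hk0.ne', one_mul]
    have e2 : r⁻¹ • v = k • (G + Z + e) := by
      rw [hv, smul_smul, ← mul_assoc, inv_mul_cancel₀ hr0.ne', one_mul]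
    have e3 : r⁻¹ • ((1 - k) • w) = (1 - k) • (r⁻¹ • u) - (1 - k) • (k • (G + Z + e)) := by
      rw [← e2, hw, smul_comm, smul_sub, smul_sub]
    have e4 : k • Bv = (1 - k) • (gradVec l (fun _ : S => y') qh - g)
        + k • (gradVec l (fun _ : S => y') q - G) + k • (k • (G + Z + e) - e) := by
      rw [hBv, smul_add k, smul_add k, e1]
    rw [hqn, gradVec_mix, e3, e4]
    module
  have h1k : 0 ≤ 1 - k := by linarith
  have b1 : ‖(k⁻¹ * (1 - k)) • (gradVec l (fun _ : S => y') qh - g)‖ ^ 2 ≤ L ^ 2 * ‖w‖ ^ 2 := by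
    have e1 := norm_gradVec_sub_sq_le hl h.mem (fun _ : S => y') (fun _ => x - u)
    simp only [hy', add_sub_cancel_left] at e1
    rw [avg_const, hw2] at e1
    rw [norm_smul, mul_pow, Real.norm_eq_abs, sq_abs]
    calc (k⁻¹ * (1 - k)) ^ 2 * ‖gradVec l (fun _ : S => y') qh - g‖ ^ 2
        ≤ (k⁻¹ * 1) ^ 2 * (L ^ 2 * (k ^ 2 * ‖w‖ ^ 2)) := by
          gcongr
          linarith
      _ = _ := by field_simp
  have b2 : ‖gradVec l (fun _ : S => y') q - G‖ ^ 2
      ≤ L ^ 2 * (3 * ‖u‖ ^ 2 + 3 * (k ^ 2 * ‖w‖ ^ 2) + 3 * D) := by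
    refine (norm_gradVec_sub_sq_le hl hq (fun _ : S => y') fun s => Θ (cl s)).trans ?_
    gcongr
  have b3 : ‖k • (G + Z + e) - e‖ ^ 2
      ≤ 2 * (k ^ 2 * (3 * ‖G‖ ^ 2 + 3 * ‖Z‖ ^ 2 + 3 * ‖e‖ ^ 2)) + 2 * ‖e‖ ^ 2 := by
    refine (norm_sub_sq_le_two _ _).trans ?_
    rw [norm_smul, mul_pow, Real.norm_eq_abs, sq_abs]
    gcongr
    exact norm_add_sq_le_three _ _ _
  have b4 : ‖Bv‖ ^ 2 ≤ 4 * (L ^ 2 * ‖w‖ ^ 2)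
      + 4 * (L ^ 2 * (3 * ‖u‖ ^ 2 + 3 * (k ^ 2 * ‖w‖ ^ 2) + 3 * D))
      + 2 * (2 * (k ^ 2 * (3 * ‖G‖ ^ 2 + 3 * ‖Z‖ ^ 2 + 3 * ‖e‖ ^ 2)) + 2 * ‖e‖ ^ 2) := by
    have e1 := norm_add_sq_le_two ((k⁻¹ * (1 - k)) • (gradVec l (fun _ : S => y') qh - g)
      + (gradVec l (fun _ : S => y') q - G)) (k • (G + Z + e) - e)
    have e2 := norm_add_sq_le_two ((k⁻¹ * (1 - k)) • (gradVec l (fun _ : S => y') qh - g))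
      (gradVec l (fun _ : S => y') q - G)
    rw [← hBv] at e1
    linarith
  have hquad := lyapunov_quadratic u v g G Z e Bv hk0 hk1 hr0 hL1 hv
  rw [← hw] at hquad
  -- sizes of the vectors
  have hv2 : ‖v‖ ^ 2 ≤ (r * k) ^ 2 * (3 * ‖G‖ ^ 2 + 3 * ‖Z‖ ^ 2 + 3 * ‖e‖ ^ 2) := by
    rw [hv, norm_smul, mul_pow, Real.norm_eq_abs, sq_abs]
    gcongr
    exact norm_add_sq_le_three _ _ _
  have hww : ‖w‖ ^ 2 ≤ 2 * ‖u‖ ^ 2 + 2 * ‖v‖ ^ 2 := norm_sub_sq_le_two u v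
  have hb1 : 1 ≤ b := hL1.trans hb
  have hk2 : k ^ 2 ≤ 1 := pow_le_one₀ hk0.le hk1
  have hkk : k ^ 2 ≤ k := by nlinarith only [hk0, hk1]
  set Λ := lyapunov cl l r k x π qh πh u with hΛ
  set FF := k ^ 2 * F with hFF
  set ΛΛ := k ^ 2 * Λ with hΛΛ
  have hFF0 : 0 ≤ FF := by positivity
  have hΛΛ0 : 0 ≤ ΛΛ := by positivity
  have sG : k ^ 2 * ‖G‖ ^ 2 ≤ 2 * L * FF := by
    calc k ^ 2 * ‖G‖ ^ 2 ≤ k ^ 2 * (2 * L * F) := by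
          gcongr; exact hG2.trans (by gcongr)
      _ = _ := by rw [hFF]; ring
  have sZ : k ^ 2 * ‖Z‖ ^ 2 ≤ b * FF := by
    calc k ^ 2 * ‖Z‖ ^ 2 ≤ k ^ 2 * (b * F) := by gcongr
      _ = _ := by rw [hFF]; ring
  have se : k ^ 2 * ‖e‖ ^ 2 ≤ b * FF := by
    calc k ^ 2 * ‖e‖ ^ 2 ≤ 1 * (b * FF) := by gcongr
      _ = _ := one_mul _
  have se' : k * ‖e‖ ^ 2 ≤ b * FF := by
    calc k * ‖e‖ ^ 2 ≤ 1 * (b * FF) := by gcongr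
      _ = _ := one_mul _
  have hR0 : risk l (fun _ : S => x - u) qh ≤ 4 / 3 * Λ := by
    have : 0 ≤ 3 * r * ‖g + r⁻¹ • u‖ ^ 2 := by positivity
    linarith only [this, hbd, hI0, hX0]
  have sR : k ^ 2 * (L * risk l (fun _ : S => x - u) qh) ≤ 4 / 3 * (L * ΛΛ) := by
    calc _ ≤ k ^ 2 * (L * (4 / 3 * Λ)) := by gcongr
      _ = _ := by rw [hΛΛ]; ring
  have sg : k ^ 2 * ‖g‖ ^ 2 ≤ 8 / 3 * (L * ΛΛ) := by
    calc k ^ 2 * ‖g‖ ^ 2 ≤ k ^ 2 * (2 * L * (4 / 3 * Λ)) := by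
          gcongr; exact hg2.trans (by gcongr)
      _ = _ := by rw [hΛΛ]; ring
  have sA : L * (k ^ 2 * ‖u‖ ^ 2) ≤ 1 / 32 * ΛΛ := by
    calc L * (k ^ 2 * ‖u‖ ^ 2) ≤ L * (k ^ 2 * (2 * r * Λ)) := by gcongr
      _ = (64 * L * r) / 32 * ΛΛ := by rw [hΛΛ]; ring
      _ = _ := by rw [hrL]
  have sA' : k ^ 2 * ‖u‖ ^ 2 ≤ L * (k ^ 2 * ‖u‖ ^ 2) :=
    le_mul_of_one_le_left (by positivity) hL1
  have sV : ‖v‖ ^ 2 ≤ 1 / 1000 * (6 * L * FF + 3 * (b * FF) + 3 * (b * FF)) := by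
    have e1 : r ^ 2 ≤ 1 / 1000 := by nlinarith only [hr0, hr1]
    calc ‖v‖ ^ 2 ≤ r ^ 2 * (3 * (k ^ 2 * ‖G‖ ^ 2) + 3 * (k ^ 2 * ‖Z‖ ^ 2)
            + 3 * (k ^ 2 * ‖e‖ ^ 2)) := hv2.trans_eq (by ring)
      _ ≤ 1 / 1000 * (3 * (2 * L * FF) + 3 * (b * FF) + 3 * (b * FF)) := by gcongr
      _ = _ := by ring
  have f1 : L * FF ≤ b * FF := by gcongr
  have f2 : b * FF ≤ b ^ 2 * FF := by gcongr; nlinarith only [hb1]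
  have f0 : L ≤ b ^ 2 := by nlinarith only [hb1, hb]
  have f3 : L * ΛΛ ≤ b ^ 2 * ΛΛ := by gcongr
  have f4 : ΛΛ ≤ b ^ 2 * ΛΛ := le_mul_of_one_le_left hΛΛ0 (one_le_pow₀ hb1)
  have f5 : L * D ≤ b ^ 2 * D := by gcongr
  have f6 : D ≤ b ^ 2 * D := le_mul_of_one_le_left hD0 (one_le_pow₀ hb1)
  have sV1 : ‖v‖ ^ 2 ≤ 1 / 50 * (b * FF) := by
    linarith only [sV, f1, show 0 ≤ L * FF by positivity, show 0 ≤ b * FF by positivity]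
  have sLV : L * ‖v‖ ^ 2 ≤ 1 / 50 * (b ^ 2 * FF) := by
    calc L * ‖v‖ ^ 2 ≤ b * (1 / 50 * (b * FF)) := by gcongr
      _ = _ := by ring
  have sW : L * (k ^ 2 * ‖w‖ ^ 2) ≤ 1 / 16 * ΛΛ + 1 / 25 * (b ^ 2 * FF) := by
    have e1 : L * (k ^ 2 * ‖w‖ ^ 2) ≤ L * (k ^ 2 * (2 * ‖u‖ ^ 2 + 2 * ‖v‖ ^ 2)) := by gcongr
    have e2 : L * (k ^ 2 * ‖v‖ ^ 2) ≤ L * (1 * ‖v‖ ^ 2) := by gcongr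
    linarith only [e1, e2, sA, sLV]
  have sW' : k ^ 2 * ‖w‖ ^ 2 ≤ L * (k ^ 2 * ‖w‖ ^ 2) :=
    le_mul_of_one_le_left (by positivity) hL1
  have sW3 : k * (L * (k ^ 2 * ‖w‖ ^ 2)) ≤ 1 * (L * (k ^ 2 * ‖w‖ ^ 2)) := by gcongr
  have sD : k * (L * D) ≤ 1 * (L * D) := by gcongr
  have sWA : k * (L * ‖w‖ ^ 2) ≤ 2 * (k * (L * ‖u‖ ^ 2)) + 2 * (L * ‖v‖ ^ 2) := by
    have e1 : k * (L * ‖w‖ ^ 2) ≤ k * (L * (2 * ‖u‖ ^ 2 + 2 * ‖v‖ ^ 2)) := by gcongr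
    have e2 : k * (L * ‖v‖ ^ 2) ≤ 1 * (L * ‖v‖ ^ 2) := by gcongr
    linarith only [e1, e2]
  have sB : 8 * r * k * ‖Bv‖ ^ 2 ≤ 1 / 2 * (k * (L * ‖w‖ ^ 2)) + 3 / 2 * (k * (L * ‖u‖ ^ 2))
      + 3 / 2 * (k * (L * (k ^ 2 * ‖w‖ ^ 2))) + 3 / 2 * (k * (L * D))
      + (6 * L * FF + 3 * (b * FF) + 3 * (b * FF)) + b * FF := by
    have e1 : 8 * r * k * ‖Bv‖ ^ 2 ≤ _ := mul_le_mul_of_nonneg_left b4 (by positivity)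
    have e2 : 8 * r * k * (2 * (2 * (k ^ 2 * (3 * ‖G‖ ^ 2 + 3 * ‖Z‖ ^ 2 + 3 * ‖e‖ ^ 2))
        + 2 * ‖e‖ ^ 2)) ≤ 8 * (1 / 64) * 1 * (2 * (2 * (6 * L * FF + 3 * (b * FF) + 3 * (b * FF))
          + 2 * (b * FF))) := by
      gcongr
      linarith only [sG, sZ, se]
    have e3 : 8 * r * k * (4 * (L ^ 2 * ‖w‖ ^ 2)
        + 4 * (L ^ 2 * (3 * ‖u‖ ^ 2 + 3 * (k ^ 2 * ‖w‖ ^ 2) + 3 * D)))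
        = (64 * L * r) * (1 / 2 * (k * (L * ‖w‖ ^ 2)) + 3 / 2 * (k * (L * ‖u‖ ^ 2))
      + 3 / 2 * (k * (L * (k ^ 2 * ‖w‖ ^ 2))) + 3 / 2 * (k * (L * D))) := by ring
    rw [hrL, one_mul] at e3
    have e4 : 0 ≤ L * FF := by positivity
    have e5 : 0 ≤ b * FF := by positivity
    linarith only [e1, e2, e3, e4, e5]
  have sr : k / (2 * r) * ‖u‖ ^ 2 = 32 * (k * (L * ‖u‖ ^ 2)) := by
    rw [hr]; field_simp; ring
  have sc : 0 ≤ 2 * r * k * ‖g + r⁻¹ • u‖ ^ 2 := by positivity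
  have sZ8 : k ^ 2 * (8 * r * ‖Z‖ ^ 2) ≤ b * FF := by
    calc k ^ 2 * (8 * r * ‖Z‖ ^ 2) = 8 * r * (k ^ 2 * ‖Z‖ ^ 2) := by ring
      _ ≤ 1 * (b * FF) := by gcongr; linarith only [hr1]
      _ = _ := one_mul _
  have su0 : 0 ≤ k * (L * ‖u‖ ^ 2) := by positivity
  have sN : inner ℝ (noiseCoeff l r k x qh u) Z
      = k * inner ℝ ((1 - k) ^ 2 • u - (8 * r * (1 - k)) • (g + r⁻¹ • u)) Z := by
    rw [noiseCoeff, inner_smul_left]; rfl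
  have i1 : inner ℝ G (k • w - u) = k * inner ℝ G w - inner ℝ G u := by
    rw [inner_sub_right, inner_smul_right]
  have i2 : inner ℝ g (u + w) = inner ℝ g u + inner ℝ g w := inner_add_right _ _ _
  have i3 : inner ℝ (G - g) w = inner ℝ G w - inner ℝ g w := inner_sub_left _ _ _
  rw [i1] at t2'
  rw [i2, i3, sr] at hquad
  have hdiv : -(‖(1 - k) • w‖ ^ 2 - ‖u‖ ^ 2) / (2 * r)
      = -(‖(1 - k) • w‖ ^ 2 / (2 * r)) + ‖u‖ ^ 2 / (2 * r) := by ring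
  rw [hdiv] at hquad
  have hΛe : Λ = risk l (fun _ => x - u) qh + respInfo cl πh qh
    + k * clientKL cl πh π - ‖u‖ ^ 2 / (2 * r) + 4 * r * ‖g + r⁻¹ • u‖ ^ 2 := rfl
  rw [sN]
  unfold lyapunov
  rw [hy, hc']
  linarith only [hen, t1, t1'', t2', t3', d1', d2', hquad, hΛe, sB, sWA, sW, sW', sW3, sD, sZ8, sc, su0, sV1, sLV, sA, sA',
    sg, sG, sR, se', f1, f2, f3, f4, f5, f6, hFF0, hΛΛ0, hD0,
    show 0 ≤ L * FF by positivity]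

end Lyapunov

/-! ### Stability of the posterior and the descent of the likelihood -/

section Stability

variable {M : ℕ}

/-- The symmetrized relative entropy of two posteriors with the same prior is controlled by the
squared differences of the losses. -/
lemma relEnt_posterior_add_le {p : Fin M → ℝ} (hp : p ∈ stdSimplex ℝ (Fin M))
    (lo lo' : Fin M → ℝ) :
    relEnt (posterior p lo) (posterior p lo') + relEnt (posterior p lo') (posterior p lo)
      ≤ ∑ m, (posterior p lo m + posterior p lo' m) * (lo m - lo' m) ^ 2 := by
  have hq := posterior_mem hp lo
  have hq' := posterior_mem hp lo'
  have h0 := posterior_eq_zero_iff hp lo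
  have h0' := posterior_eq_zero_iff hp lo'
  have e1 := freeEnergy_eq hp lo hq fun m => (h0 m).2
  have e2 := freeEnergy_eq hp lo' hq fun m => (h0 m).2
  have e3 := freeEnergy_eq hp lo hq' fun m => (h0' m).2
  have e4 := freeEnergy_eq hp lo' hq' fun m => (h0' m).2
  rw [relEnt_self] at e1 e4
  have k1 := hellinger_le_relEnt hq hq' fun m h => (h0 m).2 ((h0' m).1 h)
  have k2 := hellinger_le_relEnt hq' hq fun m h => (h0' m).2 ((h0 m).1 h)
  set q := posterior p lo with hqd
  set q' := posterior p lo' with hqd'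
  have e5 : relEnt q q' + relEnt q' q = ∑ m, (q' m - q m) * (lo m - lo' m) := by
    have : ∑ m, (q' m - q m) * (lo m - lo' m)
        = ∑ m, q m * lo' m - ∑ m, q m * lo m + ∑ m, q' m * lo m - ∑ m, q' m * lo' m := by
      rw [← Finset.sum_sub_distrib, ← Finset.sum_add_distrib, ← Finset.sum_sub_distrib]
      exact Finset.sum_congr rfl fun m _ => by ring
    linarith
  have e6 : ∑ m, (√(q' m) - √(q m)) ^ 2 = ∑ m, (√(q m) - √(q' m)) ^ 2 :=
    Finset.sum_congr rfl fun m _ => by ring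
  have e7 : ∑ m, (q' m - q m) * (lo m - lo' m)
      ≤ ∑ m, (√(q m) - √(q' m)) ^ 2
        + 1 / 2 * ∑ m, (q m + q' m) * (lo m - lo' m) ^ 2 := by
    rw [Finset.mul_sum, ← Finset.sum_add_distrib]
    refine Finset.sum_le_sum fun m _ => ?_
    have s1 := Real.sq_sqrt (hq.1 m)
    have s2 := Real.sq_sqrt (hq'.1 m)
    set a := √(q m)
    set b := √(q' m)
    rw [← s1, ← s2]
    nlinarith [sq_nonneg ((a - b) + (a + b) * (lo m - lo' m) / 2),
      sq_nonneg ((a - b) * (lo m - lo' m))]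
  linarith

lemma sq_sub_posterior_le {a b : Fin M → ℝ} (ha : a ∈ stdSimplex ℝ (Fin M))
    (hb : b ∈ stdSimplex ℝ (Fin M)) (hab : ∀ m, b m = 0 → a m = 0) {g : Fin M → ℝ}
    (hg : ∀ m, 0 ≤ g m) {η : ℝ} (hη : 0 ≤ η) :
    η * ∑ m, (a m - b m) ^ 2 * g m ≤ relEnt a b + (η * ∑ m, (a m + b m) * g m) ^ 2 := by
  have hK := hellinger_le_relEnt ha hb hab
  set K := relEnt a b
  set E := ∑ m, (a m + b m) * g m with hE
  have hE0 : 0 ≤ E := Finset.sum_nonneg fun m _ =>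
    mul_nonneg (add_nonneg (ha.1 m) (hb.1 m)) (hg m)
  have hK0 : 0 ≤ K := (Finset.sum_nonneg fun m _ => sq_nonneg _).trans hK
  have hsq : √K ^ 2 = K := Real.sq_sqrt hK0
  have h1 : ∀ m, (a m - b m) ^ 2 ≤ 2 * √K * (a m + b m) := by
    intro m
    have hm : (√(a m) - √(b m)) ^ 2 ≤ K :=
      (Finset.single_le_sum (f := fun m => (√(a m) - √(b m)) ^ 2) (fun i _ => sq_nonneg _)
        (Finset.mem_univ m)).trans hK
    have h2 : |√(a m) - √(b m)| ≤ √K := Real.abs_le_sqrt hm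
    have s1 := Real.sq_sqrt (ha.1 m)
    have s2 := Real.sq_sqrt (hb.1 m)
    have a1 := simplex_le_one ha m
    have b1 := simplex_le_one hb m
    have p1 := Real.sqrt_nonneg (a m)
    have p2 := Real.sqrt_nonneg (b m)
    have p3 := Real.sqrt_nonneg K
    have a2 : √(a m) ≤ 1 := Real.sqrt_le_one.2 a1
    have b2 : √(b m) ≤ 1 := Real.sqrt_le_one.2 b1
    set α := √(a m)
    set β := √(b m)
    rw [← s1, ← s2]
    have h3 : (α ^ 2 - β ^ 2) ^ 2 = |α - β| * (|α - β| * (α + β) ^ 2) := by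
      rw [← mul_assoc, abs_mul_abs_self]; ring
    have h4 : |α - β| ≤ 1 := abs_le.2 ⟨by linarith, by linarith⟩
    have h5 : |α - β| * (α + β) ^ 2 ≤ 2 * (α ^ 2 + β ^ 2) := by
      calc |α - β| * (α + β) ^ 2 ≤ 1 * (α + β) ^ 2 := by gcongr
        _ ≤ _ := by nlinarith [sq_nonneg (α - β)]
    rw [h3]
    calc |α - β| * (|α - β| * (α + β) ^ 2) ≤ √K * (2 * (α ^ 2 + β ^ 2)) := by gcongr
      _ = _ := by ring
  have h2 : ∑ m, (a m - b m) ^ 2 * g m ≤ 2 * √K * E := by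
    rw [hE, Finset.mul_sum]
    refine Finset.sum_le_sum fun m _ => ?_
    rw [← mul_assoc]
    exact mul_le_mul_of_nonneg_right (h1 m) (hg m)
  have h3 := mul_le_mul_of_nonneg_left h2 hη
  nlinarith [sq_nonneg (√K - η * E)]

end Stability

section Descent

variable {S : Type*} [Fintype S] {T M d : ℕ}

lemma avg_sq_le {φ : S → ℝ} (h : ∀ s, 0 ≤ φ s) :
    (avg fun s => φ s ^ 2) ≤ Fintype.card S * avg φ ^ 2 := by
  rcases isEmpty_or_nonempty S with hS | hS
  · simp [avg]
  have hc : (0 : ℝ) < Fintype.card S := by exact_mod_cast Fintype.card_pos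
  have h1 : ∑ s, φ s ^ 2 ≤ (∑ s, φ s) ^ 2 := Finset.sum_sq_le_sq_sum_of_nonneg fun s _ => h s
  unfold avg
  simp only [smul_eq_mul]
  calc (Fintype.card S : ℝ)⁻¹ * ∑ s, φ s ^ 2 ≤ (Fintype.card S : ℝ)⁻¹ * (∑ s, φ s) ^ 2 := by
        gcongr
    _ = _ := by field_simp

variable {cl : S → Fin T} {l : S → Vec d → ℝ} {L : ℝ≥0} {Θ Θ' : Fin T → Params M d}
  {π π' : Fin T → Fin M → ℝ} [Nonempty S]

/-- Growth of the free energy in one round, for a displacement of the parameters. -/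
lemma freeEnergy_next_le (hl : SmoothLoss l L) (hπ : ∀ t, π t ∈ stdSimplex ℝ (Fin M))
    (hm : IsClientMean cl (resp cl l Θ π) π') {a δ : ℝ} (ha : 0 < a)
    (hδ : ∀ t, ‖Θ' t - Θ t‖ ^ 2 ≤ δ) :
    freeEnergy cl l Θ' π' ≤ (1 + a) * freeEnergy cl l Θ π + L / 2 * (1 + 1 / a) * δ := by
  have hq := resp_mem (cl := cl) (l := l) (Θ := Θ) hπ
  have h1 := freeEnergy_le (l := l) (Θ := Θ') hm.mem hq fun s m h0 => hm.eq_zero hq h0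
  have h2 := risk_le_mul_add hl hq (fun s => Θ (cl s)) (fun s => Θ' (cl s)) ha
  have h3 := respInfo_resp_eq hπ hm
  have h4 := clientKL_step_nonneg hπ hm
  have h5 := freeEnergy_eq_resp (cl := cl) (l := l) (Θ := Θ) hπ
  have h6 : 0 ≤ respInfo cl π' (resp cl l Θ π) :=
    respInfo_nonneg hq hm.mem fun s m h0 => hm.eq_zero hq h0
  have h7 : (L : ℝ) / 2 * (1 + 1 / a) * (avg fun s => ‖Θ' (cl s) - Θ (cl s)‖ ^ 2)
      ≤ L / 2 * (1 + 1 / a) * δ := by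
    gcongr
    exact avg_le fun s => hδ _
  have h8 : 0 ≤ a * (respInfo cl π' (resp cl l Θ π) + clientKL cl π' π) := by positivity
  rw [h5, h3]
  linarith

lemma freeEnergy_mean_le (hl : SmoothLoss l L) (hπ : ∀ t, π t ∈ stdSimplex ℝ (Fin M))
    {x : Params M d} {D : ℝ} (hD : ∀ s, ‖Θ (cl s) - x‖ ^ 2 ≤ D) :
    risk l (fun _ => x) (resp cl l Θ π) + respInfo cl π (resp cl l Θ π)
      ≤ 2 * freeEnergy cl l Θ π + L * D := by
  have hq := resp_mem (cl := cl) (l := l) (Θ := Θ) hπ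
  have h2 := risk_le_mul_add hl hq (fun s => Θ (cl s)) (fun _ => x) one_pos
  have h5 := freeEnergy_eq_resp (cl := cl) (l := l) (Θ := Θ) hπ
  have h6 : 0 ≤ respInfo cl π (resp cl l Θ π) :=
    respInfo_nonneg hq hπ fun s m h0 => (resp_eq_zero_iff hπ s m).2 h0
  have h7 : (avg fun s => ‖x - Θ (cl s)‖ ^ 2) ≤ D :=
    avg_le fun s => by rw [norm_sub_rev]; exact hD s
  have h8 : (L : ℝ) / 2 * (1 + 1 / 1) * (avg fun s => ‖x - Θ (cl s)‖ ^ 2)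
      ≤ L / 2 * (1 + 1 / 1) * D := by gcongr
  linarith

/-- Evaluating the responsibilities at the local parameters instead of the mean `x` costs only
second-order terms. -/
lemma avg_relEnt_resp_le (hl : SmoothLoss l L) (hπ : ∀ t, π t ∈ stdSimplex ℝ (Fin M))
    {x : Params M d} {D : ℝ} (hD0 : 0 ≤ D) (hD : ∀ s, ‖Θ (cl s) - x‖ ^ 2 ≤ D) :
    (avg fun s => relEnt (resp cl l Θ π s) (resp cl l (fun _ => x) π s))
      ≤ 12 * L * (D * freeEnergy cl l Θ π) + 5 * L ^ 2 * D ^ 2 := by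
  have hq := resp_mem (cl := cl) (l := l) (Θ := Θ) hπ
  have hqx := resp_mem (cl := cl) (l := l) (Θ := fun _ => x) hπ
  have hL : (0 : ℝ) ≤ L := L.2
  have hx1 := freeEnergy_mean_le hl hπ hD
  have hx2 := freeEnergy_le (l := l) (Θ := fun _ => x) hπ hq
    fun s m h0 => (resp_eq_zero_iff hπ s m).2 h0
  have hx3 := risk_resp_le (cl := cl) (l := l) (Θ := fun _ => x) hπ
  have hF := risk_resp_le (cl := cl) (l := l) (Θ := Θ) hπ
  set q := resp cl l Θ π with hqdef
  set qx := resp cl l (fun _ => x) π with hqxdef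
  have key : ∀ s, relEnt (q s) (qx s) ≤ (4 * L * D * ∑ m, q s m * l s (Θ (cl s) m))
      + (4 * L * D * ∑ m, qx s m * l s (x m)) + L ^ 2 * D ^ 2 := by
    intro s
    have h1 := relEnt_posterior_add_le (hπ (cl s)) (fun m => l s (Θ (cl s) m))
      (fun m => l s (x m))
    have h2 : 0 ≤ relEnt (qx s) (q s) := relEnt_nonneg (hqx s) (hq s) fun m h0 =>
      (resp_eq_zero_iff hπ s m).2 ((resp_eq_zero_iff hπ s m).1 h0)
    have h3 : ∀ m, ‖Θ (cl s) m - x m‖ ^ 2 ≤ D := fun m => by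
      refine le_trans ?_ (hD s)
      rw [params_norm_sq]
      exact Finset.single_le_sum (f := fun m => ‖(Θ (cl s) - x) m‖ ^ 2)
        (fun i _ => sq_nonneg _) (Finset.mem_univ m)
    have h4 : ∀ m, ‖Θ (cl s) m - x m‖ ^ 4 ≤ D ^ 2 := fun m => by
      have := pow_le_pow_left₀ (by positivity) (h3 m) 2
      rwa [← pow_mul] at this
    have h5 : ∀ m, (q s m + qx s m) * (l s (Θ (cl s) m) - l s (x m)) ^ 2
        ≤ q s m * (4 * L * D * l s (Θ (cl s) m) + L ^ 2 / 2 * D ^ 2)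
          + qx s m * (4 * L * D * l s (x m) + L ^ 2 / 2 * D ^ 2) := by
      intro m
      have a1 := smooth_sub_sq_le (hl.diff s) (hl.lip s) (hl.nonneg s) hl.one_le
        (Θ (cl s) m) (x m)
      have a2 := smooth_sub_sq_le (hl.diff s) (hl.lip s) (hl.nonneg s) hl.one_le
        (x m) (Θ (cl s) m)
      have l1 := hl.nonneg s (Θ (cl s) m)
      have l2 := hl.nonneg s (x m)
      have b1 : (l s (Θ (cl s) m) - l s (x m)) ^ 2
          ≤ 4 * L * D * l s (Θ (cl s) m) + L ^ 2 / 2 * D ^ 2 := by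
        rw [← neg_sub, neg_sq]
        refine a1.trans ?_
        rw [norm_sub_rev]
        gcongr
        · exact h3 m
        · exact h4 m
      have b2 : (l s (Θ (cl s) m) - l s (x m)) ^ 2
          ≤ 4 * L * D * l s (x m) + L ^ 2 / 2 * D ^ 2 := by
        refine a2.trans ?_
        gcongr
        · exact h3 m
        · exact h4 m
      rw [add_mul]
      exact add_le_add (mul_le_mul_of_nonneg_left b1 ((hq s).1 m))
        (mul_le_mul_of_nonneg_left b2 ((hqx s).1 m))
    have h6 := Finset.sum_le_sum fun m (_ : m ∈ Finset.univ) => h5 m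
    have h7 : ∑ m, (q s m * (4 * L * D * l s (Θ (cl s) m) + L ^ 2 / 2 * D ^ 2)
          + qx s m * (4 * L * D * l s (x m) + L ^ 2 / 2 * D ^ 2))
        = (4 * L * D * ∑ m, q s m * l s (Θ (cl s) m))
          + (4 * L * D * ∑ m, qx s m * l s (x m))
          + L ^ 2 / 2 * D ^ 2 * (∑ m, q s m) + L ^ 2 / 2 * D ^ 2 * ∑ m, qx s m := by
      simp only [Finset.mul_sum]
      rw [← Finset.sum_add_distrib, ← Finset.sum_add_distrib, ← Finset.sum_add_distrib]
      exact Finset.sum_congr rfl fun m _ => by ring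
    rw [(hq s).2, (hqx s).2] at h7
    have h8 : relEnt (q s) (qx s) + relEnt (qx s) (q s) ≤ _ := h1.trans h6
    linarith
  refine (avg_mono key).trans ?_
  rw [avg_add, avg_add, avg_mul, avg_mul, avg_const]
  change 4 * L * D * risk l (fun s => Θ (cl s)) q + 4 * L * D * risk l (fun _ => x) qx
    + L ^ 2 * D ^ 2 ≤ _
  have c1 : 4 * L * D * risk l (fun s => Θ (cl s)) q ≤ 4 * L * D * freeEnergy cl l Θ π := by
    gcongr
  have c2 : 4 * L * D * risk l (fun _ => x) qx
      ≤ 4 * L * D * (2 * freeEnergy cl l Θ π + L * D) := by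
    gcongr
    linarith
  linarith

/-- Gradients of the likelihood at the mean with exact and with local responsibilities. -/
lemma norm_gradVec_resp_sub_sq_le (hl : SmoothLoss l L) (hπ : ∀ t, π t ∈ stdSimplex ℝ (Fin M))
    {x : Params M d} {D η : ℝ} (hη : 0 ≤ η) (hD0 : 0 ≤ D)
    (hD : ∀ s, ‖Θ (cl s) - x‖ ^ 2 ≤ D) :
    η * ‖gradVec l (fun _ => x) (resp cl l Θ π)
        - gradVec l (fun _ => x) (resp cl l (fun _ => x) π)‖ ^ 2
      ≤ 12 * L * (D * freeEnergy cl l Θ π) + 5 * L ^ 2 * D ^ 2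
        + Fintype.card S * (η * (8 * L * freeEnergy cl l Θ π + 4 * L ^ 2 * D)) ^ 2 := by
  have hq := resp_mem (cl := cl) (l := l) (Θ := Θ) hπ
  have hqx := resp_mem (cl := cl) (l := l) (Θ := fun _ => x) hπ
  have hL : (0 : ℝ) ≤ L := L.2
  have hx1 := freeEnergy_mean_le hl hπ hD
  have hx2 := freeEnergy_le (l := l) (Θ := fun _ => x) hπ hq
    fun s m h0 => (resp_eq_zero_iff hπ s m).2 h0
  have hx3 := risk_resp_le (cl := cl) (l := l) (Θ := fun _ => x) hπ
  have hI : 0 ≤ respInfo cl π (resp cl l Θ π) :=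
    respInfo_nonneg hq hπ fun s m h0 => (resp_eq_zero_iff hπ s m).2 h0
  have hK := avg_relEnt_resp_le hl hπ hD0 hD
  have hF0 : 0 ≤ freeEnergy cl l Θ π := freeEnergy_nonneg hl hπ
  set q := resp cl l Θ π with hqdef
  set qx := resp cl l (fun _ => x) π with hqxdef
  set g : S → Fin M → ℝ := fun s m => 2 * L * l s (x m) with hg
  set E : S → ℝ := fun s => ∑ m, (q s m + qx s m) * g s m with hE
  have hg0 : ∀ s m, 0 ≤ g s m := fun s m => by
    have := hl.nonneg s (x m); simp only [hg]; positivity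
  have hE0 : ∀ s, 0 ≤ E s := fun s => Finset.sum_nonneg fun m _ =>
    mul_nonneg (add_nonneg ((hq s).1 m) ((hqx s).1 m)) (hg0 s m)
  have h1 : ‖gradVec l (fun _ => x) q - gradVec l (fun _ => x) qx‖ ^ 2
      ≤ avg fun s => ∑ m, (q s m - qx s m) ^ 2 * g s m := by
    unfold gradVec
    rw [← avg_sub]
    refine (norm_avg_sq_le _).trans (avg_mono fun s => ?_)
    rw [params_norm_sq]
    refine Finset.sum_le_sum fun m _ => ?_
    rw [PiLp.sub_apply, WithLp.ofLp_toLp, WithLp.ofLp_toLp, ← sub_smul, norm_smul, mul_pow,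
      Real.norm_eq_abs, sq_abs]
    exact mul_le_mul_of_nonneg_left
      (norm_gradient_sq_le (hl.diff s) (hl.lip s) (hl.nonneg s) hl.one_le (x m)) (sq_nonneg _)
  have h2 : η * (avg fun s => ∑ m, (q s m - qx s m) ^ 2 * g s m)
      ≤ avg fun s => relEnt (q s) (qx s) + (η * E s) ^ 2 := by
    rw [← avg_mul]
    exact avg_mono fun s => sq_sub_posterior_le (hq s) (hqx s)
      (fun m h0 => (resp_eq_zero_iff hπ s m).2 ((resp_eq_zero_iff hπ s m).1 h0)) (hg0 s) hη
  have h3 : (avg fun s => (η * E s) ^ 2) ≤ Fintype.card S * (η * avg E) ^ 2 := by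
    rw [← avg_mul]
    exact avg_sq_le fun s => mul_nonneg hη (hE0 s)
  have h4 : avg E = 2 * L * (risk l (fun _ => x) q + risk l (fun _ => x) qx) := by
    unfold risk
    rw [← avg_add, ← avg_mul]
    congr 1; funext s
    simp only [hE, hg]
    rw [← Finset.sum_add_distrib, Finset.mul_sum]
    exact Finset.sum_congr rfl fun m _ => by ring
  have hE1 : 0 ≤ avg E := avg_nonneg hE0
  have h5 : avg E ≤ 8 * L * freeEnergy cl l Θ π + 4 * L ^ 2 * D := by
    rw [h4]
    have : risk l (fun _ => x) q + risk l (fun _ => x) qx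
        ≤ 2 * (2 * freeEnergy cl l Θ π + L * D) := by linarith
    calc 2 * L * (risk l (fun _ => x) q + risk l (fun _ => x) qx)
        ≤ 2 * L * (2 * (2 * freeEnergy cl l Θ π + L * D)) := by gcongr
      _ = _ := by ring
  have h6 : Fintype.card S * (η * avg E) ^ 2 ≤ Fintype.card S
      * (η * (8 * L * freeEnergy cl l Θ π + 4 * L ^ 2 * D)) ^ 2 := by gcongr
  have h7 := mul_le_mul_of_nonneg_left h1 hη
  rw [avg_add] at h2
  linarith

set_option maxHeartbeats 1000000 in
/-- Descent of the likelihood at the mean in one round. -/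
lemma likelihood_descent (hl : SmoothLoss l L) (hπ : ∀ t, π t ∈ stdSimplex ℝ (Fin M))
    (hm : IsClientMean cl (resp cl l Θ π) π') {r k D b : ℝ}
    (hr : r = 1 / (64 * L)) (hk0 : 0 < k) (hk1 : k ≤ 1) (x v Z e : Params M d)
    (hD0 : 0 ≤ D) (hD : ∀ s, ‖Θ (cl s) - x‖ ^ 2 ≤ D) (hb : L ≤ b)
    (hv : v = (r * k) • (gradVec l (fun s => Θ (cl s)) (resp cl l Θ π) + Z + e))
    (hZ : ‖Z‖ ^ 2 ≤ b * freeEnergy cl l Θ π)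
    (he : ‖e‖ ^ 2 ≤ b * (k ^ 2 * freeEnergy cl l Θ π)) :
    freeEnergy cl l (fun _ => x - v) π' + clientKL cl π' π
        + r * k / 8 * ‖gradVec l (fun _ => x) (resp cl l (fun _ => x) π)‖ ^ 2
      ≤ freeEnergy cl l (fun _ => x) π
        - r * k * inner ℝ (gradVec l (fun _ => x) (resp cl l Θ π)) Z
        + 100 * Fintype.card S * b ^ 2 * (D * freeEnergy cl l Θ π + D ^ 2
          + k ^ 2 * freeEnergy cl l Θ π ^ 2 + k ^ 2 * freeEnergy cl l Θ π + D) := by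
  have hL1 : (1 : ℝ) ≤ L := by exact_mod_cast hl.one_le
  have hL0 : (0 : ℝ) < L := by linarith
  have hr0 : 0 < r := by rw [hr]; positivity
  have hrL : r * L = 1 / 64 := by rw [hr]; field_simp
  have hr1 : r ≤ 1 / 64 := by nlinarith
  have hn : (1 : ℝ) ≤ Fintype.card S := by exact_mod_cast Fintype.card_pos
  have hq := resp_mem (cl := cl) (l := l) (Θ := Θ) hπ
  have hgap := avg_relEnt_resp_le hl hπ hD0 hD
  have hgr := norm_gradVec_resp_sub_sq_le hl hπ (mul_pos hr0 hk0).le hD0 hD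
  have hF0 : 0 ≤ freeEnergy cl l Θ π := freeEnergy_nonneg hl hπ
  have hFr := risk_resp_le (cl := cl) (l := l) (Θ := Θ) hπ
  have hG2 := norm_gradVec_sq_le hl hq (fun s => Θ (cl s))
  have hGg := norm_gradVec_sub_sq_le hl hq (fun _ : S => x) (fun s => Θ (cl s))
  have hx := freeEnergy_add (l := l) (Θ := fun _ => x) hπ hq
    fun s m h0 => (resp_eq_zero_iff hπ s m).2 h0
  have hx' := freeEnergy_le (l := l) (Θ := fun _ => x - v) hm.mem hq
    fun s m h0 => hm.eq_zero hq h0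
  have hI := respInfo_resp_eq hπ hm
  have hst : risk l (fun _ : S => x - v) (resp cl l Θ π) ≤ risk l (fun _ => x) (resp cl l Θ π)
      - inner ℝ (gradVec l (fun _ => x) (resp cl l Θ π)) v + L / 2 * ‖v‖ ^ 2 := by
    have := risk_le hl hq (fun _ : S => x) (fun _ => x - v)
    simp only [sub_sub_cancel_left, norm_neg] at this
    rw [dirRisk_const, avg_const, inner_neg_right] at this
    linarith
  have hDa : (avg fun s => ‖x - Θ (cl s)‖ ^ 2) ≤ D :=
    avg_le fun s => by rw [norm_sub_rev]; exact hD s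
  set F := freeEnergy cl l Θ π
  set q := resp cl l Θ π
  set qx := resp cl l (fun _ => x) π
  set g := gradVec l (fun _ => x) q
  set gx := gradVec l (fun _ => x) qx
  set G := gradVec l (fun s => Θ (cl s)) q
  set n : ℝ := (Fintype.card S : ℝ)
  have hb1 : 1 ≤ b := hL1.trans hb
  have i1 : inner ℝ g v = r * k * (inner ℝ g G + inner ℝ g Z + inner ℝ g e) := by
    rw [hv, inner_smul_right, inner_add_right, inner_add_right]
  have i2 : -inner ℝ g G ≤ -(1 / 2) * ‖g‖ ^ 2 + 1 / 2 * (L ^ 2 * D) := by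
    have h1 : ‖g - G‖ ^ 2 ≤ L ^ 2 * D := hGg.trans (by gcongr)
    rw [norm_sub_sq_real] at h1
    have := sq_nonneg ‖G‖
    linarith only [this, h1]
  have i3 : -inner ℝ g e ≤ 1 / 4 * ‖g‖ ^ 2 + ‖e‖ ^ 2 := by
    have h1 : 0 ≤ ‖(1 / 2 : ℝ) • g + e‖ ^ 2 := by positivity
    rw [norm_add_sq_real, inner_smul_left, norm_smul, mul_pow] at h1
    norm_num at h1
    linarith only [h1]
  have i4 : r * k * (-inner ℝ g G + -inner ℝ g e)
      ≤ r * k * (-(1 / 4) * ‖g‖ ^ 2 + 1 / 2 * (L ^ 2 * D) + ‖e‖ ^ 2) := by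
    exact mul_le_mul_of_nonneg_left (by linarith only [i2, i3]) (mul_pos hr0 hk0).le
  have hb0 : 0 < b := by linarith
  have hk2 : k ^ 2 ≤ 1 := pow_le_one₀ hk0.le hk1
  have sv : L / 2 * ‖v‖ ^ 2 ≤ b * (k ^ 2 * F) := by
    have h1 : ‖v‖ ^ 2 ≤ (r * k) ^ 2 * (3 * ‖G‖ ^ 2 + 3 * ‖Z‖ ^ 2 + 3 * ‖e‖ ^ 2) := by
      rw [hv, norm_smul, mul_pow, Real.norm_eq_abs, sq_abs]
      gcongr
      exact norm_add_sq_le_three _ _ _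
    have h0 := risk_nonneg hl hq (fun s => Θ (cl s))
    have h2 : ‖G‖ ^ 2 ≤ 2 * b * F := hG2.trans (by gcongr)
    have h3 : ‖e‖ ^ 2 ≤ b * (1 * F) := he.trans (by gcongr)
    calc L / 2 * ‖v‖ ^ 2 ≤ L / 2 * ((r * k) ^ 2 * (3 * (2 * b * F) + 3 * (b * F)
          + 3 * (b * (1 * F)))) := by
          gcongr; exact h1.trans (by gcongr)
      _ = 6 * (r * L) * r * (b * (k ^ 2 * F)) := by ring
      _ = 6 * (1 / 64) * r * (b * (k ^ 2 * F)) := by rw [hrL]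
      _ ≤ 6 * (1 / 64) * (1 / 64) * (b * (k ^ 2 * F)) := by gcongr
      _ ≤ _ := by
        have : 0 ≤ b * (k ^ 2 * F) := by positivity
        linarith only [this]
  have sD : r * k * (1 / 2 * (L ^ 2 * D)) ≤ L * D := by
    calc r * k * (1 / 2 * (L ^ 2 * D)) = (r * L) * k * (1 / 2) * (L * D) := by ring
      _ = 1 / 64 * k * (1 / 2) * (L * D) := by rw [hrL]
      _ ≤ 1 / 64 * 1 * (1 / 2) * (L * D) := by gcongr
      _ ≤ _ := by
        have : 0 ≤ L * D := by positivity
        linarith only [this]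
  have se : r * k * ‖e‖ ^ 2 ≤ b * (k ^ 2 * F) := by
    calc r * k * ‖e‖ ^ 2 ≤ 1 * 1 * (b * (k ^ 2 * F)) := by gcongr; linarith only [hr1]
      _ = _ := by ring
  have sgx : r * k * ‖gx‖ ^ 2 ≤ 2 * (r * k * ‖g‖ ^ 2) + 2 * (r * k * ‖g - gx‖ ^ 2) := by
    have := norm_sub_sq_le_two g (g - gx)
    rw [sub_sub_cancel] at this
    have h2 := mul_le_mul_of_nonneg_left this (mul_pos hr0 hk0).le
    linarith only [h2]
  have sq2 : (r * k * (8 * L * F + 4 * L ^ 2 * D)) ^ 2 ≤ k ^ 2 * F ^ 2 + L ^ 2 * D ^ 2 := by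
    calc (r * k * (8 * L * F + 4 * L ^ 2 * D)) ^ 2
        = (r * L) ^ 2 * k ^ 2 * (8 * F + 4 * (L * D)) ^ 2 := by ring
      _ = (1 / 64) ^ 2 * k ^ 2 * (8 * F + 4 * (L * D)) ^ 2 := by rw [hrL]
      _ ≤ (1 / 64) ^ 2 * k ^ 2 * (128 * F ^ 2 + 32 * (L * D) ^ 2) := by
        gcongr
        nlinarith only [sq_nonneg (8 * F - 4 * (L * D))]
      _ ≤ k ^ 2 * F ^ 2 + k ^ 2 * (L * D) ^ 2 := by
        have h1 : 0 ≤ k ^ 2 * F ^ 2 := by positivity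
        have h2 : 0 ≤ k ^ 2 * (L * D) ^ 2 := by positivity
        linarith only [h1, h2]
      _ ≤ k ^ 2 * F ^ 2 + 1 * (L * D) ^ 2 := by gcongr
      _ = _ := by ring
  have sn := mul_le_mul_of_nonneg_left sq2 (show 0 ≤ n by linarith)
  -- all error terms are at most a multiple of the final one
  have hnb : b ≤ n * b ^ 2 := by
    calc b = 1 * b ^ 1 := by ring
      _ ≤ n * b ^ 2 := by gcongr; norm_num
  have hnL : L ≤ n * b ^ 2 := hb.trans hnb
  have hnb2 : b ^ 2 ≤ n * b ^ 2 := le_mul_of_one_le_left (by positivity) hn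
  have hL2 : (L : ℝ) ^ 2 ≤ b ^ 2 := by gcongr
  have hnn : n ≤ n * b ^ 2 := le_mul_of_one_le_right (by linarith) (one_le_pow₀ hb1)
  have a1 : L * (D * F) ≤ n * b ^ 2 * (D * F) := by gcongr
  have a2 : L ^ 2 * D ^ 2 ≤ n * b ^ 2 * D ^ 2 := by gcongr; linarith
  have a3 : b * (k ^ 2 * F) ≤ n * b ^ 2 * (k ^ 2 * F) := by gcongr
  have a4 : L * D ≤ n * b ^ 2 * D := by gcongr
  have a5 : n * (k ^ 2 * F ^ 2) ≤ n * b ^ 2 * (k ^ 2 * F ^ 2) := by gcongr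
  have a6 : n * (L ^ 2 * D ^ 2) ≤ n * b ^ 2 * D ^ 2 := by
    rw [mul_assoc]; gcongr
  have p1 : 0 ≤ n * b ^ 2 * (D * F) := by positivity
  have p2 : 0 ≤ n * b ^ 2 * D ^ 2 := by positivity
  have p3 : 0 ≤ n * b ^ 2 * (k ^ 2 * F) := by positivity
  have p4 : 0 ≤ n * b ^ 2 * D := by positivity
  have p5 : 0 ≤ n * b ^ 2 * (k ^ 2 * F ^ 2) := by positivity
  rw [i1] at hst
  linarith only [hst, hx, hx', hI, hgap, hgr, i4, sv, sD, se, sgx, sn, a1, a2, a3, a4, a5, a6, p1,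
    p2, p3, p4, p5]

end Descent

/-! ### One round of local training -/

section Round

variable {𝒳 𝒴 𝒜 : Type*} [MeasurableSpace 𝒳] [MeasurableSpace 𝒴] {T M d : ℕ}
  (Q : FedProblem 𝒳 𝒴 𝒜 T M d)

/-- A training sample: a client and the index of one of its data points. -/
abbrev Sample : Type := (t : Fin T) × Fin (Q.n t)

/-- The loss of a training sample. -/
noncomputable def lossAt (s : Sample Q) (θ : Vec d) : ℝ := Q.sampleLoss s.1 s.2 θ

/-- The client that holds a training sample. -/
def client (s : Sample Q) : Fin T := s.1

lemma card_sample : Fintype.card (Sample Q) = Q.total := by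
  simp [Sample, FedProblem.total]

variable {Q}

lemma avg_sample {E : Type*} [AddCommGroup E] [Module ℝ E] (φ : Sample Q → E) :
    avg φ = (Q.total : ℝ)⁻¹ • ∑ t, ∑ i, φ ⟨t, i⟩ := by
  rw [avg, card_sample, Fintype.sum_sigma]

lemma isClientMean_mixtureUpdate (hn : ∀ t, 0 < Q.n t) {Θ : Fin T → Params M d}
    {π : Fin T → Fin M → ℝ} (hπ : ∀ t, π t ∈ stdSimplex ℝ (Fin M)) :
    IsClientMean (client Q) (resp (client Q) (lossAt Q) Θ π)
      fun t m => Q.mixtureUpdate (Θ t) (π t) t m where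
  mem t := by
    have hq := fun i => resp_mem (cl := client Q) (l := lossAt Q) (Θ := Θ) hπ ⟨t, i⟩
    refine ⟨fun m => div_nonneg (Finset.sum_nonneg fun i _ => (hq i).1 m) (by positivity), ?_⟩
    unfold FedProblem.mixtureUpdate
    rw [← Finset.sum_div, Finset.sum_comm]
    have : ∀ i, ∑ m, Q.eStep (Θ t) (π t) t i m = 1 := fun i => (hq i).2
    have h0 : (Q.n t : ℝ) ≠ 0 := by exact_mod_cast (hn t).ne'
    simp [this, h0]
  tower m φ := by
    rw [avg_sample, avg_sample]
    congr 1
    refine Finset.sum_congr rfl fun t _ => ?_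
    have h0 : (Q.n t : ℝ) ≠ 0 := by exact_mod_cast (hn t).ne'
    change ∑ i, Q.eStep (Θ t) (π t) t i m * φ t
      = ∑ _i : Fin (Q.n t), (∑ i, Q.eStep (Θ t) (π t) t i m) / (Q.n t : ℝ) * φ t
    rw [← Finset.sum_mul, Finset.sum_const, Finset.card_univ, Fintype.card_fin, nsmul_eq_mul]
    field_simp

lemma weight_nonneg (t : Fin T) : 0 ≤ Q.weight t := by unfold FedProblem.weight; positivity

lemma n_le_total (t : Fin T) : Q.n t ≤ Q.total :=
  Finset.single_le_sum (f := Q.n) (fun _ _ => Nat.zero_le _) (Finset.mem_univ t)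

lemma weight_le_one (t : Fin T) : Q.weight t ≤ 1 :=
  div_le_one_of_le₀ (by exact_mod_cast n_le_total t) (by positivity)

variable {𝓑 : Q.BatchScheme} {L : ℝ≥0}

lemma inv_natCast_mul_le {n : ℕ} {a c : ℝ} (hc : 0 ≤ c) (h : a ≤ n * c) : (n : ℝ)⁻¹ * a ≤ c := by
  rcases Nat.eq_zero_or_pos n with rfl | h0
  · simpa using hc
  · rwa [inv_mul_le_iff₀ (by exact_mod_cast h0)]

lemma norm_batchGrad_sub_le (hl : SmoothLoss (lossAt Q) L) {t : Fin T} {w : Fin (Q.n t) → ℝ}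
    (hw0 : ∀ i, 0 ≤ w i) (hw1 : ∀ i, w i ≤ 1) (θ θ' : Vec d) (b : 𝓑.Batch t) :
    ‖𝓑.batchGrad t w θ' b - 𝓑.batchGrad t w θ b‖ ≤ L * ‖θ' - θ‖ := by
  unfold FedProblem.BatchScheme.batchGrad
  rw [← smul_sub, ← Finset.sum_sub_distrib, norm_smul, norm_inv, Real.norm_natCast]
  have h1 : ‖∑ s, (w (b s) • gradient (Q.sampleLoss t (b s)) θ'
      - w (b s) • gradient (Q.sampleLoss t (b s)) θ)‖ ≤ 𝓑.size t * (L * ‖θ' - θ‖) := by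
    refine (norm_sum_le _ _).trans ?_
    have : ∀ s ∈ (Finset.univ : Finset (Fin (𝓑.size t))),
        ‖w (b s) • gradient (Q.sampleLoss t (b s)) θ'
          - w (b s) • gradient (Q.sampleLoss t (b s)) θ‖ ≤ L * ‖θ' - θ‖ := fun s _ => by
      rw [← smul_sub, norm_smul, Real.norm_of_nonneg (hw0 _)]
      calc w (b s) * _ ≤ 1 * (L * ‖θ' - θ‖) := by
            gcongr
            · exact hw1 _
            · exact (hl.lip ⟨t, b s⟩).norm_sub_le θ' θ
        _ = _ := one_mul _
    refine (Finset.sum_le_card_nsmul _ _ _ this).trans ?_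
    simp
  exact inv_natCast_mul_le (by positivity) h1

/-- Total weighted gradient norm over the samples of a client. -/
noncomputable def gradSum (t : Fin T) (w : Fin (Q.n t) → ℝ) (θ : Vec d) : ℝ :=
  ∑ i, w i * ‖gradient (Q.sampleLoss t i) θ‖

lemma gradSum_nonneg {t : Fin T} {w : Fin (Q.n t) → ℝ} (hw0 : ∀ i, 0 ≤ w i) (θ : Vec d) :
    0 ≤ gradSum t w θ := Finset.sum_nonneg fun i _ => mul_nonneg (hw0 i) (norm_nonneg _)

lemma norm_batchGrad_le {t : Fin T} {w : Fin (Q.n t) → ℝ}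
    (hw0 : ∀ i, 0 ≤ w i) (θ : Vec d) (b : 𝓑.Batch t) :
    ‖𝓑.batchGrad t w θ b‖ ≤ gradSum t w θ := by
  unfold FedProblem.BatchScheme.batchGrad
  rw [norm_smul, norm_inv, Real.norm_natCast]
  have h1 : ‖∑ s, w (b s) • gradient (Q.sampleLoss t (b s)) θ‖ ≤ 𝓑.size t * gradSum t w θ := by
    refine (norm_sum_le _ _).trans ?_
    have : ∀ s ∈ (Finset.univ : Finset (Fin (𝓑.size t))),
        ‖w (b s) • gradient (Q.sampleLoss t (b s)) θ‖ ≤ gradSum t w θ := fun s _ => by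
      rw [norm_smul, Real.norm_of_nonneg (hw0 _)]
      exact Finset.single_le_sum (f := fun i => w i * ‖gradient (Q.sampleLoss t i) θ‖)
        (fun i _ => mul_nonneg (hw0 i) (norm_nonneg _)) (Finset.mem_univ (b s))
    refine (Finset.sum_le_card_nsmul _ _ _ this).trans ?_
    simp
  exact inv_natCast_mul_le (gradSum_nonneg hw0 θ) h1

/-- The mean of the weighted gradients over the samples of a client. -/
noncomputable def meanGrad (t : Fin T) (w : Fin (Q.n t) → ℝ) (θ : Vec d) : Vec d :=
  (Q.n t : ℝ)⁻¹ • ∑ i, w i • gradient (Q.sampleLoss t i) θ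

lemma norm_meanGrad_le {t : Fin T} {w : Fin (Q.n t) → ℝ} (hw0 : ∀ i, 0 ≤ w i) (θ : Vec d) :
    ‖meanGrad t w θ‖ ≤ gradSum t w θ := by
  unfold meanGrad
  rw [norm_smul, norm_inv, Real.norm_natCast]
  have h1 : ‖∑ i, w i • gradient (Q.sampleLoss t i) θ‖ ≤ gradSum t w θ := by
    refine (norm_sum_le _ _).trans (Finset.sum_le_sum fun i _ => ?_)
    rw [norm_smul, Real.norm_of_nonneg (hw0 _)]
  calc ((Q.n t : ℝ)⁻¹) * _ ≤ 1 * gradSum t w θ := by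
        gcongr
        exact Nat.cast_inv_le_one _
    _ = _ := one_mul _

lemma sum_gradSum_sq_le (hl : SmoothLoss (lossAt Q) L) {Θ : Fin T → Params M d}
    {q : Sample Q → Fin M → ℝ} (hq : ∀ s, q s ∈ stdSimplex ℝ (Fin M)) :
    ∑ t, ∑ m, gradSum t (fun i => q ⟨t, i⟩ m) (Θ t m) ^ 2
      ≤ 2 * L * Q.total ^ 2 * risk (lossAt Q) (fun s => Θ (client Q s)) q := by
  have h1 : ∀ t m, gradSum t (fun i => q ⟨t, i⟩ m) (Θ t m) ^ 2
      ≤ Q.total * ∑ i, 2 * L * (q ⟨t, i⟩ m * lossAt Q ⟨t, i⟩ (Θ t m)) := by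
    intro t m
    unfold gradSum
    refine sq_sum_le_card_mul_sum_sq.trans ?_
    rw [Finset.card_univ, Fintype.card_fin]
    gcongr with i
    · exact_mod_cast n_le_total t
    · have h0 := (hq ⟨t, i⟩).1 m
      have h1 := simplex_le_one (hq ⟨t, i⟩) m
      have h2 := norm_gradient_sq_le (hl.diff ⟨t, i⟩) (hl.lip _) (hl.nonneg _) hl.one_le (Θ t m)
      rw [mul_pow]
      calc q ⟨t, i⟩ m ^ 2 * ‖gradient (Q.sampleLoss t i) (Θ t m)‖ ^ 2
          ≤ q ⟨t, i⟩ m * (2 * L * lossAt Q ⟨t, i⟩ (Θ t m)) := by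
            gcongr
            · nlinarith
            · exact h2
        _ = _ := by ring
  refine (Finset.sum_le_sum fun t _ => Finset.sum_le_sum fun m _ => h1 t m).trans ?_
  unfold risk
  rw [avg_sample, smul_eq_mul]
  rcases Nat.eq_zero_or_pos Q.total with h0 | h0
  · rw [h0]; simp
  · have h0 : (0 : ℝ) < Q.total := by exact_mod_cast h0
    refine le_of_eq ?_
    simp only [← Finset.mul_sum]
    rw [show (2 : ℝ) * L * Q.total ^ 2 * ((Q.total : ℝ)⁻¹ * ∑ t, ∑ i : Fin (Q.n t),
      ∑ m, q ⟨t, i⟩ m * lossAt Q ⟨t, i⟩ (Θ (client Q ⟨t, i⟩) m))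
      = Q.total * (2 * L * ∑ t, ∑ i : Fin (Q.n t),
      ∑ m, q ⟨t, i⟩ m * lossAt Q ⟨t, i⟩ (Θ (client Q ⟨t, i⟩) m)) by field_simp]
    congr 2
    exact Finset.sum_congr rfl fun t _ => Finset.sum_comm

lemma sub_localSGD (η : ℝ) (t : Fin T) (w : Fin (Q.n t) → ℝ) (b : ℕ → 𝓑.Batch t) (θ : Vec d)
    (J : ℕ) : θ - 𝓑.localSGD η t w b θ J = (Q.weight t * η) •
      ∑ j ∈ Finset.range J, 𝓑.batchGrad t w (𝓑.localSGD η t w b θ j) (b j) := by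
  induction J with
  | zero => simp [FedProblem.BatchScheme.localSGD]
  | succ J ih =>
    rw [Finset.sum_range_succ, smul_add, ← ih, FedProblem.BatchScheme.localSGD]
    abel

/-- Drift of the local iterates. -/
lemma norm_localSGD_sub_le (hl : SmoothLoss (lossAt Q) L) {t : Fin T} {w : Fin (Q.n t) → ℝ}
    (hw0 : ∀ i, 0 ≤ w i) (hw1 : ∀ i, w i ≤ 1) {η : ℝ} (hη : 0 ≤ η) {J : ℕ}
    (hJ : 2 * (η * J * L) ≤ 1) (b : ℕ → 𝓑.Batch t) (θ : Vec d) {j : ℕ} (hj : j ≤ J) :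
    ‖𝓑.localSGD η t w b θ j - θ‖ ≤ 2 * (η * j) * gradSum t w θ := by
  have hS := gradSum_nonneg hw0 θ
  have hL : (0 : ℝ) ≤ L := L.2
  induction j with
  | zero => simp [FedProblem.BatchScheme.localSGD]
  | succ j ih =>
    have ih := ih (by omega)
    set θj := 𝓑.localSGD η t w b θ j
    set s := gradSum t w θ
    have h1 : ‖𝓑.batchGrad t w θj (b j)‖ ≤ 2 * s := by
      have e1 := norm_batchGrad_sub_le (𝓑 := 𝓑) hl hw0 hw1 θ θj (b j)
      have e2 := norm_batchGrad_le (𝓑 := 𝓑) hw0 θ (b j)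
      have e3 := norm_le_norm_sub_add (𝓑.batchGrad t w θj (b j)) (𝓑.batchGrad t w θ (b j))
      have e4 : L * ‖θj - θ‖ ≤ 1 * s := by
        calc L * ‖θj - θ‖ ≤ L * (2 * (η * J) * s) := by
              gcongr
              refine ih.trans ?_
              gcongr
              omega
          _ = 2 * (η * J * L) * s := by ring
          _ ≤ 1 * s := by gcongr
      linarith
    have h2 : 𝓑.localSGD η t w b θ (j + 1) - θ
        = (θj - θ) - (Q.weight t * η) • 𝓑.batchGrad t w θj (b j) := by
      rw [FedProblem.BatchScheme.localSGD]; abel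
    rw [h2]
    refine (norm_sub_le _ _).trans ?_
    rw [norm_smul, Real.norm_of_nonneg (mul_nonneg (weight_nonneg t) hη)]
    have h3 : Q.weight t * η * ‖𝓑.batchGrad t w θj (b j)‖ ≤ 1 * η * (2 * s) := by
      gcongr
      exact weight_le_one t
    push_cast
    linarith

/-- The mean-zero part of the update of the mean iterate. -/
noncomputable def roundNoise (𝓑 : Q.BatchScheme) (J : ℕ) (Θ : Fin T → Params M d)
    (π : Fin T → Fin M → ℝ) (b : (t : Fin T) → Fin M → ℕ → 𝓑.Batch t) : Params M d :=
  WithLp.toLp 2 fun m => (J : ℝ)⁻¹ • ∑ t, ∑ j ∈ Finset.range J, Q.weight t •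
    (𝓑.batchGrad t (fun i => Q.eStep (Θ t) (π t) t i m) (Θ t m) (b t m j)
      - meanGrad t (fun i => Q.eStep (Θ t) (π t) t i m) (Θ t m))

/-- The part of the update of the mean iterate that is caused by the drift of the local
iterates. -/
noncomputable def roundDrift (𝓑 : Q.BatchScheme) (η : ℝ) (J : ℕ) (Θ : Fin T → Params M d)
    (π : Fin T → Fin M → ℝ) (b : (t : Fin T) → Fin M → ℕ → 𝓑.Batch t) : Params M d :=
  WithLp.toLp 2 fun m => (J : ℝ)⁻¹ • ∑ t, ∑ j ∈ Finset.range J, Q.weight t •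
    (𝓑.batchGrad t (fun i => Q.eStep (Θ t) (π t) t i m)
        (𝓑.localSGD η t (fun i => Q.eStep (Θ t) (π t) t i m) (b t m) (Θ t m) j) (b t m j)
      - 𝓑.batchGrad t (fun i => Q.eStep (Θ t) (π t) t i m) (Θ t m) (b t m j))

lemma average_sub_localRound (hn : ∀ t, 0 < Q.n t) (η : ℝ) {J : ℕ} (hJ : 1 ≤ J)
    (Θ : Fin T → Params M d) (π : Fin T → Fin M → ℝ)
    (b : (t : Fin T) → Fin M → ℕ → 𝓑.Batch t) :
    FedProblem.average Θ - FedProblem.average (fun t => 𝓑.localRound η J ⟨Θ, π⟩ t (b t))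
      = (η * J / T) • (gradVec (lossAt Q) (fun s => Θ (client Q s))
          (resp (client Q) (lossAt Q) Θ π) + roundNoise 𝓑 J Θ π b + roundDrift 𝓑 η J Θ π b) := by
  have hJ0 : (J : ℝ) ≠ 0 := by positivity
  unfold FedProblem.average
  rw [← smul_sub, ← Finset.sum_sub_distrib]
  ext m : 1
  have hG : (gradVec (lossAt Q) (fun s => Θ (client Q s))
      (resp (client Q) (lossAt Q) Θ π)) m = (J : ℝ)⁻¹ • ∑ t, ∑ j ∈ Finset.range J, Q.weight t •
        meanGrad t (fun i => Q.eStep (Θ t) (π t) t i m) (Θ t m) := by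
    unfold gradVec
    rw [avg_sample]
    simp only [Finset.sum_const, Finset.card_range]
    rw [← Finset.smul_sum, ← Nat.cast_smul_eq_nsmul ℝ, smul_smul, inv_mul_cancel₀ hJ0, one_smul]
    simp only [PiLp.smul_apply, WithLp.ofLp_sum, Finset.sum_apply]
    rw [Finset.smul_sum]
    refine Finset.sum_congr rfl fun t _ => ?_
    have h0 : (Q.n t : ℝ) ≠ 0 := by exact_mod_cast (hn t).ne'
    rw [meanGrad, smul_smul, FedProblem.weight, div_mul_eq_mul_div, mul_inv_cancel₀ h0, one_div]
    rfl
  simp only [PiLp.smul_apply, PiLp.add_apply, WithLp.ofLp_sum, Finset.sum_apply, PiLp.sub_apply]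
  rw [hG, roundNoise, roundDrift]
  simp only [WithLp.ofLp_toLp, FedProblem.BatchScheme.localRound]
  rw [← smul_add, ← smul_add, ← Finset.sum_add_distrib, ← Finset.sum_add_distrib, smul_smul,
    show η * J / T * (J : ℝ)⁻¹ = (T : ℝ)⁻¹ * η by field_simp, mul_smul]
  congr 1
  rw [Finset.smul_sum]
  refine Finset.sum_congr rfl fun t _ => ?_
  rw [← Finset.sum_add_distrib, ← Finset.sum_add_distrib, sub_localSGD, mul_comm, mul_smul,
    Finset.smul_sum]
  congr 1
  refine Finset.sum_congr rfl fun j _ => ?_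
  rw [← smul_add, ← smul_add]
  congr 1
  abel

lemma norm_sq_sum_clients_le {a B : Fin T → Fin M → ℝ} {c : ℝ} {J : ℕ} (hJ : 1 ≤ J)
    (y : (t : Fin T) → Fin M → ℕ → Vec d) (hy : ∀ t m, ∀ j < J, ‖y t m j‖ ≤ c * a t m)
    (hB : B = fun t m => a t m ^ 2) :
    ‖(WithLp.toLp 2 fun m => (J : ℝ)⁻¹ • ∑ t, ∑ j ∈ Finset.range J, Q.weight t • y t m j :
      Params M d)‖ ^ 2 ≤ T * c ^ 2 * ∑ t, ∑ m, B t m := by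
  subst hB
  have hJ0 : (0 : ℝ) < J := by positivity
  rw [params_norm_sq, Finset.sum_comm, Finset.mul_sum]
  refine Finset.sum_le_sum fun m _ => ?_
  rw [WithLp.ofLp_toLp]
  have h1 : ‖(J : ℝ)⁻¹ • ∑ t, ∑ j ∈ Finset.range J, Q.weight t • y t m j‖
      ≤ ∑ t, c * a t m := by
    rw [norm_smul, norm_inv, Real.norm_natCast, inv_mul_le_iff₀ hJ0, Finset.mul_sum]
    refine (norm_sum_le _ _).trans (Finset.sum_le_sum fun t _ => ?_)
    refine (norm_sum_le _ _).trans ?_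
    have : ∀ j ∈ Finset.range J, ‖Q.weight t • y t m j‖ ≤ c * a t m := fun j hj => by
      rw [norm_smul, Real.norm_of_nonneg (weight_nonneg t)]
      exact (mul_le_of_le_one_left (norm_nonneg _) (weight_le_one t)).trans
        (hy t m j (Finset.mem_range.1 hj))
    refine (Finset.sum_le_card_nsmul _ _ _ this).trans ?_
    simp
  calc _ ≤ (∑ t, c * a t m) ^ 2 := by gcongr
    _ ≤ T * ∑ t, (c * a t m) ^ 2 := by
      refine sq_sum_le_card_mul_sum_sq.trans ?_
      simp
    _ = _ := by
      rw [mul_assoc, Finset.mul_sum (a := c ^ 2)]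
      simp only [mul_pow]

section Bounds

variable {Θ : Fin T → Params M d} {π : Fin T → Fin M → ℝ}

lemma norm_roundNoise_sq_le (hl : SmoothLoss (lossAt Q) L)
    (hπ : ∀ t, π t ∈ stdSimplex ℝ (Fin M)) {J : ℕ} (hJ : 1 ≤ J)
    (b : (t : Fin T) → Fin M → ℕ → 𝓑.Batch t) :
    ‖roundNoise 𝓑 J Θ π b‖ ^ 2
      ≤ 8 * L * T * Q.total ^ 2 * freeEnergy (client Q) (lossAt Q) Θ π := by
  have hq := resp_mem (cl := client Q) (l := lossAt Q) (Θ := Θ) hπ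
  have h0 : ∀ t m (i : Fin (Q.n t)), 0 ≤ Q.eStep (Θ t) (π t) t i m := fun t m i =>
    (hq ⟨t, i⟩).1 m
  refine (norm_sq_sum_clients_le (Q := Q) (c := 2)
    (a := fun t m => gradSum t (fun i => Q.eStep (Θ t) (π t) t i m) (Θ t m)) hJ _
    (fun t m j _ => ?_) rfl).trans ?_
  · refine (norm_sub_le _ _).trans ?_
    have := norm_batchGrad_le (𝓑 := 𝓑) (h0 t m) (Θ t m) (b t m j)
    have := norm_meanGrad_le (h0 t m) (Θ t m)
    linarith
  · have h1 := sum_gradSum_sq_le hl (Θ := Θ) hq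
    have h2 := risk_resp_le (cl := client Q) (l := lossAt Q) (Θ := Θ) hπ
    calc _ ≤ T * 2 ^ 2 * (2 * L * Q.total ^ 2 * freeEnergy (client Q) (lossAt Q) Θ π) := by
          gcongr
          exact h1.trans (by gcongr)
      _ = _ := by ring

lemma norm_roundDrift_sq_le (hl : SmoothLoss (lossAt Q) L)
    (hπ : ∀ t, π t ∈ stdSimplex ℝ (Fin M)) {η : ℝ} (hη : 0 ≤ η) {J : ℕ} (hJ : 1 ≤ J)
    (hηJ : 2 * (η * J * L) ≤ 1) (b : (t : Fin T) → Fin M → ℕ → 𝓑.Batch t) :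
    ‖roundDrift 𝓑 η J Θ π b‖ ^ 2
      ≤ 8 * L ^ 3 * T * J ^ 2 * Q.total ^ 2 * (η ^ 2 * freeEnergy (client Q) (lossAt Q) Θ π) := by
  have hq := resp_mem (cl := client Q) (l := lossAt Q) (Θ := Θ) hπ
  have h0 : ∀ t m (i : Fin (Q.n t)), 0 ≤ Q.eStep (Θ t) (π t) t i m := fun t m i =>
    (hq ⟨t, i⟩).1 m
  have h1 : ∀ t m (i : Fin (Q.n t)), Q.eStep (Θ t) (π t) t i m ≤ 1 := fun t m i =>
    simplex_le_one (hq ⟨t, i⟩) m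
  have hL : (0 : ℝ) ≤ L := L.2
  refine (norm_sq_sum_clients_le (Q := Q) (c := L * (2 * (η * J)))
    (a := fun t m => gradSum t (fun i => Q.eStep (Θ t) (π t) t i m) (Θ t m)) hJ _
    (fun t m j hj => ?_) rfl).trans ?_
  · refine (norm_batchGrad_sub_le hl (h0 t m) (h1 t m) _ _ _).trans ?_
    rw [mul_assoc]
    gcongr
    refine (norm_localSGD_sub_le hl (h0 t m) (h1 t m) hη hηJ (b t m) (Θ t m) hj.le).trans ?_
    have := gradSum_nonneg (h0 t m) (Θ t m)
    gcongr
  · have h1 := sum_gradSum_sq_le hl (Θ := Θ) hq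
    have h2 := risk_resp_le (cl := client Q) (l := lossAt Q) (Θ := Θ) hπ
    calc _ ≤ T * (L * (2 * (η * J))) ^ 2
          * (2 * L * Q.total ^ 2 * freeEnergy (client Q) (lossAt Q) Θ π) := by
          gcongr
          exact h1.trans (by gcongr)
      _ = _ := by ring

lemma sum_norm_localRound_sub_sq_le (hl : SmoothLoss (lossAt Q) L)
    (hπ : ∀ t, π t ∈ stdSimplex ℝ (Fin M)) {η : ℝ} (hη : 0 ≤ η) {J : ℕ}
    (hηJ : 2 * (η * J * L) ≤ 1) (b : (t : Fin T) → Fin M → ℕ → 𝓑.Batch t) :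
    ∑ t, ‖𝓑.localRound η J ⟨Θ, π⟩ t (b t) - Θ t‖ ^ 2
      ≤ 8 * L * J ^ 2 * Q.total ^ 2 * (η ^ 2 * freeEnergy (client Q) (lossAt Q) Θ π) := by
  have hq := resp_mem (cl := client Q) (l := lossAt Q) (Θ := Θ) hπ
  have h0 : ∀ t m (i : Fin (Q.n t)), 0 ≤ Q.eStep (Θ t) (π t) t i m := fun t m i =>
    (hq ⟨t, i⟩).1 m
  have h1 : ∀ t m (i : Fin (Q.n t)), Q.eStep (Θ t) (π t) t i m ≤ 1 := fun t m i =>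
    simplex_le_one (hq ⟨t, i⟩) m
  have h2 := sum_gradSum_sq_le hl (Θ := Θ) hq
  have h3 := risk_resp_le (cl := client Q) (l := lossAt Q) (Θ := Θ) hπ
  calc ∑ t, ‖𝓑.localRound η J ⟨Θ, π⟩ t (b t) - Θ t‖ ^ 2
      ≤ ∑ t, ∑ m, (2 * (η * J)) ^ 2 * gradSum t (fun i => Q.eStep (Θ t) (π t) t i m) (Θ t m) ^ 2 := by
        refine Finset.sum_le_sum fun t _ => ?_
        rw [params_norm_sq]
        refine Finset.sum_le_sum fun m _ => ?_
        rw [← mul_pow]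
        refine pow_le_pow_left₀ (norm_nonneg _) ?_ 2
        exact norm_localSGD_sub_le hl (h0 t m) (h1 t m) hη hηJ (b t m) (Θ t m) le_rfl
    _ = (2 * (η * J)) ^ 2 * ∑ t, ∑ m, gradSum t (fun i => Q.eStep (Θ t) (π t) t i m) (Θ t m) ^ 2 := by
        simp only [Finset.mul_sum]
    _ ≤ (2 * (η * J)) ^ 2 * (2 * L * Q.total ^ 2 * freeEnergy (client Q) (lossAt Q) Θ π) := by
        gcongr
        exact h2.trans (by gcongr)
    _ = _ := by ring

end Bounds

end Round

/-! ### The gradient of the likelihood -/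

section Gradient

variable {𝒳 𝒴 𝒜 : Type*} [MeasurableSpace 𝒳] [MeasurableSpace 𝒴] {T M d : ℕ}
  {Q : FedProblem 𝒳 𝒴 𝒜 T M d} {L : ℝ≥0}

lemma hasFDerivAt_neg_log_evidence {p : Fin M → ℝ} (hp : p ∈ stdSimplex ℝ (Fin M))
    {f : Vec d → ℝ} (hf : Differentiable ℝ f) (Θ : Params M d) :
    HasFDerivAt (fun Θ : Params M d => -Real.log (evidence p fun m => f (Θ m)))
      (innerSL ℝ (WithLp.toLp 2 fun m => posterior p (fun m => f (Θ m)) m • gradient f (Θ m) :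
        Params M d)) Θ := by
  have h1 : ∀ m, HasFDerivAt (fun Θ : Params M d => p m * Real.exp (-f (Θ m)))
      (p m • (Real.exp (-f (Θ m)) • -((innerSL ℝ (gradient f (Θ m))).comp
        (PiLp.proj 2 (fun _ : Fin M => Vec d) m : Params M d →L[ℝ] Vec d)))) Θ := fun m => by
    have h2 : HasFDerivAt f (innerSL ℝ (gradient f (Θ m))) (Θ m) :=
      (hf (Θ m)).hasGradientAt.hasFDerivAt
    have h3 : HasFDerivAt (fun Θ : Params M d => Θ m)
        (PiLp.proj 2 (fun _ : Fin M => Vec d) m : Params M d →L[ℝ] Vec d) Θ :=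
      (PiLp.proj 2 (fun _ : Fin M => Vec d) m : Params M d →L[ℝ] Vec d).hasFDerivAt
    exact (((h2.comp Θ h3).neg).exp).const_mul (p m)
  have h2 := HasFDerivAt.fun_sum fun m (_ : m ∈ Finset.univ) => h1 m
  have hZ := evidence_pos hp fun m => f (Θ m)
  have h3 := (h2.log hZ.ne').neg
  refine h3.congr_fderiv ?_
  ext w
  simp only [neg_apply, smul_apply, sum_apply,
    ContinuousLinearMap.comp_apply, innerSL_apply_apply, smul_eq_mul,
    PiLp.inner_apply, inner_smul_left, conj_trivial, posterior, PiLp.proj_apply]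
  rw [Finset.mul_sum, ← Finset.sum_neg_distrib]
  refine Finset.sum_congr rfl fun m _ => ?_
  have : (∑ m, p m * Real.exp (-f (Θ m))) = evidence p fun m => f (Θ m) := rfl
  rw [this]
  ring

lemma negLogLik_eq (hreg : Q.Regular) {π : Fin T → Fin M → ℝ}
    (hπ : ∀ t, π t ∈ stdSimplex ℝ (Fin M)) (Θ : Params M d) :
    Q.negLogLik Θ π = freeEnergy (client Q) (lossAt Q) (fun _ => Θ) π
      - avg fun s : Sample Q => Real.log (Q.margDensity (Q.data s.1 s.2).1) + Q.c := by
  unfold FedProblem.negLogLik freeEnergy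
  rw [← avg_sub, avg_sample, smul_eq_mul, ← mul_neg, ← Finset.sum_neg_distrib]
  congr 1
  refine Finset.sum_congr rfl fun t _ => ?_
  rw [← Finset.sum_neg_distrib]
  refine Finset.sum_congr rfl fun i _ => ?_
  have h1 : ∑ m, π t m * Q.modelDensity (Θ m) (Q.data t i).1 (Q.data t i).2
      = (Q.margDensity (Q.data t i).1 * Real.exp Q.c)
        * evidence (π t) fun m => lossAt Q ⟨t, i⟩ (Θ m) := by
    unfold evidence
    rw [Finset.mul_sum]
    refine Finset.sum_congr rfl fun m _ => ?_
    rw [FedProblem.modelDensity, sub_eq_add_neg, Real.exp_add]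
    simp only [lossAt, FedProblem.sampleLoss]
    ring
  have h2 : (0 : ℝ) < Q.margDensity (Q.data t i).1 := by exact_mod_cast hreg.support t i
  rw [h1, Real.log_mul (by positivity) (evidence_pos (hπ t) _).ne', Real.log_mul h2.ne'
    (Real.exp_pos _).ne', Real.log_exp]
  simp only [client]
  ring

lemma gradient_negLogLik (hreg : Q.Regular) (hl : SmoothLoss (lossAt Q) L)
    {π : Fin T → Fin M → ℝ} (hπ : ∀ t, π t ∈ stdSimplex ℝ (Fin M)) (x : Params M d) :
    gradient (fun Θ => Q.negLogLik Θ π) x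
      = gradVec (lossAt Q) (fun _ => x) (resp (client Q) (lossAt Q) (fun _ => x) π) := by
  have h1 : HasFDerivAt (fun Θ => freeEnergy (client Q) (lossAt Q) (fun _ => Θ) π)
      (innerSL ℝ (gradVec (lossAt Q) (fun _ => x)
        (resp (client Q) (lossAt Q) (fun _ => x) π))) x := by
    unfold freeEnergy avg
    have := (HasFDerivAt.fun_sum fun s (_ : s ∈ (Finset.univ : Finset (Sample Q))) =>
      hasFDerivAt_neg_log_evidence (hπ (client Q s)) (hl.diff s) x).const_smul
        (Fintype.card (Sample Q) : ℝ)⁻¹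
    refine this.congr_fderiv ?_
    simp only [gradVec, avg, map_smul, map_sum]
    rfl
  have h2 : HasGradientAt (fun Θ => Q.negLogLik Θ π) (gradVec (lossAt Q) (fun _ => x)
        (resp (client Q) (lossAt Q) (fun _ => x) π)) x := by
    simp_rw [negLogLik_eq hreg hπ]
    exact hasGradientAt_iff_hasFDerivAt.2 (h1.sub_const _)
  exact h2.gradient

end Gradient

/-! ### From rounds to blocks of rounds -/

/-- One-round bounds along a trajectory, for the Lyapunov function `Λ`, the part `X` of it that
compares weights, the free energy `F`, the consensus distance `D` and the noise `N`; `κ` is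
proportional to the step size. The parameter `a` of `energy` is free, since one round has to be
compared both with a fixed factor and with factors close to `1`. -/
structure RoundBounds (C κ : ℝ) (Λ X F D N : ℕ → ℝ) : Prop where
  X_nonneg : ∀ k, 0 ≤ X k
  X_le : ∀ k, X k ≤ Λ k
  F_nonneg : ∀ k, 0 ≤ F k
  D_nonneg : ∀ k, 0 ≤ D k
  lyap : ∀ k, Λ (k + 1) ≤ Λ k + N k + C * (κ ^ 2 * F k + κ ^ 2 * Λ k + D k)
  noise : ∀ k, N k ^ 2 ≤ C * κ ^ 2 * (Λ k * F k)
  energy : ∀ k a, 0 < a → a ≤ 1 → F (k + 1) ≤ (1 + a) * F k + C / a * (D k + κ ^ 2 * F k)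
  kl : ∀ k, X (k + 1) ≤ X k + κ * (C * (Λ k + D k) - F k)
  energy_le : ∀ k, κ * F k ≤ C * (Λ k + D k)
  spread : ∀ k, D (k + 1) ≤ C * (D k + κ ^ 2 * F k)

/-- Bounds for the transition from the start of a block of rounds, `(Λ, X, F, D)`, to its end,
`(Λ', X', F', D')`; `N` is the accumulated noise and `ρ` the contraction by mixing. -/
structure BlockBounds (C κ Λ X F D N ρ Λ' X' F' D' : ℝ) : Prop where
  X_nonneg : 0 ≤ X
  X_le : X ≤ Λ
  F_nonneg : 0 ≤ F
  D_nonneg : 0 ≤ D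
  X_nonneg' : 0 ≤ X'
  X_le' : X' ≤ Λ'
  F_nonneg' : 0 ≤ F'
  D_nonneg' : 0 ≤ D'
  rho_nonneg : 0 ≤ ρ
  rho_le : ρ ≤ 1
  lyap : Λ' ≤ Λ + N + C * (κ ^ 2 * F + κ ^ 2 * Λ + D)
  noise : N ^ 2 ≤ C * κ ^ 2 * ((Λ + D) * (F + D))
  energy : F' ≤ 4 * F + C * D
  energy_fine : F' ≤ (1 + C * κ) * F + C / κ * D
  kl : X' ≤ X + κ * (C * (Λ + D) - F)
  energy_le : κ * F ≤ C * (Λ + D)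
  spread : D' ≤ 2 * ρ * D + C * κ ^ 2 * (F + D)

lemma one_add_pow_le {κ : ℝ} (h0 : 0 ≤ κ) (h1 : κ ≤ 1) (i : ℕ) :
    (1 + κ) ^ i ≤ 1 + (2 ^ i - 1) * κ := by
  induction i with
  | zero => simp
  | succ i ih =>
    have h2 : (1 : ℝ) ≤ 2 ^ i := one_le_pow₀ (by norm_num)
    have h3 : (2 ^ i - 1) * κ ^ 2 ≤ (2 ^ i - 1) * κ := by
      apply mul_le_mul_of_nonneg_left _ (by linarith); nlinarith
    calc (1 + κ) ^ (i + 1) = (1 + κ) ^ i * (1 + κ) := pow_succ _ _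
      _ ≤ (1 + (2 ^ i - 1) * κ) * (1 + κ) := by gcongr
      _ ≤ _ := by rw [pow_succ]; linarith

lemma one_add_inv_pow_le {R : ℕ} : (1 + 1 / (R : ℝ)) ^ R ≤ 3 := by
  rcases Nat.eq_zero_or_pos R with rfl | h
  · norm_num
  have hR : (R : ℝ) ≠ 0 := by positivity
  calc (1 + 1 / (R : ℝ)) ^ R ≤ Real.exp (1 / R) ^ R := by
        gcongr; rw [add_comm]; exact Real.add_one_le_exp _
    _ = Real.exp 1 := by rw [← Real.exp_nat_mul]; congr 1; field_simp
    _ ≤ 3 := by linarith [Real.exp_one_lt_d9]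

namespace RoundBounds

variable {C κ : ℝ} {Λ X F D N : ℕ → ℝ}

lemma lyap_nonneg (h : RoundBounds C κ Λ X F D N) (k : ℕ) : 0 ≤ Λ k :=
  (h.X_nonneg k).trans (h.X_le k)

lemma spread_energy_le (h : RoundBounds C κ Λ X F D N) (hC : 1 ≤ C)
    (hκ1 : κ ^ 2 ≤ 1) (b i : ℕ) :
    D (b + i) + κ ^ 2 * F (b + i) ≤ (2 * C + 2) ^ i * (D b + κ ^ 2 * F b) := by
  induction i with
  | zero => simp
  | succ i ih =>
    have h1 := h.spread (b + i)
    have h2 := h.energy (b + i) 1 one_pos le_rfl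
    set e := D (b + i) + κ ^ 2 * F (b + i) with he
    have hF := h.F_nonneg (b + i)
    have hD := h.D_nonneg (b + i)
    have he0 : 0 ≤ e := by positivity
    have h3 : κ ^ 2 * F (b + i + 1) ≤ 2 * (κ ^ 2 * F (b + i)) + 1 * (C * e) := by
      calc κ ^ 2 * F (b + i + 1) ≤ κ ^ 2 * ((1 + 1) * F (b + i) + C / 1 * e) := by gcongr
        _ = 2 * (κ ^ 2 * F (b + i)) + κ ^ 2 * (C * e) := by ring
        _ ≤ _ := by gcongr
    calc D (b + (i + 1)) + κ ^ 2 * F (b + (i + 1)) ≤ (2 * C + 2) * e := by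
          rw [← add_assoc]; linarith
      _ ≤ (2 * C + 2) * ((2 * C + 2) ^ i * (D b + κ ^ 2 * F b)) := by gcongr
      _ = _ := by ring

lemma energy_iterate_le (h : RoundBounds C κ Λ X F D N) (hC : 1 ≤ C)
    (hκ1 : κ ^ 2 ≤ 1) {a : ℝ} (ha0 : 0 < a) (ha1 : a ≤ 1) (b i : ℕ) :
    F (b + i) ≤ (1 + a) ^ i * F b + C / a * ((2 * C + 2) ^ i * (D b + κ ^ 2 * F b)) := by
  have hF := h.F_nonneg b
  have hD := h.D_nonneg b
  induction i with
  | zero => simp; positivity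
  | succ i ih =>
    have h1 := h.energy (b + i) a ha0 ha1
    have h2 := h.spread_energy_le hC hκ1 b i
    set e := D b + κ ^ 2 * F b with he
    have he0 : 0 ≤ e := by positivity
    have hB : 0 ≤ C / a * ((2 * C + 2) ^ i * e) := by positivity
    calc F (b + (i + 1)) ≤ (1 + a) * ((1 + a) ^ i * F b + C / a * ((2 * C + 2) ^ i * e))
          + C / a * ((2 * C + 2) ^ i * e) := by
          rw [← add_assoc]
          refine h1.trans ?_
          gcongr
      _ = (1 + a) ^ (i + 1) * F b + (2 + a) * (C / a * ((2 * C + 2) ^ i * e)) := by ring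
      _ ≤ (1 + a) ^ (i + 1) * F b + (2 * C + 2) * (C / a * ((2 * C + 2) ^ i * e)) := by
          exact add_le_add_right (mul_le_mul_of_nonneg_right (by linarith only [ha1, hC]) hB) _
      _ = _ := by ring

lemma lyap_spread_le (h : RoundBounds C κ Λ X F D N) (hC : 1 ≤ C) (hκ0 : 0 ≤ κ) (hκ1 : κ ≤ 1)
    (b i : ℕ) : Λ (b + i) + D (b + i) ≤ (10 * C ^ 2) ^ i * (Λ b + D b) := by
  induction i with
  | zero => simp
  | succ i ih =>
    have h1 := h.lyap (b + i)
    have h2 := h.noise (b + i)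
    have h3 := h.energy_le (b + i)
    have h4 := h.spread (b + i)
    have hΛ := h.lyap_nonneg (b + i)
    have hF := h.F_nonneg (b + i)
    have hD := h.D_nonneg (b + i)
    set y := Λ (b + i) + D (b + i) with hy
    have hy0 : 0 ≤ y := by positivity
    have hκ2 : κ ^ 2 ≤ 1 := pow_le_one₀ hκ0 hκ1
    have hN : N (b + i) ≤ C * y := by
      apply le_of_sq_le_sq _ (by positivity)
      calc N (b + i) ^ 2 ≤ C * κ * (Λ (b + i) * (κ * F (b + i))) := h2.trans_eq (by ring)
        _ ≤ C * 1 * (y * (C * y)) := by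
          gcongr
          linarith
        _ = _ := by ring
    have e1 : κ ^ 2 * F (b + i) ≤ C * y := by
      calc κ ^ 2 * F (b + i) = κ * (κ * F (b + i)) := by ring
        _ ≤ 1 * (C * y) := by gcongr
        _ = _ := one_mul _
    have e2 : κ ^ 2 * Λ (b + i) ≤ y := by
      calc κ ^ 2 * Λ (b + i) ≤ 1 * y := by gcongr; linarith
        _ = _ := one_mul _
    have e3 : D (b + i) ≤ y := by linarith
    have e4 : κ ^ 2 * F (b + i) + κ ^ 2 * Λ (b + i) + D (b + i) ≤ C * y + 2 * y := by linarith
    have e5 : C * (κ ^ 2 * F (b + i) + κ ^ 2 * Λ (b + i) + D (b + i)) ≤ C * (C * y + 2 * y) := by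
      gcongr
    have e6 : C * (D (b + i) + κ ^ 2 * F (b + i)) ≤ C * (y + C * y) := by gcongr
    have e7 : C * y ≤ C ^ 2 * y := by gcongr; nlinarith
    have e8 : y ≤ C ^ 2 * y := le_mul_of_one_le_left hy0 (one_le_pow₀ hC)
    calc Λ (b + (i + 1)) + D (b + (i + 1)) ≤ 10 * C ^ 2 * y := by
          rw [← add_assoc]; linarith
      _ ≤ 10 * C ^ 2 * ((10 * C ^ 2) ^ i * (Λ b + D b)) := by gcongr
      _ = _ := by ring

end RoundBounds

/-- A constant that dominates the growth of all the quantities of `RoundBounds` in `R` rounds. -/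
noncomputable def blockConst (C : ℝ) (R : ℕ) : ℝ :=
  4 * C ^ 2 * (R + 1) ^ 2 * (2 * C + 2) ^ R * (10 * C ^ 2) ^ R

section Block

variable {C κ : ℝ} {Λ X F D N : ℕ → ℝ} {R : ℕ}

lemma le_blockConst (hC : 1 ≤ C) (R : ℕ) {x y z w : ℝ} (hy0 : 0 ≤ y)
    (hz0 : 0 ≤ z) (hw0 : 0 ≤ w) (hx : x ≤ 4 * C ^ 2) (hy : y ≤ (R + 1) ^ 2)
    (hz : z ≤ (2 * C + 2) ^ R) (hw : w ≤ (10 * C ^ 2) ^ R) : x * y * z * w ≤ blockConst C R := by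
  unfold blockConst
  gcongr

lemma one_le_pow_blockBase (hC : 1 ≤ C) (R : ℕ) :
    1 ≤ (2 * C + 2) ^ R ∧ 1 ≤ (10 * C ^ 2) ^ R ∧ (1 : ℝ) ≤ (R + 1) ^ 2 ∧ (R : ℝ) ≤ (R + 1) ^ 2 ∧
      C ≤ C ^ 2 ∧ 1 ≤ C ^ 2 := by
  have hR : (0 : ℝ) ≤ R := by positivity
  have : C ≤ C ^ 2 := by nlinarith
  exact ⟨one_le_pow₀ (by linarith), one_le_pow₀ (by linarith), by nlinarith, by nlinarith, this,
    by linarith⟩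

lemma one_le_blockConst (hC : 1 ≤ C) (R : ℕ) : 1 ≤ blockConst C R := by
  obtain ⟨h1, h2, h3, h4, h5, h6⟩ := one_le_pow_blockBase hC R
  simpa using le_blockConst hC R (x := 1) (y := 1) (z := 1) (w := 1) zero_le_one
    zero_le_one zero_le_one (by linarith) h3 h1 h2

/-- Inside a block, everything is controlled by the start of the block. -/
lemma RoundBounds.inside (h : RoundBounds C κ Λ X F D N) (hC : 1 ≤ C) (hκ0 : 0 ≤ κ) (hκ1 : κ ≤ 1)
    (b : ℕ) {i : ℕ} (hi : i ≤ R) :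
    F (b + i) ≤ blockConst C R * (F b + D b)
      ∧ D (b + i) + κ ^ 2 * F (b + i) ≤ blockConst C R * (D b + κ ^ 2 * F b)
      ∧ Λ (b + i) ≤ blockConst C R * (Λ b + D b) := by
  obtain ⟨h1, h2, h3, h4, h5, h6⟩ := one_le_pow_blockBase hC R
  have hF := h.F_nonneg b
  have hD := h.D_nonneg b
  have hΛ := h.lyap_nonneg b
  have hκ2 : κ ^ 2 ≤ 1 := pow_le_one₀ hκ0 hκ1
  have hB : (1 : ℝ) ≤ 2 * C + 2 := by linarith
  have hB' : (1 : ℝ) ≤ 10 * C ^ 2 := by linarith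
  have i1 : (2 * C + 2) ^ i ≤ (2 * C + 2) ^ R := pow_le_pow_right₀ hB hi
  have i2 : (10 * C ^ 2) ^ i ≤ (10 * C ^ 2) ^ R := pow_le_pow_right₀ hB' hi
  have i3 : (1 + 1 : ℝ) ^ i ≤ (2 * C + 2) ^ R :=
    (pow_le_pow_left₀ (by norm_num) (by linarith) i).trans i1
  refine ⟨?_, ?_, ?_⟩
  · refine (h.energy_iterate_le hC hκ2 one_pos le_rfl b i).trans ?_
    have k1 : (2 * C) * 1 * (2 * C + 2) ^ R * 1 ≤ blockConst C R :=
      le_blockConst hC R zero_le_one (by positivity) zero_le_one (by linarith) h3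
        le_rfl h2
    calc (1 + 1) ^ i * F b + C / 1 * ((2 * C + 2) ^ i * (D b + κ ^ 2 * F b))
        ≤ (2 * C + 2) ^ R * F b + C / 1 * ((2 * C + 2) ^ R * (D b + 1 * F b)) := by gcongr
      _ ≤ C * (2 * C + 2) ^ R * F b + C / 1 * ((2 * C + 2) ^ R * (D b + 1 * F b)) := by
          gcongr
          exact le_mul_of_one_le_left (by positivity) hC
      _ ≤ (2 * C * 1 * (2 * C + 2) ^ R * 1) * (F b + D b) := by
          have : 0 ≤ C * (2 * C + 2) ^ R * D b := by positivity
          linarith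
      _ ≤ _ := by gcongr
  · refine (h.spread_energy_le hC hκ2 b i).trans ?_
    have k1 : 1 * 1 * (2 * C + 2) ^ R * 1 ≤ blockConst C R :=
      le_blockConst hC R zero_le_one (by positivity) zero_le_one (by linarith) h3
        le_rfl h2
    gcongr
    linarith
  · have := h.lyap_spread_le hC hκ0 hκ1 b i
    have hD' := h.D_nonneg (b + i)
    have k1 : 1 * 1 * 1 * (10 * C ^ 2) ^ R ≤ blockConst C R :=
      le_blockConst hC R zero_le_one (by positivity) (by positivity) (by linarith) h3
        h1 le_rfl
    calc Λ (b + i) ≤ (10 * C ^ 2) ^ i * (Λ b + D b) := by linarith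
      _ ≤ _ := by gcongr; linarith

set_option maxHeartbeats 1000000 in
/-- Bounds for a block of `R` rounds. -/
lemma RoundBounds.block (h : RoundBounds C κ Λ X F D N) (hC : 1 ≤ C) (hR : 1 ≤ R) (hκ0 : 0 < κ)
    (hκ : κ * blockConst C R ≤ 1) (b : ℕ) {ρ : ℝ} (hρ0 : 0 ≤ ρ) (hρ1 : ρ ≤ 1)
    (hmix : D (b + R) ≤ 2 * ρ * D b + C * κ ^ 2 * ∑ i ∈ Finset.range R, F (b + i)) :
    BlockBounds (2 * blockConst C R ^ 2 * C * R ^ 2) κ (Λ b) (X b) (F b) (D b)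
      (∑ i ∈ Finset.range R, N (b + i)) ρ (Λ (b + R)) (X (b + R)) (F (b + R)) (D (b + R)) := by
  have hA1 := one_le_blockConst hC R
  have hκ1 : κ ≤ 1 := by nlinarith
  have hκ2 : κ ^ 2 ≤ 1 := pow_le_one₀ hκ0.le hκ1
  have hin := fun i (hi : i ≤ R) => h.inside hC hκ0.le hκ1 b hi
  obtain ⟨h1, h2, h3, h4, h5, h6⟩ := one_le_pow_blockBase hC R
  have hF := h.F_nonneg b
  have hD := h.D_nonneg b
  have hΛ := h.lyap_nonneg b
  have hR1 : (1 : ℝ) ≤ R := by exact_mod_cast hR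
  have hR2 : (R : ℝ) ≤ R ^ 2 := by nlinarith
  set A := blockConst C R with hA
  have hAA : A ≤ A ^ 2 := by nlinarith
  set C₁ := 2 * A ^ 2 * C * R ^ 2 with hC1
  have hAC : 2 * A * C * R ≤ C₁ := by rw [hC1]; gcongr
  have hCR : C * R ≤ C₁ := by
    refine le_trans ?_ hAC
    nlinarith [mul_pos (show 0 < C by linarith) (show (0 : ℝ) < R by linarith)]
  have hC1' : C ≤ C₁ := le_trans (by nlinarith) hCR
  have hR3 : (1 : ℝ) ≤ R ^ 2 := by linarith
  refine
    { X_nonneg := h.X_nonneg b, X_le := h.X_le b, F_nonneg := hF, D_nonneg := hD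
      X_nonneg' := h.X_nonneg _, X_le' := h.X_le _, F_nonneg' := h.F_nonneg _
      D_nonneg' := h.D_nonneg _, rho_nonneg := hρ0, rho_le := hρ1
      lyap := ?_, noise := ?_, energy := ?_, energy_fine := ?_, kl := ?_, energy_le := ?_
      spread := ?_ }
  · have key : ∀ i ≤ R, Λ (b + i) ≤ Λ b + ∑ j ∈ Finset.range i, N (b + j)
        + i * (2 * A * C * (κ ^ 2 * F b + κ ^ 2 * Λ b + D b)) := by
      intro i
      induction i with
      | zero => simp
      | succ i ih =>
        intro hi
        have ih := ih (by omega)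
        have e1 := h.lyap (b + i)
        obtain ⟨-, e2, e3⟩ := hin i (by omega)
        have e4 : κ ^ 2 * Λ (b + i) ≤ A * (κ ^ 2 * Λ b + D b) := by
          calc κ ^ 2 * Λ (b + i) ≤ κ ^ 2 * (A * (Λ b + D b)) := by gcongr
            _ = A * (κ ^ 2 * Λ b + κ ^ 2 * D b) := by ring
            _ ≤ A * (κ ^ 2 * Λ b + 1 * D b) := by gcongr
            _ = _ := by ring
        have e5 : κ ^ 2 * F (b + i) + κ ^ 2 * Λ (b + i) + D (b + i)
            ≤ 2 * A * (κ ^ 2 * F b + κ ^ 2 * Λ b + D b) := by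
          have : 0 ≤ A * (κ ^ 2 * F b) := by positivity
          have : 0 ≤ A * (κ ^ 2 * Λ b) := by positivity
          linarith
        have e6 : C * (κ ^ 2 * F (b + i) + κ ^ 2 * Λ (b + i) + D (b + i))
            ≤ C * (2 * A * (κ ^ 2 * F b + κ ^ 2 * Λ b + D b)) := by gcongr
        rw [Finset.sum_range_succ, ← add_assoc]
        push_cast
        linarith
    refine (key R le_rfl).trans (add_le_add_right ?_ _)
    calc R * (2 * A * C * (κ ^ 2 * F b + κ ^ 2 * Λ b + D b))
        = 2 * A * C * R * (κ ^ 2 * F b + κ ^ 2 * Λ b + D b) := by ring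
      _ ≤ _ := by gcongr
  · calc (∑ i ∈ Finset.range R, N (b + i)) ^ 2
        ≤ R * ∑ i ∈ Finset.range R, N (b + i) ^ 2 := by
          simpa using sq_sum_le_card_mul_sum_sq (s := Finset.range R) (f := fun i => N (b + i))
      _ ≤ R * ∑ i ∈ Finset.range R, C * κ ^ 2 * ((A * (Λ b + D b)) * (A * (F b + D b))) := by
          gcongr with i hi
          obtain ⟨e1, -, e3⟩ := hin i (Finset.mem_range.1 hi).le
          refine (h.noise (b + i)).trans ?_
          have := h.F_nonneg (b + i)
          gcongr
      _ = A ^ 2 * C * R ^ 2 * (κ ^ 2 * ((Λ b + D b) * (F b + D b))) := by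
          simp; ring
      _ ≤ C₁ * (κ ^ 2 * ((Λ b + D b) * (F b + D b))) := by
          gcongr
          rw [hC1]
          have : 0 ≤ A ^ 2 * C * R ^ 2 := by positivity
          linarith
      _ = _ := by ring
  · have hRp : (0 : ℝ) < R := by linarith
    have e1 := h.energy_iterate_le hC hκ2 (a := 1 / R) (by positivity)
      (by rw [div_le_one hRp]; exact hR1) b R
    have k1 : C * R * (2 * C + 2) ^ R * 1 ≤ A :=
      le_blockConst hC R (by positivity) (by positivity) zero_le_one (by linarith) h4
        le_rfl h2
    have e2 : C / (1 / R) * ((2 * C + 2) ^ R * (D b + κ ^ 2 * F b)) ≤ A * (D b + κ ^ 2 * F b) := by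
      calc _ = (C * R * (2 * C + 2) ^ R * 1) * (D b + κ ^ 2 * F b) := by field_simp
        _ ≤ _ := by gcongr
    have e3 : A * κ ^ 2 ≤ 1 := by nlinarith
    have e4 : A * (κ ^ 2 * F b) ≤ 1 * F b := by rw [← mul_assoc]; gcongr
    have e5 : (1 + 1 / (R : ℝ)) ^ R * F b ≤ 3 * F b := by gcongr; exact one_add_inv_pow_le
    have e6 : A * D b ≤ C₁ * D b := by
      gcongr
      refine le_trans ?_ hAC
      nlinarith [mul_pos (show 0 < C by linarith) hRp, mul_le_mul hC hR1 zero_le_one (by linarith)]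
    linarith
  · have e1 := h.energy_iterate_le hC hκ2 hκ0 hκ1 b R
    have k1 : C * 1 * (2 * C + 2) ^ R * 1 ≤ A :=
      le_blockConst hC R zero_le_one (by positivity) zero_le_one (by linarith) h3
        le_rfl h2
    have e2 : C / κ * ((2 * C + 2) ^ R * (D b + κ ^ 2 * F b)) ≤ A / κ * D b + A * κ * F b := by
      calc _ = (C * 1 * (2 * C + 2) ^ R * 1) * (1 / κ * D b + κ * F b) := by field_simp
        _ ≤ A * (1 / κ * D b + κ * F b) := by gcongr
        _ = _ := by ring
    have e3 := mul_le_mul_of_nonneg_right (one_add_pow_le hκ0.le hκ1 R) hF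
    have k2 : 1 * 1 * (2 * C + 2) ^ R * 1 ≤ A :=
      le_blockConst hC R zero_le_one (by positivity) zero_le_one (by linarith) h3
        le_rfl h2
    have e4 : (2 : ℝ) ^ R ≤ (2 * C + 2) ^ R := pow_le_pow_left₀ (by norm_num) (by linarith) R
    have hA2 : 2 * A ≤ C₁ := by
      refine le_trans ?_ hAC
      nlinarith [mul_pos (show 0 < C by linarith) (show (0 : ℝ) < R by linarith),
        mul_le_mul hC hR1 zero_le_one (by linarith)]
    have e5 : (2 ^ R - 1) * κ * F b ≤ A * κ * F b := by gcongr; linarith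
    have e6 : 2 * A * κ * F b ≤ C₁ * κ * F b := by gcongr
    have e7 : A / κ * D b ≤ C₁ / κ * D b := by gcongr; linarith
    linarith
  · have key : ∀ i ≤ R, 1 ≤ i → X (b + i) ≤ X b + κ * (i * (2 * A * C * (Λ b + D b)) - F b) := by
      intro i
      induction i with
      | zero => intro _ h0; omega
      | succ i ih =>
        intro hi _
        have e1 := h.kl (b + i)
        obtain ⟨-, e2, e3⟩ := hin i (by omega)
        have hFi := h.F_nonneg (b + i)
        have e4 : D (b + i) ≤ (10 * C ^ 2) ^ R * (Λ b + D b) := by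
          have e5 := h.lyap_spread_le hC hκ0.le hκ1 b i
          have e6 := h.lyap_nonneg (b + i)
          have : (10 * C ^ 2) ^ i * (Λ b + D b) ≤ (10 * C ^ 2) ^ R * (Λ b + D b) := by
            gcongr
            · linarith
            · omega
          linarith
        have k1 : 1 * 1 * 1 * (10 * C ^ 2) ^ R ≤ A :=
          le_blockConst hC R zero_le_one (by positivity) (by positivity)
            (by linarith) h3 h1 le_rfl
        have e5 : (10 * C ^ 2) ^ R * (Λ b + D b) ≤ A * (Λ b + D b) := by gcongr; linarith
        have e6 : C * (Λ (b + i) + D (b + i)) ≤ 2 * A * C * (Λ b + D b) := by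
          calc C * (Λ (b + i) + D (b + i)) ≤ C * (A * (Λ b + D b) + A * (Λ b + D b)) := by
                gcongr; linarith
            _ = _ := by ring
        have e7 := mul_le_mul_of_nonneg_left e6 hκ0.le
        rw [← add_assoc]
        rcases Nat.eq_zero_or_pos i with rfl | hi0
        · simp only [add_zero, zero_add, Nat.cast_one] at *
          linarith
        · have ih := ih (by omega) hi0
          have := mul_nonneg hκ0.le hFi
          push_cast
          linarith
    refine (key R le_rfl hR).trans ?_
    refine add_le_add_right (mul_le_mul_of_nonneg_left (sub_le_sub_right ?_ _) hκ0.le) _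
    calc R * (2 * A * C * (Λ b + D b)) = 2 * A * C * R * (Λ b + D b) := by ring
      _ ≤ _ := by gcongr
  · exact (h.energy_le b).trans (by gcongr)
  · refine hmix.trans ?_
    gcongr 2 * ρ * D b + ?_
    calc C * κ ^ 2 * ∑ i ∈ Finset.range R, F (b + i)
        ≤ C * κ ^ 2 * ∑ i ∈ Finset.range R, A * (F b + D b) := by
          gcongr with i hi
          exact (hin i (Finset.mem_range.1 hi).le).1
      _ = A * C * R * (κ ^ 2 * (F b + D b)) := by simp; ring
      _ ≤ C₁ * (κ ^ 2 * (F b + D b)) := by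
          gcongr
          have : 0 ≤ A * C * R := by positivity
          linarith
      _ = _ := by ring

end Block

/-! ### The potential of a block -/

/-- Potential of second degree in `(Λ, X, F, D)`, and so of fourth degree in the parameters, that
decreases in expectation over a block. The powers of `C` order the terms in such a way that every
cross term in the recursion of one of them is absorbed by the decrease of another. -/
noncomputable def potential (C κ Λ X F D : ℝ) : ℝ :=
  28 * C ^ 3 * ((Λ + 52 * C ^ 3 * (κ * X)) ^ 2 + 16 * C ^ 2 * ((Λ + 52 * C ^ 3 * (κ * X)) * D)
    + 200 * C ^ 3 * D ^ 2) + 6 * C * (κ * (F * X)) + F * D + D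

/-- Coefficient of the noise in the increment of `potential`. -/
noncomputable def potentialNoise (C κ Λ X F D : ℝ) : ℝ :=
  28 * C ^ 3 * (2 * ((1 + C * (1 + 52 * C ^ 3) * κ ^ 2) * (Λ + 52 * C ^ 3 * (κ * X)) + 2 * C * D
    - (52 * C ^ 3 - C) * κ ^ 2 * F))

/-- Coefficient of the deviation of the contraction factor in the increment of `potential`. -/
noncomputable def potentialMix (C κ Λ X F D : ℝ) : ℝ :=
  28 * C ^ 3 * (16 * C ^ 2 * (6 * ((Λ + 52 * C ^ 3 * (κ * X)) * D)) + 200 * C ^ 3 * (8 * D ^ 2))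
    + 8 * (F * D) + 2 * D

section Potential

variable {C κ Λ X F D N ρ Λ' X' F' D' : ℝ}

lemma pow_mul_le_of_small (hC : 1 ≤ C) (hκ0 : 0 < κ) (hκ : 2000 * C ^ 7 * κ ≤ 1) {j : ℕ}
    (hj : j ≤ 7) : C ^ j * κ ≤ 1 / 2000 := by
  have : C ^ j * κ ≤ C ^ 7 * κ := by gcongr
  linarith

lemma kappa_sq_mul_le {H : ℝ} (hκ0 : 0 < κ) (hD0 : 0 ≤ D) (hκF : κ * F ≤ C * (H + D)) :
    κ ^ 2 * (F * D) ≤ C * κ * (H * D + D ^ 2) := by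
  calc κ ^ 2 * (F * D) = κ * (D * (κ * F)) := by ring
    _ ≤ κ * (D * (C * (H + D))) := by gcongr
    _ = _ := by ring

/-- Recursion of the square of `H`, where `N` is the noise. -/
lemma sq_le_of_block {H H' ε γ : ℝ} (hC : 1 ≤ C) (hκ0 : 0 < κ) (hκ : 2000 * C ^ 7 * κ ≤ 1)
    (hH0 : 0 ≤ H) (hF0 : 0 ≤ F) (hD0 : 0 ≤ D) (hκF : κ * F ≤ C * (H + D))
    (hε0 : 0 ≤ ε) (hε1 : ε ≤ 1) (hγ : 51 * C ^ 3 ≤ γ) (hγ' : γ ≤ 52 * C ^ 3) (hH0' : 0 ≤ H')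
    (hH' : H' ≤ (1 + ε) * H + 2 * C * D - γ * κ ^ 2 * F + N)
    (hN : N ^ 2 ≤ C * κ ^ 2 * ((H + D) * (F + D))) :
    H' ^ 2 ≤ H ^ 2 + 3 * ε * H ^ 2 + 10 * C ^ 2 * (H * D + D ^ 2)
      - 50 * C ^ 3 * (κ ^ 2 * (H * F))
      + 2 * ((1 + ε) * H + 2 * C * D - γ * κ ^ 2 * F) * N := by
  have s4 := pow_mul_le_of_small hC hκ0 hκ (j := 4) (by norm_num)
  have s1 := pow_mul_le_of_small hC hκ0 hκ (j := 1) (by norm_num)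
  have s0 := pow_mul_le_of_small hC hκ0 hκ (j := 0) (by norm_num)
  have hDF := kappa_sq_mul_le hκ0 hD0 hκF
  have hC0 : 0 < C := by linarith only [hC]
  have c2 : C ≤ C ^ 2 := by nlinarith only [hC]
  have c3 : C ≤ C ^ 3 := le_self_pow₀ hC (by norm_num)
  have hγ0 : 0 ≤ γ := le_trans (by positivity) hγ
  rw [pow_one] at s1
  rw [pow_zero, one_mul] at s0
  set HD := H * D with hHD
  set DD := D ^ 2 with hDD
  set HF := κ ^ 2 * (H * F) with hHF
  set FD := F * D with hFD
  have pHD : 0 ≤ HD := by positivity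
  have pDD : 0 ≤ DD := by positivity
  have pHF : 0 ≤ HF := by positivity
  have pFD : 0 ≤ FD := by positivity
  have hDF' : κ ^ 2 * FD ≤ 1 * (HD + DD) := by
    refine hDF.trans ?_
    gcongr
    linarith only [s1]
  set U := (1 + ε) * H + 2 * C * D - γ * κ ^ 2 * F with hU
  have hNsq : N ^ 2 ≤ C * HF + 2 * C ^ 2 * (HD + DD) := by
    have e1 : C * (κ ^ 2 * FD) ≤ C ^ 2 * (1 * (HD + DD)) := by gcongr
    have e2 : C * (κ ^ 2 * (HD + DD)) ≤ C ^ 2 * (1 * (HD + DD)) := by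
      gcongr
      nlinarith only [s0, hκ0]
    have e3 : C * κ ^ 2 * ((H + D) * (F + D)) = C * HF + C * (κ ^ 2 * FD)
      + C * (κ ^ 2 * (HD + DD)) := by rw [hHF, hFD, hHD, hDD]; ring
    linarith only [e1, e2, e3, hN]
  have hUsq : U ^ 2 ≤ H ^ 2 + 3 * ε * H ^ 2 + 8 * C ^ 2 * HD + 4 * C ^ 2 * DD - γ * HF := by
    have e1 : (γ * κ ^ 2 * F) ^ 2 ≤ γ * HF + γ * (κ ^ 2 * FD) := by
      have e2 : γ * κ * C ≤ 1 := by
        calc γ * κ * C ≤ (52 * C ^ 3) * κ * C := by gcongr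
          _ = 52 * (C ^ 4 * κ) := by ring
          _ ≤ 1 := by linarith only [s4]
      calc (γ * κ ^ 2 * F) ^ 2 = γ * (κ ^ 2 * F) * (γ * κ * (κ * F)) := by ring
        _ ≤ γ * (κ ^ 2 * F) * (γ * κ * (C * (H + D))) := by gcongr
        _ = γ * (κ ^ 2 * F) * (γ * κ * C * (H + D)) := by ring
        _ ≤ γ * (κ ^ 2 * F) * (1 * (H + D)) := by gcongr
        _ = _ := by rw [hHF, hFD]; ring
    have e3 : U ^ 2 = (1 + ε) ^ 2 * H ^ 2 + 4 * C * (1 + ε) * HD + 4 * C ^ 2 * DD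
        - 2 * γ * ((1 + ε) * HF) - 4 * C * γ * (κ ^ 2 * FD) + (γ * κ ^ 2 * F) ^ 2 := by
      rw [hU, hHF, hFD, hHD, hDD]; ring
    have e4 : (1 + ε) ^ 2 * H ^ 2 ≤ (1 + 3 * ε) * H ^ 2 := by
      gcongr; nlinarith only [hε0, hε1]
    have e5 : 4 * C * (1 + ε) * HD ≤ 4 * C ^ 2 * (1 + 1) * HD := by gcongr
    have e6 : 0 ≤ γ * (ε * HF) := by positivity
    have e7 : 0 ≤ γ * (κ ^ 2 * FD) := by positivity
    have e8 : 1 * (γ * (κ ^ 2 * FD)) ≤ C * (γ * (κ ^ 2 * FD)) := by gcongr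
    linarith only [e1, e3, e4, e5, e6, e7, e8]
  have e1 : H' ^ 2 ≤ (U + N) ^ 2 := by gcongr
  have e2 : (U + N) ^ 2 = U ^ 2 + 2 * U * N + N ^ 2 := by ring
  have e3 : C * HF + 50 * C ^ 3 * HF ≤ γ * HF := by
    rw [← add_mul]; gcongr; linarith only [hγ, c3]
  have e4 : 0 ≤ C ^ 2 * DD := by positivity
  linarith only [e1, e2, e3, e4, hUsq, hNsq]

lemma le_of_block {H H' ε γ : ℝ} (hC : 1 ≤ C) (hκ0 : 0 < κ) (hκ : 2000 * C ^ 7 * κ ≤ 1)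
    (hH0 : 0 ≤ H) (hF0 : 0 ≤ F) (hD0 : 0 ≤ D) (hκF : κ * F ≤ C * (H + D))
    (hε1 : ε ≤ 1) (hγ0 : 0 ≤ γ)
    (hH' : H' ≤ (1 + ε) * H + 2 * C * D - γ * κ ^ 2 * F + N)
    (hN : N ^ 2 ≤ C * κ ^ 2 * ((H + D) * (F + D))) : H' ≤ 3 * H + 3 * C * D := by
  have s2 := pow_mul_le_of_small hC hκ0 hκ (j := 2) (by norm_num)
  have s1 := pow_mul_le_of_small hC hκ0 hκ (j := 1) (by norm_num)
  have s0 := pow_mul_le_of_small hC hκ0 hκ (j := 0) (by norm_num)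
  rw [pow_one] at s1
  rw [pow_zero, one_mul] at s0
  have hNabs : N ≤ H + D := by
    apply le_of_sq_le_sq _ (by positivity)
    calc N ^ 2 ≤ C * κ * ((H + D) * (κ * F + κ * D)) := hN.trans_eq (by ring)
      _ ≤ C * κ * ((H + D) * (C * (H + D) + 1 * (H + D))) := by
          gcongr
          · linarith only [s0]
          · linarith only [hH0]
      _ = (C ^ 2 * κ + C * κ) * (H + D) ^ 2 := by ring
      _ ≤ 1 * (H + D) ^ 2 := by gcongr; linarith only [s1, s2]
      _ = _ := one_mul _
  have e1 : ε * H ≤ 1 * H := by gcongr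
  have e2 : 0 ≤ γ * κ ^ 2 * F := by positivity
  have e3 : 1 * D ≤ C * D := by gcongr
  linarith only [e1, e2, e3, hNabs, hH']

/-- Recursion of the product of `H` and `D`. -/
lemma mul_le_of_block {H H' : ℝ} (hC : 1 ≤ C) (hκ0 : 0 < κ) (hκ : 2000 * C ^ 7 * κ ≤ 1)
    (hH0 : 0 ≤ H) (hF0 : 0 ≤ F) (hD0 : 0 ≤ D) (hD0' : 0 ≤ D') (hρ1 : ρ ≤ 1)
    (hκF : κ * F ≤ C * (H + D)) (hH' : H' ≤ 3 * H + 3 * C * D)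
    (hspread : D' ≤ 2 * ρ * D + C * κ ^ 2 * (F + D)) :
    H' * D' ≤ 1 / 4 * (H * D) + 7 * C * D ^ 2 + 3 * C * (κ ^ 2 * (H * F))
      + 6 * (H * D) * (ρ - 1 / 64) := by
  have s3 := pow_mul_le_of_small hC hκ0 hκ (j := 3) (by norm_num)
  have s2 := pow_mul_le_of_small hC hκ0 hκ (j := 2) (by norm_num)
  have s1 := pow_mul_le_of_small hC hκ0 hκ (j := 1) (by norm_num)
  have s0 := pow_mul_le_of_small hC hκ0 hκ (j := 0) (by norm_num)
  rw [pow_one] at s1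
  rw [pow_zero, one_mul] at s0
  have hκκ : κ ^ 2 ≤ κ := by nlinarith only [s0, hκ0]
  have hDF := kappa_sq_mul_le hκ0 hD0 hκF
  have e1 : H' * D' ≤ (3 * H + 3 * C * D) * (2 * ρ * D + C * κ ^ 2 * (F + D)) := by gcongr
  set HD := H * D with hHD
  set DD := D ^ 2 with hDD
  set HF := κ ^ 2 * (H * F) with hHF
  set FD := F * D with hFD
  have pHD : 0 ≤ HD := by positivity
  have pDD : 0 ≤ DD := by positivity
  have pHF : 0 ≤ HF := by positivity
  have hρDD : ρ * DD ≤ 1 * DD := by gcongr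
  have e2 : (3 * H + 3 * C * D) * (2 * ρ * D + C * κ ^ 2 * (F + D))
      = 6 * (ρ * HD) + 6 * C * (ρ * DD) + 3 * C * HF + 3 * C * κ ^ 2 * HD
        + 3 * C ^ 2 * (κ ^ 2 * FD) + 3 * C ^ 2 * κ ^ 2 * DD := by
    rw [hHF, hFD, hHD, hDD]; ring
  have e3 : 3 * C ^ 2 * (κ ^ 2 * FD) ≤ 3 * C ^ 2 * (C * κ * (HD + DD)) := by gcongr
  have e4 : 3 * C ^ 2 * (C * κ * (HD + DD)) ≤ 1 / 100 * (HD + DD) := by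
    calc _ = 3 * (C ^ 3 * κ) * (HD + DD) := by ring
      _ ≤ 3 * (1 / 2000) * (HD + DD) := by gcongr
      _ ≤ _ := by linarith only [pHD, pDD]
  have e5 : 3 * C * κ ^ 2 * HD ≤ 1 / 100 * HD := by
    gcongr
    have : C * κ ^ 2 ≤ C * κ := by gcongr
    linarith only [this, s1]
  have e6 : 3 * C ^ 2 * κ ^ 2 * DD ≤ 1 / 100 * DD := by
    gcongr
    have : C ^ 2 * κ ^ 2 ≤ C ^ 2 * κ := by gcongr
    linarith only [this, s2]
  have e7 : C * (ρ * DD) ≤ C * (1 * DD) := by gcongr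
  have e8 : 1 * DD ≤ C * DD := by gcongr
  linarith only [e1, e2, e3, e4, e5, e6, e7, e8, pHD, pDD]

/-- Recursion of the square of `D`. -/
lemma spread_sq_le_of_block {H : ℝ} (hC : 1 ≤ C) (hκ0 : 0 < κ) (hκ : 2000 * C ^ 7 * κ ≤ 1)
    (hH0 : 0 ≤ H) (hF0 : 0 ≤ F) (hD0 : 0 ≤ D) (hD0' : 0 ≤ D') (hρ0 : 0 ≤ ρ) (hρ1 : ρ ≤ 1)
    (hκF : κ * F ≤ C * (H + D)) (hspread : D' ≤ 2 * ρ * D + C * κ ^ 2 * (F + D)) :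
    D' ^ 2 ≤ 1 / 4 * D ^ 2 + 8 * C ^ 4 * κ * (κ ^ 2 * (H * F) + H * D)
      + 8 * D ^ 2 * (ρ - 1 / 64) := by
  have s4 := pow_mul_le_of_small hC hκ0 hκ (j := 4) (by norm_num)
  have s2 := pow_mul_le_of_small hC hκ0 hκ (j := 2) (by norm_num)
  have s0 := pow_mul_le_of_small hC hκ0 hκ (j := 0) (by norm_num)
  rw [pow_zero, one_mul] at s0
  have hκκ : κ ^ 2 ≤ κ := by nlinarith only [s0, hκ0]
  have c4 : C ^ 3 ≤ C ^ 4 := pow_le_pow_right₀ hC (by norm_num)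
  have hDF := kappa_sq_mul_le hκ0 hD0 hκF
  have e1 : D' ^ 2 ≤ (2 * ρ * D + C * κ ^ 2 * (F + D)) ^ 2 := by gcongr
  set HD := H * D with hHD
  set DD := D ^ 2 with hDD
  set HF := κ ^ 2 * (H * F) with hHF
  set FD := F * D with hFD
  have pHD : 0 ≤ HD := by positivity
  have pDD : 0 ≤ DD := by positivity
  have pHF : 0 ≤ HF := by positivity
  have e2 : (2 * ρ * D + C * κ ^ 2 * (F + D)) ^ 2
      ≤ 8 * ρ ^ 2 * DD + 4 * C ^ 2 * κ ^ 4 * F ^ 2 + 4 * C ^ 2 * κ ^ 4 * DD := by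
    rw [hDD]
    nlinarith only [sq_nonneg (2 * ρ * D - C * κ ^ 2 * (F + D)),
      sq_nonneg (C * κ ^ 2 * (F - D))]
  have e3 : ρ ^ 2 * DD ≤ ρ * DD := by gcongr; nlinarith only [hρ0, hρ1]
  have e4 : κ ^ 4 * F ^ 2 ≤ C * κ * HF + C ^ 2 * κ ^ 2 * (HD + DD) := by
    calc κ ^ 4 * F ^ 2 = κ ^ 3 * F * (κ * F) := by ring
      _ ≤ κ ^ 3 * F * (C * (H + D)) := by gcongr
      _ = C * κ * HF + C * κ * (κ ^ 2 * FD) := by rw [hHF, hFD]; ring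
      _ ≤ C * κ * HF + C * κ * (C * κ * (HD + DD)) := by gcongr
      _ = _ := by ring
  have e5 : C ^ 2 * (κ ^ 4 * F ^ 2) ≤ C ^ 2 * (C * κ * HF + C ^ 2 * κ ^ 2 * (HD + DD)) := by
    gcongr
  have e6 : C ^ 2 * (C * κ * HF) ≤ C ^ 4 * κ * HF := by
    calc C ^ 2 * (C * κ * HF) = C ^ 3 * κ * HF := by ring
      _ ≤ _ := by gcongr
  have e7 : C ^ 2 * (C ^ 2 * κ ^ 2 * (HD + DD)) ≤ C ^ 4 * κ * (HD + DD) := by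
    calc C ^ 2 * (C ^ 2 * κ ^ 2 * (HD + DD)) = C ^ 4 * κ ^ 2 * (HD + DD) := by ring
      _ ≤ _ := by gcongr
  have e8 : C ^ 2 * κ ^ 4 * DD ≤ 1 / 2000 * DD := by
    gcongr
    have : C ^ 2 * κ ^ 4 ≤ C ^ 2 * κ := by
      gcongr
      calc κ ^ 4 = κ ^ 2 * κ ^ 2 := by ring
        _ ≤ κ * 1 := by gcongr; linarith only [hκκ, s0]
        _ = κ := mul_one _
    linarith only [this, s2]
  have e9 : C ^ 4 * κ * DD ≤ 1 / 2000 * DD := by gcongr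
  have e10 : 0 ≤ C ^ 4 * κ * HF := by positivity
  have e11 : 0 ≤ C ^ 4 * κ * HD := by positivity
  linarith only [e1, e2, e3, e4, e5, e6, e7, e8, e9, e10, e11, pDD]

/-- Recursion of the product of `F` and `X`. -/
lemma energy_mul_kl_le_of_block {H : ℝ} (hC : 1 ≤ C) (hκ0 : 0 < κ)
    (hκ : 2000 * C ^ 7 * κ ≤ 1) (hF0 : 0 ≤ F) (hD0 : 0 ≤ D) (hX0 : 0 ≤ X)
    (hXH : X ≤ H) (hX0' : 0 ≤ X')
    (hκF : κ * F ≤ C * (H + D)) (hen : F' ≤ (1 + C * κ) * F + C / κ * D)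
    (hkl : X' ≤ X + κ * (C * (H + D) - F)) :
    κ * (F' * X') ≤ κ * (F * X) - κ ^ 2 * F ^ 2
      + 4 * C ^ 2 * (κ ^ 2 * (H * F) + H * D + D ^ 2) := by
  have s2 := pow_mul_le_of_small hC hκ0 hκ (j := 2) (by norm_num)
  have s1 := pow_mul_le_of_small hC hκ0 hκ (j := 1) (by norm_num)
  rw [pow_one] at s1
  have c2 : C ≤ C ^ 2 := by nlinarith only [hC]
  have hH0 : 0 ≤ H := hX0.trans hXH
  have hDF := kappa_sq_mul_le hκ0 hD0 hκF
  set Y := X + κ * (C * (H + D)) with hY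
  have e1 : X' ≤ Y - κ * F := by
    rw [hY]
    linarith only [hkl]
  have e2 : κ * (F' * X') ≤ κ * (((1 + C * κ) * F + C / κ * D) * (Y - κ * F)) := by gcongr
  set HD := H * D with hHD
  set DD := D ^ 2 with hDD
  set HF := κ ^ 2 * (H * F) with hHF
  set FD := F * D with hFD
  set FF := κ ^ 2 * F ^ 2 with hFF
  have pHD : 0 ≤ HD := by positivity
  have pDD : 0 ≤ DD := by positivity
  have pHF : 0 ≤ HF := by positivity
  have pFD : 0 ≤ FD := by positivity
  have pFF : 0 ≤ FF := by positivity
  have e3 : κ * (((1 + C * κ) * F + C / κ * D) * (Y - κ * F))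
      = κ * (F * X) + C * (κ ^ 2 * (F * X)) + C * (1 + C * κ) * (HF + κ ^ 2 * FD)
        - (1 + C * κ) * FF + C * (D * X) + C ^ 2 * κ * (HD + DD) - C * κ * FD := by
    rw [hY, hHF, hFD, hFF, hHD, hDD]; field_simp; ring
  have e4 : C * (κ ^ 2 * (F * X)) ≤ C * HF := by
    rw [hHF, mul_comm H]; gcongr
  have e5 : C * (1 + C * κ) * (HF + κ ^ 2 * FD) ≤ C * (1 + 1) * (HF + κ ^ 2 * FD) := by
    gcongr; linarith only [s1]
  have e6 : C * (κ ^ 2 * FD) ≤ C * (C * κ * (HD + DD)) := by gcongr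
  have e7 : C ^ 2 * κ * (HD + DD) ≤ 1 / 2000 * (HD + DD) := by gcongr
  have e8 : C * (D * X) ≤ C * HD := by rw [hHD, mul_comm H]; gcongr
  have e9 : 0 ≤ C * κ * FF := by positivity
  have e10 : 0 ≤ C * κ * FD := by positivity
  have f1 : C * HF ≤ C ^ 2 * HF := by gcongr
  have f2 : C * HD ≤ C ^ 2 * HD := by gcongr
  have f3 : 1 * (HD + DD) ≤ C ^ 2 * (HD + DD) := by gcongr; linarith only [c2, hC]
  have f4 : 0 ≤ C ^ 2 * HF := by positivity
  have f5 : 0 ≤ C ^ 2 * HD := by positivity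
  have f6 : 0 ≤ C ^ 2 * DD := by positivity
  linarith only [e2, e3, e4, e5, e6, e7, e8, e9, e10, f1, f2, f3, f4, f5, f6]

/-- Recursion of the product of `F` and `D`. -/
lemma energy_mul_spread_le_of_block (hC : 1 ≤ C) (hκ0 : 0 < κ) (hκ : 2000 * C ^ 7 * κ ≤ 1)
    (hF0 : 0 ≤ F) (hD0 : 0 ≤ D) (hD0' : 0 ≤ D') (hρ0 : 0 ≤ ρ) (hρ1 : ρ ≤ 1)
    (hen : F' ≤ 4 * F + C * D) (hspread : D' ≤ 2 * ρ * D + C * κ ^ 2 * (F + D)) :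
    F' * D' ≤ 1 / 2 * (F * D) + 4 * C * (κ ^ 2 * F ^ 2) + 3 * C ^ 2 * D ^ 2
      + 8 * (F * D) * (ρ - 1 / 64) := by
  have s2 := pow_mul_le_of_small hC hκ0 hκ (j := 2) (by norm_num)
  have s1 := pow_mul_le_of_small hC hκ0 hκ (j := 1) (by norm_num)
  have s0 := pow_mul_le_of_small hC hκ0 hκ (j := 0) (by norm_num)
  rw [pow_one] at s1
  rw [pow_zero, one_mul] at s0
  have hκκ : κ ^ 2 ≤ κ := by nlinarith only [s0, hκ0]
  have c2 : C ≤ C ^ 2 := by nlinarith only [hC]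
  have e1 : F' * D' ≤ (4 * F + C * D) * (2 * ρ * D + C * κ ^ 2 * (F + D)) := by gcongr
  set DD := D ^ 2 with hDD
  set FD := F * D with hFD
  set FF := κ ^ 2 * F ^ 2 with hFF
  have pDD : 0 ≤ DD := by positivity
  have pFD : 0 ≤ FD := by positivity
  have e2 : (4 * F + C * D) * (2 * ρ * D + C * κ ^ 2 * (F + D))
      = 8 * (ρ * FD) + 4 * C * FF + 4 * (C * κ ^ 2 * FD) + 2 * (C * (ρ * DD))
        + C ^ 2 * κ ^ 2 * FD + C ^ 2 * κ ^ 2 * DD := by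
    rw [hFF, hFD, hDD]; ring
  have e3 : C * κ ^ 2 * FD ≤ 1 / 2000 * FD := by
    gcongr
    exact le_trans (by gcongr) s1
  have e4 : C ^ 2 * κ ^ 2 * FD ≤ 1 / 2000 * FD := by
    gcongr
    exact le_trans (by gcongr) s2
  have e5 : C ^ 2 * κ ^ 2 * DD ≤ 1 / 2000 * DD := by
    gcongr
    exact le_trans (by gcongr) s2
  have e6 : C * (ρ * DD) ≤ C ^ 2 * (1 * DD) := by gcongr
  have e7 : 1 * DD ≤ C ^ 2 * DD := by gcongr; linarith only [c2, hC]
  linarith only [e1, e2, e3, e4, e5, e6, e7, pFD, pDD]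

lemma spread_le_of_block (hC : 1 ≤ C) (hκ0 : 0 < κ) (hκ : 2000 * C ^ 7 * κ ≤ 1)
    (hD0 : 0 ≤ D) (hspread : D' ≤ 2 * ρ * D + C * κ ^ 2 * (F + D)) :
    D' ≤ 1 / 2 * D + C * κ ^ 2 + C * (κ ^ 2 * F ^ 2) + 2 * D * (ρ - 1 / 64) := by
  have s1 := pow_mul_le_of_small hC hκ0 hκ (j := 1) (by norm_num)
  have s0 := pow_mul_le_of_small hC hκ0 hκ (j := 0) (by norm_num)
  rw [pow_one] at s1
  rw [pow_zero, one_mul] at s0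
  have hκκ : κ ^ 2 ≤ κ := by nlinarith only [s0, hκ0]
  have e1 : F ≤ 1 + F ^ 2 := by nlinarith only [sq_nonneg (F - 1), sq_nonneg F]
  have e2 : C * κ ^ 2 * F ≤ C * κ ^ 2 * (1 + F ^ 2) := by gcongr
  have e3 : C * κ ^ 2 * D ≤ 1 / 2000 * D := by
    gcongr
    exact le_trans (by gcongr) s1
  linarith only [e2, e3, hspread, hD0]

/-- Decrease of the potential over a block, up to a term in the noise and a term in the deviation of
the contraction factor from its mean bound `1 / 64`. -/
lemma BlockBounds.potential_le (h : BlockBounds C κ Λ X F D N ρ Λ' X' F' D') (hC : 1 ≤ C)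
    (hκ0 : 0 < κ) (hκ : 2000 * C ^ 7 * κ ≤ 1) :
    potential C κ Λ' X' F' D' ≤ (1 + 159 * C ^ 4 * κ ^ 2) * potential C κ Λ X F D + C * κ ^ 2
      - 1 / 2 * (κ ^ 2 * F ^ 2 + F * D + D ^ 2 + D)
      + potentialNoise C κ Λ X F D * N + potentialMix C κ Λ X F D * (ρ - 1 / 64) := by
  obtain ⟨hX0, hXΛ, hF0, hD0, hX0', hXΛ', hF0', hD0', hρ0, hρ1, hlyap, hnoise, hen, hen', hkl,
    hκF, hspread⟩ := h
  unfold potential potentialNoise potentialMix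
  have s7 := pow_mul_le_of_small hC hκ0 hκ (j := 7) le_rfl
  have s4 := pow_mul_le_of_small hC hκ0 hκ (j := 4) (by norm_num)
  have s3 := pow_mul_le_of_small hC hκ0 hκ (j := 3) (by norm_num)
  have s0 := pow_mul_le_of_small hC hκ0 hκ (j := 0) (by norm_num)
  rw [pow_zero, one_mul] at s0
  have hκκ : κ ^ 2 ≤ κ := by nlinarith only [s0, hκ0]
  have c2 : 1 ≤ C ^ 2 := one_le_pow₀ hC
  have c3 : 1 ≤ C ^ 3 := one_le_pow₀ hC
  have c23 : C ^ 2 ≤ C ^ 3 := pow_le_pow_right₀ hC (by norm_num)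
  have c13 : C ≤ C ^ 3 := le_self_pow₀ hC (by norm_num)
  have c14 : C ≤ C ^ 4 := le_self_pow₀ hC (by norm_num)
  have hC0 : 0 < C := by linarith only [hC]
  set α := 52 * C ^ 3 with hα
  set γ := α - C with hγ
  set H := Λ + α * (κ * X) with hH
  set H' := Λ' + α * (κ * X') with hH'
  set ε := C * (1 + α) * κ ^ 2 with hε
  have hα0 : 0 < α := by positivity
  have hγ1 : 51 * C ^ 3 ≤ γ := by rw [hγ, hα]; linarith only [c13]
  have hγ2 : γ ≤ 52 * C ^ 3 := by rw [hγ, hα]; linarith only [hC0]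
  have hΛ0 : 0 ≤ Λ := hX0.trans hXΛ
  have hΛ0' : 0 ≤ Λ' := hX0'.trans hXΛ'
  have hαX : 0 ≤ α * (κ * X) := by positivity
  have hΛH : Λ ≤ H := by rw [hH]; linarith only [hαX]
  have hH0 : 0 ≤ H := hΛ0.trans hΛH
  have hH0' : 0 ≤ H' := by rw [hH']; positivity
  have hXH : X ≤ H := hXΛ.trans hΛH
  have hκF' : κ * F ≤ C * (H + D) := hκF.trans (by gcongr)
  have hkl' : X' ≤ X + κ * (C * (H + D) - F) := hkl.trans (by gcongr)
  have hε0 : 0 ≤ ε := by rw [hε]; positivity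
  have hε1 : ε ≤ 53 * C ^ 4 * κ ^ 2 := by
    rw [hε, hα]
    have : C * κ ^ 2 ≤ C ^ 4 * κ ^ 2 := by gcongr
    linarith only [this]
  have hε2 : ε ≤ 1 := by
    refine hε1.trans ?_
    have : C ^ 4 * κ ^ 2 ≤ C ^ 4 * κ := by gcongr
    linarith only [this, s4]
  have hN2 : N ^ 2 ≤ C * κ ^ 2 * ((H + D) * (F + D)) := hnoise.trans (by gcongr)
  have hHU : H' ≤ (1 + ε) * H + 2 * C * D - γ * κ ^ 2 * F + N := by
    have e1 : α * κ * X' ≤ α * κ * (X + κ * (C * (H + D) - F)) := by gcongr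
    have e2 : α * κ ^ 2 * (C * D) ≤ 1 * (C * D) := by
      gcongr
      calc α * κ ^ 2 ≤ α * κ := by gcongr
        _ ≤ 1 := by rw [hα]; linarith only [s3]
    have e3 : C * (κ ^ 2 * Λ) ≤ C * (κ ^ 2 * H) := by gcongr
    have e4 : ε * H = C * (κ ^ 2 * H) + α * κ * (κ * (C * H)) := by rw [hε]; ring
    have e5 : H = Λ + α * (κ * X) := hH
    rw [hH', add_mul, one_mul, e4, hγ]
    linarith only [hlyap, e1, e2, e3, e5]
  have hHsq := sq_le_of_block hC hκ0 hκ hH0 hF0 hD0 hκF' hε0 hε2 hγ1 hγ2 hH0' hHU hN2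
  have hH3 := le_of_block hC hκ0 hκ hH0 hF0 hD0 hκF' hε2 (le_trans (by positivity) hγ1) hHU hN2
  have hHD' := mul_le_of_block hC hκ0 hκ hH0 hF0 hD0 hD0' hρ1 hκF' hH3 hspread
  have hDD' := spread_sq_le_of_block hC hκ0 hκ hH0 hF0 hD0 hD0' hρ0 hρ1 hκF' hspread
  have hFX := energy_mul_kl_le_of_block hC hκ0 hκ hF0 hD0 hX0 hXH hX0' hκF' hen' hkl'
  have hFD' := energy_mul_spread_le_of_block hC hκ0 hκ hF0 hD0 hD0' hρ0 hρ1 hen hspread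
  have hD' := spread_le_of_block hC hκ0 hκ hD0 hspread
  set U := (1 + ε) * H + 2 * C * D - γ * κ ^ 2 * F
  set HD := H * D with hHD
  set DD := D ^ 2 with hDD
  set HF := κ ^ 2 * (H * F) with hHF
  set FD := F * D with hFD
  set FF := κ ^ 2 * F ^ 2 with hFF
  have pHD : 0 ≤ HD := by positivity
  have pDD : 0 ≤ DD := by positivity
  have pHF : 0 ≤ HF := by positivity
  have pFD : 0 ≤ FD := by positivity
  have pFF : 0 ≤ FF := by positivity
  have hBs : 200 * C ^ 3 * (8 * C ^ 4 * κ * (HF + HD)) ≤ 1 * (HF + HD) := by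
    calc _ = 1600 * (C ^ 7 * κ) * (HF + HD) := by ring
      _ ≤ 1 * (HF + HD) := by gcongr; linarith only [s7]
  have hΦ1 : H' ^ 2 + 16 * C ^ 2 * (H' * D') + 200 * C ^ 3 * D' ^ 2
      ≤ H ^ 2 + 3 * ε * H ^ 2 + 16 * C ^ 2 * HD + 200 * C ^ 3 * DD - (HF + HD + DD) + 2 * U * N
        + (16 * C ^ 2 * (6 * HD) + 200 * C ^ 3 * (8 * DD)) * (ρ - 1 / 64) := by
    have e1 := mul_le_mul_of_nonneg_left hHD' (show 0 ≤ 16 * C ^ 2 by positivity)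
    have e2 := mul_le_mul_of_nonneg_left hDD' (show 0 ≤ 200 * C ^ 3 by positivity)
    have f1 : 1 * HF ≤ C ^ 3 * HF := by gcongr
    have f2 : 1 * HD ≤ C ^ 2 * HD := by gcongr
    have f3 : 1 * DD ≤ C ^ 3 * DD := by gcongr
    have f4 : C ^ 2 * DD ≤ C ^ 3 * DD := by gcongr
    linarith only [hHsq, hBs, e1, e2, f1, f2, f3, f4, pDD]
  have e1 := mul_le_mul_of_nonneg_left hΦ1 (show 0 ≤ 28 * C ^ 3 by positivity)
  have e2 := mul_le_mul_of_nonneg_left hFX (show 0 ≤ 6 * C by positivity)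
  have f1 : 1 * (HF + HD + DD) ≤ C ^ 3 * (HF + HD + DD) := by gcongr
  have f2 : C ^ 2 * DD ≤ C ^ 3 * DD := by gcongr
  have f3 : 1 * FF ≤ C * FF := by gcongr
  have f4 : 0 ≤ C ^ 3 * HF := by positivity
  have f5 : 0 ≤ C ^ 3 * HD := by positivity
  have f6 : 0 ≤ C ^ 3 * DD := by positivity
  have f7 : 28 * C ^ 3 * (3 * ε * H ^ 2) ≤ 159 * C ^ 4 * κ ^ 2 * (28 * C ^ 3 * H ^ 2) := by
    calc 28 * C ^ 3 * (3 * ε * H ^ 2) ≤ 28 * C ^ 3 * (3 * (53 * C ^ 4 * κ ^ 2) * H ^ 2) := by gcongr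
      _ = _ := by ring
  have f8 : 0 ≤ 159 * C ^ 4 * κ ^ 2 * (28 * C ^ 3 * (16 * C ^ 2 * HD + 200 * C ^ 3 * DD)
      + 6 * C * (κ * (F * X)) + FD + D) := by positivity
  linarith only [e1, e2, hFD', hD', f1, f2, f3, f4, f5, f6, f7, f8, pDD, pFF, pHF, pHD]

lemma BlockBounds.potentialMix_nonneg (h : BlockBounds C κ Λ X F D N ρ Λ' X' F' D')
    (hC : 1 ≤ C) (hκ0 : 0 < κ) : 0 ≤ potentialMix C κ Λ X F D := by
  have := h.X_nonneg
  have := h.F_nonneg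
  have := h.D_nonneg
  have : 0 ≤ Λ := h.X_nonneg.trans h.X_le
  unfold potentialMix
  positivity

end Potential

/-! ### Mixing -/

section Mixing

open FedProblem hiding average

variable {T M d : ℕ}

/-- The consensus distance as a real number. -/
noncomputable def spread (Ξ : Fin T → Params M d) : ℝ := ∑ t, ‖Ξ t - FedProblem.average Ξ‖ ^ 2

lemma spread_nonneg (Ξ : Fin T → Params M d) : 0 ≤ spread Ξ :=
  Finset.sum_nonneg fun _ _ => sq_nonneg _

lemma consensusDist_eq (Ξ : Fin T → Params M d) :
    consensusDist Ξ = ENNReal.ofReal (spread Ξ) := by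
  unfold consensusDist spread
  rw [ENNReal.ofReal_sum_of_nonneg fun _ _ => sq_nonneg _]
  refine Finset.sum_congr rfl fun t _ => ?_
  rw [← ofReal_norm, ENNReal.ofReal_pow (norm_nonneg _)]

lemma norm_sub_average_sq_le (Ξ : Fin T → Params M d) (t : Fin T) :
    ‖Ξ t - FedProblem.average Ξ‖ ^ 2 ≤ spread Ξ :=
  Finset.single_le_sum (f := fun t => ‖Ξ t - FedProblem.average Ξ‖ ^ 2) (fun _ _ => sq_nonneg _)
    (Finset.mem_univ t)

variable {W : Matrix (Fin T) (Fin T) ℝ}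

lemma mix_mix (Ξ : Fin T → Params M d) (A B : Matrix (Fin T) (Fin T) ℝ) :
    mix (mix Ξ A) B = mix Ξ (A * B) := by
  funext t
  simp only [mix, Matrix.mul_apply, Finset.smul_sum, Finset.sum_smul, smul_smul]
  rw [Finset.sum_comm]
  exact Finset.sum_congr rfl fun s _ => Finset.sum_congr rfl fun r _ => by rw [mul_comm]

lemma mix_one (Ξ : Fin T → Params M d) : mix Ξ (1 : Matrix (Fin T) (Fin T) ℝ) = Ξ := by
  funext t
  simp [mix, Matrix.one_apply, ite_smul]

lemma mix_sub (Ξ Υ : Fin T → Params M d) (A : Fin T → Fin T → ℝ) :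
    mix (fun t => Ξ t - Υ t) A = fun t => mix Ξ A t - mix Υ A t := by
  funext t
  simp [mix, smul_sub, Finset.sum_sub_distrib]

lemma average_mix (hW : W ∈ doublyStochastic ℝ (Fin T)) (Ξ : Fin T → Params M d) :
    FedProblem.average (mix Ξ W) = FedProblem.average Ξ := by
  unfold FedProblem.average mix
  rw [Finset.sum_comm]
  simp only [← Finset.sum_smul, sum_row_of_mem_doublyStochastic hW, one_smul]

lemma sum_norm_mix_sq_le (hW : W ∈ doublyStochastic ℝ (Fin T)) (Ξ : Fin T → Params M d) :
    ∑ t, ‖mix Ξ W t‖ ^ 2 ≤ ∑ t, ‖Ξ t‖ ^ 2 := by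
  have h1 : ∀ t, ‖mix Ξ W t‖ ^ 2 ≤ ∑ s, W s t * ‖Ξ s‖ ^ 2 := fun t => by
    have e1 : ‖mix Ξ W t‖ ≤ ∑ s, W s t * ‖Ξ s‖ := (norm_sum_le _ _).trans_eq <|
      Finset.sum_congr rfl fun s _ => by
        rw [norm_smul, Real.norm_of_nonneg (nonneg_of_mem_doublyStochastic hW)]
    calc ‖mix Ξ W t‖ ^ 2 ≤ (∑ s, W s t * ‖Ξ s‖) ^ 2 := by gcongr
      _ ≤ ∑ s, W s t * ‖Ξ s‖ ^ 2 := by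
        have := (convexOn_pow 2).map_sum_le (t := Finset.univ) (w := fun s => W s t)
          (p := fun s => ‖Ξ s‖) (fun s _ => nonneg_of_mem_doublyStochastic hW)
          (sum_col_of_mem_doublyStochastic hW t) (fun s _ => norm_nonneg _)
        simpa using this
  refine (Finset.sum_le_sum fun t _ => h1 t).trans ?_
  rw [Finset.sum_comm]
  simp only [← Finset.sum_mul, sum_row_of_mem_doublyStochastic hW, one_mul, le_refl]

lemma mix_sub_const (hW : W ∈ doublyStochastic ℝ (Fin T)) (Ξ : Fin T → Params M d)
    (c : Params M d) (t : Fin T) : mix (fun s => Ξ s - c) W t = mix Ξ W t - c := by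
  simp only [mix, smul_sub, Finset.sum_sub_distrib, ← Finset.sum_smul]
  rw [sum_col_of_mem_doublyStochastic hW, one_smul]

lemma spread_mix_le (hW : W ∈ doublyStochastic ℝ (Fin T)) (Ξ : Fin T → Params M d) :
    spread (mix Ξ W) ≤ spread Ξ := by
  unfold spread
  rw [average_mix hW]
  simp only [← mix_sub_const hW]
  exact sum_norm_mix_sq_le hW _

lemma sum_sub_average (hT : T ≠ 0) (Ξ : Fin T → Params M d) : ∑ t, (Ξ t - FedProblem.average Ξ) = 0 := by
  have : (T : ℝ) ≠ 0 := by exact_mod_cast hT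
  rw [Finset.sum_sub_distrib, Finset.sum_const, Finset.card_univ, Fintype.card_fin, FedProblem.average,
    ← Nat.cast_smul_eq_nsmul ℝ, smul_smul, mul_inv_cancel₀ this, one_smul, sub_self]

/-- Squared Frobenius distance of a matrix to the averaging matrix. -/
noncomputable def frobDist (P : Matrix (Fin T) (Fin T) ℝ) : ℝ := ∑ s, ∑ t, (P s t - (T : ℝ)⁻¹) ^ 2

lemma frobDist_nonneg (P : Matrix (Fin T) (Fin T) ℝ) : 0 ≤ frobDist P :=
  Finset.sum_nonneg fun _ _ => Finset.sum_nonneg fun _ _ => sq_nonneg _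

lemma frobDist_transpose (P : Matrix (Fin T) (Fin T) ℝ) : frobDist P.transpose = frobDist P :=
  Finset.sum_comm

lemma spread_mix_le_frobDist (hT : T ≠ 0) (hW : W ∈ doublyStochastic ℝ (Fin T))
    (Ξ : Fin T → Params M d) : spread (mix Ξ W) ≤ frobDist W * spread Ξ := by
  unfold spread frobDist
  rw [average_mix hW, Finset.sum_comm, Finset.sum_mul]
  refine Finset.sum_le_sum fun t _ => ?_
  have e : mix Ξ W t - FedProblem.average Ξ = ∑ s, (W s t - (T : ℝ)⁻¹) • (Ξ s - FedProblem.average Ξ) := by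
    rw [← mix_sub_const hW]
    simp only [sub_smul, Finset.sum_sub_distrib, ← Finset.smul_sum, sum_sub_average hT, smul_zero,
      sub_zero]
    rfl
  rw [e]
  calc _ ≤ (∑ s, |W s t - (T : ℝ)⁻¹| * ‖Ξ s - FedProblem.average Ξ‖) ^ 2 := by
        gcongr
        refine (norm_sum_le _ _).trans_eq (Finset.sum_congr rfl fun s _ => ?_)
        rw [norm_smul, Real.norm_eq_abs]
    _ ≤ (∑ s, |W s t - (T : ℝ)⁻¹| ^ 2) * ∑ s, ‖Ξ s - FedProblem.average Ξ‖ ^ 2 :=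
        Finset.sum_mul_sq_le_sq_mul_sq _ _ _
    _ = _ := by simp only [sq_abs]

lemma spread_add_le (hT : T ≠ 0) (Ξ Υ : Fin T → Params M d) :
    spread (fun t => Ξ t + Υ t) ≤ 2 * spread Ξ + 2 * ∑ t, ‖Υ t‖ ^ 2 := by
  have hav : FedProblem.average (fun t => Ξ t + Υ t) = FedProblem.average Ξ + FedProblem.average Υ := by
    simp [FedProblem.average, Finset.sum_add_distrib]
  have hvar : ∑ t, ‖Υ t - FedProblem.average Υ‖ ^ 2 ≤ ∑ t, ‖Υ t‖ ^ 2 := by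
    have h1 : ∀ t, ‖Υ t - FedProblem.average Υ‖ ^ 2
        = ‖Υ t‖ ^ 2 - ‖FedProblem.average Υ‖ ^ 2 - 2 * inner ℝ (Υ t - FedProblem.average Υ) (FedProblem.average Υ) := fun t => by
      rw [norm_sub_sq_real, inner_sub_left, real_inner_self_eq_norm_sq]; ring
    simp only [h1]
    rw [Finset.sum_sub_distrib, Finset.sum_sub_distrib, ← Finset.mul_sum, ← sum_inner,
      sum_sub_average hT, inner_zero_left]
    have : 0 ≤ ∑ _t : Fin T, ‖FedProblem.average Υ‖ ^ 2 := Finset.sum_nonneg fun _ _ => sq_nonneg _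
    linarith
  unfold spread
  rw [hav, Finset.mul_sum]
  calc ∑ t, ‖Ξ t + Υ t - (FedProblem.average Ξ + FedProblem.average Υ)‖ ^ 2
      ≤ ∑ t, (2 * ‖Ξ t - FedProblem.average Ξ‖ ^ 2 + 2 * ‖Υ t - FedProblem.average Υ‖ ^ 2) := by
        refine Finset.sum_le_sum fun t _ => ?_
        rw [add_sub_add_comm]
        exact norm_add_sq_le_two _ _
    _ = ∑ t, 2 * ‖Ξ t - FedProblem.average Ξ‖ ^ 2 + 2 * ∑ t, ‖Υ t - FedProblem.average Υ‖ ^ 2 := by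
        rw [Finset.sum_add_distrib, ← Finset.mul_sum (a := (2 : ℝ)) (f := fun t =>
          ‖Υ t - FedProblem.average Υ‖ ^ 2)]
    _ ≤ _ := by gcongr

lemma windowProd_transpose_succ {W : ℕ → Fin T → Fin T → ℝ} {a r : ℕ}
    (hs : (Matrix.of (W (a + r))).IsSymm) :
    (windowProd W a (r + 1)).transpose
      = (windowProd W a r).transpose * Matrix.of (W (a + r)) := by
  rw [windowProd, Matrix.transpose_mul, hs.eq]

lemma windowProd_mem {W : ℕ → Fin T → Fin T → ℝ}
    (hW : ∀ k, Matrix.of (W k) ∈ doublyStochastic ℝ (Fin T)) (a r : ℕ) :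
    windowProd W a r ∈ doublyStochastic ℝ (Fin T) := by
  induction r with
  | zero => exact one_mem _
  | succ r ih => exact mul_mem (hW _) ih

lemma transpose_mem {W : Matrix (Fin T) (Fin T) ℝ} (hW : W ∈ doublyStochastic ℝ (Fin T)) :
    W.transpose ∈ doublyStochastic ℝ (Fin T) := by
  rw [mem_doublyStochastic_iff_sum] at hW ⊢
  exact ⟨fun i j => hW.1 j i, hW.2.2, hW.2.1⟩

/-- Consensus distance after several rounds in which the parameters are displaced by `V` and
mixed. -/
lemma spread_le_of_rounds (hT : T ≠ 0) {W : ℕ → Fin T → Fin T → ℝ}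
    (hW : ∀ k, Matrix.of (W k) ∈ doublyStochastic ℝ (Fin T))
    (hs : ∀ k, (Matrix.of (W k)).IsSymm) {Θ V : ℕ → Fin T → Params M d}
    (hΘ : ∀ k, Θ (k + 1) = mix (fun t => Θ k t - V k t) (W k)) (a R : ℕ) :
    spread (Θ (a + R)) ≤ 2 * min 1 (frobDist (windowProd W a R)) * spread (Θ a)
      + 2 * (R * ∑ i ∈ Finset.range R, ∑ t, ‖V (a + i) t‖ ^ 2) := by
  -- distance to the trajectory without displacements
  have key : ∀ r, ∑ t, ‖Θ (a + r) t - mix (Θ a) (windowProd W a r).transpose t‖ ^ 2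
      ≤ r * ∑ i ∈ Finset.range r, ∑ t, ‖V (a + i) t‖ ^ 2 := by
    intro r
    set Y : ℕ → Fin T → Params M d := fun r t =>
      Θ (a + r) t - mix (Θ a) (windowProd W a r).transpose t with hY
    let E : ℕ → PiLp 2 (fun _ : Fin T => Params M d) := fun r => WithLp.toLp 2 (Y r)
    let U : ℕ → PiLp 2 (fun _ : Fin T => Params M d) := fun r => WithLp.toLp 2 (V (a + r))
    have hE2 : ∀ r, ‖E r‖ ^ 2 = ∑ t, ‖Y r t‖ ^ 2 := fun r => PiLp.norm_sq_eq_of_L2 _ _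
    have hU2 : ∀ r, ‖U r‖ ^ 2 = ∑ t, ‖V (a + r) t‖ ^ 2 := fun r => PiLp.norm_sq_eq_of_L2 _ _
    have hstep : ∀ r, ‖E (r + 1)‖ ≤ ‖E r‖ + ‖U r‖ := fun r => by
      have e1 : Y (r + 1) = mix (fun t => Y r t - V (a + r) t) (W (a + r)) := by
        rw [mix_sub, hY]
        simp only
        rw [mix_sub, ← add_assoc, hΘ (a + r), mix_sub, windowProd_transpose_succ (hs _)]
        have := mix_mix (Θ a) (windowProd W a r).transpose (Matrix.of (W (a + r)))
        rw [← this]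
        funext t
        change _ = _ - mix _ (W (a + r)) t - _
        exact sub_right_comm _ _ _
      have e2 : ‖E (r + 1)‖ ^ 2 ≤ ‖E r - U r‖ ^ 2 := by
        rw [hE2, e1, PiLp.norm_sq_eq_of_L2]
        exact sum_norm_mix_sq_le (hW (a + r)) _
      have e3 : ‖E (r + 1)‖ ≤ ‖E r - U r‖ := le_of_sq_le_sq e2 (norm_nonneg _)
      exact e3.trans (norm_sub_le _ _)
    have hsum : ∀ r, ‖E r‖ ≤ ∑ i ∈ Finset.range r, ‖U i‖ := by
      intro r
      induction r with
      | zero =>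
        have : E 0 = 0 := by
          ext t : 1
          change Θ a t - mix (Θ a) (windowProd W a 0).transpose t = 0
          rw [windowProd, Matrix.transpose_one, mix_one, sub_self]
        simp [this]
      | succ r ih =>
        rw [Finset.sum_range_succ]
        exact (hstep r).trans (by gcongr)
    rw [← hE2]
    calc ‖E r‖ ^ 2 ≤ (∑ i ∈ Finset.range r, ‖U i‖) ^ 2 := by
          gcongr; exact hsum r
      _ ≤ r * ∑ i ∈ Finset.range r, ‖U i‖ ^ 2 := by
          simpa using sq_sum_le_card_mul_sum_sq (s := Finset.range r) (f := fun i => ‖U i‖)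
      _ = _ := by simp only [hU2]
  have hP := transpose_mem (windowProd_mem hW a R)
  have h1 := spread_add_le hT (mix (Θ a) (windowProd W a R).transpose)
    fun t => Θ (a + R) t - mix (Θ a) (windowProd W a R).transpose t
  simp only [add_sub_cancel] at h1
  have h2 : spread (mix (Θ a) (windowProd W a R).transpose)
      ≤ min 1 (frobDist (windowProd W a R)) * spread (Θ a) := by
    rw [min_mul_of_nonneg _ _ (spread_nonneg _), one_mul]
    refine le_min (spread_mix_le hP _) ?_
    rw [← frobDist_transpose]
    exact spread_mix_le_frobDist hT hP _
  have h3 := key R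
  linarith

end Mixing

/-! ### The trajectory and its moving averages -/

section Track

variable {𝒳 𝒴 𝒜 : Type*} [MeasurableSpace 𝒳] [MeasurableSpace 𝒴] {T M d : ℕ}

/-- A state of the algorithm together with the moving averages that enter the Lyapunov function:
client parameters, client weights, averaged responsibilities, averaged weights, and the lag of
the averaged mean iterate. -/
abbrev Tracked (Q : FedProblem 𝒳 𝒴 𝒜 T M d) : Type :=
  (Fin T → Params M d) × (Fin T → Fin M → ℝ) × (Sample Q → Fin M → ℝ) × (Fin T → Fin M → ℝ) ×
    Params M d

section Defs

variable (Q : FedProblem 𝒳 𝒴 𝒜 T M d)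

/-- The moving averages start at the first responsibilities and weights. -/
noncomputable def trackInit (S₀ : FedProblem.ClientState T M d) : Tracked Q :=
  (S₀.Θ, S₀.π, resp (client Q) (lossAt Q) S₀.Θ S₀.π,
    fun t m => Q.mixtureUpdate (S₀.Θ t) (S₀.π t) t m, 0)

variable {Q}

/-- One round of the algorithm, and one step of the moving averages with rate `κ`. -/
noncomputable def trackStep (𝓑 : Q.BatchScheme) (η κ : ℝ) (J : ℕ) (W : Fin T → Fin T → ℝ)
    (b : (t : Fin T) → Fin M → ℕ → 𝓑.Batch t) (z : Tracked Q) : Tracked Q :=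
  (FedProblem.mix (fun t => 𝓑.localRound η J ⟨z.1, z.2.1⟩ t (b t)) W,
    fun t m => Q.mixtureUpdate (z.1 t) (z.2.1 t) t m,
    fun s m => (1 - κ) * z.2.2.1 s m + κ * resp (client Q) (lossAt Q) z.1 z.2.1 s m,
    fun t m => (1 - κ) * z.2.2.2.1 t m + κ * Q.mixtureUpdate (z.1 t) (z.2.1 t) t m,
    (1 - κ) • (z.2.2.2.2 - (FedProblem.average z.1
      - FedProblem.average fun t => 𝓑.localRound η J ⟨z.1, z.2.1⟩ t (b t))))

/-- The trajectory of the algorithm with its moving averages. -/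
noncomputable def track (𝓑 : Q.BatchScheme) (η κ : ℝ) (J : ℕ)
    (S₀ : FedProblem.ClientState T M d) (W : ℕ → Fin T → Fin T → ℝ)
    (b : ℕ → (t : Fin T) → Fin M → ℕ → 𝓑.Batch t) : ℕ → Tracked Q
  | 0 => trackInit Q S₀
  | k + 1 => trackStep 𝓑 η κ J (W k) (b k) (track 𝓑 η κ J S₀ W b k)

lemma track_eq_iterate (𝓑 : Q.BatchScheme) (η κ : ℝ) (J : ℕ)
    (S₀ : FedProblem.ClientState T M d) (W : ℕ → Fin T → Fin T → ℝ)
    (b : ℕ → (t : Fin T) → Fin M → ℕ → 𝓑.Batch t) (k : ℕ) :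
    𝓑.iterate η J S₀ W b k
      = ⟨(track 𝓑 η κ J S₀ W b k).1, (track 𝓑 η κ J S₀ W b k).2.1⟩ := by
  induction k with
  | zero => rfl
  | succ k ih => rw [FedProblem.BatchScheme.iterate, ih]; rfl

/-- The Lyapunov function along the trajectory. -/
noncomputable def trackLyap (r κ : ℝ) (z : Tracked Q) : ℝ :=
  lyapunov (client Q) (lossAt Q) r κ (FedProblem.average z.1) z.2.1 z.2.2.1 z.2.2.2.1 z.2.2.2.2

/-- The scaled divergence of the averaged weights from the weights. -/
noncomputable def trackKL (κ : ℝ) (z : Tracked Q) : ℝ :=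
  κ * clientKL (client Q) z.2.2.2.1 z.2.1

/-- The free energy along the trajectory. -/
noncomputable def trackEnergy (z : Tracked Q) : ℝ := freeEnergy (client Q) (lossAt Q) z.1 z.2.1

/-- The noise in the increment of the Lyapunov function. -/
noncomputable def trackNoise (𝓑 : Q.BatchScheme) (J : ℕ) (r κ : ℝ) (z : Tracked Q)
    (b : (t : Fin T) → Fin M → ℕ → 𝓑.Batch t) : ℝ :=
  inner ℝ (noiseCoeff (lossAt Q) r κ (FedProblem.average z.1) z.2.2.1 z.2.2.2.2)
    (roundNoise 𝓑 J z.1 z.2.1 b)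

/-- The gradient at the mean iterate, weighted with the responsibilities that the clients
compute. -/
noncomputable def trackGrad (z : Tracked Q) : Params M d :=
  gradVec (lossAt Q) (fun _ => FedProblem.average z.1) (resp (client Q) (lossAt Q) z.1 z.2.1)

end Defs

variable {Q : FedProblem 𝒳 𝒴 𝒜 T M d} {𝓑 : Q.BatchScheme} {L : ℝ≥0}

lemma nonempty_sample (hn : ∀ t, 0 < Q.n t) (hT : T ≠ 0) : Nonempty (Sample Q) :=
  ⟨⟨⟨0, Nat.pos_of_ne_zero hT⟩, ⟨0, hn _⟩⟩⟩

lemma comparator_trackInit (hn : ∀ t, 0 < Q.n t) {S₀ : FedProblem.ClientState T M d}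
    (hS₀ : ∀ t, S₀.π t ∈ stdSimplex ℝ (Fin M)) :
    Comparator (client Q) (trackInit Q S₀).2.1 (trackInit Q S₀).2.2.1
      (trackInit Q S₀).2.2.2.1 where
  weights := hS₀
  mem := resp_mem hS₀
  mean := isClientMean_mixtureUpdate hn hS₀
  ac s m h0 := (resp_eq_zero_iff hS₀ s m).2 h0

lemma comparator_trackStep (hn : ∀ t, 0 < Q.n t) [Nonempty (Sample Q)] {η κ : ℝ} {J : ℕ}
    {W : Fin T → Fin T → ℝ} {b : (t : Fin T) → Fin M → ℕ → 𝓑.Batch t} {z : Tracked Q}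
    (hκ0 : 0 ≤ κ) (hκ1 : κ ≤ 1) (hz : Comparator (client Q) z.2.1 z.2.2.1 z.2.2.2.1) :
    Comparator (client Q) (trackStep 𝓑 η κ J W b z).2.1 (trackStep 𝓑 η κ J W b z).2.2.1
      (trackStep 𝓑 η κ J W b z).2.2.2.1 :=
  hz.next (isClientMean_mixtureUpdate hn hz.weights) hκ0 hκ1

/-- The step size and the smoothness constant in the normalization used for the trajectory: `r`
is the step size of the moving averages and `η J / T` the effective step size of a round. -/
structure StepSize (T J : ℕ) (L : ℝ≥0) (r κ η : ℝ) : Prop where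
  r_eq : r = 1 / (64 * L)
  kappa_pos : 0 < κ
  kappa_le : κ ≤ 1
  eta_eq : η * J = r * κ * T
  eta_nonneg : 0 ≤ η
  eta_small : 2 * (η * J * L) ≤ 1

/-- Constant for the second moments of noise, drift and displacement in a round. -/
noncomputable def roundConst (T N : ℕ) (L : ℝ≥0) : ℝ := 8 * L * T ^ 3 * N ^ 2

section Round

variable {r κ η : ℝ} {J : ℕ} {W : Fin T → Fin T → ℝ}
  {b : (t : Fin T) → Fin M → ℕ → 𝓑.Batch t} {z : Tracked Q}

lemma le_roundConst (hl : SmoothLoss (lossAt Q) L) (hT : T ≠ 0) [Nonempty (Sample Q)] :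
    (L : ℝ) ≤ roundConst T Q.total L ∧ 8 ≤ roundConst T Q.total L
      ∧ 8 * L * T * (Q.total : ℝ) ^ 2 ≤ roundConst T Q.total L
      ∧ 8 * L * T ^ 2 * (Q.total : ℝ) ^ 2 ≤ roundConst T Q.total L := by
  have h1 : (1 : ℝ) ≤ L := by exact_mod_cast hl.one_le
  have h2 : (1 : ℝ) ≤ T := by exact_mod_cast Nat.one_le_iff_ne_zero.2 hT
  have h3 : (1 : ℝ) ≤ Q.total := by
    rw [← card_sample]; exact_mod_cast Fintype.card_pos
  have h4 : (1 : ℝ) ≤ (Q.total : ℝ) ^ 2 := one_le_pow₀ h3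
  have h5 : (T : ℝ) ≤ (T : ℝ) ^ 3 := le_self_pow₀ h2 (by norm_num)
  have h6 : (T : ℝ) ^ 2 ≤ (T : ℝ) ^ 3 := pow_le_pow_right₀ h2 (by norm_num)
  have h7 : (1 : ℝ) ≤ T ^ 3 := h2.trans h5
  have h8 : (1 : ℝ) ≤ T ^ 3 * (Q.total : ℝ) ^ 2 := one_le_mul_of_one_le_of_one_le h7 h4
  have e : roundConst T Q.total L = 8 * L * (T ^ 3 * (Q.total : ℝ) ^ 2) := by
    unfold roundConst; ring
  refine ⟨?_, ?_, ?_, ?_⟩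
  · rw [e]; nlinarith
  · rw [e]; nlinarith
  · unfold roundConst; gcongr
  · unfold roundConst; gcongr

lemma StepSize.r_pos (h : StepSize T J L r κ η) (hL : 1 ≤ L) : 0 < r := by
  have : (1 : ℝ) ≤ L := by exact_mod_cast hL
  rw [h.r_eq]; positivity

lemma StepSize.r_mul (h : StepSize T J L r κ η) (hL : 1 ≤ L) : 64 * (L * r) = 1 := by
  have : (1 : ℝ) ≤ L := by exact_mod_cast hL
  rw [h.r_eq]; field_simp

lemma StepSize.r_le_one (h : StepSize T J L r κ η) (hL : 1 ≤ L) : r ≤ 1 := by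
  have h1 : (1 : ℝ) ≤ L := by exact_mod_cast hL
  have := h.r_mul hL
  have := h.r_pos hL
  nlinarith

lemma StepSize.sq_le (h : StepSize T J L r κ η) (hL : 1 ≤ L) :
    (J : ℝ) ^ 2 * η ^ 2 ≤ T ^ 2 * κ ^ 2 := by
  have h1 : (J : ℝ) ^ 2 * η ^ 2 = r ^ 2 * (T ^ 2 * κ ^ 2) := by
    rw [← mul_pow, mul_comm (J : ℝ), h.eta_eq]; ring
  have h2 : r ^ 2 ≤ 1 := pow_le_one₀ (h.r_pos hL).le (h.r_le_one hL)
  rw [h1]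
  exact mul_le_of_le_one_left (by positivity) h2

variable [Nonempty (Sample Q)]

omit [Nonempty (Sample Q)] in
/-- Displacement of the mean iterate in one round. -/
lemma average_displacement (hn : ∀ t, 0 < Q.n t) (hT : T ≠ 0) (hJ : 1 ≤ J)
    (hs : StepSize T J L r κ η) (b : (t : Fin T) → Fin M → ℕ → 𝓑.Batch t) (z : Tracked Q) :
    FedProblem.average z.1 - FedProblem.average (fun t => 𝓑.localRound η J ⟨z.1, z.2.1⟩ t (b t))
      = (r * κ) • (gradVec (lossAt Q) (fun s => z.1 (client Q s))
          (resp (client Q) (lossAt Q) z.1 z.2.1) + roundNoise 𝓑 J z.1 z.2.1 b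
          + roundDrift 𝓑 η J z.1 z.2.1 b) := by
  have : (T : ℝ) ≠ 0 := by exact_mod_cast hT
  rw [average_sub_localRound hn η hJ, hs.eta_eq, mul_div_cancel_right₀ _ this]

lemma roundNoise_sq_le (hl : SmoothLoss (lossAt Q) L) (hT : T ≠ 0) (hJ : 1 ≤ J)
    (hz : ∀ t, z.2.1 t ∈ stdSimplex ℝ (Fin M)) :
    ‖roundNoise 𝓑 J z.1 z.2.1 b‖ ^ 2 ≤ roundConst T Q.total L * trackEnergy z :=
  (norm_roundNoise_sq_le hl hz hJ b).trans <|
    mul_le_mul_of_nonneg_right (le_roundConst hl hT).2.2.1 (freeEnergy_nonneg hl hz)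

omit [Nonempty (Sample Q)] in
lemma roundDrift_sq_le (hl : SmoothLoss (lossAt Q) L) (hJ : 1 ≤ J)
    (hs : StepSize T J L r κ η) (hz : ∀ t, z.2.1 t ∈ stdSimplex ℝ (Fin M)) :
    ‖roundDrift 𝓑 η J z.1 z.2.1 b‖ ^ 2
      ≤ roundConst T Q.total L * (κ ^ 2 * trackEnergy z) := by
  have hF : 0 ≤ trackEnergy z := freeEnergy_nonneg hl hz
  refine (norm_roundDrift_sq_le hl hz hs.eta_nonneg hJ hs.eta_small b).trans ?_
  have h1 : (J : ℝ) ^ 2 * η ^ 2 = r ^ 2 * (T ^ 2 * κ ^ 2) := by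
    rw [← mul_pow, mul_comm (J : ℝ), hs.eta_eq]; ring
  have h2 : (L * r) ^ 2 ≤ 1 := by
    have := hs.r_mul hl.one_le
    have e : (L * r) = 1 / 64 := by linarith
    rw [e]; norm_num
  calc _ = 8 * L * T * Q.total ^ 2 * L ^ 2 * (J ^ 2 * η ^ 2) * trackEnergy z := by
        unfold trackEnergy; ring
    _ = 8 * L * T ^ 3 * Q.total ^ 2 * (κ ^ 2 * trackEnergy z) * (L * r) ^ 2 := by rw [h1]; ring
    _ ≤ 8 * L * T ^ 3 * Q.total ^ 2 * (κ ^ 2 * trackEnergy z) * 1 := by gcongr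
    _ = _ := by unfold roundConst; ring

lemma displacement_sq_le (hl : SmoothLoss (lossAt Q) L) (hT : T ≠ 0)
    (hs : StepSize T J L r κ η) (hz : ∀ t, z.2.1 t ∈ stdSimplex ℝ (Fin M)) :
    ∑ t, ‖𝓑.localRound η J ⟨z.1, z.2.1⟩ t (b t) - z.1 t‖ ^ 2
      ≤ roundConst T Q.total L * (κ ^ 2 * trackEnergy z) := by
  have hF : 0 ≤ trackEnergy z := freeEnergy_nonneg hl hz
  refine (sum_norm_localRound_sub_sq_le hl hz hs.eta_nonneg hs.eta_small b).trans ?_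
  have h1 := hs.sq_le hl.one_le
  calc _ = 8 * L * Q.total ^ 2 * (J ^ 2 * η ^ 2) * trackEnergy z := by unfold trackEnergy; ring
    _ ≤ 8 * L * Q.total ^ 2 * (T ^ 2 * κ ^ 2) * trackEnergy z := by gcongr
    _ = 8 * L * T ^ 2 * Q.total ^ 2 * (κ ^ 2 * trackEnergy z) := by ring
    _ ≤ _ := mul_le_mul_of_nonneg_right (le_roundConst hl hT).2.2.2 (by positivity)

lemma norm_average_sq_le (Ξ : Fin T → Params M d) :
    ‖FedProblem.average Ξ‖ ^ 2 ≤ ∑ t, ‖Ξ t‖ ^ 2 := by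
  have h := norm_avg_sq_le Ξ
  have e : avg Ξ = FedProblem.average Ξ := by simp [avg, FedProblem.average]
  rw [e] at h
  refine h.trans ?_
  rw [avg, Fintype.card_fin, smul_eq_mul]
  refine inv_natCast_mul_le (Finset.sum_nonneg fun _ _ => sq_nonneg _) ?_
  rcases Nat.eq_zero_or_pos T with rfl | hT
  · simp
  · exact le_mul_of_one_le_left (Finset.sum_nonneg fun _ _ => sq_nonneg _) (by exact_mod_cast hT)

lemma spread_trackStep_le (hl : SmoothLoss (lossAt Q) L) (hT : T ≠ 0)
    (hs : StepSize T J L r κ η) (hz : ∀ t, z.2.1 t ∈ stdSimplex ℝ (Fin M))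
    (hW : Matrix.of W ∈ doublyStochastic ℝ (Fin T)) :
    spread (trackStep 𝓑 η κ J W b z).1
      ≤ 2 * spread z.1 + 2 * (roundConst T Q.total L * (κ ^ 2 * trackEnergy z)) := by
  refine (spread_mix_le hW _).trans ?_
  have h := spread_add_le hT z.1 fun t => 𝓑.localRound η J ⟨z.1, z.2.1⟩ t (b t) - z.1 t
  simp only [add_sub_cancel] at h
  have := displacement_sq_le (b := b) hl hT hs hz
  linarith

omit [Nonempty (Sample Q)] in
lemma average_trackStep (hW : Matrix.of W ∈ doublyStochastic ℝ (Fin T)) (η κ : ℝ) (J : ℕ) :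
    FedProblem.average (trackStep 𝓑 η κ J W b z).1
      = FedProblem.average z.1 - (FedProblem.average z.1
        - FedProblem.average fun t => 𝓑.localRound η J ⟨z.1, z.2.1⟩ t (b t)) := by
  rw [sub_sub_cancel]
  exact average_mix hW _

lemma norm_trackStep_sub_sq_le (hl : SmoothLoss (lossAt Q) L) (hT : T ≠ 0)
    (hs : StepSize T J L r κ η) (hz : ∀ t, z.2.1 t ∈ stdSimplex ℝ (Fin M))
    (hW : Matrix.of W ∈ doublyStochastic ℝ (Fin T)) (t : Fin T) :
    ‖(trackStep 𝓑 η κ J W b z).1 t - z.1 t‖ ^ 2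
      ≤ 9 * (spread z.1 + roundConst T Q.total L * (κ ^ 2 * trackEnergy z)) := by
  set z' := trackStep 𝓑 η κ J W b z with hz'
  have e : z'.1 t - z.1 t = (z'.1 t - FedProblem.average z'.1)
      + (FedProblem.average z'.1 - FedProblem.average z.1) + (FedProblem.average z.1 - z.1 t) := by
    abel
  have h1 := norm_sub_average_sq_le z'.1 t
  have h2 := norm_sub_average_sq_le z.1 t
  have h3 := spread_trackStep_le (b := b) hl hT hs hz hW
  have h4 : ‖FedProblem.average z'.1 - FedProblem.average z.1‖ ^ 2
      ≤ roundConst T Q.total L * (κ ^ 2 * trackEnergy z) := by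
    rw [hz', average_trackStep hW, sub_sub_cancel]
    have : FedProblem.average (fun t => 𝓑.localRound η J ⟨z.1, z.2.1⟩ t (b t))
        - FedProblem.average z.1
        = FedProblem.average fun t => 𝓑.localRound η J ⟨z.1, z.2.1⟩ t (b t) - z.1 t := by
      simp [FedProblem.average, Finset.sum_sub_distrib, smul_sub]
    rw [this]
    exact (norm_average_sq_le _).trans (displacement_sq_le hl hT hs hz)
  rw [e]
  refine (norm_add_sq_le_three _ _ _).trans ?_
  rw [norm_sub_rev (FedProblem.average z.1)]
  have := spread_nonneg z.1
  linarith

lemma norm_trackNoise_sq_le (hl : SmoothLoss (lossAt Q) L) (hT : T ≠ 0) (hJ : 1 ≤ J)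
    (hs : StepSize T J L r κ η) (hz : Comparator (client Q) z.2.1 z.2.2.1 z.2.2.2.1) :
    trackNoise 𝓑 J r κ z b ^ 2
      ≤ 50 * roundConst T Q.total L * κ ^ 2 * (trackLyap r κ z * trackEnergy z) := by
  have hr0 := hs.r_pos hl.one_le
  have hr8 : 8 * L * r ≤ 1 := by have := hs.r_mul hl.one_le; nlinarith
  have h1 := hz.norm_noiseCoeff_sq_le hl hr0 hr8 hs.kappa_pos.le hs.kappa_le
    (FedProblem.average z.1) z.2.2.2.2
  have h2 := roundNoise_sq_le (b := b) hl hT hJ hz.weights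
  calc _ ≤ ‖noiseCoeff (lossAt Q) r κ (FedProblem.average z.1) z.2.2.1 z.2.2.2.2‖ ^ 2
        * ‖roundNoise 𝓑 J z.1 z.2.1 b‖ ^ 2 := by
        rw [← mul_pow]
        exact sq_le_sq' (neg_le_of_abs_le (abs_real_inner_le_norm _ _)) (real_inner_le_norm _ _)
    _ ≤ (50 * κ ^ 2 * trackLyap r κ z) * (roundConst T Q.total L * trackEnergy z) :=
        mul_le_mul h1 h2 (sq_nonneg _) ((sq_nonneg _).trans h1)
    _ = _ := by ring

end Round

section Path

variable {r κ η : ℝ} {J R : ℕ} {W : ℕ → Fin T → Fin T → ℝ}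
  {b : ℕ → (t : Fin T) → Fin M → ℕ → 𝓑.Batch t} {z : ℕ → Tracked Q}

/-- Constant for the bounds along a trajectory that is divided into blocks of `R` rounds. -/
noncomputable def trackConst (T N R : ℕ) (L : ℝ≥0) : ℝ := 100 * R * roundConst T N L ^ 2

lemma comparator_track (hn : ∀ t, 0 < Q.n t) [Nonempty (Sample Q)]
    {S₀ : FedProblem.ClientState T M d} (hS₀ : ∀ t, S₀.π t ∈ stdSimplex ℝ (Fin M))
    (hκ0 : 0 ≤ κ) (hκ1 : κ ≤ 1) (k : ℕ) :
    Comparator (client Q) (track 𝓑 η κ J S₀ W b k).2.1 (track 𝓑 η κ J S₀ W b k).2.2.1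
      (track 𝓑 η κ J S₀ W b k).2.2.2.1 := by
  induction k with
  | zero => exact comparator_trackInit hn hS₀
  | succ k ih => exact comparator_trackStep hn hκ0 hκ1 ih

variable [Nonempty (Sample Q)]

lemma le_trackConst (hl : SmoothLoss (lossAt Q) L) (hT : T ≠ 0) (hR : 1 ≤ R) :
    100 * roundConst T Q.total L ^ 2 ≤ trackConst T Q.total R L
      ∧ 100 * R * roundConst T Q.total L ≤ trackConst T Q.total R L
      ∧ 100 * roundConst T Q.total L ≤ trackConst T Q.total R L
      ∧ 1 ≤ trackConst T Q.total R L := by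
  have h8 := (le_roundConst hl hT).2.1
  have hR1 : (1 : ℝ) ≤ R := by exact_mod_cast hR
  set c := roundConst T Q.total L
  have h1 : c ≤ c ^ 2 := by nlinarith
  have h2 : 100 * c ^ 2 ≤ 100 * R * c ^ 2 := by
    have : 0 ≤ c ^ 2 := sq_nonneg _
    nlinarith
  have h3 : 100 * R * c ≤ 100 * R * c ^ 2 := by gcongr
  have e : trackConst T Q.total R L = 100 * R * c ^ 2 := rfl
  rw [e]
  exact ⟨h2, h3, by linarith, by linarith⟩

/-- The quantities along a trajectory satisfy the one-round bounds. -/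
theorem roundBounds_track (hn : ∀ t, 0 < Q.n t) (hl : SmoothLoss (lossAt Q) L) (hT : T ≠ 0)
    (hJ : 1 ≤ J) (hR : 1 ≤ R) (hs : StepSize T J L r κ η)
    (hW : ∀ k, Matrix.of (W k) ∈ doublyStochastic ℝ (Fin T))
    (hz : ∀ k, Comparator (client Q) (z k).2.1 (z k).2.2.1 (z k).2.2.2.1)
    (hstep : ∀ k, z (k + 1) = trackStep 𝓑 η κ J (W k) (b k) (z k)) :
    RoundBounds (trackConst T Q.total R L) κ (fun k => trackLyap r κ (z k))
      (fun k => trackKL κ (z k)) (fun k => trackEnergy (z k)) (fun k => spread (z k).1)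
      (fun k => trackNoise 𝓑 J r κ (z k) (b k)) := by
  have hr0 := hs.r_pos hl.one_le
  have hr8 : 8 * L * r ≤ 1 := by have := hs.r_mul hl.one_le; nlinarith
  have hκ0 := hs.kappa_pos
  have hκ1 := hs.kappa_le
  obtain ⟨hC1, -, hC2, hC3⟩ := le_trackConst (Q := Q) hl hT hR
  obtain ⟨hcL, hc8, -, -⟩ := le_roundConst hl hT
  have hm : ∀ k, IsClientMean (client Q) (resp (client Q) (lossAt Q) (z k).1 (z k).2.1)
      (z (k + 1)).2.1 := fun k => by
    rw [hstep]; exact isClientMean_mixtureUpdate hn (hz k).weights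
  have hD0 : ∀ k, 0 ≤ spread (z k).1 := fun k => spread_nonneg _
  have hF0 : ∀ k, 0 ≤ trackEnergy (z k) := fun k => freeEnergy_nonneg hl (hz k).weights
  have hΛ0 : ∀ k, 0 ≤ trackLyap r κ (z k) := fun k =>
    (hz k).lyapunov_nonneg hl hr0 hr8 hκ0.le _ _
  have hD : ∀ k (s : Sample Q), ‖(z k).1 (client Q s) - FedProblem.average (z k).1‖ ^ 2
      ≤ spread (z k).1 := fun k s => norm_sub_average_sq_le _ _
  set c := roundConst T Q.total L with hc
  set C := trackConst T Q.total R L with hC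
  exact {
    X_nonneg := fun k => mul_nonneg hκ0.le (hz k).kl_nonneg
    X_le := fun k => by
      have h1 := (hz k).lyapunov_ge hl hr0 hr8 (k := κ) (FedProblem.average (z k).1)
        (z k).2.2.2.2
      have h2 := risk_nonneg hl (hz k).mem
        (fun _ => FedProblem.average (z k).1 - (z k).2.2.2.2)
      have h3 := (hz k).info_nonneg
      have h4 : 0 ≤ 3 * r * ‖gradVec (lossAt Q)
          (fun _ => FedProblem.average (z k).1 - (z k).2.2.2.2) (z k).2.2.1
          + r⁻¹ • (z k).2.2.2.2‖ ^ 2 := by positivity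
      unfold trackKL trackLyap
      linarith only [h1, h2, h3, h4]
    F_nonneg := hF0
    D_nonneg := hD0
    lyap := fun k => by
      have h := (hz k).lyapunov_next_le hl (hm k) hs.r_eq hκ0 hκ1 (FedProblem.average (z k).1)
        (z k).2.2.2.2 _ _ _ (hD0 k) (hD k) hcL (average_displacement hn hT hJ hs (b k) (z k))
        (roundNoise_sq_le hl hT hJ (hz k).weights)
        (roundDrift_sq_le hl hJ hs (hz k).weights)
      rw [← average_trackStep (hW k) η κ J] at h
      have h5 : 100 * c ^ 2 * (κ ^ 2 * trackEnergy (z k) + κ ^ 2 * trackLyap r κ (z k)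
          + spread (z k).1) ≤ C * (κ ^ 2 * trackEnergy (z k) + κ ^ 2 * trackLyap r κ (z k)
          + spread (z k).1) := by
        refine mul_le_mul_of_nonneg_right hC1 ?_
        have := mul_nonneg (sq_nonneg κ) (hF0 k)
        have := mul_nonneg (sq_nonneg κ) (hΛ0 k)
        linarith only [this, hD0 k, mul_nonneg (sq_nonneg κ) (hF0 k)]
      refine le_trans ?_ (add_le_add_right h5 _)
      rw [hstep k] at h ⊢
      exact h
    noise := fun k => by
      refine (norm_trackNoise_sq_le hl hT hJ hs (hz k)).trans ?_
      have := mul_nonneg (hΛ0 k) (hF0 k)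
      gcongr
      linarith only [hC2, hc8]
    energy := fun k a ha0 ha1 => by
      have h1 := freeEnergy_next_le hl (hz k).weights (hm k) ha0
        (norm_trackStep_sub_sq_le (b := b k) hl hT hs (hz k).weights (hW k))
      rw [← hstep k] at h1
      have h2 : L / 2 * (1 + 1 / a) ≤ L / a := by
        have : 1 ≤ 1 / a := (one_le_div ha0).2 ha1
        have hL : (0 : ℝ) ≤ L := L.2
        calc L / 2 * (1 + 1 / a) ≤ L / 2 * (1 / a + 1 / a) := by gcongr
          _ = L / a := by ring
      refine h1.trans (add_le_add_right ?_ _)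
      have h3 := mul_nonneg (sq_nonneg κ) (hF0 k)
      have h4 : (0 : ℝ) ≤ spread (z k).1 + c * (κ ^ 2 * trackEnergy (z k)) := by
        have := hD0 k; positivity
      calc _ ≤ L / a * (9 * (spread (z k).1 + c * (κ ^ 2 * trackEnergy (z k)))) := by gcongr
        _ ≤ c / a * (9 * (c * spread (z k).1 + c * (κ ^ 2 * trackEnergy (z k)))) := by
            gcongr
            exact le_mul_of_one_le_left (hD0 k) (by linarith only [hc8])
        _ = (9 * c ^ 2) / a * (spread (z k).1 + κ ^ 2 * trackEnergy (z k)) := by ring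
        _ ≤ _ := by
            have := hD0 k
            gcongr
            nlinarith only [hC1, sq_nonneg c]
    kl := fun k => by
      have h := (hz k).kl_next_le_lyapunov hl (hm k) hr0 hr8 hκ0.le hκ1
        (FedProblem.average (z k).1) (z k).2.2.2.2 (hD k)
      have e : trackKL κ (z (k + 1)) = κ * clientKL (client Q)
          (fun t m => (1 - κ) * (z k).2.2.2.1 t m + κ * (z (k + 1)).2.1 t m)
          (z (k + 1)).2.1 := by
        rw [hstep k]; rfl
      rw [e]
      refine h.trans (add_le_add_right (mul_le_mul_of_nonneg_left ?_ hκ0.le) _)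
      have h1 : 4 * trackLyap r κ (z k) ≤ C * trackLyap r κ (z k) :=
        mul_le_mul_of_nonneg_right (by linarith only [hC2, hc8]) (hΛ0 k)
      have h2 : 2 * L * spread (z k).1 ≤ C * spread (z k).1 :=
        mul_le_mul_of_nonneg_right (by linarith only [hC2, hcL, hc8]) (hD0 k)
      unfold trackLyap trackEnergy at *
      linarith only [h1, h2]
    energy_le := fun k => by
      have h := (hz k).mul_freeEnergy_le (Θ := (z k).1) hl hr0 hr8 hκ0.le hκ1
        (FedProblem.average (z k).1) (z k).2.2.2.2 (hD0 k) (hD k)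
      have h1 : 5 * trackLyap r κ (z k) ≤ C * trackLyap r κ (z k) :=
        mul_le_mul_of_nonneg_right (by linarith only [hC2, hc8]) (hΛ0 k)
      have h2 : 2 * L * spread (z k).1 ≤ C * spread (z k).1 :=
        mul_le_mul_of_nonneg_right (by linarith only [hC2, hcL, hc8]) (hD0 k)
      unfold trackLyap trackEnergy at *
      linarith only [h, h1, h2]
    spread := fun k => by
      have h := spread_trackStep_le (b := b k) hl hT hs (hz k).weights (hW k)
      rw [← hstep k] at h
      have h3 := mul_nonneg (sq_nonneg κ) (hF0 k)
      have h1 : 2 * spread (z k).1 ≤ C * spread (z k).1 :=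
        mul_le_mul_of_nonneg_right (by linarith only [hC2, hc8]) (hD0 k)
      have h2 : 2 * c * (κ ^ 2 * trackEnergy (z k)) ≤ C * (κ ^ 2 * trackEnergy (z k)) :=
        mul_le_mul_of_nonneg_right (by linarith only [hC2, hc8]) h3
      linarith only [h, h1, h2] }

/-- Contraction of the consensus distance over a block of `R` rounds. -/
lemma spread_track_block (hl : SmoothLoss (lossAt Q) L) (hT : T ≠ 0)
    (hR : 1 ≤ R) (hs : StepSize T J L r κ η)
    (hW : ∀ k, Matrix.of (W k) ∈ doublyStochastic ℝ (Fin T))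
    (hsym : ∀ k, (Matrix.of (W k)).IsSymm)
    (hz : ∀ k t, (z k).2.1 t ∈ stdSimplex ℝ (Fin M))
    (hstep : ∀ k, z (k + 1) = trackStep 𝓑 η κ J (W k) (b k) (z k)) (a : ℕ) :
    spread (z (a + R)).1
      ≤ 2 * min 1 (frobDist (FedProblem.windowProd W a R)) * spread (z a).1
        + trackConst T Q.total R L * κ ^ 2 * ∑ i ∈ Finset.range R, trackEnergy (z (a + i)) := by
  have h := spread_le_of_rounds hT hW hsym (Θ := fun k => (z k).1)
    (V := fun k t => (z k).1 t - 𝓑.localRound η J ⟨(z k).1, (z k).2.1⟩ t (b k t))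
    (fun k => by rw [hstep k]; simp only [sub_sub_cancel]; rfl) a R
  refine h.trans (add_le_add_right ?_ _)
  have h1 : ∀ i, ∑ t, ‖(z (a + i)).1 t
      - 𝓑.localRound η J ⟨(z (a + i)).1, (z (a + i)).2.1⟩ t (b (a + i) t)‖ ^ 2
      ≤ roundConst T Q.total L * (κ ^ 2 * trackEnergy (z (a + i))) := fun i => by
    simp only [norm_sub_rev ((z (a + i)).1 _)]
    exact displacement_sq_le hl hT hs (hz _)
  have h2 : 0 ≤ ∑ i ∈ Finset.range R, trackEnergy (z (a + i)) :=
    Finset.sum_nonneg fun i _ => freeEnergy_nonneg hl (hz _)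
  have h3 := (le_trackConst (Q := Q) hl hT hR).2.1
  have h4 := (le_roundConst (Q := Q) hl hT).2.1
  calc _ ≤ 2 * (R * ∑ i ∈ Finset.range R,
        roundConst T Q.total L * (κ ^ 2 * trackEnergy (z (a + i)))) := by
        gcongr with i _
        exact h1 i
    _ = (2 * R * roundConst T Q.total L) * (κ ^ 2 * ∑ i ∈ Finset.range R,
        trackEnergy (z (a + i))) := by rw [← Finset.mul_sum, ← Finset.mul_sum]; ring
    _ ≤ (100 * R * roundConst T Q.total L) * (κ ^ 2 * ∑ i ∈ Finset.range R,
        trackEnergy (z (a + i))) := by gcongr; norm_num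
    _ ≤ trackConst T Q.total R L * (κ ^ 2 * ∑ i ∈ Finset.range R,
        trackEnergy (z (a + i))) := by gcongr
    _ = _ := by ring

/-- Descent of the likelihood along a trajectory. -/
lemma likelihood_track_le (hn : ∀ t, 0 < Q.n t) (hl : SmoothLoss (lossAt Q) L) (hT : T ≠ 0)
    (hJ : 1 ≤ J) (hs : StepSize T J L r κ η)
    (hW : ∀ k, Matrix.of (W k) ∈ doublyStochastic ℝ (Fin T))
    (hz : ∀ k t, (z k).2.1 t ∈ stdSimplex ℝ (Fin M))
    (hstep : ∀ k, z (k + 1) = trackStep 𝓑 η κ J (W k) (b k) (z k)) (k : ℕ) :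
    freeEnergy (client Q) (lossAt Q) (fun _ => FedProblem.average (z (k + 1)).1) (z (k + 1)).2.1
        + clientKL (client Q) (z (k + 1)).2.1 (z k).2.1
        + r * κ / 8 * ‖gradVec (lossAt Q) (fun _ => FedProblem.average (z k).1)
          (resp (client Q) (lossAt Q) (fun _ => FedProblem.average (z k).1) (z k).2.1)‖ ^ 2
      ≤ freeEnergy (client Q) (lossAt Q) (fun _ => FedProblem.average (z k).1) (z k).2.1
        - r * κ * inner ℝ (trackGrad (z k)) (roundNoise 𝓑 J (z k).1 (z k).2.1 (b k))
        + 100 * Q.total * roundConst T Q.total L ^ 2 * (spread (z k).1 * trackEnergy (z k)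
          + spread (z k).1 ^ 2 + κ ^ 2 * trackEnergy (z k) ^ 2 + κ ^ 2 * trackEnergy (z k)
          + spread (z k).1) := by
  have hm : IsClientMean (client Q) (resp (client Q) (lossAt Q) (z k).1 (z k).2.1)
      (z (k + 1)).2.1 := by
    rw [hstep]; exact isClientMean_mixtureUpdate hn (hz k)
  have h := likelihood_descent hl (hz k) hm hs.r_eq hs.kappa_pos hs.kappa_le
    (FedProblem.average (z k).1) _ _ _ (spread_nonneg _)
    (fun s => norm_sub_average_sq_le (z k).1 (client Q s)) (le_roundConst hl hT).1
    (average_displacement hn hT hJ hs (b k) (z k))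
    (roundNoise_sq_le hl hT hJ (hz k)) (roundDrift_sq_le hl hJ hs (hz k))
  rw [← average_trackStep (hW k) η κ J, card_sample] at h
  rw [hstep k] at h ⊢
  exact h

end Path

end Track

/-! ### Expected moments along a random trajectory -/

lemma sum_le_of_recursion {a g : ℕ → ℝ} {ε δ : ℝ} {n : ℕ} (hε : 0 ≤ ε) (hδ : 0 ≤ δ)
    (ha : ∀ j, 0 ≤ a j) (hg : ∀ j, 0 ≤ g j)
    (h : ∀ j < n, a (j + 1) ≤ (1 + ε) * a j + δ - g j) :
    ∑ j ∈ Finset.range n, g j ≤ (1 + ε) ^ n * (a 0 + n * δ) := by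
  have key : ∀ k ≤ n, a k + ∑ j ∈ Finset.range k, g j ≤ (1 + ε) ^ k * (a 0 + k * δ) := by
    intro k hk
    induction k with
    | zero => simp
    | succ k ih =>
      have h1 := ih (by omega)
      have h2 := h k (by omega)
      have h3 : 0 ≤ ∑ j ∈ Finset.range k, g j := Finset.sum_nonneg fun _ _ => hg _
      have h4 : 1 ≤ (1 + ε) ^ (k + 1) := one_le_pow₀ (by linarith)
      have h5 := mul_le_mul_of_nonneg_left h1 (show 0 ≤ 1 + ε by linarith)
      have h6 : (1 + ε) * ((1 + ε) ^ k * (a 0 + k * δ)) = (1 + ε) ^ (k + 1) * (a 0 + k * δ) := by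
        rw [pow_succ]; ring
      have h7 : δ ≤ (1 + ε) ^ (k + 1) * δ := le_mul_of_one_le_left hδ h4
      have h8 : 0 ≤ ε * ∑ j ∈ Finset.range k, g j := mul_nonneg hε h3
      rw [Finset.sum_range_succ]
      push_cast
      linarith
  have := key n le_rfl
  linarith [ha n]

/-- Blocks of double length, started at the multiples of `R` below `n R`, cover an initial
segment of length `(n + 1) R`. -/
lemma sum_range_le_sum_blocks {a : ℕ → ℝ} (ha : ∀ k, 0 ≤ a k) (R : ℕ) {n : ℕ} (hn : 1 ≤ n) :
    ∑ k ∈ Finset.range ((n + 1) * R), a k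
      ≤ ∑ j ∈ Finset.range n, ∑ i ∈ Finset.range (2 * R), a (j * R + i) := by
  induction n, hn using Nat.le_induction with
  | base => simp
  | succ n hn ih =>
    rw [show (n + 1 + 1) * R = (n + 1) * R + R by ring, Finset.sum_range_add,
      Finset.sum_range_succ (n := n)]
    refine add_le_add ih ?_
    rw [show 2 * R = R + R by ring, Finset.sum_range_add]
    have h1 : 0 ≤ ∑ i ∈ Finset.range R, a (n * R + i) := Finset.sum_nonneg fun _ _ => ha _
    have h2 : ∀ i, (n + 1) * R + i = n * R + (R + i) := fun i => by ring
    simp only [h2]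
    linarith

/-- The quantity whose sum over the rounds is bounded in expectation. -/
def moment (κ F D : ℝ) : ℝ := κ ^ 2 * F ^ 2 + F * D + D ^ 2 + D

lemma moment_nonneg {κ F D : ℝ} (hF : 0 ≤ F) (hD : 0 ≤ D) : 0 ≤ moment κ F D := by
  unfold moment; positivity

lemma RoundBounds.moment_le {C κ : ℝ} {Λ X F D N : ℕ → ℝ} (h : RoundBounds C κ Λ X F D N)
    (hC : 1 ≤ C) (hκ0 : 0 ≤ κ) (hκ1 : κ ≤ 1) (b : ℕ) {R i : ℕ} (hi : i ≤ R) :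
    moment κ (F (b + i)) (D (b + i))
      ≤ 6 * blockConst C R ^ 2 * (moment κ (F b) (D b) + κ ^ 2) := by
  obtain ⟨h1, h2, -⟩ := h.inside hC hκ0 hκ1 b hi
  have hB := one_le_blockConst hC R
  set B := blockConst C R
  have hF := h.F_nonneg b
  have hD := h.D_nonneg b
  have hF' := h.F_nonneg (b + i)
  have hD' := h.D_nonneg (b + i)
  have hk : κ ^ 2 ≤ 1 := pow_le_one₀ hκ0 hκ1
  have hk0 : 0 ≤ κ ^ 2 := sq_nonneg κ
  set k2 := κ ^ 2
  set f := F b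
  set e := D b
  have h3 : D (b + i) ≤ B * (e + k2 * f) := by
    have := mul_nonneg hk0 hF'
    linarith
  have hB2 : B ≤ B ^ 2 := by nlinarith
  have hkf : 0 ≤ k2 * f := by positivity
  have e1 : k2 * F (b + i) ^ 2 ≤ B ^ 2 * (2 * (k2 * f ^ 2) + 2 * e ^ 2) := by
    calc k2 * F (b + i) ^ 2 ≤ k2 * (B * (f + e)) ^ 2 := by gcongr
      _ = B ^ 2 * (k2 * (f + e) ^ 2) := by ring
      _ ≤ _ := by
        gcongr
        nlinarith [mul_nonneg hk0 (sq_nonneg (f - e)), mul_nonneg (sub_nonneg.2 hk) (sq_nonneg e)]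
  have hkk : (k2 * f) ^ 2 ≤ k2 * f ^ 2 := by
    have : k2 * (k2 * f ^ 2) ≤ 1 * (k2 * f ^ 2) := by gcongr
    nlinarith
  have e2 : F (b + i) * D (b + i) ≤ B ^ 2 * (2 * (f * e) + k2 * f ^ 2 + e ^ 2) := by
    calc F (b + i) * D (b + i) ≤ (B * (f + e)) * (B * (e + k2 * f)) := by gcongr
      _ = B ^ 2 * (f * e + k2 * f ^ 2 + e ^ 2 + k2 * (f * e)) := by ring
      _ ≤ _ := by
        have : k2 * (f * e) ≤ 1 * (f * e) := by gcongr
        exact mul_le_mul_of_nonneg_left (by linarith) (sq_nonneg B)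
  have e3 : D (b + i) ^ 2 ≤ B ^ 2 * (2 * e ^ 2 + 2 * (k2 * f ^ 2)) := by
    calc D (b + i) ^ 2 ≤ (B * (e + k2 * f)) ^ 2 := by gcongr
      _ = B ^ 2 * (e + k2 * f) ^ 2 := by ring
      _ ≤ _ := by
        gcongr
        nlinarith [sq_nonneg (e - k2 * f)]
  have e4 : D (b + i) ≤ B ^ 2 * (e + k2 * f ^ 2 + k2) := by
    have h4 : k2 * f ≤ k2 * f ^ 2 + k2 := by nlinarith [sq_nonneg (f - 1)]
    calc D (b + i) ≤ B * (e + k2 * f) := h3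
      _ ≤ B ^ 2 * (e + k2 * f) := by gcongr
      _ ≤ _ := mul_le_mul_of_nonneg_left (by linarith) (sq_nonneg B)
  have e5 : 0 ≤ B ^ 2 * (f * e) := by positivity
  have e6 : 0 ≤ B ^ 2 * e ^ 2 := by positivity
  have e7 : 0 ≤ B ^ 2 * e := by positivity
  have e8 : 0 ≤ B ^ 2 * k2 := by positivity
  have e9 : 0 ≤ B ^ 2 * (k2 * f ^ 2) := by positivity
  unfold moment
  change k2 * F (b + i) ^ 2 + F (b + i) * D (b + i) + D (b + i) ^ 2 + D (b + i)
    ≤ 6 * B ^ 2 * (k2 * f ^ 2 + f * e + e ^ 2 + e + k2)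
  linarith

section Probability

variable {Ω : Type u} [MeasurableSpace Ω] {P : Measure Ω} [IsProbabilityMeasure P]

lemma integrable_comp_of_bounded {E : Type*} [NormedAddCommGroup E] [ProperSpace E]
    [MeasurableSpace E] [BorelSpace E] [SecondCountableTopology E] {V : Ω → E}
    (hV : Measurable V) {B : ℝ} (hB : ∀ᵐ ω ∂P, ‖V ω‖ ≤ B) {f : E → ℝ} (hf : Continuous f) :
    Integrable (fun ω => f (V ω)) P := by
  obtain ⟨c, hc⟩ := (isCompact_closedBall (0 : E) B).exists_bound_of_continuousOn hf.continuousOn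
  refine Integrable.of_bound (hf.measurable.comp hV).aestronglyMeasurable c ?_
  filter_upwards [hB] with ω hω
  exact hc _ (by simpa using hω)

/-- A random trajectory that satisfies the one-round bounds, whose noise is centered given the
past, and whose mixing contracts each of the first `n` blocks of `R` rounds in mean. -/
structure RandomBounds (P : Measure Ω) (C κ B₀ : ℝ) (R n : ℕ) (Λ X F D N : ℕ → Ω → ℝ)
    (ρ : ℕ → Ω → ℝ) : Prop where
  bounds : ∀ᵐ ω ∂P, RoundBounds C κ (fun k => Λ k ω) (fun k => X k ω) (fun k => F k ω)
    (fun k => D k ω) (fun k => N k ω)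
  rho_mem : ∀ j ω, ρ j ω ∈ Set.Icc (0 : ℝ) 1
  mixing : ∀ᵐ ω ∂P, ∀ j, D (j * R + R) ω ≤ 2 * ρ j ω * D (j * R) ω
    + C * κ ^ 2 * ∑ i ∈ Finset.range R, F (j * R + i) ω
  meas : ∀ k, Measurable fun ω => (Λ k ω, X k ω, F k ω, D k ω, N k ω)
  rho_meas : ∀ j, Measurable (ρ j)
  initial : ∀ ω, Λ 0 ω ≤ B₀ ∧ F 0 ω ≤ B₀ ∧ D 0 ω ≤ B₀
  noise : ∀ C' b i, ∫ ω, potentialNoise C' κ (Λ b ω) (X b ω) (F b ω) (D b ω) * N (b + i) ω ∂P = 0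
  contraction : ∀ C', ∀ j < n,
    ∫ ω, potentialMix C' κ (Λ (j * R) ω) (X (j * R) ω) (F (j * R) ω) (D (j * R) ω) * ρ j ω ∂P
      = (∫ ω, potentialMix C' κ (Λ (j * R) ω) (X (j * R) ω) (F (j * R) ω) (D (j * R) ω) ∂P)
        * ∫ ω, ρ j ω ∂P
  rho_le : ∀ j < n, ∫ ω, ρ j ω ∂P ≤ 1 / 64

namespace RandomBounds

variable {C κ B₀ : ℝ} {R n : ℕ} {Λ X F D N : ℕ → Ω → ℝ} {ρ : ℕ → Ω → ℝ}

omit [IsProbabilityMeasure P] in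
lemma bounded (h : RandomBounds P C κ B₀ R n Λ X F D N ρ) (hC : 1 ≤ C) (hκ0 : 0 ≤ κ)
    (hκ1 : κ ≤ 1) (k : ℕ) :
    ∃ B, ∀ᵐ ω ∂P, ‖(Λ k ω, X k ω, F k ω, D k ω, N k ω)‖ ≤ B := by
  set A := blockConst C k * (2 * B₀)
  refine ⟨max A (√(C * (A * A))), ?_⟩
  filter_upwards [h.bounds] with ω hω
  obtain ⟨i1, i2, i3⟩ := h.initial ω
  have hB := one_le_blockConst hC k
  have hk : κ ^ 2 ≤ 1 := pow_le_one₀ hκ0 hκ1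
  obtain ⟨h1, h2, h3⟩ := hω.inside hC hκ0 hκ1 0 (le_refl k)
  simp only [zero_add] at h1 h2 h3
  have hF0 := hω.F_nonneg 0
  have hB0 : 0 ≤ blockConst C k := by linarith
  have e1 : F k ω ≤ A := h1.trans (mul_le_mul_of_nonneg_left (by linarith) hB0)
  have e2 : D k ω ≤ A := by
    have : 0 ≤ κ ^ 2 * F k ω := mul_nonneg (sq_nonneg _) (hω.F_nonneg k)
    have h4 : κ ^ 2 * F 0 ω ≤ 1 * F 0 ω := by gcongr
    have h5 : blockConst C k * (D 0 ω + κ ^ 2 * F 0 ω) ≤ A :=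
      mul_le_mul_of_nonneg_left (by linarith) hB0
    linarith
  have e3 : Λ k ω ≤ A := h3.trans (mul_le_mul_of_nonneg_left (by linarith) hB0)
  have hF := hω.F_nonneg k
  have hD := hω.D_nonneg k
  have hX := hω.X_nonneg k
  have hXΛ := hω.X_le k
  have hΛ : 0 ≤ Λ k ω := hX.trans hXΛ
  have hA0 : 0 ≤ A := hF.trans e1
  have e4 : |N k ω| ≤ √(C * (A * A)) := by
    refine Real.abs_le_sqrt ((hω.noise k).trans ?_)
    calc C * κ ^ 2 * (Λ k ω * F k ω) ≤ C * 1 * (A * A) := by gcongr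
      _ = _ := by ring
  simp only [Prod.norm_def, Real.norm_eq_abs, abs_of_nonneg hF, abs_of_nonneg hD,
    abs_of_nonneg hX, abs_of_nonneg hΛ, max_le_iff]
  exact ⟨le_max_of_le_left e3, le_max_of_le_left (hXΛ.trans e3), le_max_of_le_left e1,
    le_max_of_le_left e2, le_max_of_le_right e4⟩

lemma integrable_comp (h : RandomBounds P C κ B₀ R n Λ X F D N ρ) (hC : 1 ≤ C) (hκ0 : 0 ≤ κ)
    (hκ1 : κ ≤ 1) (k : ℕ) {f : ℝ × ℝ × ℝ × ℝ × ℝ → ℝ} (hf : Continuous f) :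
    Integrable (fun ω => f (Λ k ω, X k ω, F k ω, D k ω, N k ω)) P := by
  obtain ⟨B, hB⟩ := h.bounded hC hκ0 hκ1 k
  exact integrable_comp_of_bounded (h.meas k) hB hf

lemma integrable_moment (h : RandomBounds P C κ B₀ R n Λ X F D N ρ) (hC : 1 ≤ C) (hκ0 : 0 ≤ κ)
    (hκ1 : κ ≤ 1) (k : ℕ) : Integrable (fun ω => moment κ (F k ω) (D k ω)) P :=
  h.integrable_comp hC hκ0 hκ1 k (f := fun x => moment κ x.2.2.1 x.2.2.2.1)
    (by unfold moment; fun_prop)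

lemma integrable_noise (h : RandomBounds P C κ B₀ R n Λ X F D N ρ) (hC : 1 ≤ C) (hκ0 : 0 ≤ κ)
    (hκ1 : κ ≤ 1) (C' : ℝ) (b i : ℕ) :
    Integrable (fun ω => potentialNoise C' κ (Λ b ω) (X b ω) (F b ω) (D b ω) * N (b + i) ω) P := by
  obtain ⟨B, hB⟩ := h.bounded hC hκ0 hκ1 (b + i)
  have h1 := h.integrable_comp hC hκ0 hκ1 b
    (f := fun x => potentialNoise C' κ x.1 x.2.1 x.2.2.1 x.2.2.2.1)
    (by unfold potentialNoise; fun_prop)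
  refine h1.mul_bdd (c := B) (((h.meas (b + i)).snd.snd.snd.snd).aestronglyMeasurable) ?_
  filter_upwards [hB] with ω hω
  have := norm_snd_le (Λ (b + i) ω, X (b + i) ω, F (b + i) ω, D (b + i) ω, N (b + i) ω)
  exact ((norm_snd_le _).trans ((norm_snd_le _).trans ((norm_snd_le _).trans this))).trans hω

/-- Bound for the sum of the expected moments over the starts of the blocks. -/
lemma sum_blocks_le (h : RandomBounds P C κ B₀ R n Λ X F D N ρ) (hC : 1 ≤ C) (hR : 1 ≤ R)
    (hκ0 : 0 < κ) (hκ1 : κ ≤ 1) {A : ℝ} (hA : A = 2 * blockConst C R ^ 2 * C * R ^ 2)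
    (hB : κ * blockConst C R ≤ 1) (hAκ : 2000 * A ^ 7 * κ ≤ 1) :
    ∑ j ∈ Finset.range n, ∫ ω, moment κ (F (j * R) ω) (D (j * R) ω) ∂P
      ≤ 2 * ((1 + 159 * A ^ 4 * κ ^ 2) ^ n
        * (∫ ω, potential A κ (Λ 0 ω) (X 0 ω) (F 0 ω) (D 0 ω) ∂P + n * (A * κ ^ 2))) := by
  have hA1 : 1 ≤ A := by
    have h1 := one_le_blockConst hC R
    have h2 : (1 : ℝ) ≤ R := by exact_mod_cast hR
    have h3 : 1 ≤ blockConst C R ^ 2 := one_le_pow₀ h1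
    have h4 : (1 : ℝ) ≤ R ^ 2 := one_le_pow₀ h2
    have h5 := one_le_mul_of_one_le_of_one_le (one_le_mul_of_one_le_of_one_le h3 hC) h4
    rw [hA]; linarith
  set Φ : ℕ → Ω → ℝ := fun k ω => potential A κ (Λ k ω) (X k ω) (F k ω) (D k ω) with hΦ
  set ψ : ℕ → Ω → ℝ := fun k ω => potentialMix A κ (Λ k ω) (X k ω) (F k ω) (D k ω) with hψ
  have iΦ : ∀ k, Integrable (Φ k) P := fun k =>
    h.integrable_comp hC hκ0.le hκ1 k
      (f := fun x => potential A κ x.1 x.2.1 x.2.2.1 x.2.2.2.1) (by unfold potential; fun_prop)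
  have iψ : ∀ k, Integrable (ψ k) P := fun k =>
    h.integrable_comp hC hκ0.le hκ1 k
      (f := fun x => potentialMix A κ x.1 x.2.1 x.2.2.1 x.2.2.2.1)
      (by unfold potentialMix; fun_prop)
  have im := h.integrable_moment hC hκ0.le hκ1
  have iψρ : ∀ k j, Integrable (fun ω => ψ k ω * ρ j ω) P := fun k j =>
    (iψ k).mul_bdd (c := 1) (h.rho_meas j).aestronglyMeasurable
      (Filter.Eventually.of_forall fun ω => by
        rw [Real.norm_of_nonneg (h.rho_mem j ω).1]; exact (h.rho_mem j ω).2)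
  have iN : ∀ b, Integrable (fun ω => ∑ i ∈ Finset.range R,
      potentialNoise A κ (Λ b ω) (X b ω) (F b ω) (D b ω) * N (b + i) ω) P := fun b =>
    integrable_finsetSum _ fun i _ => h.integrable_noise hC hκ0.le hκ1 A b i
  have hblock : ∀ᵐ ω ∂P, ∀ j, BlockBounds A κ (Λ (j * R) ω) (X (j * R) ω) (F (j * R) ω)
      (D (j * R) ω) (∑ i ∈ Finset.range R, N (j * R + i) ω) (ρ j ω) (Λ (j * R + R) ω)
      (X (j * R + R) ω) (F (j * R + R) ω) (D (j * R + R) ω) := by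
    filter_upwards [h.bounds, h.mixing] with ω h1 h2 j
    rw [hA]
    exact h1.block hC hR hκ0 hB (j * R) (h.rho_mem j ω).1 (h.rho_mem j ω).2 (h2 j)
  have hnn : ∀ j, 0 ≤ ∫ ω, Φ (j * R) ω ∂P := fun j => by
    refine integral_nonneg_of_ae ?_
    filter_upwards [h.bounds] with ω h1
    have hX := h1.X_nonneg (j * R)
    have hΛ := hX.trans (h1.X_le (j * R))
    have hF := h1.F_nonneg (j * R)
    have hD := h1.D_nonneg (j * R)
    simp only [hΦ, potential]
    positivity
  have hrec : ∀ j < n, ∫ ω, Φ ((j + 1) * R) ω ∂P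
      ≤ (1 + 159 * A ^ 4 * κ ^ 2) * ∫ ω, Φ (j * R) ω ∂P + A * κ ^ 2
        - 1 / 2 * ∫ ω, moment κ (F (j * R) ω) (D (j * R) ω) ∂P := by
    intro j hj
    have i1 : Integrable (fun ω => (1 + 159 * A ^ 4 * κ ^ 2) * Φ (j * R) ω + A * κ ^ 2) P :=
      ((iΦ _).const_mul _).add (integrable_const _)
    have i2 : Integrable (fun ω => (1 + 159 * A ^ 4 * κ ^ 2) * Φ (j * R) ω + A * κ ^ 2
        - 1 / 2 * moment κ (F (j * R) ω) (D (j * R) ω)) P := i1.sub ((im _).const_mul _)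
    have i3 : Integrable (fun ω => (1 + 159 * A ^ 4 * κ ^ 2) * Φ (j * R) ω + A * κ ^ 2
        - 1 / 2 * moment κ (F (j * R) ω) (D (j * R) ω)
        + ∑ i ∈ Finset.range R, potentialNoise A κ (Λ (j * R) ω) (X (j * R) ω) (F (j * R) ω)
          (D (j * R) ω) * N (j * R + i) ω) P := i2.add (iN (j * R))
    have i4 : Integrable (fun ω => ψ (j * R) ω * ρ j ω - ψ (j * R) ω * (1 / 64)) P :=
      (iψρ _ _).sub ((iψ _).mul_const _)
    have e1 : ∫ ω, Φ ((j + 1) * R) ω ∂P ≤ ∫ ω, ((1 + 159 * A ^ 4 * κ ^ 2) * Φ (j * R) ω + A * κ ^ 2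
        - 1 / 2 * moment κ (F (j * R) ω) (D (j * R) ω)
        + (∑ i ∈ Finset.range R, potentialNoise A κ (Λ (j * R) ω) (X (j * R) ω) (F (j * R) ω)
          (D (j * R) ω) * N (j * R + i) ω)
        + (ψ (j * R) ω * ρ j ω - ψ (j * R) ω * (1 / 64))) ∂P := by
      refine integral_mono_ae (iΦ _) (i3.add i4) ?_
      filter_upwards [hblock] with ω hω
      have := (hω j).potential_le hA1 hκ0 hAκ
      rw [Finset.mul_sum, mul_sub] at this
      rw [add_mul, one_mul]
      exact this
    refine e1.trans ?_
    rw [integral_add i3 i4, integral_add i2 (iN _), integral_sub i1 ((im _).const_mul _),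
      integral_add ((iΦ _).const_mul _) (integrable_const _),
      integral_sub (iψρ _ _) ((iψ _).mul_const _),
      integral_finsetSum _ fun i _ => h.integrable_noise hC hκ0.le hκ1 A (j * R) i,
      integral_const_mul, integral_const_mul, integral_mul_const, integral_const]
    simp only [integral_const_mul, h.noise, Finset.sum_const_zero, probReal_univ, smul_eq_mul, one_mul]
    have e2 : ∫ ω, ψ (j * R) ω * ρ j ω ∂P = _ := h.contraction A j hj
    have e3 : 0 ≤ ∫ ω, ψ (j * R) ω ∂P := integral_nonneg_of_ae <| by
      filter_upwards [hblock] with ω hω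
      exact (hω j).potentialMix_nonneg hA1 hκ0
    have e4 := mul_le_mul_of_nonneg_left (h.rho_le j hj) e3
    change (∫ ω, ψ (j * R) ω ∂P) * _ ≤ _ at e4
    change _ = (∫ ω, ψ (j * R) ω ∂P) * _ at e2
    linarith
  have hmn : ∀ j, 0 ≤ 1 / 2 * ∫ ω, moment κ (F (j * R) ω) (D (j * R) ω) ∂P := fun j => by
    refine mul_nonneg (by norm_num) (integral_nonneg_of_ae ?_)
    filter_upwards [h.bounds] with ω h1
    exact moment_nonneg (h1.F_nonneg _) (h1.D_nonneg _)
  have := sum_le_of_recursion (n := n) (ε := 159 * A ^ 4 * κ ^ 2) (δ := A * κ ^ 2) (by positivity)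
    (by positivity) hnn hmn hrec
  rw [← Finset.mul_sum, zero_mul] at this
  linarith

/-- Bound for the sum of the expected moments over all rounds. -/
theorem sum_moment_le (h : RandomBounds P C κ B₀ R n Λ X F D N ρ) (hC : 1 ≤ C) (hR : 1 ≤ R)
    (hn : 1 ≤ n) (hκ0 : 0 < κ) (hκ1 : κ ≤ 1) (hB₀ : 0 ≤ B₀) {A : ℝ}
    (hA : A = 2 * blockConst C R ^ 2 * C * R ^ 2)
    (hB : κ * blockConst C R ≤ 1) (hAκ : 2000 * A ^ 7 * κ ≤ 1) {c : ℝ} (hc : n * κ ^ 2 ≤ c) :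
    ∑ k ∈ Finset.range ((n + 1) * R), ∫ ω, moment κ (F k ω) (D k ω) ∂P
      ≤ 2 * R * (6 * blockConst C (2 * R) ^ 2 * (2 * (Real.exp (159 * A ^ 4 * c)
        * (potential A 1 B₀ B₀ B₀ B₀ + A * c)) + c)) := by
  have im := h.integrable_moment hC hκ0.le hκ1
  have hmn : ∀ k, 0 ≤ ∫ ω, moment κ (F k ω) (D k ω) ∂P := fun k => by
    refine integral_nonneg_of_ae ?_
    filter_upwards [h.bounds] with ω h1
    exact moment_nonneg (h1.F_nonneg _) (h1.D_nonneg _)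
  have hA0 : 0 ≤ A := by rw [hA]; have := one_le_blockConst hC R; positivity
  have h1 : ∀ b, ∀ i ≤ 2 * R, ∫ ω, moment κ (F (b + i) ω) (D (b + i) ω) ∂P
      ≤ 6 * blockConst C (2 * R) ^ 2 * (∫ ω, moment κ (F b ω) (D b ω) ∂P + κ ^ 2) := by
    intro b i hi
    calc _ ≤ ∫ ω, 6 * blockConst C (2 * R) ^ 2 * (moment κ (F b ω) (D b ω) + κ ^ 2) ∂P := by
          refine integral_mono_ae (im _) (((im b).add (integrable_const _)).const_mul _) ?_
          filter_upwards [h.bounds] with ω hω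
          exact hω.moment_le hC hκ0.le hκ1 b hi
      _ = _ := by
          rw [integral_const_mul, integral_add (im b) (integrable_const _), integral_const]
          simp
  have h2 := h.sum_blocks_le hC hR hκ0 hκ1 hA hB hAκ
  have h3 : ∫ ω, potential A κ (Λ 0 ω) (X 0 ω) (F 0 ω) (D 0 ω) ∂P
      ≤ potential A 1 B₀ B₀ B₀ B₀ := by
    have e1 : ∀ᵐ ω ∂P, potential A κ (Λ 0 ω) (X 0 ω) (F 0 ω) (D 0 ω)
        ≤ potential A 1 B₀ B₀ B₀ B₀ := by
      filter_upwards [h.bounds] with ω hω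
      obtain ⟨i1, i2, i3⟩ := h.initial ω
      have hX := hω.X_nonneg 0
      have hXΛ := hω.X_le 0
      have hF := hω.F_nonneg 0
      have hD := hω.D_nonneg 0
      have hXB := hXΛ.trans i1
      have hΛ := hX.trans hXΛ
      unfold potential
      gcongr
    calc _ ≤ ∫ _, potential A 1 B₀ B₀ B₀ B₀ ∂P := integral_mono_ae
          (h.integrable_comp hC hκ0.le hκ1 0
            (f := fun x => potential A κ x.1 x.2.1 x.2.2.1 x.2.2.2.1)
            (by unfold potential; fun_prop)) (integrable_const _) e1
      _ = _ := by simp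
  have h4 : (1 + 159 * A ^ 4 * κ ^ 2) ^ n ≤ Real.exp (159 * A ^ 4 * c) := by
    calc (1 + 159 * A ^ 4 * κ ^ 2) ^ n ≤ Real.exp (159 * A ^ 4 * κ ^ 2) ^ n := by
          gcongr; rw [add_comm]; exact Real.add_one_le_exp _
      _ = Real.exp (159 * A ^ 4 * (n * κ ^ 2)) := by rw [← Real.exp_nat_mul]; ring_nf
      _ ≤ _ := by gcongr
  have hpot : 0 ≤ potential A 1 B₀ B₀ B₀ B₀ := by unfold potential; positivity
  have h5 : ∑ j ∈ Finset.range n, ∫ ω, moment κ (F (j * R) ω) (D (j * R) ω) ∂P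
      ≤ 2 * (Real.exp (159 * A ^ 4 * c) * (potential A 1 B₀ B₀ B₀ B₀ + A * c)) := by
    refine h2.trans ?_
    have h6 : ∫ ω, potential A κ (Λ 0 ω) (X 0 ω) (F 0 ω) (D 0 ω) ∂P + n * (A * κ ^ 2)
        ≤ potential A 1 B₀ B₀ B₀ B₀ + A * c := by
      refine add_le_add h3 ?_
      rw [mul_left_comm]
      gcongr
    have h7 : (1 + 159 * A ^ 4 * κ ^ 2) ^ n * (∫ ω, potential A κ (Λ 0 ω) (X 0 ω) (F 0 ω) (D 0 ω) ∂P
        + n * (A * κ ^ 2)) ≤ (1 + 159 * A ^ 4 * κ ^ 2) ^ n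
          * (potential A 1 B₀ B₀ B₀ B₀ + A * c) :=
      mul_le_mul_of_nonneg_left h6 (by positivity)
    have hc0 : 0 ≤ c := le_trans (by positivity) hc
    have h8 : (1 + 159 * A ^ 4 * κ ^ 2) ^ n * (potential A 1 B₀ B₀ B₀ B₀ + A * c)
        ≤ Real.exp (159 * A ^ 4 * c) * (potential A 1 B₀ B₀ B₀ B₀ + A * c) :=
      mul_le_mul_of_nonneg_right h4 (by positivity)
    linarith
  calc _ ≤ ∑ j ∈ Finset.range n, ∑ i ∈ Finset.range (2 * R),
        ∫ ω, moment κ (F (j * R + i) ω) (D (j * R + i) ω) ∂P := sum_range_le_sum_blocks hmn R hn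
    _ ≤ ∑ j ∈ Finset.range n, ∑ i ∈ Finset.range (2 * R), 6 * blockConst C (2 * R) ^ 2
        * (∫ ω, moment κ (F (j * R) ω) (D (j * R) ω) ∂P + κ ^ 2) :=
        Finset.sum_le_sum fun j _ => Finset.sum_le_sum fun i hi =>
          h1 (j * R) i (Finset.mem_range.1 hi).le
    _ = 2 * R * (6 * blockConst C (2 * R) ^ 2
        * (∑ j ∈ Finset.range n, ∫ ω, moment κ (F (j * R) ω) (D (j * R) ω) ∂P + n * κ ^ 2)) := by
        simp only [Finset.sum_const, Finset.card_range, nsmul_eq_mul]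
        rw [← Finset.mul_sum, ← Finset.mul_sum, Finset.sum_add_distrib, Finset.sum_const,
          Finset.card_range, nsmul_eq_mul]
        push_cast
        rfl
    _ ≤ _ := by gcongr

end RandomBounds

end Probability

/-! ### Measurability of the trajectory -/

section Measurability

variable {α : Type*} [MeasurableSpace α]

section Functionals

variable {S : Type*} {T M d : ℕ} {cl : S → Fin T} {l : S → Vec d → ℝ} {L : ℝ≥0}

lemma SmoothLoss.measurable (hl : SmoothLoss l L) (s : S) : Measurable (l s) :=
  (hl.diff s).continuous.measurable

lemma SmoothLoss.measurable_gradient (hl : SmoothLoss l L) (s : S) : Measurable (gradient (l s)) :=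
  (hl.lip s).continuous.measurable

lemma measurable_toLp {f : α → Fin M → Vec d} (hf : ∀ m, Measurable fun x => f x m) :
    Measurable fun x => (WithLp.toLp 2 (f x) : Params M d) :=
  (WithLp.measurable_toLp 2 _).comp (measurable_pi_lambda _ hf)

variable {Θ : α → Fin T → Params M d} {π π' : α → Fin T → Fin M → ℝ}
  {q : α → S → Fin M → ℝ} {x u : α → Params M d}

lemma measurable_resp (hl : SmoothLoss l L) (hΘ : Measurable Θ) (hπ : Measurable π) :
    Measurable fun a => resp cl l (Θ a) (π a) := by
  have h := hl.measurable
  refine measurable_pi_lambda _ fun s => measurable_pi_lambda _ fun m => ?_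
  unfold resp posterior evidence
  have h1 : ∀ m, Measurable fun a => l s (Θ a (cl s) m) := fun m => (h s).comp (by fun_prop)
  fun_prop

variable [Fintype S]

lemma measurable_avg {φ : α → S → ℝ} (hφ : ∀ s, Measurable fun a => φ a s) :
    Measurable fun a => avg (φ a) := by
  unfold avg; fun_prop

lemma measurable_relEnt {a b : α → Fin M → ℝ} (ha : Measurable a) (hb : Measurable b) :
    Measurable fun x => relEnt (a x) (b x) := by
  unfold relEnt; fun_prop

lemma measurable_freeEnergy (hl : SmoothLoss l L) (hΘ : Measurable Θ) (hπ : Measurable π) :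
    Measurable fun a => freeEnergy cl l (Θ a) (π a) := by
  refine measurable_avg fun s => ?_
  have h1 : ∀ m, Measurable fun a => l s (Θ a (cl s) m) := fun m =>
    (hl.measurable s).comp (by fun_prop)
  have h2 : Measurable fun a => evidence (π a (cl s)) fun m => l s (Θ a (cl s) m) :=
    Finset.measurable_fun_sum _ fun m _ =>
      (by fun_prop : Measurable fun a => π a (cl s) m).mul (h1 m).neg.exp
  exact h2.log.neg

lemma measurable_clientKL (hπ' : Measurable π') (hπ : Measurable π) :
    Measurable fun a => clientKL cl (π' a) (π a) :=
  measurable_avg fun s => measurable_relEnt (by fun_prop) (by fun_prop)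

lemma measurable_gradVec (hl : SmoothLoss l L) {z : α → S → Params M d} (hz : Measurable z)
    (hq : Measurable q) : Measurable fun a => gradVec l (z a) (q a) := by
  have h1 : ∀ s m, Measurable fun a => gradient (l s) (z a s m) := fun s m =>
    (hl.measurable_gradient s).comp (by fun_prop)
  have h2 : ∀ s, Measurable fun a =>
      (WithLp.toLp 2 fun m => q a s m • gradient (l s) (z a s m) : Params M d) := fun s =>
    measurable_toLp fun m => (by fun_prop : Measurable fun a => q a s m).smul (h1 s m)
  have h3 := Finset.measurable_fun_sum Finset.univ fun s (_ : s ∈ Finset.univ) => h2 s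
  exact h3.const_smul (Fintype.card S : ℝ)⁻¹

lemma measurable_noiseCoeff (hl : SmoothLoss l L) (r k : ℝ) (hx : Measurable x)
    (hq : Measurable q) (hu : Measurable u) :
    Measurable fun a => noiseCoeff l r k (x a) (q a) (u a) := by
  unfold noiseCoeff
  have h1 := measurable_gradVec hl (z := fun a _ => x a - u a) (by fun_prop) hq
  fun_prop

lemma measurable_lyapunov (hl : SmoothLoss l L) (r k : ℝ) (hx : Measurable x)
    (hπ : Measurable π) (hq : Measurable q) (hπ' : Measurable π') (hu : Measurable u) :
    Measurable fun a => lyapunov cl l r k (x a) (π a) (q a) (π' a) (u a) := by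
  have h1 := measurable_gradVec hl (z := fun a _ => x a - u a) (by fun_prop) hq
  have h2 : Measurable fun a => risk l (fun _ => x a - u a) (q a) := by
    refine measurable_avg fun s => ?_
    have h3 : ∀ m, Measurable fun a => l s ((x a - u a) m) := fun m =>
      (hl.measurable s).comp (by fun_prop)
    exact Finset.measurable_fun_sum _ fun m _ =>
      (by fun_prop : Measurable fun a => q a s m).mul (h3 m)
  have h4 : Measurable fun a => respInfo cl (π' a) (q a) :=
    measurable_avg fun s => measurable_relEnt (by fun_prop) (by fun_prop)
  have h5 := measurable_clientKL (cl := cl) hπ' hπ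
  unfold lyapunov
  fun_prop

lemma measurable_average (hΘ : Measurable Θ) : Measurable fun a => FedProblem.average (Θ a) := by
  unfold FedProblem.average; fun_prop

lemma measurable_spread (hΘ : Measurable Θ) : Measurable fun a => spread (Θ a) := by
  have := measurable_average hΘ
  unfold spread; fun_prop

lemma measurable_mix (hΘ : Measurable Θ) {W : α → Fin T → Fin T → ℝ} (hW : Measurable W) :
    Measurable fun a => FedProblem.mix (Θ a) (W a) := by
  unfold FedProblem.mix
  fun_prop

lemma measurable_windowProd {W : ℕ → α → Fin T → Fin T → ℝ} (a R : ℕ)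
    (hW : ∀ k, a ≤ k → k < a + R → Measurable (W k)) (s t : Fin T) :
    Measurable fun x => FedProblem.windowProd (fun k => W k x) a R s t := by
  induction R generalizing s t with
  | zero => exact measurable_const
  | succ R ih =>
    have h1 := ih fun k h1 h2 => hW k h1 (by omega)
    have h2 := hW (a + R) (by omega) (by omega)
    simp only [FedProblem.windowProd, Matrix.mul_apply, Matrix.of_apply]
    exact Finset.measurable_fun_sum _ fun j _ =>
      (by fun_prop : Measurable fun x => W (a + R) x s j).mul (h1 j t)

lemma measurable_frobDist {P : α → Matrix (Fin T) (Fin T) ℝ}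
    (hP : ∀ s t, Measurable fun a => P a s t) : Measurable fun a => frobDist (P a) := by
  unfold frobDist; fun_prop

end Functionals

section Track

variable {𝒳 𝒴 𝒜 : Type*} [MeasurableSpace 𝒳] [MeasurableSpace 𝒴] {T M d : ℕ}
  {Q : FedProblem 𝒳 𝒴 𝒜 T M d} {𝓑 : Q.BatchScheme} {L : ℝ≥0}

lemma measurable_comp_index {n : ℕ} {E : Type*} [MeasurableSpace E] {g : Fin n → α → E}
    (hg : ∀ i, Measurable (g i)) {i : α → Fin n} (hi : Measurable i) :
    Measurable fun a => g (i a) a :=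
  (measurable_from_prod_countable_left (f := fun p : α × Fin n => g p.2 p.1) hg).comp
    (measurable_id.prodMk hi)

lemma measurable_batchGrad (hl : SmoothLoss (lossAt Q) L) {t : Fin T} {w : α → Fin (Q.n t) → ℝ}
    {θ : α → Vec d} {b : α → 𝓑.Batch t} (hw : Measurable w) (hθ : Measurable θ)
    (hb : Measurable b) : Measurable fun a => 𝓑.batchGrad t (w a) (θ a) (b a) := by
  unfold FedProblem.BatchScheme.batchGrad
  have h : ∀ s, Measurable fun a => w a (b a s) • gradient (Q.sampleLoss t (b a s)) (θ a) := by
    intro s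
    refine measurable_comp_index (g := fun i a => w a i • gradient (Q.sampleLoss t i) (θ a))
      (fun i => ?_) (i := fun a => b a s) (by fun_prop)
    have : Measurable fun a => gradient (Q.sampleLoss t i) (θ a) :=
      (hl.measurable_gradient ⟨t, i⟩).comp hθ
    fun_prop
  fun_prop

lemma measurable_meanGrad (hl : SmoothLoss (lossAt Q) L) {t : Fin T} {w : α → Fin (Q.n t) → ℝ}
    {θ : α → Vec d} (hw : Measurable w) (hθ : Measurable θ) :
    Measurable fun a => meanGrad t (w a) (θ a) := by
  unfold meanGrad
  have : ∀ i, Measurable fun a => gradient (Q.sampleLoss t i) (θ a) := fun i =>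
    (hl.measurable_gradient ⟨t, i⟩).comp hθ
  fun_prop

lemma measurable_localSGD (hl : SmoothLoss (lossAt Q) L) (η : ℝ) {t : Fin T}
    {w : α → Fin (Q.n t) → ℝ} {θ : α → Vec d} {b : α → ℕ → 𝓑.Batch t} (hw : Measurable w)
    (hθ : Measurable θ) (hb : Measurable b) (J : ℕ) :
    Measurable fun a => 𝓑.localSGD η t (w a) (b a) (θ a) J := by
  induction J with
  | zero => exact hθ
  | succ J ih =>
    have := measurable_batchGrad hl hw ih (b := fun a => b a J) (by fun_prop)
    simp only [FedProblem.BatchScheme.localSGD]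
    fun_prop

section State

variable {Θ : α → Fin T → Params M d} {π : α → Fin T → Fin M → ℝ}
  {b : α → (t : Fin T) → Fin M → ℕ → 𝓑.Batch t}

lemma measurable_eStep (hl : SmoothLoss (lossAt Q) L) (hΘ : Measurable Θ) (hπ : Measurable π)
    (t : Fin T) (m : Fin M) :
    Measurable fun a (i : Fin (Q.n t)) => Q.eStep (Θ a t) (π a t) t i m := by
  have h := measurable_resp (cl := client Q) hl hΘ hπ
  refine measurable_pi_lambda _ fun i => ?_
  exact (measurable_pi_apply m).comp ((measurable_pi_apply (⟨t, i⟩ : Sample Q)).comp h)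

lemma measurable_localRound (hl : SmoothLoss (lossAt Q) L) (η : ℝ) (J : ℕ) (hΘ : Measurable Θ)
    (hπ : Measurable π) (hb : Measurable b) :
    Measurable fun a t => 𝓑.localRound η J ⟨Θ a, π a⟩ t (b a t) :=
  measurable_pi_lambda _ fun t => measurable_toLp fun m =>
    measurable_localSGD hl η (measurable_eStep hl hΘ hπ t m) (b := fun a => b a t m)
      (by fun_prop) (by fun_prop) J

lemma measurable_roundNoise (hl : SmoothLoss (lossAt Q) L) (J : ℕ) (hΘ : Measurable Θ)
    (hπ : Measurable π) (hb : Measurable b) :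
    Measurable fun a => roundNoise 𝓑 J (Θ a) (π a) (b a) := by
  refine measurable_toLp fun m => ?_
  have h1 : ∀ t j, Measurable fun a => 𝓑.batchGrad t (fun i => Q.eStep (Θ a t) (π a t) t i m)
      (Θ a t m) (b a t m j) := fun t j =>
    measurable_batchGrad hl (measurable_eStep hl hΘ hπ t m) (by fun_prop)
      (b := fun a => b a t m j) (by fun_prop)
  have h2 : ∀ t, Measurable fun a => meanGrad t (fun i => Q.eStep (Θ a t) (π a t) t i m)
      (Θ a t m) := fun t =>
    measurable_meanGrad hl (measurable_eStep hl hΘ hπ t m) (by fun_prop)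
  fun_prop

lemma measurable_mixtureUpdate (hl : SmoothLoss (lossAt Q) L) (hΘ : Measurable Θ)
    (hπ : Measurable π) :
    Measurable fun a t m => Q.mixtureUpdate (Θ a t) (π a t) t m := by
  refine measurable_pi_lambda _ fun t => measurable_pi_lambda _ fun m => ?_
  unfold FedProblem.mixtureUpdate
  have := measurable_pi_iff.1 (measurable_eStep hl hΘ hπ t m)
  fun_prop

end State

section Tracked

variable {z : α → Tracked Q}

lemma measurable_trackLyap (hl : SmoothLoss (lossAt Q) L) (r κ : ℝ) (hz : Measurable z) :
    Measurable fun a => trackLyap r κ (z a) :=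
  measurable_lyapunov hl r κ (measurable_average hz.fst) hz.snd.fst hz.snd.snd.fst
    hz.snd.snd.snd.fst hz.snd.snd.snd.snd

lemma measurable_trackKL (κ : ℝ) (hz : Measurable z) : Measurable fun a => trackKL κ (z a) :=
  (measurable_clientKL hz.snd.snd.snd.fst hz.snd.fst).const_mul κ

lemma measurable_trackEnergy (hl : SmoothLoss (lossAt Q) L) (hz : Measurable z) :
    Measurable fun a => trackEnergy (z a) :=
  measurable_freeEnergy hl hz.fst hz.snd.fst

lemma measurable_trackGrad (hl : SmoothLoss (lossAt Q) L) (hz : Measurable z) :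
    Measurable fun a => trackGrad (z a) :=
  measurable_gradVec hl
    (measurable_pi_lambda _ fun _ => measurable_average hz.fst) (measurable_resp hl hz.fst hz.snd.fst)

lemma measurable_track_noiseCoeff (hl : SmoothLoss (lossAt Q) L) (r κ : ℝ) (hz : Measurable z) :
    Measurable fun a => noiseCoeff (lossAt Q) r κ (FedProblem.average (z a).1) (z a).2.2.1
      (z a).2.2.2.2 :=
  measurable_noiseCoeff hl r κ (measurable_average hz.fst) hz.snd.snd.fst hz.snd.snd.snd.snd

lemma measurable_track_roundNoise (hl : SmoothLoss (lossAt Q) L) (J : ℕ) (hz : Measurable z)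
    {b : α → (t : Fin T) → Fin M → ℕ → 𝓑.Batch t} (hb : Measurable b) :
    Measurable fun a => roundNoise 𝓑 J (z a).1 (z a).2.1 (b a) :=
  measurable_roundNoise hl J hz.fst hz.snd.fst hb

lemma measurable_trackStep (hl : SmoothLoss (lossAt Q) L) (η κ : ℝ) (J : ℕ) (hz : Measurable z)
    {W : α → Fin T → Fin T → ℝ} (hW : Measurable W)
    {b : α → (t : Fin T) → Fin M → ℕ → 𝓑.Batch t} (hb : Measurable b) :
    Measurable fun a => trackStep 𝓑 η κ J (W a) (b a) (z a) := by
  have h1 := measurable_localRound hl η J hz.fst hz.snd.fst hb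
  have h2 := measurable_mixtureUpdate hl hz.fst hz.snd.fst
  have h3 := measurable_resp (cl := client Q) hl hz.fst hz.snd.fst
  have h4 := measurable_average h1
  have h5 := measurable_average hz.fst
  have h6 := hz.snd.snd.fst
  have h7 := hz.snd.snd.snd.fst
  have h8 := hz.snd.snd.snd.snd
  refine (measurable_mix h1 hW).prodMk (h2.prodMk (Measurable.prodMk ?_ (Measurable.prodMk ?_ ?_)))
  · exact measurable_pi_lambda _ fun s => measurable_pi_lambda _ fun m => by fun_prop
  · exact measurable_pi_lambda _ fun t => measurable_pi_lambda _ fun m =>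
      (((measurable_pi_apply m).comp ((measurable_pi_apply t).comp h7)).const_mul _).add
        (((measurable_pi_apply m).comp ((measurable_pi_apply t).comp h2)).const_mul _)
  · fun_prop

/-- The state after `k` rounds is a measurable function of what was drawn in these rounds. -/
lemma measurable_track (hl : SmoothLoss (lossAt Q) L) (η κ : ℝ) (J : ℕ)
    (S₀ : FedProblem.ClientState T M d) {W : ℕ → α → Fin T → Fin T → ℝ}
    {b : ℕ → α → (t : Fin T) → Fin M → ℕ → 𝓑.Batch t} (k : ℕ)
    (hW : ∀ j < k, Measurable (W j)) (hb : ∀ j < k, Measurable (b j)) :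
    Measurable fun a => track 𝓑 η κ J S₀ (fun j => W j a) (fun j => b j a) k := by
  induction k with
  | zero => exact measurable_const
  | succ k ih =>
    exact measurable_trackStep hl η κ J
      (ih (fun j hj => hW j (by omega)) fun j hj => hb j (by omega)) (hW k (by omega))
      (hb k (by omega))

end Tracked

end Track

end Measurability

/-! ### Independence of the draws and centering of the noise -/

section Independence

variable {𝒳 𝒴 𝒜 : Type*} [MeasurableSpace 𝒳] [MeasurableSpace 𝒴] {T M d : ℕ}
  {Q : FedProblem 𝒳 𝒴 𝒜 T M d} {𝓑 : Q.BatchScheme} {L : ℝ≥0}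

variable {Ω : Type u} [MeasurableSpace Ω] {P : Measure Ω}

lemma lintegral_of_indepFun [IsProbabilityMeasure P] {α β : Type*} [MeasurableSpace α]
    [MeasurableSpace β] {X : Ω → α} {Y : Ω → β} (hX : Measurable X) (hY : Measurable Y)
    (h : IndepFun X Y P) {f : α × β → ℝ≥0∞} (hf : Measurable f) :
    ∫⁻ ω, f (X ω, Y ω) ∂P = ∫⁻ ω, ∫⁻ ω', f (X ω, Y ω') ∂P ∂P := by
  have h1 := (indepFun_iff_map_prod_eq_prod_map_map hX.aemeasurable hY.aemeasurable).1 h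
  have := Measure.isProbabilityMeasure_map (μ := P) hX.aemeasurable
  have := Measure.isProbabilityMeasure_map (μ := P) hY.aemeasurable
  have e1 : ∫⁻ ω, f (X ω, Y ω) ∂P = ∫⁻ x, f x ∂(P.map fun ω => (X ω, Y ω)) :=
    (lintegral_map hf (hX.prodMk hY)).symm
  rw [e1, h1, lintegral_prod _ hf.aemeasurable, lintegral_map hf.lintegral_prod_right' hX]
  refine lintegral_congr fun ω => ?_
  exact lintegral_map (hf.comp measurable_prodMk_left) hY

/-- If a function of two independent variables is centered for each fixed value of the first one,
then it is centered. -/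
lemma integral_eq_zero_of_indepFun [IsProbabilityMeasure P] {α β : Type*} [MeasurableSpace α]
    [MeasurableSpace β] {X : Ω → α} {Y : Ω → β} (hX : Measurable X) (hY : Measurable Y)
    (h : IndepFun X Y P) {f : α × β → ℝ} (hf : Measurable f)
    (h0 : ∀ x, ∫ ω, f (x, Y ω) ∂P = 0) : ∫ ω, f (X ω, Y ω) ∂P = 0 := by
  have h1 := (indepFun_iff_map_prod_eq_prod_map_map hX.aemeasurable hY.aemeasurable).1 h
  have := Measure.isProbabilityMeasure_map (μ := P) hX.aemeasurable
  have := Measure.isProbabilityMeasure_map (μ := P) hY.aemeasurable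
  have e1 : ∫ ω, f (X ω, Y ω) ∂P = ∫ x, f x ∂(P.map fun ω => (X ω, Y ω)) :=
    (integral_map (hX.prodMk hY).aemeasurable hf.aestronglyMeasurable).symm
  rw [e1, h1]
  by_cases hi : Integrable f ((P.map X).prod (P.map Y))
  · rw [integral_prod _ hi]
    have : ∀ x, ∫ y, f (x, y) ∂(P.map Y) = 0 := fun x => by
      rw [integral_map (f := fun y => f (x, y)) hY.aemeasurable
        (hf.comp measurable_prodMk_left).aestronglyMeasurable, h0]
    simp [this]
  · exact integral_undef hi

variable (W : ℕ → Ω → Fin T → Fin T → ℝ) (ξ : ℕ → (t : Fin T) → Fin M → ℕ → Ω → 𝓑.Batch t)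

/-- The σ-algebra generated by a set of draws; `Sum.inl k` stands for the `k`-th mixing matrix and
`Sum.inr (k, t, m, j)` for a batch. -/
@[reducible]
noncomputable def drawn (s : Set (ℕ ⊕ (ℕ × Fin T × Fin M × ℕ))) : MeasurableSpace Ω :=
  ⨆ i ∈ s, Sum.elim (fun k : ℕ => MeasurableSpace.comap (W k) inferInstance)
    (fun a : ℕ × Fin T × Fin M × ℕ =>
      MeasurableSpace.comap (ξ a.1 a.2.1 a.2.2.1 a.2.2.2) inferInstance) i

/-- The draws of the rounds before round `k`. -/
def pastDraws (T M k : ℕ) : Set (ℕ ⊕ (ℕ × Fin T × Fin M × ℕ)) :=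
  {i | Sum.elim (fun j => j < k) (fun a => a.1 < k) i}

/-- The batches of round `k`. -/
def batchDraws (T M k : ℕ) : Set (ℕ ⊕ (ℕ × Fin T × Fin M × ℕ)) :=
  {i | Sum.elim (fun _ => False) (fun a => a.1 = k) i}

/-- The mixing matrices of the rounds `a, …, a + R - 1`. -/
def mixDraws (T M a R : ℕ) : Set (ℕ ⊕ (ℕ × Fin T × Fin M × ℕ)) :=
  {i | Sum.elim (fun j => a ≤ j ∧ j < a + R) (fun _ => False) i}

lemma disjoint_past_batch (k : ℕ) : Disjoint (pastDraws T M k) (batchDraws T M k) := by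
  rw [Set.disjoint_left]
  rintro (j | a) h1 h2
  · exact h2
  · exact absurd h2 (ne_of_lt h1)

lemma disjoint_past_mix (a R : ℕ) : Disjoint (pastDraws T M a) (mixDraws T M a R) := by
  rw [Set.disjoint_left]
  rintro (j | a) h1 h2
  · exact absurd h2.1 (not_le.2 h1)
  · exact h2

lemma disjoint_mix_mix (a R R' : ℕ) :
    Disjoint (mixDraws T M (a + R) R') (mixDraws T M a R) := by
  rw [Set.disjoint_left]
  rintro (j | a) h1 h2
  · exact absurd h2.2 (not_lt.2 h1.1)
  · exact h2

variable {W ξ}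

omit [MeasurableSpace Ω] in
lemma measurable_mixing_drawn {s : Set (ℕ ⊕ (ℕ × Fin T × Fin M × ℕ))} {k : ℕ}
    (hk : Sum.inl k ∈ s) : Measurable[drawn W ξ s] (W k) :=
  Measurable.mono (comap_measurable (W k)) (le_iSup₂_of_le (Sum.inl k) hk le_rfl) le_rfl

omit [MeasurableSpace Ω] in
lemma measurable_batches_drawn {s : Set (ℕ ⊕ (ℕ × Fin T × Fin M × ℕ))} {k : ℕ}
    (hk : ∀ t m j, Sum.inr (k, t, m, j) ∈ s) :
    Measurable[drawn W ξ s] fun ω t m j => ξ k t m j ω := by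
  refine @measurable_pi_lambda _ _ _ (drawn W ξ s) _ _ fun t =>
    @measurable_pi_lambda _ _ _ (drawn W ξ s) _ _ fun m =>
    @measurable_pi_lambda _ _ _ (drawn W ξ s) _ _ fun j => ?_
  exact Measurable.mono (comap_measurable (ξ k t m j))
    (le_iSup₂_of_le (Sum.inr (k, t, m, j)) (hk t m j) le_rfl) le_rfl

lemma drawn_le (hW : ∀ k, Measurable (W k)) (hξ : ∀ k t m j, Measurable (ξ k t m j))
    (s : Set (ℕ ⊕ (ℕ × Fin T × Fin M × ℕ))) : drawn W ξ s ≤ ‹MeasurableSpace Ω› := by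
  refine iSup₂_le fun i _ => ?_
  rcases i with k | a
  · exact (hW k).comap_le
  · exact (hξ _ _ _ _).comap_le

lemma indepFun_of_drawn (hW : ∀ k, Measurable (W k))
    (hind : FedProblem.IndependentSampling 𝓑 W ξ P)
    {s s' : Set (ℕ ⊕ (ℕ × Fin T × Fin M × ℕ))} (hd : Disjoint s s') {α β : Type*}
    [MeasurableSpace α] [MeasurableSpace β] {X : Ω → α} {Y : Ω → β}
    (hX : Measurable[drawn W ξ s] X) (hY : Measurable[drawn W ξ s'] Y) : IndepFun X Y P := by
  have h := indep_iSup_of_disjoint (m := Sum.elim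
      (fun k : ℕ => MeasurableSpace.comap (W k) inferInstance)
      (fun a : ℕ × Fin T × Fin M × ℕ =>
        MeasurableSpace.comap (ξ a.1 a.2.1 a.2.2.1 a.2.2.2) inferInstance)) (μ := P)
    (fun i => by
      rcases i with k | a
      · exact (hW k).comap_le
      · exact (hind.measurable _ _ _ _).comap_le) hind.indep hd
  rw [IndepFun_iff_Indep]
  exact indep_of_indep_of_le_left (indep_of_indep_of_le_right h hY.comap_le) hX.comap_le

omit [MeasurableSpace Ω] in
lemma measurable_track_drawn (hl : SmoothLoss (lossAt Q) L) (η κ : ℝ) (J : ℕ)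
    (S₀ : FedProblem.ClientState T M d) {b k : ℕ} (hbk : b ≤ k) :
    Measurable[drawn W ξ (pastDraws T M k)] fun ω =>
      track 𝓑 η κ J S₀ (fun j => W j ω) (fun i t m j => ξ i t m j ω) b :=
  @measurable_track _ (drawn W ξ (pastDraws T M k)) _ _ _ _ _ _ _ _ Q 𝓑 L hl η κ J S₀ W
    (fun i ω t m j => ξ i t m j ω) b
    (fun _ hj => measurable_mixing_drawn (lt_of_lt_of_le hj hbk))
    (fun _ hj => measurable_batches_drawn fun _ _ _ => lt_of_lt_of_le hj hbk)

lemma integral_batchGrad [IsProbabilityMeasure P] (hunif : 𝓑.Uniform) {t : Fin T}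
    {b : Ω → 𝓑.Batch t} (hb : Measurable b) (hlaw : HasLaw b (𝓑.law t) P)
    (w : Fin (Q.n t) → ℝ) (θ : Vec d) :
    Integrable (fun ω => 𝓑.batchGrad t w θ (b ω)) P ∧
      ∫ ω, 𝓑.batchGrad t w θ (b ω) ∂P = meanGrad t w θ := by
  have h1 : ∀ s, Measurable fun ω => b ω s := fun s => by fun_prop
  set g : Fin (Q.n t) → Vec d := fun i => w i • gradient (Q.sampleLoss t i) θ with hg
  have hgi : ∀ (μ : Measure (Fin (Q.n t))) [IsFiniteMeasure μ], Integrable g μ := fun μ _ =>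
    Integrable.of_finite
  have h2 : ∀ s, Integrable (fun ω => g (b ω s)) P := fun s => by
    have := Measure.isProbabilityMeasure_map (μ := P) (h1 s).aemeasurable
    exact (hgi (P.map fun ω => b ω s)).comp_measurable (h1 s)
  have h3 : ∀ s, ∫ ω, g (b ω s) ∂P = (Q.n t : ℝ)⁻¹ • ∑ i, g i := fun s => by
    have := Measure.isProbabilityMeasure_map (μ := P) (h1 s).aemeasurable
    rw [← integral_map (f := g) (h1 s).aemeasurable (hgi _).aestronglyMeasurable,
      integral_fintype (hgi _), Finset.smul_sum]
    refine Finset.sum_congr rfl fun i _ => ?_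
    congr 1
    rw [Measure.real, Measure.map_apply (h1 s) (measurableSet_singleton i)]
    have e1 : (fun ω => b ω s) ⁻¹' {i} = b ⁻¹' {b' | b' s = i} := rfl
    rw [e1, ← Measure.map_apply hb (MeasurableSet.of_discrete), hlaw.map_eq, hunif.uniform]
    simp
  have h4 : (𝓑.size t : ℝ) ≠ 0 := by exact_mod_cast (hunif.size_pos t).ne'
  constructor
  · exact (integrable_finsetSum _ fun s _ => h2 s).smul (𝓑.size t : ℝ)⁻¹
  · change ∫ ω, (𝓑.size t : ℝ)⁻¹ • ∑ s, g (b ω s) ∂P = _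
    rw [integral_smul, integral_finsetSum _ fun s _ => h2 s]
    simp only [h3, Finset.sum_const, Finset.card_univ, Fintype.card_fin]
    rw [← Nat.cast_smul_eq_nsmul ℝ, smul_smul, inv_mul_cancel₀ h4, one_smul]
    rfl

lemma integral_inner_roundNoise [IsProbabilityMeasure P] (hunif : 𝓑.Uniform)
    (hind : FedProblem.IndependentSampling 𝓑 W ξ P) (J k : ℕ) (A : Params M d)
    (Θ : Fin T → Params M d) (π : Fin T → Fin M → ℝ) :
    ∫ ω, inner ℝ A (roundNoise 𝓑 J Θ π fun t m j => ξ k t m j ω) ∂P = 0 := by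
  set g : Fin M → Fin T → ℕ → Ω → Vec d := fun m t j ω =>
    𝓑.batchGrad t (fun i => Q.eStep (Θ t) (π t) t i m) (Θ t m) (ξ k t m j ω)
      - meanGrad t (fun i => Q.eStep (Θ t) (π t) t i m) (Θ t m) with hg
  have h1 : ∀ m t j, Integrable (g m t j) P := fun m t j =>
    (integral_batchGrad hunif (hind.measurable k t m j) (hind.law k t m j) _ _).1.sub
      (integrable_const _)
  have h2 : ∀ m t j, ∫ ω, g m t j ω ∂P = 0 := fun m t j => by
    obtain ⟨e1, e2⟩ := integral_batchGrad hunif (hind.measurable k t m j) (hind.law k t m j)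
      (fun i => Q.eStep (Θ t) (π t) t i m) (Θ t m)
    rw [hg]
    simp only
    rw [integral_sub e1 (integrable_const _), e2, integral_const]
    simp
  have h0 : ∀ m t j, Integrable (fun ω => Q.weight t • g m t j ω) P := fun m t j =>
    (h1 m t j).smul (Q.weight t)
  have h3 : ∀ m t, Integrable (fun ω => ∑ j ∈ Finset.range J, Q.weight t • g m t j ω) P :=
    fun m t => integrable_finsetSum _ fun j _ => h0 m t j
  have h4 : ∀ m, Integrable
      (fun ω => (J : ℝ)⁻¹ • ∑ t, ∑ j ∈ Finset.range J, Q.weight t • g m t j ω) P := fun m =>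
    (integrable_finsetSum _ fun t _ => h3 m t).smul (J : ℝ)⁻¹
  have h5 : ∀ m, ∫ ω, (J : ℝ)⁻¹ • ∑ t, ∑ j ∈ Finset.range J, Q.weight t • g m t j ω ∂P = 0 := by
    intro m
    rw [integral_smul, integral_finsetSum _ fun t _ => h3 m t, Finset.sum_eq_zero, smul_zero]
    intro t _
    rw [integral_finsetSum _ fun j _ => h0 m t j]
    exact Finset.sum_eq_zero fun j _ => by rw [integral_smul, h2, smul_zero]
  have e : ∀ ω, inner ℝ A (roundNoise 𝓑 J Θ π fun t m j => ξ k t m j ω)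
      = ∑ m, inner ℝ (A m) ((J : ℝ)⁻¹ • ∑ t, ∑ j ∈ Finset.range J, Q.weight t • g m t j ω) :=
    fun ω => PiLp.inner_apply _ _
  simp only [e]
  rw [integral_finsetSum _ fun m _ => (h4 m).const_inner (A m)]
  refine Finset.sum_eq_zero fun m _ => ?_
  rw [integral_inner (h4 m), h5, inner_zero_right]

/-- The noise of a round is orthogonal to functions of the states that precede it. -/
lemma integral_mul_roundNoise [IsProbabilityMeasure P] (hl : SmoothLoss (lossAt Q) L)
    (hunif : 𝓑.Uniform) (hW : ∀ k, Measurable (W k))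
    (hind : FedProblem.IndependentSampling 𝓑 W ξ P) (η κ : ℝ) (J : ℕ)
    (S₀ : FedProblem.ClientState T M d) {φ : Tracked Q → ℝ} (hφ : Measurable φ)
    {A : Tracked Q → Params M d} (hA : Measurable A) {b k : ℕ} (hbk : b ≤ k)
    {z : ℕ → Ω → Tracked Q}
    (hz : z = fun k ω => track 𝓑 η κ J S₀ (fun j => W j ω) (fun i t m j => ξ i t m j ω) k) :
    ∫ ω, φ (z b ω) * inner ℝ (A (z k ω))
      (roundNoise 𝓑 J (z k ω).1 (z k ω).2.1 fun t m j => ξ k t m j ω) ∂P = 0 := by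
  have h1 : ∀ i ≤ k, Measurable[drawn W ξ (pastDraws T M k)] (z i) := fun i hi => by
    rw [hz]; exact measurable_track_drawn hl η κ J S₀ hi
  have h2 : Measurable[drawn W ξ (pastDraws T M k)] fun ω => (z b ω, z k ω) :=
    (h1 b hbk).prodMk (h1 k le_rfl)
  have h3 : Measurable[drawn W ξ (batchDraws T M k)] fun ω t m j => ξ k t m j ω :=
    measurable_batches_drawn fun _ _ _ => rfl
  have hle := drawn_le (W := W) (ξ := ξ) hW hind.measurable
  refine integral_eq_zero_of_indepFun (X := fun ω => (z b ω, z k ω))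
    (Y := fun ω t m j => ξ k t m j ω)
    (f := fun x : (Tracked Q × Tracked Q) × ((t : Fin T) → Fin M → ℕ → 𝓑.Batch t) =>
      φ x.1.1 * inner ℝ (A x.1.2) (roundNoise 𝓑 J x.1.2.1 x.1.2.2.1 x.2))
    (h2.mono (hle _) le_rfl) (h3.mono (hle _) le_rfl)
    (indepFun_of_drawn hW hind (disjoint_past_batch k) h2 h3) ?_ ?_
  · have h4 := measurable_track_roundNoise hl J
      (z := fun x : (Tracked Q × Tracked Q) × ((t : Fin T) → Fin M → ℕ → 𝓑.Batch t) => x.1.2)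
      (by fun_prop) (b := fun x => x.2) (by fun_prop)
    have h5 : Measurable
        fun x : (Tracked Q × Tracked Q) × ((t : Fin T) → Fin M → ℕ → 𝓑.Batch t) => A x.1.2 :=
      hA.comp (by fun_prop)
    exact (hφ.comp (by fun_prop)).mul (h5.inner h4)
  · intro x
    simp only
    rw [integral_const_mul, integral_inner_roundNoise hunif hind, mul_zero]

end Independence

/-! ### Contraction of the mixing products -/

section Contraction

variable {T M d : ℕ} {Ω : Type u} [MeasurableSpace Ω] {P : Measure Ω}

lemma windowProd_add (W : ℕ → Fin T → Fin T → ℝ) (a r r' : ℕ) :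
    FedProblem.windowProd W a (r + r')
      = FedProblem.windowProd W (a + r) r' * FedProblem.windowProd W a r := by
  induction r' with
  | zero => simp [FedProblem.windowProd]
  | succ r' ih =>
    rw [← add_assoc, FedProblem.windowProd, ih, FedProblem.windowProd, Matrix.mul_assoc, add_assoc]

/-- The spread of a unit vector that is held by client `s` only measures, after mixing, a row of
the deviation of the mixing matrix from the averaging matrix. -/
lemma sum_spread_mix_single {A : Matrix (Fin T) (Fin T) ℝ}
    (hA : A ∈ doublyStochastic ℝ (Fin T)) {v : Params M d} (hv : ‖v‖ = 1) :
    frobDist A = ∑ s, spread (FedProblem.mix (fun t => if t = s then v else 0) A) := by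
  unfold frobDist spread
  refine Finset.sum_congr rfl fun s _ => Finset.sum_congr rfl fun t _ => ?_
  have e1 : FedProblem.mix (fun t => if t = s then v else 0) A t = A s t • v := by
    simp [FedProblem.mix]
  have e2 : FedProblem.average (fun t => if t = s then v else 0) = (T : ℝ)⁻¹ • v := by
    simp [FedProblem.average]
  rw [average_mix hA, e1, e2, ← sub_smul, norm_smul, hv, mul_one, Real.norm_eq_abs, sq_abs]

lemma spread_le_sum (hT : T ≠ 0) (Ξ : Fin T → Params M d) : spread Ξ ≤ ∑ t, ‖Ξ t‖ ^ 2 := by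
  have h1 : ∀ t, ‖Ξ t - FedProblem.average Ξ‖ ^ 2
      = ‖Ξ t‖ ^ 2 - ‖FedProblem.average Ξ‖ ^ 2
        - 2 * inner ℝ (Ξ t - FedProblem.average Ξ) (FedProblem.average Ξ) := fun t => by
    rw [norm_sub_sq_real, inner_sub_left, real_inner_self_eq_norm_sq]; ring
  unfold spread
  simp only [h1]
  rw [Finset.sum_sub_distrib, Finset.sum_sub_distrib, ← Finset.mul_sum, ← sum_inner,
    sum_sub_average hT, inner_zero_left]
  have : 0 ≤ ∑ _t : Fin T, ‖FedProblem.average Ξ‖ ^ 2 := Finset.sum_nonneg fun _ _ => sq_nonneg _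
  linarith

variable [IsProbabilityMeasure P] {𝒳 𝒴 𝒜 : Type*} [MeasurableSpace 𝒳] [MeasurableSpace 𝒴]
  {Q : FedProblem 𝒳 𝒴 𝒜 T M d} {𝓑 : Q.BatchScheme}
  {W : ℕ → Ω → Fin T → Fin T → ℝ} {ξ : ℕ → (t : Fin T) → Fin M → ℕ → Ω → 𝓑.Batch t}
  {p : ℝ} {τ K : ℕ}

/-- Iterated consensus rate over `n` consecutive windows. -/
lemma lintegral_consensusDist_le (hcons : FedProblem.ExpectedConsensus M d W p τ K P)
    (hind : FedProblem.IndependentSampling 𝓑 W ξ P) (l : ℕ) {n : ℕ}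
    (hn : ∀ i < n, l + i ≤ K / τ) (Ξ : Fin T → Params M d) :
    ∫⁻ ω, FedProblem.consensusDist
        (FedProblem.mix Ξ (FedProblem.windowProd (fun k => W k ω) (l * τ) (n * τ))) ∂P
      ≤ ENNReal.ofReal (1 - p) ^ n * FedProblem.consensusDist Ξ := by
  induction n generalizing Ξ with
  | zero =>
    simp only [zero_mul, FedProblem.windowProd, mix_one, lintegral_const, measure_univ, mul_one,
      pow_zero, one_mul, le_refl]
  | succ n ih =>
    have hmeas : ∀ a R, Measurable[drawn W ξ (mixDraws T M a R)] fun ω (s t : Fin T) =>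
        FedProblem.windowProd (fun k => W k ω) a R s t := fun a R =>
      @measurable_pi_lambda _ _ _ (drawn W ξ (mixDraws T M a R)) _ _ fun s =>
        @measurable_pi_lambda _ _ _ (drawn W ξ (mixDraws T M a R)) _ _ fun t =>
          @measurable_windowProd _ (drawn W ξ (mixDraws T M a R)) _ _ a R
            (fun k h1 h2 => measurable_mixing_drawn ⟨h1, h2⟩) s t
    have hle := drawn_le (W := W) (ξ := ξ) hcons.measurable hind.measurable
    have hX := hmeas (l * τ + n * τ) τ
    have hY := hmeas (l * τ) (n * τ)
    have hi := indepFun_of_drawn hcons.measurable hind (disjoint_mix_mix (l * τ) (n * τ) τ) hX hY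
    have hf : Measurable fun x : (Fin T → Fin T → ℝ) × (Fin T → Fin T → ℝ) =>
        FedProblem.consensusDist (FedProblem.mix (FedProblem.mix Ξ x.1) x.2) := by
      simp only [consensusDist_eq]
      exact (measurable_spread (measurable_mix (measurable_mix measurable_const measurable_fst)
        measurable_snd)).ennreal_ofReal
    have hrate := hcons.rate Ξ (l + n) (hn n (by omega))
    have hmixed : ∀ ω, FedProblem.windowProd (fun k => W k ω) (l * τ) ((n + 1) * τ)
        = FedProblem.windowProd (fun k => W k ω) (l * τ + n * τ) τ
          * FedProblem.windowProd (fun k => W k ω) (l * τ) (n * τ) := fun ω => by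
      rw [add_mul, one_mul, windowProd_add]
    calc _ = ∫⁻ ω, FedProblem.consensusDist (FedProblem.mix (FedProblem.mix Ξ
            (FedProblem.windowProd (fun k => W k ω) (l * τ + n * τ) τ))
            (FedProblem.windowProd (fun k => W k ω) (l * τ) (n * τ))) ∂P := by
          refine lintegral_congr fun ω => ?_
          rw [hmixed ω, mix_mix]
      _ = ∫⁻ ω, ∫⁻ ω', FedProblem.consensusDist (FedProblem.mix (FedProblem.mix Ξ
            (FedProblem.windowProd (fun k => W k ω) (l * τ + n * τ) τ))
            (FedProblem.windowProd (fun k => W k ω') (l * τ) (n * τ))) ∂P ∂P :=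
          lintegral_of_indepFun (hX.mono (hle _) le_rfl) (hY.mono (hle _) le_rfl) hi hf
      _ ≤ ∫⁻ ω, ENNReal.ofReal (1 - p) ^ n * FedProblem.consensusDist (FedProblem.mix Ξ
            (FedProblem.windowProd (fun k => W k ω) ((l + n) * τ) τ)) ∂P := by
          refine lintegral_mono fun ω => ?_
          rw [add_mul]
          exact ih (fun i hi => hn i (by omega)) _
      _ = ENNReal.ofReal (1 - p) ^ n * ∫⁻ ω, FedProblem.consensusDist (FedProblem.mix Ξ
            (FedProblem.windowProd (fun k => W k ω) ((l + n) * τ) τ)) ∂P :=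
          lintegral_const_mul' _ _ (ENNReal.pow_ne_top ENNReal.ofReal_ne_top)
      _ ≤ ENNReal.ofReal (1 - p) ^ n *
            (ENNReal.ofReal (1 - p) * FedProblem.consensusDist Ξ) := by
          gcongr
          refine le_trans (le_of_eq (lintegral_congr_ae ?_)) hrate
          have hds : ∀ᵐ ω ∂P, ∀ k, Matrix.of (W k ω) ∈ doublyStochastic ℝ (Fin T) :=
            ae_all_iff.2 hcons.stochastic
          filter_upwards [hds] with ω hω
          unfold FedProblem.consensusDist
          rw [average_mix (windowProd_mem hω _ _)]
      _ = _ := by rw [pow_succ, mul_assoc]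

/-- Mean square deviation of a product of mixing matrices from the averaging matrix. -/
lemma integral_frobDist_le [Nontrivial (Params M d)] (hT : T ≠ 0) (hp₁ : p ≤ 1)
    (hcons : FedProblem.ExpectedConsensus M d W p τ K P)
    (hind : FedProblem.IndependentSampling 𝓑 W ξ P) (l : ℕ) {n : ℕ}
    (hn : ∀ i < n, l + i ≤ K / τ) :
    ∫ ω, min 1 (frobDist (FedProblem.windowProd (fun k => W k ω) (l * τ) (n * τ))) ∂P
      ≤ T * (1 - p) ^ n := by
  obtain ⟨v, hv⟩ := exists_norm_eq (Params M d) zero_le_one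
  have hds : ∀ᵐ ω ∂P, ∀ k, Matrix.of (W k ω) ∈ doublyStochastic ℝ (Fin T) :=
    ae_all_iff.2 hcons.stochastic
  have hm : Measurable fun ω => frobDist (FedProblem.windowProd (fun k => W k ω) (l * τ) (n * τ)) :=
    measurable_frobDist fun s t => measurable_windowProd _ _ (fun k _ _ => hcons.measurable k) s t
  rw [integral_eq_lintegral_of_nonneg_ae
    (Filter.Eventually.of_forall fun ω => le_min zero_le_one (frobDist_nonneg _))
    (measurable_const.min hm).aestronglyMeasurable]
  refine ENNReal.toReal_le_of_le_ofReal
    (mul_nonneg (Nat.cast_nonneg _) (pow_nonneg (by linarith) _)) ?_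
  calc _ ≤ ∫⁻ ω, ∑ s, FedProblem.consensusDist (FedProblem.mix (fun t => if t = s then v else 0)
        (FedProblem.windowProd (fun k => W k ω) (l * τ) (n * τ))) ∂P := by
        refine lintegral_mono_ae ?_
        filter_upwards [hds] with ω hω
        rw [sum_spread_mix_single (windowProd_mem hω _ _) hv]
        simp only [consensusDist_eq]
        rw [← ENNReal.ofReal_sum_of_nonneg fun _ _ => spread_nonneg _]
        exact ENNReal.ofReal_le_ofReal (min_le_right _ _)
    _ = ∑ s, ∫⁻ ω, FedProblem.consensusDist (FedProblem.mix (fun t => if t = s then v else 0)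
        (FedProblem.windowProd (fun k => W k ω) (l * τ) (n * τ))) ∂P := by
        refine lintegral_finsetSum _ fun s _ => ?_
        simp only [consensusDist_eq]
        refine (measurable_spread (measurable_mix measurable_const ?_)).ennreal_ofReal
        exact measurable_pi_lambda _ fun s => measurable_pi_lambda _ fun t =>
          measurable_windowProd _ _ (fun k _ _ => hcons.measurable k) s t
    _ ≤ ∑ _s : Fin T, ENNReal.ofReal (1 - p) ^ n * 1 := by
        refine Finset.sum_le_sum fun s _ =>
          (lintegral_consensusDist_le hcons hind l hn _).trans ?_
        gcongr
        rw [consensusDist_eq, ← ENNReal.ofReal_one]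
        refine ENNReal.ofReal_le_ofReal ((spread_le_sum hT _).trans_eq ?_)
        simp [apply_ite (fun x => ‖x‖ ^ 2), hv]
    _ = ENNReal.ofReal (T * (1 - p) ^ n) := by
        rw [Finset.sum_const, Finset.card_univ, Fintype.card_fin, nsmul_eq_mul, mul_one,
          ENNReal.ofReal_mul (Nat.cast_nonneg _), ENNReal.ofReal_natCast,
          ENNReal.ofReal_pow (by linarith)]

end Contraction

/-! ### Expected descent along a run of the algorithm -/

section Run

variable {𝒳 𝒴 𝒜 : Type*} [MeasurableSpace 𝒳] [MeasurableSpace 𝒴] {T M d : ℕ}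
  {Q : FedProblem 𝒳 𝒴 𝒜 T M d}

/-- Likelihood at the mean iterate, up to an additive constant. -/
noncomputable def meanEnergy (z : Tracked Q) : ℝ :=
  freeEnergy (client Q) (lossAt Q) (fun _ => FedProblem.average z.1) z.2.1

/-- Squared norm of the gradient of the likelihood at the mean iterate. -/
noncomputable def meanGradSq (z : Tracked Q) : ℝ :=
  ‖gradVec (lossAt Q) (fun _ => FedProblem.average z.1)
    (resp (client Q) (lossAt Q) (fun _ => FedProblem.average z.1) z.2.1)‖ ^ 2

/-- The standing assumptions on a random run of the algorithm; `z` is the trajectory with its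
moving averages. -/
structure RandomRun (𝓑 : Q.BatchScheme) (L : ℝ≥0) (J : ℕ) (S₀ : FedProblem.ClientState T M d)
    (r κ η : ℝ) {Ω : Type u} [MeasurableSpace Ω] (P : Measure Ω) (W : ℕ → Ω → Fin T → Fin T → ℝ)
    (ξ : ℕ → (t : Fin T) → Fin M → ℕ → Ω → 𝓑.Batch t) (z : ℕ → Ω → Tracked Q) : Prop where
  samples : ∀ t, 0 < Q.n t
  loss : SmoothLoss (lossAt Q) L
  clients : T ≠ 0
  steps : 1 ≤ J
  init : ∀ t, S₀.π t ∈ stdSimplex ℝ (Fin M)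
  stepSize : StepSize T J L r κ η
  uniform : 𝓑.Uniform
  mix_meas : ∀ k, Measurable (W k)
  mix_mem : ∀ᵐ ω ∂P, ∀ k, Matrix.of (W k ω) ∈ doublyStochastic ℝ (Fin T)
    ∧ (Matrix.of (W k ω)).IsSymm
  sampling : FedProblem.IndependentSampling 𝓑 W ξ P
  traj : z = fun k ω => track 𝓑 η κ J S₀ (fun j => W j ω) (fun i t m j => ξ i t m j ω) k

namespace RandomRun

variable {𝓑 : Q.BatchScheme} {L : ℝ≥0} {J : ℕ} {S₀ : FedProblem.ClientState T M d}
  {r κ η : ℝ} {Ω : Type u} [MeasurableSpace Ω] {P : Measure Ω}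
  {W : ℕ → Ω → Fin T → Fin T → ℝ} {ξ : ℕ → (t : Fin T) → Fin M → ℕ → Ω → 𝓑.Batch t}
  {z : ℕ → Ω → Tracked Q}

lemma nonempty (h : RandomRun 𝓑 L J S₀ r κ η P W ξ z) : Nonempty (Sample Q) :=
  nonempty_sample h.samples h.clients

lemma measurable (h : RandomRun 𝓑 L J S₀ r κ η P W ξ z) (k : ℕ) : Measurable (z k) := by
  rw [h.traj]
  refine measurable_track h.loss η κ J S₀ (b := fun i ω t m j => ξ i t m j ω) k
    (fun j _ => h.mix_meas j) fun j _ => ?_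
  exact measurable_pi_lambda _ fun t => measurable_pi_lambda _ fun m =>
    measurable_pi_lambda _ fun i => h.sampling.measurable j t m i

lemma comparator (h : RandomRun 𝓑 L J S₀ r κ η P W ξ z) (k : ℕ) (ω : Ω) :
    Comparator (client Q) (z k ω).2.1 (z k ω).2.2.1 (z k ω).2.2.2.1 := by
  have := h.nonempty
  rw [h.traj]
  exact comparator_track h.samples h.init h.stepSize.kappa_pos.le h.stepSize.kappa_le k

lemma step_eq (h : RandomRun 𝓑 L J S₀ r κ η P W ξ z) (k : ℕ) (ω : Ω) :
    z (k + 1) ω = trackStep 𝓑 η κ J (W k ω) (fun t m j => ξ k t m j ω) (z k ω) := by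
  rw [h.traj]; rfl

lemma init_eq (h : RandomRun 𝓑 L J S₀ r κ η P W ξ z) (ω : Ω) : z 0 ω = trackInit Q S₀ := by
  rw [h.traj]; rfl

lemma roundBounds (h : RandomRun 𝓑 L J S₀ r κ η P W ξ z) {R : ℕ} (hR : 1 ≤ R) :
    ∀ᵐ ω ∂P, RoundBounds (trackConst T Q.total R L) κ (fun k => trackLyap r κ (z k ω))
      (fun k => trackKL κ (z k ω)) (fun k => trackEnergy (z k ω)) (fun k => spread (z k ω).1)
      (fun k => trackNoise 𝓑 J r κ (z k ω) fun t m j => ξ k t m j ω) := by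
  have := h.nonempty
  filter_upwards [h.mix_mem] with ω hω
  exact roundBounds_track h.samples h.loss h.clients h.steps hR h.stepSize (fun k => (hω k).1)
    (fun k => h.comparator k ω) fun k => h.step_eq k ω

/-- Bound for the initial state, uniformly in the rate of the moving averages. -/
noncomputable def initBound (r : ℝ) (S₀ : FedProblem.ClientState T M d) : ℝ :=
  trackLyap r 1 (trackInit Q S₀) + trackEnergy (trackInit Q S₀) + spread (trackInit Q S₀).1

lemma initBound_spec (h : RandomRun 𝓑 L J S₀ r κ η P W ξ z) :
    0 ≤ initBound (Q := Q) r S₀ ∧ ∀ ω, trackLyap r κ (z 0 ω) ≤ initBound (Q := Q) r S₀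
      ∧ trackEnergy (z 0 ω) ≤ initBound (Q := Q) r S₀
      ∧ spread (z 0 ω).1 ≤ initBound (Q := Q) r S₀ := by
  have := h.nonempty
  have hc := comparator_trackInit (Q := Q) h.samples h.init
  have hr0 := h.stepSize.r_pos h.loss.one_le
  have hr8 : 8 * L * r ≤ 1 := by have := h.stepSize.r_mul h.loss.one_le; nlinarith
  have h1 : 0 ≤ trackLyap r 1 (trackInit Q S₀) :=
    hc.lyapunov_nonneg h.loss hr0 hr8 zero_le_one _ _
  have h2 : 0 ≤ trackEnergy (trackInit Q S₀) := freeEnergy_nonneg h.loss h.init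
  have h3 := spread_nonneg (trackInit Q S₀).1
  have h4 : trackLyap r κ (trackInit Q S₀) ≤ trackLyap r 1 (trackInit Q S₀) := by
    unfold trackLyap lyapunov
    have := mul_le_mul_of_nonneg_right h.stepSize.kappa_le hc.kl_nonneg
    linarith
  unfold initBound
  refine ⟨by linarith, fun ω => ?_⟩
  rw [h.init_eq]
  exact ⟨by linarith, by linarith, by linarith⟩

lemma measurable_values (h : RandomRun 𝓑 L J S₀ r κ η P W ξ z) (k : ℕ) :
    Measurable fun ω => (trackLyap r κ (z k ω), trackKL κ (z k ω), trackEnergy (z k ω),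
      spread (z k ω).1, trackNoise 𝓑 J r κ (z k ω) fun t m j => ξ k t m j ω) := by
  have hz := h.measurable k
  have hξ : Measurable fun ω t m j => ξ k t m j ω :=
    measurable_pi_lambda _ fun t => measurable_pi_lambda _ fun m =>
      measurable_pi_lambda _ fun i => h.sampling.measurable k t m i
  exact (measurable_trackLyap h.loss r κ hz).prodMk ((measurable_trackKL κ hz).prodMk
    ((measurable_trackEnergy h.loss hz).prodMk ((measurable_spread hz.fst).prodMk
      ((measurable_track_noiseCoeff h.loss r κ hz).inner
        (measurable_track_roundNoise h.loss J hz hξ)))))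

variable [IsProbabilityMeasure P]

/-- The run satisfies the bounds of a random trajectory, for blocks of `w` windows. -/
theorem randomBounds (h : RandomRun 𝓑 L J S₀ r κ η P W ξ z) {p : ℝ} (hp₁ : p ≤ 1) {τ K w : ℕ}
    (hw : 1 ≤ w) (hτ : 1 ≤ τ) (hwp : T * (1 - p) ^ w ≤ 1 / 64)
    (hcons : FedProblem.ExpectedConsensus M d W p τ K P) :
    ∃ ρ : ℕ → Ω → ℝ, RandomBounds P (trackConst T Q.total (w * τ) L) κ (initBound (Q := Q) r S₀)
      (w * τ) ((K / τ + 1) / w) (fun k ω => trackLyap r κ (z k ω)) (fun k ω => trackKL κ (z k ω))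
      (fun k ω => trackEnergy (z k ω)) (fun k ω => spread (z k ω).1)
      (fun k ω => trackNoise 𝓑 J r κ (z k ω) fun t m j => ξ k t m j ω) ρ := by
  have := h.nonempty
  have hR : 1 ≤ w * τ := Nat.mul_pos hw hτ
  have hnoise : ∀ C' b i, ∫ ω, potentialNoise C' κ (trackLyap r κ (z b ω)) (trackKL κ (z b ω))
      (trackEnergy (z b ω)) (spread (z b ω).1)
      * trackNoise 𝓑 J r κ (z (b + i) ω) (fun t m j => ξ (b + i) t m j ω) ∂P = 0 := by
    intro C' b i
    refine integral_mul_roundNoise h.loss h.uniform h.mix_meas h.sampling η κ J S₀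
      (φ := fun y => potentialNoise C' κ (trackLyap r κ y) (trackKL κ y) (trackEnergy y)
        (spread y.1))
      (A := fun y => noiseCoeff (lossAt Q) r κ (FedProblem.average y.1) y.2.2.1 y.2.2.2.2)
      ?_ (measurable_track_noiseCoeff h.loss r κ measurable_id) (Nat.le_add_right b i) h.traj
    have h1 := measurable_trackLyap h.loss (Q := Q) r κ measurable_id
    have h2 := measurable_trackKL (Q := Q) κ measurable_id
    have h3 := measurable_trackEnergy h.loss (Q := Q) measurable_id
    have h4 : Measurable fun y : Tracked Q => spread y.1 := measurable_spread measurable_fst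
    unfold potentialNoise
    simp only [id] at h1 h2 h3
    fun_prop
  rcases subsingleton_or_nontrivial (Params M d) with hs | hs
  · have h0 : ∀ Ξ : Fin T → Params M d, spread Ξ = 0 := fun Ξ => by
      unfold spread
      exact Finset.sum_eq_zero fun t _ => by rw [Subsingleton.elim (Ξ t - _) 0]; simp
    refine ⟨fun _ _ => 0, ⟨h.roundBounds hR, fun _ _ => by simp, ?_, h.measurable_values,
      fun _ => measurable_const, h.initBound_spec.2, hnoise, fun _ _ _ => by simp,
      fun _ _ => by simp⟩⟩
    filter_upwards [h.roundBounds hR] with ω hω j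
    have h1 : 0 ≤ ∑ i ∈ Finset.range (w * τ), trackEnergy (z (j * (w * τ) + i) ω) :=
      Finset.sum_nonneg fun i _ => hω.F_nonneg _
    have h2 := (le_trackConst (Q := Q) h.loss h.clients hR).2.2.2
    rw [h0, h0]
    simp only [mul_zero, zero_add]
    positivity
  · refine ⟨fun j ω => min 1 (frobDist (FedProblem.windowProd (fun k => W k ω) (j * (w * τ))
      (w * τ))), ⟨h.roundBounds hR, fun j ω => ⟨le_min zero_le_one (frobDist_nonneg _),
        min_le_left _ _⟩, ?_, h.measurable_values, fun j => ?_, h.initBound_spec.2, hnoise,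
        fun C' j _ => ?_, fun j hj => ?_⟩⟩
    · filter_upwards [h.mix_mem] with ω hω j
      exact spread_track_block h.loss h.clients hR h.stepSize (fun k => (hω k).1)
        (fun k => (hω k).2) (fun k => (h.comparator k ω).weights) (fun k => h.step_eq k ω) _
    · exact measurable_const.min (measurable_frobDist fun s t =>
        measurable_windowProd _ _ (fun k _ _ => h.mix_meas k) s t)
    · set a := j * (w * τ)
      have h1 : Measurable[drawn W ξ (pastDraws T M a)] (z a) := by
        rw [h.traj]; exact measurable_track_drawn h.loss η κ J S₀ le_rfl
      have h2 : Measurable[drawn W ξ (mixDraws T M a (w * τ))] fun ω =>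
          min 1 (frobDist (FedProblem.windowProd (fun k => W k ω) a (w * τ))) :=
        measurable_const.min (@measurable_frobDist _ (drawn W ξ (mixDraws T M a (w * τ))) _ _
          fun s t => @measurable_windowProd _ (drawn W ξ (mixDraws T M a (w * τ))) _ _ _ _
            (fun k h1 h2 => measurable_mixing_drawn ⟨h1, h2⟩) s t)
      have h3 := indepFun_of_drawn h.mix_meas h.sampling (disjoint_past_mix a (w * τ)) h1 h2
      have h4 : Measurable fun y : Tracked Q => potentialMix C' κ (trackLyap r κ y) (trackKL κ y)
          (trackEnergy y) (spread y.1) := by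
        have e1 := measurable_trackLyap h.loss (Q := Q) r κ measurable_id
        have e2 := measurable_trackKL (Q := Q) κ measurable_id
        have e3 := measurable_trackEnergy h.loss (Q := Q) measurable_id
        have e4 : Measurable fun y : Tracked Q => spread y.1 := measurable_spread measurable_fst
        unfold potentialMix
        simp only [id] at e1 e2 e3
        fun_prop
      have h5 := h3.comp h4 measurable_id
      have hle := drawn_le (W := W) (ξ := ξ) h.mix_meas h.sampling.measurable
      exact h5.integral_fun_mul_eq_mul_integral
        (h4.comp (h.measurable a)).aestronglyMeasurable (h2.mono (hle _) le_rfl).aestronglyMeasurable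
    · rw [← mul_assoc]
      refine (integral_frobDist_le h.clients hp₁ hcons h.sampling (j * w) fun i hi => ?_).trans hwp
      have h1 : (j + 1) * w ≤ K / τ + 1 := by
        calc (j + 1) * w ≤ (K / τ + 1) / w * w := Nat.mul_le_mul_right _ hj
          _ ≤ _ := Nat.div_mul_le_self _ _
      rw [add_mul, one_mul] at h1
      omega

/-- Constant in the expected descent of the likelihood. -/
noncomputable def descentConst (T N : ℕ) (L : ℝ≥0) : ℝ := 100 * N * roundConst T N L ^ 2

/-- Telescoped expected descent of the likelihood. -/
theorem sum_descent_le (h : RandomRun 𝓑 L J S₀ r κ η P W ξ z) {C B₀ : ℝ} {R n : ℕ} (hC : 1 ≤ C)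
    {ρ : ℕ → Ω → ℝ} (hb : RandomBounds P C κ B₀ R n (fun k ω => trackLyap r κ (z k ω))
      (fun k ω => trackKL κ (z k ω)) (fun k ω => trackEnergy (z k ω))
      (fun k ω => spread (z k ω).1)
      (fun k ω => trackNoise 𝓑 J r κ (z k ω) fun t m j => ξ k t m j ω) ρ) (m : ℕ) :
    (∀ k, Integrable (fun ω => clientKL (client Q) (z (k + 1) ω).2.1 (z k ω).2.1) P)
      ∧ (∀ k, Integrable (fun ω => meanGradSq (z k ω)) P)
      ∧ ∑ k ∈ Finset.range m, ∫ ω, clientKL (client Q) (z (k + 1) ω).2.1 (z k ω).2.1 ∂P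
        + r * κ / 8 * ∑ k ∈ Finset.range m, ∫ ω, meanGradSq (z k ω) ∂P
      ≤ (2 + L) * B₀ + descentConst T Q.total L *
        (2 * ∑ k ∈ Finset.range m, ∫ ω, moment κ (trackEnergy (z k ω)) (spread (z k ω).1) ∂P
          + m * κ ^ 2) := by
  have := h.nonempty
  have hκ0 := h.stepSize.kappa_pos
  have hκ1 := h.stepSize.kappa_le
  have hr0 := h.stepSize.r_pos h.loss.one_le
  have hrκ : 0 < r * κ := mul_pos hr0 hκ0
  set c := descentConst T Q.total L with hc
  have hc0 : 0 ≤ c := by rw [hc]; unfold descentConst; positivity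
  set V : ℕ → Ω → ℝ := fun k ω => inner ℝ (trackGrad (z k ω))
    (roundNoise 𝓑 J (z k ω).1 (z k ω).2.1 fun t m j => ξ k t m j ω) with hV
  have hF0 : ∀ k ω, 0 ≤ trackEnergy (z k ω) := fun k ω =>
    freeEnergy_nonneg h.loss (h.comparator k ω).weights
  have hD0 : ∀ k ω, 0 ≤ spread (z k ω).1 := fun k ω => spread_nonneg _
  have hD : ∀ k ω (s : Sample Q), ‖(z k ω).1 (client Q s) - FedProblem.average (z k ω).1‖ ^ 2
      ≤ spread (z k ω).1 := fun k ω s => norm_sub_average_sq_le _ _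
  have hmean : ∀ k ω, risk (lossAt Q) (fun _ => FedProblem.average (z k ω).1)
      (resp (client Q) (lossAt Q) (z k ω).1 (z k ω).2.1)
      + respInfo (client Q) (z k ω).2.1 (resp (client Q) (lossAt Q) (z k ω).1 (z k ω).2.1)
      ≤ 2 * trackEnergy (z k ω) + L * spread (z k ω).1 := fun k ω =>
    freeEnergy_mean_le h.loss (h.comparator k ω).weights (hD k ω)
  have hq : ∀ k ω (s : Sample Q), resp (client Q) (lossAt Q) (z k ω).1 (z k ω).2.1 s
      ∈ stdSimplex ℝ (Fin M) := fun k ω => resp_mem (h.comparator k ω).weights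
  have hac : ∀ k ω (s : Sample Q) m, (z k ω).2.1 (client Q s) m = 0 →
      resp (client Q) (lossAt Q) (z k ω).1 (z k ω).2.1 s m = 0 := fun k ω s m h0 =>
    (resp_eq_zero_iff (h.comparator k ω).weights s m).2 h0
  have hE0 : ∀ k ω, 0 ≤ meanEnergy (z k ω) := fun k ω =>
    freeEnergy_nonneg h.loss (h.comparator k ω).weights
  have hE : ∀ k ω, meanEnergy (z k ω) ≤ 2 * trackEnergy (z k ω) + L * spread (z k ω).1 :=
    fun k ω => (freeEnergy_le (Θ := fun _ => FedProblem.average (z k ω).1)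
      (h.comparator k ω).weights (hq k ω) (hac k ω)).trans (hmean k ω)
  have hVb : ∀ k ω, |V k ω| ≤ L * (2 * trackEnergy (z k ω) + L * spread (z k ω).1)
      + roundConst T Q.total L * trackEnergy (z k ω) := fun k ω => by
    have e1 : ‖trackGrad (z k ω)‖ ^ 2
        ≤ 2 * L * (2 * trackEnergy (z k ω) + L * spread (z k ω).1) := by
      refine (norm_gradVec_sq_le h.loss (hq k ω) _).trans ?_
      have := respInfo_nonneg (hq k ω) (h.comparator k ω).weights (hac k ω)
      have := hmean k ω
      gcongr
      linarith
    have e2 := roundNoise_sq_le (b := fun t m j => ξ k t m j ω) h.loss h.clients h.steps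
      (h.comparator k ω).weights
    have e3 := abs_real_inner_le_norm (trackGrad (z k ω))
      (roundNoise 𝓑 J (z k ω).1 (z k ω).2.1 fun t m j => ξ k t m j ω)
    have e4 := sq_nonneg (roundConst T Q.total L * trackEnergy (z k ω))
    have e5 := two_mul_le_add_sq ‖trackGrad (z k ω)‖
      ‖roundNoise 𝓑 J (z k ω).1 (z k ω).2.1 fun t m j => ξ k t m j ω‖
    have e6 := mul_nonneg (show 0 ≤ roundConst T Q.total L by unfold roundConst; positivity)
      (hF0 k ω)
    simp only [hV]
    linarith
  have hm : ∀ k ω, IsClientMean (client Q) (resp (client Q) (lossAt Q) (z k ω).1 (z k ω).2.1)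
      (z (k + 1) ω).2.1 := fun k ω => by
    rw [h.step_eq]; exact isClientMean_mixtureUpdate h.samples (h.comparator k ω).weights
  have hKL0 : ∀ k ω, 0 ≤ clientKL (client Q) (z (k + 1) ω).2.1 (z k ω).2.1 := fun k ω =>
    clientKL_step_nonneg (h.comparator k ω).weights (hm k ω)
  have hG0 : ∀ k ω, 0 ≤ meanGradSq (z k ω) := fun k ω => sq_nonneg _
  have hM0 : ∀ k ω, 0 ≤ moment κ (trackEnergy (z k ω)) (spread (z k ω).1) := fun k ω =>
    moment_nonneg (hF0 k ω) (hD0 k ω)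
  have hdesc : ∀ᵐ ω ∂P, ∀ k, meanEnergy (z (k + 1) ω)
      + clientKL (client Q) (z (k + 1) ω).2.1 (z k ω).2.1 + r * κ / 8 * meanGradSq (z k ω)
      ≤ meanEnergy (z k ω) - r * κ * V k ω
        + c * (2 * moment κ (trackEnergy (z k ω)) (spread (z k ω).1) + κ ^ 2) := by
    filter_upwards [h.mix_mem] with ω hω k
    have e1 := likelihood_track_le h.samples h.loss h.clients h.steps h.stepSize
      (z := fun k => z k ω) (fun k => (hω k).1) (fun k => (h.comparator k ω).weights)
      (fun k => h.step_eq k ω) k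
    refine e1.trans (add_le_add_right (mul_le_mul_of_nonneg_left ?_ hc0) _)
    have e2 : κ ^ 2 * trackEnergy (z k ω) ≤ κ ^ 2 * trackEnergy (z k ω) ^ 2 + κ ^ 2 := by
      have : trackEnergy (z k ω) ≤ trackEnergy (z k ω) ^ 2 + 1 := by
        nlinarith [sq_nonneg (trackEnergy (z k ω) - 1)]
      nlinarith [sq_nonneg κ]
    have e3 : 0 ≤ trackEnergy (z k ω) * spread (z k ω).1 := mul_nonneg (hF0 k ω) (hD0 k ω)
    have e4 := hD0 k ω
    have e5 := sq_nonneg (spread (z k ω).1)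
    unfold moment
    linarith
  have hz := h.measurable
  have mE : ∀ k, Measurable fun ω => meanEnergy (z k ω) := fun k =>
    measurable_freeEnergy h.loss
      (measurable_pi_lambda _ fun _ => measurable_average (hz k).fst) (hz k).snd.fst
  have mG : ∀ k, Measurable fun ω => meanGradSq (z k ω) := fun k =>
    ((measurable_gradVec h.loss (z := fun ω _ => FedProblem.average (z k ω).1)
      (measurable_pi_lambda _ fun _ => measurable_average (hz k).fst)
      (measurable_resp h.loss (Θ := fun ω _ => FedProblem.average (z k ω).1)
        (measurable_pi_lambda _ fun _ => measurable_average (hz k).fst)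
        (hz k).snd.fst)).norm).pow_const 2
  have mKL : ∀ k, Measurable fun ω => clientKL (client Q) (z (k + 1) ω).2.1 (z k ω).2.1 :=
    fun k => measurable_clientKL (hz (k + 1)).snd.fst (hz k).snd.fst
  have mV : ∀ k, Measurable (V k) := fun k =>
    (measurable_trackGrad h.loss (hz k)).inner (measurable_track_roundNoise h.loss J (hz k)
      (measurable_pi_lambda _ fun t => measurable_pi_lambda _ fun m =>
        measurable_pi_lambda _ fun i => h.sampling.measurable k t m i))
  have iFD : ∀ (x y : ℝ) k, Integrable
      (fun ω => x * trackEnergy (z k ω) + y * spread (z k ω).1) P := fun x y k =>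
    hb.integrable_comp hC hκ0.le hκ1 k (f := fun v => x * v.2.2.1 + y * v.2.2.2.1) (by fun_prop)
  have iM : ∀ k, Integrable (fun ω => moment κ (trackEnergy (z k ω)) (spread (z k ω).1)) P :=
    hb.integrable_moment hC hκ0.le hκ1
  have iE : ∀ k, Integrable (fun ω => meanEnergy (z k ω)) P := fun k =>
    (iFD 2 L k).mono' (mE k).aestronglyMeasurable (Filter.Eventually.of_forall fun ω => by
      rw [Real.norm_of_nonneg (hE0 k ω)]; exact hE k ω)
  have iV : ∀ k, Integrable (V k) P := fun k =>
    (iFD (2 * L + roundConst T Q.total L) (L * L) k).mono' (mV k).aestronglyMeasurable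
      (Filter.Eventually.of_forall fun ω => by
        rw [Real.norm_eq_abs]
        refine (hVb k ω).trans_eq ?_
        ring)
  have i1 : ∀ k, Integrable (fun ω => meanEnergy (z k ω) - r * κ * V k ω) P := fun k =>
    (iE k).sub ((iV k).const_mul _)
  have i2 : ∀ k, Integrable
      (fun ω => 2 * moment κ (trackEnergy (z k ω)) (spread (z k ω).1) + κ ^ 2) P := fun k =>
    ((iM k).const_mul 2).add (integrable_const _)
  have iR : ∀ k, Integrable (fun ω => meanEnergy (z k ω) - r * κ * V k ω
      + c * (2 * moment κ (trackEnergy (z k ω)) (spread (z k ω).1) + κ ^ 2)) P := fun k =>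
    (i1 k).add ((i2 k).const_mul c)
  have iKL : ∀ k, Integrable (fun ω => clientKL (client Q) (z (k + 1) ω).2.1 (z k ω).2.1) P := by
    intro k
    refine (iR k).mono' (mKL k).aestronglyMeasurable ?_
    filter_upwards [hdesc] with ω hω
    rw [Real.norm_of_nonneg (hKL0 k ω)]
    have := hω k
    have := hE0 (k + 1) ω
    have := mul_nonneg (by positivity : 0 ≤ r * κ / 8) (hG0 k ω)
    linarith
  have iG : ∀ k, Integrable (fun ω => meanGradSq (z k ω)) P := by
    intro k
    refine ((iR k).const_mul (r * κ / 8)⁻¹).mono' (mG k).aestronglyMeasurable ?_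
    filter_upwards [hdesc] with ω hω
    rw [Real.norm_of_nonneg (hG0 k ω), ← div_eq_inv_mul, le_div_iff₀ (by positivity)]
    have := hω k
    have := hE0 (k + 1) ω
    have := hKL0 k ω
    linarith
  have hVz : ∀ k, ∫ ω, V k ω ∂P = 0 := fun k => by
    have e1 := integral_mul_roundNoise h.loss h.uniform h.mix_meas h.sampling η κ J S₀
      (φ := fun _ => 1) measurable_const (A := trackGrad)
      (measurable_trackGrad h.loss measurable_id) (le_refl k) h.traj
    simpa only [one_mul] using e1
  have hstep : ∀ k, ∫ ω, meanEnergy (z (k + 1) ω) ∂P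
      + ∫ ω, clientKL (client Q) (z (k + 1) ω).2.1 (z k ω).2.1 ∂P
      + r * κ / 8 * ∫ ω, meanGradSq (z k ω) ∂P
      ≤ ∫ ω, meanEnergy (z k ω) ∂P
        + c * (2 * ∫ ω, moment κ (trackEnergy (z k ω)) (spread (z k ω).1) ∂P + κ ^ 2) := by
    intro k
    have i3 : Integrable (fun ω => meanEnergy (z (k + 1) ω)
        + clientKL (client Q) (z (k + 1) ω).2.1 (z k ω).2.1) P := (iE (k + 1)).add (iKL k)
    have e1 := integral_mono_ae (i3.add ((iG k).const_mul (r * κ / 8))) (iR k)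
      (hdesc.mono fun ω hω => hω k)
    have e2 : ∫ ω, (meanEnergy (z (k + 1) ω)
        + clientKL (client Q) (z (k + 1) ω).2.1 (z k ω).2.1 + r * κ / 8 * meanGradSq (z k ω)) ∂P
        = _ := integral_add i3 ((iG k).const_mul (r * κ / 8))
    rw [integral_add (iE (k + 1)) (iKL k), integral_const_mul] at e2
    rw [integral_add (i1 k) ((i2 k).const_mul c), integral_sub (iE k) ((iV k).const_mul _),
      integral_const_mul, integral_const_mul, hVz,
      integral_add ((iM k).const_mul 2) (integrable_const _), integral_const_mul,
      integral_const] at e1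
    simp only [probReal_univ, smul_eq_mul, one_mul, mul_zero, sub_zero] at e1
    exact e2.symm.le.trans e1
  refine ⟨iKL, iG, ?_⟩
  have key : ∀ m : ℕ, ∫ ω, meanEnergy (z m ω) ∂P
      + (∑ k ∈ Finset.range m, ∫ ω, clientKL (client Q) (z (k + 1) ω).2.1 (z k ω).2.1 ∂P
        + r * κ / 8 * ∑ k ∈ Finset.range m, ∫ ω, meanGradSq (z k ω) ∂P)
      ≤ ∫ ω, meanEnergy (z 0 ω) ∂P + c *
        (2 * ∑ k ∈ Finset.range m, ∫ ω, moment κ (trackEnergy (z k ω)) (spread (z k ω).1) ∂P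
          + m * κ ^ 2) := by
    intro m
    induction m with
    | zero => simp
    | succ m ih =>
      have := hstep m
      simp only [Finset.sum_range_succ]
      push_cast
      linarith
  have e0 : ∫ ω, meanEnergy (z 0 ω) ∂P ≤ (2 + L) * B₀ := by
    calc ∫ ω, meanEnergy (z 0 ω) ∂P ≤ ∫ _, (2 + L) * B₀ ∂P := by
          refine integral_mono (iE 0) (integrable_const _) fun ω => (hE 0 ω).trans ?_
          obtain ⟨-, e1, e2⟩ := hb.initial ω
          have e3 : trackEnergy (z 0 ω) ≤ B₀ := e1
          have e4 : (L : ℝ) * spread (z 0 ω).1 ≤ L * B₀ := mul_le_mul_of_nonneg_left e2 L.2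
          linarith
      _ = _ := by simp
  have e1 : 0 ≤ ∫ ω, meanEnergy (z m ω) ∂P := integral_nonneg fun ω => hE0 m ω
  have := key m
  linarith

end RandomRun

end Run

/-! ### The controlled quantities in terms of the trajectory -/

section Conclusion

variable {𝒳 𝒴 𝒜 : Type*} [MeasurableSpace 𝒳] [MeasurableSpace 𝒴] {T M d : ℕ}
  {Q : FedProblem 𝒳 𝒴 𝒜 T M d}

lemma smoothLoss_lossAt {L : ℝ≥0} (h : Q.Smooth L) : SmoothLoss (lossAt Q) (L + 1) where
  diff s := (h s.1 s.2).1.differentiable (by norm_num)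
  lip s := (h s.1 s.2).2.weaken le_self_add
  nonneg _ _ := NNReal.coe_nonneg _
  one_le := le_add_self

lemma clientKL_client (a b : Fin T → Fin M → ℝ) :
    clientKL (client Q) a b = ∑ t, Q.weight t * relEnt (a t) (b t) := by
  rw [clientKL, avg_sample, smul_eq_mul, Finset.mul_sum]
  refine Finset.sum_congr rfl fun t _ => ?_
  simp only [client, Finset.sum_const, Finset.card_univ, Fintype.card_fin, nsmul_eq_mul,
    FedProblem.weight]
  ring

lemma inv_mul_sum_ofReal {K : ℕ} (hK : 1 ≤ K) {ι : Type*} (s : Finset ι) {a : ι → ℝ}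
    (ha : ∀ i, 0 ≤ a i) :
    (K : ℝ≥0∞)⁻¹ * ∑ i ∈ s, ENNReal.ofReal (a i) = ENNReal.ofReal ((∑ i ∈ s, a i) / K) := by
  have hK' : (0 : ℝ) < K := by exact_mod_cast hK
  rw [← ENNReal.ofReal_sum_of_nonneg fun _ _ => ha _, div_eq_inv_mul,
    ENNReal.ofReal_mul (by positivity), ENNReal.ofReal_inv_of_pos hK', ENNReal.ofReal_natCast]

namespace RandomRun

variable {𝓑 : Q.BatchScheme} {L : ℝ≥0} {J : ℕ} {S₀ : FedProblem.ClientState T M d}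
  {r κ η : ℝ} {Ω : Type u} [MeasurableSpace Ω] {P : Measure Ω}
  {W : ℕ → Ω → Fin T → Fin T → ℝ} {ξ : ℕ → (t : Fin T) → Fin M → ℕ → Ω → 𝓑.Batch t}
  {z : ℕ → Ω → Tracked Q}

lemma lintegral_gradient (h : RandomRun 𝓑 L J S₀ r κ η P W ξ z) (hreg : Q.Regular) {k : ℕ}
    (hi : Integrable (fun ω => meanGradSq (z k ω)) P) :
    ∫⁻ ω, ‖gradient (fun Θ => Q.negLogLik Θ (z k ω).2.1) (FedProblem.average (z k ω).1)‖ₑ ^ 2 ∂P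
      = ENNReal.ofReal (∫ ω, meanGradSq (z k ω) ∂P) := by
  rw [ofReal_integral_eq_lintegral_ofReal hi (Filter.Eventually.of_forall fun ω => sq_nonneg _)]
  refine lintegral_congr fun ω => ?_
  rw [gradient_negLogLik hreg h.loss (h.comparator k ω).weights, ← ofReal_norm,
    ← ENNReal.ofReal_pow (norm_nonneg _)]
  rfl

lemma sum_lintegral_klVec (h : RandomRun 𝓑 L J S₀ r κ η P W ξ z) {k : ℕ}
    (hi : Integrable (fun ω => clientKL (client Q) (z (k + 1) ω).2.1 (z k ω).2.1) P) :
    ∑ t, ENNReal.ofReal (Q.weight t) * ∫⁻ ω, klVec ((z (k + 1) ω).2.1 t) ((z k ω).2.1 t) ∂P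
      = ENNReal.ofReal (∫ ω, clientKL (client Q) (z (k + 1) ω).2.1 (z k ω).2.1 ∂P) := by
  have := h.nonempty
  have hm : ∀ ω, IsClientMean (client Q) (resp (client Q) (lossAt Q) (z k ω).1 (z k ω).2.1)
      (z (k + 1) ω).2.1 := fun ω => by
    rw [h.step_eq]; exact isClientMean_mixtureUpdate h.samples (h.comparator k ω).weights
  have hac : ∀ ω t m, (z k ω).2.1 t m = 0 → (z (k + 1) ω).2.1 t m = 0 := fun ω t m h0 =>
    (hm ω).eq_zero' (s := ⟨t, ⟨0, h.samples t⟩⟩) fun s' hs' =>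
      (resp_eq_zero_iff (h.comparator k ω).weights s' m).2 (by rw [hs']; exact h0)
  have hkl : ∀ ω t, klVec ((z (k + 1) ω).2.1 t) ((z k ω).2.1 t)
      = ENNReal.ofReal (relEnt ((z (k + 1) ω).2.1 t) ((z k ω).2.1 t)) := fun ω t => by
    rw [klVec, if_pos (hac ω t), relEnt]
  have hnn : ∀ ω t, 0 ≤ relEnt ((z (k + 1) ω).2.1 t) ((z k ω).2.1 t) := fun ω t =>
    relEnt_nonneg ((hm ω).mem t) ((h.comparator k ω).weights t) (hac ω t)
  have hmeas : ∀ t, Measurable fun ω =>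
      ENNReal.ofReal (relEnt ((z (k + 1) ω).2.1 t) ((z k ω).2.1 t)) := fun t =>
    (measurable_relEnt (measurable_pi_iff.1 (h.measurable (k + 1)).snd.fst t)
      (measurable_pi_iff.1 (h.measurable k).snd.fst t)).ennreal_ofReal
  rw [ofReal_integral_eq_lintegral_ofReal hi (Filter.Eventually.of_forall fun ω =>
    clientKL_step_nonneg (h.comparator k ω).weights (hm ω))]
  simp only [hkl, clientKL_client]
  simp only [← lintegral_const_mul _ (hmeas _)]
  rw [← lintegral_finsetSum _ fun t _ => (hmeas t).const_mul _]
  refine lintegral_congr fun ω => ?_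
  rw [ENNReal.ofReal_sum_of_nonneg fun t _ => mul_nonneg (weight_nonneg t) (hnn ω t)]
  exact Finset.sum_congr rfl fun t _ => (ENNReal.ofReal_mul (weight_nonneg t)).symm

end RandomRun

/-- The choice of constants. For all large `K`, the run with learning rate `a₀ / √K` and the moving
averages of rate `κ₀ / √K` satisfies bounds, summed over the rounds, that do not depend on `K`. -/
theorem exists_summed_bounds (𝓑 : Q.BatchScheme) (hn : ∀ t, 0 < Q.n t) (hT : T ≠ 0) {L : ℝ≥0}
    (hl : SmoothLoss (lossAt Q) L) (hunif : 𝓑.Uniform) {p : ℝ} (hp₀ : 0 < p) (hp₁ : p ≤ 1)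
    {τ : ℕ} (hτ : 1 ≤ τ) {J : ℕ} (hJ : 1 ≤ J) {a₀ : ℝ} (ha₀ : 0 < a₀)
    {S₀ : FedProblem.ClientState T M d} (hS₀ : ∀ t, S₀.π t ∈ stdSimplex ℝ (Fin M)) :
    ∃ (r κ₀ Cm C₂ : ℝ) (K₀ : ℕ), 0 < r ∧ 0 < κ₀ ∧ ∀ K : ℕ, 1 ≤ K → K₀ ≤ K →
      ∀ (Ω : Type u) [MeasurableSpace Ω] (P : Measure Ω) [IsProbabilityMeasure P]
        (W : ℕ → Ω → Fin T → Fin T → ℝ)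
        (ξ : ℕ → (t : Fin T) → Fin M → ℕ → Ω → 𝓑.Batch t),
        FedProblem.ExpectedConsensus M d W p τ K P →
        FedProblem.IndependentSampling 𝓑 W ξ P →
        ∃ z : ℕ → Ω → Tracked Q,
          RandomRun 𝓑 L J S₀ r (κ₀ / √(K : ℝ)) (a₀ / √(K : ℝ)) P W ξ z ∧
          (∀ k, Integrable (fun ω => clientKL (client Q) (z (k + 1) ω).2.1 (z k ω).2.1) P) ∧
          (∀ k, Integrable (fun ω => meanGradSq (z k ω)) P) ∧
          (∀ k, Integrable (fun ω => spread (z k ω).1) P) ∧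
          ∑ k ∈ Finset.range (K + 1), ∫ ω, clientKL (client Q) (z (k + 1) ω).2.1 (z k ω).2.1 ∂P
            + r * (κ₀ / √(K : ℝ)) / 8
              * ∑ k ∈ Finset.range (K + 1), ∫ ω, meanGradSq (z k ω) ∂P ≤ C₂ ∧
          ∑ k ∈ Finset.range (K + 1), ∫ ω, spread (z k ω).1 ∂P ≤ Cm := by
  have hTpos : 0 < T := Nat.pos_of_ne_zero hT
  have hT1 : (1 : ℝ) ≤ T := by exact_mod_cast hTpos
  have hne : Nonempty (Sample Q) := nonempty_sample hn hT
  have hL1 : (1 : ℝ) ≤ L := by exact_mod_cast hl.one_le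
  set r : ℝ := 1 / (64 * L) with hr
  have hr0 : 0 < r := by rw [hr]; positivity
  have hJ1 : (1 : ℝ) ≤ J := by exact_mod_cast hJ
  -- `κ₀ / √K` is the rate of the moving averages for which `r κ` is the step size of a round
  set κ₀ : ℝ := a₀ * J / (T * r) with hκ₀
  have hκ₀0 : 0 < κ₀ := by rw [hκ₀]; positivity
  obtain ⟨w, hw⟩ := exists_pow_lt_of_lt_one (show 0 < 1 / (64 * (T : ℝ)) by positivity)
    (show 1 - p < 1 by linarith)
  have hw1 : 1 ≤ w := by
    rw [Nat.one_le_iff_ne_zero]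
    rintro rfl
    rw [pow_zero, lt_div_iff₀ (by positivity)] at hw
    linarith
  have hwp : T * (1 - p) ^ w ≤ 1 / 64 := by
    rw [lt_div_iff₀ (by positivity)] at hw
    linarith
  set R := w * τ with hR
  have hR1 : 1 ≤ R := Nat.mul_pos hw1 hτ
  set C₁ := trackConst T Q.total R L with hC₁
  have hC₁1 : 1 ≤ C₁ := (le_trackConst (Q := Q) hl hT hR1).2.2.2
  have hB1 := one_le_blockConst hC₁1 R
  set A := 2 * blockConst C₁ R ^ 2 * C₁ * R ^ 2 with hA
  have hA0 : 0 ≤ A := by rw [hA]; positivity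
  set E := 1 + T + blockConst C₁ R + 2000 * A ^ 7 with hE
  have hE7 : 0 ≤ 2000 * A ^ 7 := by positivity
  set B₀ := RandomRun.initBound (Q := Q) r S₀ with hB₀
  set Cm := 2 * R * (6 * blockConst C₁ (2 * R) ^ 2 * (2 * (Real.exp (159 * A ^ 4 * (2 * κ₀ ^ 2))
    * (potential A 1 B₀ B₀ B₀ B₀ + A * (2 * κ₀ ^ 2))) + 2 * κ₀ ^ 2)) with hCm
  set C₂ := (2 + L) * B₀ + RandomRun.descentConst T Q.total L
    * (2 * Cm + 2 * κ₀ ^ 2) with hC₂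
  refine ⟨r, κ₀, Cm, C₂, max R ⌈(κ₀ * E) ^ 2⌉₊, hr0, hκ₀0, ?_⟩
  intro K hK hK₀ Ω _ P _ W ξ hcons hind
  have hK1 : (1 : ℝ) ≤ K := by exact_mod_cast hK
  have hsq1 : 1 ≤ √(K : ℝ) := Real.one_le_sqrt.2 hK1
  have hsq0 : 0 < √(K : ℝ) := by linarith
  have hsqK : √(K : ℝ) * √(K : ℝ) = K := Real.mul_self_sqrt (by positivity)
  set κ : ℝ := κ₀ / √(K : ℝ) with hκ
  have hκ0 : 0 < κ := by rw [hκ]; positivity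
  have hκE : κ * E ≤ 1 := by
    rw [hκ, div_mul_eq_mul_div, div_le_one hsq0]
    refine Real.le_sqrt_of_sq_le ((Nat.le_ceil _).trans ?_)
    exact_mod_cast (le_max_right _ _).trans hK₀
  have hκx : ∀ x, x ≤ E → κ * x ≤ 1 := fun x hx =>
    (mul_le_mul_of_nonneg_left hx hκ0.le).trans hκE
  have hκ1 : κ ≤ 1 := by simpa using hκx 1 (by linarith)
  have hκT : κ * T ≤ 1 := hκx T (by linarith)
  have hκB : κ * blockConst C₁ R ≤ 1 := hκx _ (by linarith)
  have hκA : 2000 * A ^ 7 * κ ≤ 1 := by rw [mul_comm]; exact hκx _ (by linarith)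
  have hηJ : a₀ / √(K : ℝ) * J = r * κ * T := by
    rw [hκ, hκ₀]
    have : (T : ℝ) ≠ 0 := by positivity
    field_simp
  have hstep : StepSize T J L r κ (a₀ / √(K : ℝ)) :=
    { r_eq := hr
      kappa_pos := hκ0
      kappa_le := hκ1
      eta_eq := hηJ
      eta_nonneg := by positivity
      eta_small := by
        rw [hηJ]
        have e : 2 * (r * κ * T * L) = κ * T / 32 := by
          rw [hr]; field_simp; norm_num
        rw [e]
        linarith }
  set z : ℕ → Ω → Tracked Q := fun k ω => track 𝓑 (a₀ / √(K : ℝ)) κ J S₀ (fun j => W j ω)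
    (fun i t m j => ξ i t m j ω) k with hz
  have hrun : RandomRun 𝓑 L J S₀ r κ (a₀ / √(K : ℝ)) P W ξ z :=
    { samples := hn
      loss := hl
      clients := hT
      steps := hJ
      init := hS₀
      stepSize := hstep
      uniform := hunif
      mix_meas := hcons.measurable
      mix_mem := by
        filter_upwards [ae_all_iff.2 hcons.stochastic, ae_all_iff.2 hcons.symmetric] with ω h1 h2 k
        exact ⟨h1 k, h2 k⟩
      sampling := hind
      traj := rfl }
  obtain ⟨ρ, hbounds⟩ := hrun.randomBounds hp₁ hw1 hτ hwp hcons
  have hB₀0 : 0 ≤ B₀ := hrun.initBound_spec.1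
  -- the blocks of `R` rounds that are covered by the windows with known contraction
  set N := (K / τ + 1) / w with hN
  have hKτ : K < (K / τ + 1) * τ := by
    rw [mul_comm]; exact Nat.lt_mul_div_succ K hτ
  have hN1 : 1 ≤ N := by
    rw [hN, Nat.one_le_div_iff (by omega)]
    have h1 : w ≤ K / τ := (Nat.le_div_iff_mul_le hτ).2 ((le_max_left _ _).trans hK₀)
    omega
  have hcover : K + 1 ≤ (N + 1) * R := by
    have h1 : K / τ + 1 < (N + 1) * w := by
      rw [mul_comm, hN]; exact Nat.lt_mul_div_succ _ (by omega)
    have h2 : (K / τ + 1) * τ ≤ (N + 1) * w * τ := Nat.mul_le_mul_right _ h1.le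
    rw [hR, ← mul_assoc]
    omega
  have hκsq : (K : ℝ) * κ ^ 2 = κ₀ ^ 2 := by
    rw [hκ, div_pow, sq (√(K : ℝ)), hsqK]
    field_simp
  have hK1κ : ((K + 1 : ℕ) : ℝ) * κ ^ 2 ≤ 2 * κ₀ ^ 2 := by
    push_cast
    have : 1 * κ ^ 2 ≤ K * κ ^ 2 := by gcongr
    linarith
  have hNκ : (N : ℝ) * κ ^ 2 ≤ 2 * κ₀ ^ 2 := by
    refine le_trans ?_ hK1κ
    have h1 : N ≤ K + 1 := (Nat.div_le_self _ _).trans (Nat.succ_le_succ (Nat.div_le_self _ _))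
    gcongr
  have hmom := hbounds.sum_moment_le hC₁1 hR1 hN1 hκ0 hκ1 hB₀0 hA hκB hκA hNκ
  have hm0 : ∀ k, 0 ≤ ∫ ω, moment κ (trackEnergy (z k ω)) (spread (z k ω).1) ∂P := fun k =>
    integral_nonneg fun ω => moment_nonneg
      (freeEnergy_nonneg hl (hrun.comparator k ω).weights) (spread_nonneg _)
  have hmomK : ∑ k ∈ Finset.range (K + 1),
      ∫ ω, moment κ (trackEnergy (z k ω)) (spread (z k ω).1) ∂P ≤ Cm :=
    (Finset.sum_le_sum_of_subset_of_nonneg (Finset.range_mono hcover)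
      fun k _ _ => hm0 k).trans hmom
  have hdc : 0 ≤ RandomRun.descentConst T Q.total L := by
    unfold RandomRun.descentConst; positivity
  have iD : ∀ k, Integrable (fun ω => spread (z k ω).1) P := fun k =>
    hbounds.integrable_comp hC₁1 hκ0.le hκ1 k (f := fun v => v.2.2.2.1) (by fun_prop)
  have hD : ∀ k, ∫ ω, spread (z k ω).1 ∂P
      ≤ ∫ ω, moment κ (trackEnergy (z k ω)) (spread (z k ω).1) ∂P := fun k => by
    refine integral_mono (iD k) (hbounds.integrable_moment hC₁1 hκ0.le hκ1 k) fun ω => ?_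
    have h1 : 0 ≤ trackEnergy (z k ω) := freeEnergy_nonneg hl (hrun.comparator k ω).weights
    have h2 := spread_nonneg (z k ω).1
    have h3 : 0 ≤ κ ^ 2 * trackEnergy (z k ω) ^ 2 + trackEnergy (z k ω) * spread (z k ω).1
      + spread (z k ω).1 ^ 2 := by positivity
    simp only [moment]
    linarith
  obtain ⟨iKL, iG, hdesc⟩ := hrun.sum_descent_le hC₁1 hbounds (K + 1)
  exact ⟨z, hrun, iKL, iG, iD,
    hdesc.trans (add_le_add_right (mul_le_mul_of_nonneg_left (by linarith) hdc) _),
    (Finset.sum_le_sum fun k _ => hD k).trans hmomK⟩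

end Conclusion
end FedEM

open FedEM in
theorem theorem2 {𝒳 𝒴 𝒜 : Type*}
    [MeasurableSpace 𝒳] [MeasurableSpace 𝒴] {T M d : ℕ}
    (Q : FedProblem 𝒳 𝒴 𝒜 T M d) (𝓑 : Q.BatchScheme)
    (hreg : Q.Regular)
    (hmix : Q.Mixture) (hmarg : Q.CommonMarginal) (hlog : Q.LogLoss)
    (hbdd : Q.BoundedBelow)
    (L : ℝ≥0) (hsmooth : Q.Smooth L)
    (hunif : 𝓑.Uniform) (σ : ℝ) (hvar : 𝓑.BoundedVariance σ)
    (G β : ℝ) (hdis : Q.BoundedDissimilarity G β)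
    (p : ℝ) (hp₀ : 0 < p) (hp₁ : p ≤ 1) (τ : ℕ) (hτ : 1 ≤ τ)
    (J : ℕ) (hJ : 1 ≤ J) (a₀ : ℝ) (ha₀ : 0 < a₀)
    (S₀ : FedProblem.ClientState T M d) (hS₀ : ∀ t, S₀.π t ∈ stdSimplex ℝ (Fin M)) :
    ∃ (C : ℝ) (K₀ : ℕ), ∀ K : ℕ, 1 ≤ K → K₀ ≤ K →
      ∀ (Ω : Type u) [MeasurableSpace Ω] (P : Measure Ω) [IsProbabilityMeasure P]
        (W : ℕ → Ω → Fin T → Fin T → ℝ)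
        (ξ : ℕ → (t : Fin T) → Fin M → ℕ → Ω → 𝓑.Batch t),
        FedProblem.ExpectedConsensus M d W p τ K P →
        FedProblem.IndependentSampling 𝓑 W ξ P →
        ∀ S : ℕ → Ω → FedProblem.ClientState T M d,
          (∀ k ω, S k ω = 𝓑.iterate (a₀ / √(K : ℝ)) J S₀ (fun k => W k ω)
            (fun k t m j => ξ k t m j ω) k) →
          (K : ℝ≥0∞)⁻¹ * ∑ k ∈ Finset.Icc 1 K,
              ∫⁻ ω, ‖gradient (fun Θ => Q.negLogLik Θ (S k ω).π)
                (FedProblem.average (S k ω).Θ)‖ₑ ^ 2 ∂P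
            ≤ ENNReal.ofReal (C / √(K : ℝ)) ∧
          (K : ℝ≥0∞)⁻¹ * ∑ k ∈ Finset.Icc 1 K, ∑ t, ENNReal.ofReal (Q.weight t) *
              ∫⁻ ω, klVec ((S k ω).π t) ((S (k - 1) ω).π t) ∂P
            ≤ ENNReal.ofReal (C / (K : ℝ)) ∧
          (⨅ k ∈ Finset.Icc 1 K, ∫⁻ ω, FedProblem.consensusDist (S k ω).Θ ∂P)
            ≤ ENNReal.ofReal (C / √(K : ℝ)) := by
  rcases Nat.eq_zero_or_pos T with rfl | hTpos
  · refine ⟨0, 0, fun K hK _ Ω _ P _ W ξ _ _ S _ => ⟨?_, ?_, ?_⟩⟩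
    · have h0 : ∀ ϖ, (fun Θ => Q.negLogLik Θ ϖ) = fun _ => 0 := fun ϖ => by
        funext Θ; simp [FedProblem.negLogLik]
      simp [h0]
    · simp
    · exact iInf₂_le_of_le 1 (Finset.mem_Icc.2 ⟨le_rfl, hK⟩)
        (by simp [FedProblem.consensusDist])
  have hT : T ≠ 0 := hTpos.ne'
  obtain ⟨r, κ₀, Cm, C₂, K₀, hr0, hκ₀0, H⟩ := exists_summed_bounds 𝓑 hreg.samples hT
    (smoothLoss_lossAt hsmooth) hunif hp₀ hp₁ hτ hJ ha₀ hS₀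
  refine ⟨8 * |C₂| / (r * κ₀) + |C₂| + |Cm|, K₀, ?_⟩
  intro K hK hK₀ Ω _ P _ W ξ hcons hind S hS
  obtain ⟨z, hrun, iKL, iG, iD, hdesc, hsD⟩ := H K hK hK₀ Ω P W ξ hcons hind
  have hC₂ := le_abs_self C₂
  have hCm := le_abs_self Cm
  have hC₂0 := abs_nonneg C₂
  have hCm0 := abs_nonneg Cm
  have hK1 : (1 : ℝ) ≤ K := by exact_mod_cast hK
  have hsq1 : 1 ≤ √(K : ℝ) := Real.one_le_sqrt.2 hK1
  have hsq0 : 0 < √(K : ℝ) := by linarith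
  have hsqK : √(K : ℝ) * √(K : ℝ) = K := Real.mul_self_sqrt (by positivity)
  have hSz : ∀ k ω, S k ω = ⟨(z k ω).1, (z k ω).2.1⟩ := fun k ω => by
    rw [hS, hrun.traj]; exact track_eq_iterate _ _ _ _ _ _ _ _
  have := hrun.nonempty
  have hKL0 : ∀ k, 0 ≤ ∫ ω, clientKL (client Q) (z (k + 1) ω).2.1 (z k ω).2.1 ∂P := fun k =>
    integral_nonneg fun ω => clientKL_step_nonneg (hrun.comparator k ω).weights <| by
      rw [hrun.step_eq]
      exact isClientMean_mixtureUpdate hreg.samples (hrun.comparator k ω).weights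
  have hG0 : ∀ k, 0 ≤ ∫ ω, meanGradSq (z k ω) ∂P := fun k => integral_nonneg fun ω => sq_nonneg _
  have hsKL : 0 ≤ ∑ k ∈ Finset.range (K + 1),
      ∫ ω, clientKL (client Q) (z (k + 1) ω).2.1 (z k ω).2.1 ∂P :=
    Finset.sum_nonneg fun k _ => hKL0 k
  have hsG : 0 ≤ ∑ k ∈ Finset.range (K + 1), ∫ ω, meanGradSq (z k ω) ∂P :=
    Finset.sum_nonneg fun k _ => hG0 k
  have hCG : 0 ≤ 8 * |C₂| / (r * κ₀) := by positivity
  have hIcc : Finset.Icc 1 K ⊆ Finset.range (K + 1) := fun k hk =>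
    Finset.mem_range.2 (Nat.lt_succ_of_le (Finset.mem_Icc.1 hk).2)
  refine ⟨?_, ?_, ?_⟩
  · simp only [hSz, hrun.lintegral_gradient hreg (iG _)]
    rw [inv_mul_sum_ofReal hK _ hG0]
    refine ENNReal.ofReal_le_ofReal ?_
    have h1 : ∑ k ∈ Finset.Icc 1 K, ∫ ω, meanGradSq (z k ω) ∂P
        ≤ 8 * |C₂| / (r * (κ₀ / √(K : ℝ))) := by
      refine (Finset.sum_le_sum_of_subset_of_nonneg hIcc fun k _ _ => hG0 k).trans ?_
      rw [le_div_iff₀ (by positivity)]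
      linarith
    have h2 : 8 * |C₂| / (r * (κ₀ / √(K : ℝ))) / K = 8 * |C₂| / (r * κ₀) / √(K : ℝ) := by
      nth_rewrite 2 [← hsqK]
      field_simp
    refine (div_le_div_of_nonneg_right h1 (by positivity)).trans ?_
    rw [h2]
    exact div_le_div_of_nonneg_right (by linarith) hsq0.le
  · have h1 : ∀ k ∈ Finset.Icc 1 K, ∑ t, ENNReal.ofReal (Q.weight t) *
        ∫⁻ ω, klVec ((S k ω).π t) ((S (k - 1) ω).π t) ∂P
        = ENNReal.ofReal (∫ ω, clientKL (client Q) (z (k - 1 + 1) ω).2.1 (z (k - 1) ω).2.1 ∂P) := by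
      intro k hk
      rw [← hrun.sum_lintegral_klVec (iKL (k - 1)), Nat.sub_add_cancel (Finset.mem_Icc.1 hk).1]
      simp only [hSz]
    rw [Finset.sum_congr rfl h1, inv_mul_sum_ofReal hK _ fun k => hKL0 (k - 1)]
    refine ENNReal.ofReal_le_ofReal ?_
    have h2 : ∑ k ∈ Finset.Icc 1 K, ∫ ω, clientKL (client Q) (z (k - 1 + 1) ω).2.1
        (z (k - 1) ω).2.1 ∂P
        = ∑ k ∈ Finset.range K, ∫ ω, clientKL (client Q) (z (k + 1) ω).2.1 (z k ω).2.1 ∂P := by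
      rw [← Finset.Ico_add_one_right_eq_Icc, Finset.sum_Ico_eq_sum_range]
      simp
    rw [h2]
    refine div_le_div_of_nonneg_right ?_ (by positivity)
    have h3 : ∑ k ∈ Finset.range K, ∫ ω, clientKL (client Q) (z (k + 1) ω).2.1 (z k ω).2.1 ∂P
        ≤ ∑ k ∈ Finset.range (K + 1), ∫ ω, clientKL (client Q) (z (k + 1) ω).2.1 (z k ω).2.1 ∂P :=
      Finset.sum_le_sum_of_subset_of_nonneg (Finset.range_mono (Nat.le_succ K)) fun k _ _ => hKL0 k
    have h4 : 0 ≤ r * (κ₀ / √(K : ℝ)) / 8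
        * ∑ k ∈ Finset.range (K + 1), ∫ ω, meanGradSq (z k ω) ∂P := by
      positivity
    linarith
  · have hsum : ∑ k ∈ Finset.Icc 1 K, ∫ ω, spread (z k ω).1 ∂P
        ≤ ∑ _k ∈ Finset.Icc 1 K, |Cm| / K := by
      rw [Finset.sum_const, Nat.card_Icc, Nat.add_sub_cancel, nsmul_eq_mul,
        mul_div_cancel₀ _ (by positivity : (K : ℝ) ≠ 0)]
      exact (Finset.sum_le_sum_of_subset_of_nonneg hIcc fun k _ _ =>
        integral_nonneg fun ω => spread_nonneg _).trans (hsD.trans hCm)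
    obtain ⟨k, hk, hkD⟩ := Finset.exists_le_of_sum_le ⟨1, Finset.mem_Icc.2 ⟨le_rfl, hK⟩⟩ hsum
    refine iInf₂_le_of_le k hk ?_
    simp only [hSz, consensusDist_eq]
    rw [← ofReal_integral_eq_lintegral_ofReal (iD k)
      (Filter.Eventually.of_forall fun ω => spread_nonneg _)]
    refine ENNReal.ofReal_le_ofReal (hkD.trans ?_)
    have h1 : √(K : ℝ) ≤ K := by nlinarith
    exact (div_le_div_of_nonneg_left hCm0 hsq0 h1).trans
      (div_le_div_of_nonneg_right (by linarith) hsq0.le)
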